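/- **Poics.** A *poic* is a pair $(\sigma,N)$ of a finitely generated free abelian group $N$ and a non-empty full-dimensional $\sigma\subseteq N_{\mathbb R}=\mathbb R\otimes N$ which is a finite intersection of closed and open integral half-spaces; a morphism of poics is an integral linear map carrying cone into cone. A *face* of a cone $\sigma$ is a non-empty set $\sigma\cap\{f\ge 0\}$ with $f$ an integral functional that is non-positive on $\sigma$; the relative interior $\sigma^{o}$ is the set of points in no proper face. A *face-embedding* is an injective morphism of poics whose image is a face. A *poic-space* is a functor $\mathcal X\colon C\to\mathrm{POIC}$ on an essentially finite category $C$ with finite Hom-sets, sending morphisms to face-embeddings and such that every face $\tau$ of every $\mathcal X(x)$, with the lattice $N\cap\mathrm{Lin}(\tau)$, is the image of a morphism $w\to x$ of $C$ that is unique up to isomorphism over $x$. It is a *poic-complex* if $C$ is thin. A morphism $F\colon\mathcal X\to\mathcal Y$ is a functor $F\colon C\to D$ with a natural transformation $\eta_F\colon\mathcal X\to\mathcal Y\circ F$ such that no $\eta_{F,x}(\mathcal X(x))$ lies in a proper face of $\mathcal Y(F(x))$; write $F_x=\eta_{F,x}$. For a finitely generated free abelian group $N$, $\underline{N_{\mathbb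 R}}$ is the one-object poic-complex with value $(N_{\mathbb R},N)$. A *linear* poic-complex $\Phi_X$ is a poic-complex $\Phi$ with a morphism $X\colon\Phi\to\underline{N_{\mathbb R}}$; a morphism of linear poic-complexes is a morphism $P$ of poic-complexes with an integral linear map $\varphi$ such that $\varphi\circ X_s=Y_{P(s)}\circ P_s$ for all $s$. A *subdivision* $S\colon\Phi'\to\Phi$ of poic-complexes is an essentially surjective morphism such that: each $S_t$ is injective on lattices, and bijective on lattices if $\Phi'(t)$ and $\Phi(S(t))$ have equal dimension; for every $s$ the images of the relative interiors $\Phi'(p)^{o}$, over all $p$ with $S(p)\cong s$, cover $\Phi(s)^{o}$, and two of them meet only if the cones $p$ are isomorphic; and each $s\to S(t)$ is, up to isomorphism of $s$, the image of some $q\to t$. A morphism $P\colon\Phi\to\Psi$ of poic-complexes is *weakly proper* if for every $s$ and every face $\tau$ of the closure of $P_s(\Phi(s))$ in $\Psi(P(s))$ there is $q\to s$ with $P_s(\Phi(q))=\tau$, where, if $P_s$ is injective, $q$ has in $s$ the same codimension as $\tau$ in $P_s(\Phi(s))$. It is *proper* if $P\circ S$ is weakly proper for all subdivisions $S$ of $\Phi$.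 A morphism $F$ of poic-spaces *lifts isomorphisms* if for all $x$ and all isomorphisms $f\colon F(x)\to y$ there is an isomorphism $f'\colon x\to x'$ with $F(x')=y$, $F(f')=f$, and for two such lifts $f_1\colon x\to x_1$, $f_2\colon x\to x_2$ there is exactly one isomorphism $i\colon x_1\to x_2$ over $\mathrm{id}_y$, and it satisfies $i f_1=f_2$. A *poic-fibration* $\pi\colon\Phi\to\mathcal X$ is a morphism from a poic-complex to a poic-space, essentially surjective on objects, whose maps $\pi_p$ are bijective on lattices and identify $\Phi(p)^{o}$ with $\mathcal X(\pi(p))^{o}$, and such that each $\pi(p)\to x$ lifts to a morphism $p\to q$ with an isomorphism $\pi(q)\cong x$, uniquely up to isomorphism. It is linear if $\Phi$ is. A *weakly proper morphism* of linear poic-fibrations from $\pi\colon\Phi_X\to\mathcal X$ to $\rho\colon\Psi_Y\to\mathcal Y$ consists of a morphism $\mathfrak f^{c}\colon\Phi_X\to\Psi_Y$ of linear poic-complexes that is weakly proper and a morphism $\mathfrak f^{s}\colon\mathcal X\to\mathcal Y$ of poic-spaces that lifts isomorphisms, with $\rho\circ\mathfrak f^{c}\cong\mathfrak f^{s}\circ\pi$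 through a natural isomorphism of functors compatible with the maps of cones. **Graphs.** Fix an infinite set $U$. A graph $G$ is a finite set $F(G)\subseteq U$ of flags with an idempotent root map $r$ and an involution $\iota$ fixing the image $V(G)$ of $r$; legs are the $\iota$-fixed points outside $V(G)$, edges the two-element $\iota$-orbits; $\operatorname{val}v=\#r^{-1}(v)-1$. For $g\ge 0$ and a finite set $A$, $\mathbb G_{g,A}$ is the category of connected graphs of genus $g$ with all vertices of valency at least $3$ and legs bijectively marked by $A$; its morphisms are the contractions compatible with the markings, that is, maps of flags commuting with $r,\iota$ for which the preimage of every vertex is a tree without legs and every other flag has exactly one preimage. Let $\sigma_G\subseteq\mathbb R_{\ge 0}^{E(G)}$ be the cone of $\delta$ whose zero set is a forest, with lattice $\mathbb Z^{E(G)}$. A contraction $G\to H$ induces $\sigma_H\to\sigma_G$ (extension by zero on contracted edges), and this gives $\mathrm M^{\mathrm{trop}}_{g,A}\colon\mathbb G_{g,A}^{op}\to\mathrm{POIC}$, $G\mapsto\sigma_G$. **Forgetting a mark.** Let $a\in A$, and let $V_a$ be the vertex of the $a$-leg of $G$. The graph $\mathrm{ft}_aG\in\mathbb G_{g,A\setminus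 a}$ and the map $\eta\colon\sigma_G\to\sigma_{\mathrm{ft}_aG}$ are as follows. (1) If $\operatorname{val}V_a>3$, delete the $a$-leg; $\eta=\mathrm{id}$. (2) If $\operatorname{val}V_a=3$ and $V_a$ is on two edges $\{f_i,\iota f_i\}$ with $r(f_i)=V_a$, $i=1,2$, delete $r^{-1}(V_a)$ and let the new involution exchange $\iota f_1$ and $\iota f_2$; $\eta$ gives the new edge the sum of the two lengths and keeps the other lengths. (3) If $\operatorname{val}V_a=3$ and $V_a$ is on one edge $\{f,\iota f\}$ with $r(f)=V_a$ and on a second leg $l$, delete the $a$-leg, $f$, $\iota f$, $V_a$ and let the new root of $l$ be $r(\iota f)$; $\eta$ forgets the length of the edge. For a contraction $k\colon G\to H$ the map $\mathrm{ft}_ak$ is the restriction of $k$, except that in case (2) it maps $\iota f_1$ to $k(f_2)$ if $k$ contracts the edge of $f_1$, and $\iota f_2$ to $k(f_1)$ if $k$ contracts the edge of $f_2$. **Distances.** For a finite set $X$ let $Q_X$ be the cokernel of $\mathbb R^{X}\to\mathbb R^{\binom X2}$, $(x_i)\mapsto(x_i+x_j)$. For $I\subseteq X$ let $v_I\in Q_X$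 be the class of the vector that is $1$ at the pairs separated by $I$ and $0$ elsewhere, and let $N_{\mathrm{dist}_X}$ be the lattice generated by the $v_I$ with $1<\#I<\#X-1$. The morphism $\mathrm{dist}_X\colon\mathrm M^{\mathrm{trop}}_{0,X}\to\underline{(N_{\mathrm{dist}_X})_{\mathbb R}}$ sends a metric tree to the class of its vector of distances between legs. The coordinate projection $\mathbb R^{\binom X2}\to\mathbb R^{\binom{X\setminus a}2}$ induces $p_a\colon N_{\mathrm{dist}_X}\to N_{\mathrm{dist}_{X\setminus a}}$. **Spanning trees.** Let $X_A=A\sqcup\{1,\dots,g,1^*,\dots,g^*\}$. The poic-complex $\mathrm{ST}_{g,A}\colon\mathbb G_{0,X_A}^{op}\to\mathrm{POIC}$ is $T\mapsto\sigma_T\times\mathbb R_{>0}^g$ (lattice $\mathbb Z^{E(T)}\times\mathbb Z^g$); it is linear through the projection to $\mathrm M^{\mathrm{trop}}_{0,X_A}$ followed by $\mathrm{dist}_{X_A}$. The morphism $\mathrm{st}_{g,A}\colon\mathrm{ST}_{g,A}\to\mathrm M^{\mathrm{trop}}_{g,A}$ joins, for each $i$, the $i$-leg and the $i^*$-leg of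 $T$ to an edge, whose length is the $i$-th coordinate of $\mathbb R^g_{>0}$. Let $\mathfrak{ft}_a^{c}\colon\mathrm{ST}_{g,A}\to\mathrm{ST}_{g,A\setminus a}$ be given by the functor $\mathrm{ft}_a$ and the linear maps $\begin{pmatrix}\eta_{\mathrm{ft}_a,T}&0\\ M(T,a)&\mathrm{Id}\end{pmatrix}$, where $M(T,a)_{i,e}=1$ if $\operatorname{val}V_a=3$ and $V_a$ is incident to $e$ and to the $i$-leg or the $i^*$-leg, and $M(T,a)_{i,e}=0$ otherwise. **Theorem.** Let $g\ge 0$, let $A$ be a finite set with $2g+\#A-2>1$, and let $a\in A$. 1. $\mathrm M^{\mathrm{trop}}_{g,A}$ and $\mathrm M^{\mathrm{trop}}_{g,A\setminus a}$ are poic-spaces, and the construction above defines a functor and a natural transformation, giving a morphism of poic-spaces $\mathrm{ft}_a\colon\mathrm M^{\mathrm{trop}}_{g,A}\to\mathrm M^{\mathrm{trop}}_{g,A\setminus a}$. 2. If $b\in A\setminus a$ and $2g+\#A-2>2$, then $\mathrm{ft}_a\circ\mathrm{ft}_b=\mathrm{ft}_b\circ\mathrm{ft}_a$ as morphisms $\mathrm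 M^{\mathrm{trop}}_{g,A}\to\mathrm M^{\mathrm{trop}}_{g,A\setminus\{a,b\}}$. 3. If $g=0$, then $\mathrm{ft}_a$ is a proper morphism of poic-complexes. 4. $\mathrm{ft}_a$ lifts isomorphisms (in particular for $g>0$). 5. $\mathrm{dist}_{X_A}$ and $\mathrm{dist}_{X_{A\setminus a}}$ are morphisms of poic-complexes, and $p_a\circ\mathrm{dist}_{X_A}=\mathrm{dist}_{X_{A\setminus a}}\circ\mathrm{ft}_a$, so that $\mathrm{ft}_a\colon\mathrm M^{\mathrm{trop}}_{0,X_A}\to\mathrm M^{\mathrm{trop}}_{0,X_{A\setminus a}}$ with $p_a$ is a morphism of linear poic-complexes. 6. $\mathrm{st}_{g,A}$ and $\mathrm{st}_{g,A\setminus a}$ are linear poic-fibrations, and $(\mathfrak{ft}_a^{c},\mathrm{ft}_a,p_a)$ is a weakly proper morphism of linear poic-fibrations $\mathrm{st}_{g,A}\to\mathrm{st}_{g,A\setminus a}$. -/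

import Mathlib

open CategoryTheory TensorProduct Opposite
open scoped Classical

universe u v w

noncomputable section

/-! ### Partially open integral cones -/

/-- The real functional on `N_ℝ = ℝ ⊗ N` induced by an integral functional on `N`. -/
def evalR {N : Type u} [AddCommGroup N] (f : Module.Dual ℤ N) : (ℝ ⊗[ℤ] N) →ₗ[ℝ] ℝ :=
  (TensorProduct.AlgebraTensorModule.rid ℤ ℝ ℝ).toLinearMap ∘ₗ LinearMap.baseChange ℝ f

theorem evalR_tmul {N : Type u} [AddCommGroup N] (f : Module.Dual ℤ N) (c : ℝ) (n : N) :
    evalR f (c ⊗ₜ[ℤ] n) = (f n : ℝ) * c := by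
  simp [evalR]

theorem evalR_baseChange {N M : Type u} [AddCommGroup N] [AddCommGroup M]
    (f : Module.Dual ℤ M) (φ : N →ₗ[ℤ] M) (x : ℝ ⊗[ℤ] N) :
    evalR f (LinearMap.baseChange ℝ φ x) = evalR (f ∘ₗ φ) x := by
  simp [evalR, LinearMap.baseChange_comp]

/-- A partially open integral cone of `N_ℝ`: a non-empty finite intersection of closed and open
integral half-spaces. -/
def IsPoicSet {N : Type u} [AddCommGroup N] (σ : Set (ℝ ⊗[ℤ] N)) : Prop :=
  σ.Nonempty ∧ ∃ C O : Finset (Module.Dual ℤ N),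
    σ = {x | (∀ f ∈ C, 0 ≤ evalR f x) ∧ ∀ f ∈ O, 0 < evalR f x}

/-- `τ` is a (non-empty) face of `K`: it is `K ∩ {f ≥ 0}` for an integral functional `f` which is
non-positive on `K`. -/
def IsFace {N : Type u} [AddCommGroup N] (K τ : Set (ℝ ⊗[ℤ] N)) : Prop :=
  τ.Nonempty ∧ ∃ f : Module.Dual ℤ N, (∀ x ∈ K, evalR f x ≤ 0) ∧ τ = {x ∈ K | 0 ≤ evalR f x}

/-- The relative interior of a partially open cone: the points that lie in no proper face. -/
def relInt {N : Type u} [AddCommGroup N] (K : Set (ℝ ⊗[ℤ] N)) : Set (ℝ ⊗[ℤ] N) :=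
  {x ∈ K | ∀ τ, IsFace K τ → x ∈ τ → τ = K}

/-- The dimension of a subset of `N_ℝ`: the dimension of its linear span. -/
def coneDim {N : Type u} [AddCommGroup N] (K : Set (ℝ ⊗[ℤ] N)) : ℕ :=
  Module.finrank ℝ (Submodule.span ℝ K)

/-- The closure of `I` inside `K`, for the Euclidean topology of `N_ℝ` (on a finite-dimensional
real vector space this is the module topology). -/
def closureIn {N : Type u} [AddCommGroup N] (K I : Set (ℝ ⊗[ℤ] N)) : Set (ℝ ⊗[ℤ] N) :=
  K ∩ @closure (ℝ ⊗[ℤ] N) (moduleTopology ℝ (ℝ ⊗[ℤ] N)) I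

/-- A partially open integral cone (poic): a finitely generated free abelian group `N` with a
full-dimensional partially open integral cone of `N_ℝ`. -/
structure Poic : Type (u + 1) where
  N : Type u
  [grp : AddCommGroup N]
  [free : Module.Free ℤ N]
  [fin : Module.Finite ℤ N]
  cone : Set (ℝ ⊗[ℤ] N)
  isPoic : IsPoicSet cone
  full : Submodule.span ℝ cone = ⊤

attribute [instance] Poic.grp Poic.free Poic.fin

namespace Poic

/-- A morphism of poics: an integral linear map whose real extension maps cone to cone. -/
@[ext]
structure Hom (σ ξ : Poic.{u}) where
  lin : σ.N →ₗ[ℤ] ξ.N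
  maps : ∀ x ∈ σ.cone, LinearMap.baseChange ℝ lin x ∈ ξ.cone

instance : Category Poic.{u} where
  Hom := Hom
  id σ := ⟨LinearMap.id, by intro x hx; simpa [LinearMap.baseChange_id] using hx⟩
  comp f g := ⟨g.lin ∘ₗ f.lin, by
    intro x hx
    rw [LinearMap.baseChange_comp]
    exact g.maps _ (f.maps x hx)⟩

/-- The integral linear map underlying a morphism of poics. -/
def lin {σ ξ : Poic.{u}} (f : σ ⟶ ξ) : σ.N →ₗ[ℤ] ξ.N := Hom.lin f

/-- Its extension to the ambient real vector spaces. -/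
def linR {σ ξ : Poic.{u}} (f : σ ⟶ ξ) : (ℝ ⊗[ℤ] σ.N) →ₗ[ℝ] (ℝ ⊗[ℤ] ξ.N) :=
  LinearMap.baseChange ℝ (lin f)

theorem linR_mem {σ ξ : Poic.{u}} (f : σ ⟶ ξ) {x : ℝ ⊗[ℤ] σ.N} (hx : x ∈ σ.cone) :
    linR f x ∈ ξ.cone := Hom.maps f x hx

@[simp] theorem lin_id (σ : Poic.{u}) : lin (𝟙 σ) = LinearMap.id := rfl

@[simp] theorem lin_comp {σ ξ ζ : Poic.{u}} (f : σ ⟶ ξ) (g : ξ ⟶ ζ) :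
    lin (f ≫ g) = lin g ∘ₗ lin f := rfl

theorem linR_comp {σ ξ ζ : Poic.{u}} (f : σ ⟶ ξ) (g : ξ ⟶ ζ) :
    linR (f ≫ g) = linR g ∘ₗ linR f := by
  simp [linR, LinearMap.baseChange_comp]

theorem hom_ext {σ ξ : Poic.{u}} {f g : σ ⟶ ξ} (h : lin f = lin g) : f = g :=
  Hom.ext h

/-- The dimension of a poic. -/
def dim (σ : Poic.{u}) : ℕ := coneDim σ.cone

/-- A face-embedding: the real extension is injective and maps the cone onto a face. -/
def IsFaceEmbedding {σ ξ : Poic.{u}} (f : σ ⟶ ξ) : Prop :=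
  Function.Injective (linR f) ∧ IsFace ξ.cone (linR f '' σ.cone)

/-- The morphism `f` identifies `σ` with the poic `(τ, N ∩ Lin(τ))`, where `τ` is a subset of the
cone `ξ` (in practice a face). -/
def IsIsoOnto {σ ξ : Poic.{u}} (f : σ ⟶ ξ) (τ : Set (ℝ ⊗[ℤ] ξ.N)) : Prop :=
  Function.Injective (linR f) ∧ linR f '' σ.cone = τ ∧
    ∀ n : ξ.N, (1 : ℝ) ⊗ₜ[ℤ] n ∈ Submodule.span ℝ τ → n ∈ LinearMap.range (lin f)

/-- The poic `(N_ℝ, N)`. -/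
def whole (N : Type u) [AddCommGroup N] [Module.Free ℤ N] [Module.Finite ℤ N] : Poic.{u} where
  N := N
  cone := Set.univ
  isPoic := ⟨⟨0, trivial⟩, ∅, ∅, by simp⟩
  full := by simp

theorem evalR_proj_one {I : Type u} (i : I) (t : ℝ) :
    evalR (LinearMap.proj i : Module.Dual ℤ (I → ℤ)) (t ⊗ₜ[ℤ] (fun _ => (1 : ℤ))) = t := by
  rw [evalR_tmul]; simp

/-- The subset of `(ℤ^I)_ℝ` of the points of the non-negative orthant whose set of vanishing
coordinates satisfies `P`. -/
def orthantCone (I : Type u) (P : Set I → Prop) : Set (ℝ ⊗[ℤ] (I → ℤ)) :=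
  {x | (∀ i, 0 ≤ evalR (LinearMap.proj i) x) ∧ P {i | evalR (LinearMap.proj i) x = 0}}

theorem mem_orthantCone_of_pos {I : Type u} {P : Set I → Prop} (h0 : P ∅) {y : ℝ ⊗[ℤ] (I → ℤ)}
    (hy : ∀ i, 0 < evalR (LinearMap.proj i) y) : y ∈ orthantCone I P := by
  refine ⟨fun i => (hy i).le, ?_⟩
  have : {i : I | evalR (LinearMap.proj i) y = 0} = ∅ := by
    ext i; simpa using (hy i).ne'
  rw [this]; exact h0

theorem orthantCone_isPoic {I : Type u} [Finite I] {P : Set I → Prop} (h0 : P ∅)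
    (hP : ∀ S T : Set I, S ⊆ T → P T → P S) : IsPoicSet (orthantCone I P) := by
  have : Fintype I := Fintype.ofFinite I
  refine ⟨⟨(1 : ℝ) ⊗ₜ[ℤ] (fun _ => (1 : ℤ)), mem_orthantCone_of_pos h0 fun i => ?_⟩, ?_⟩
  · rw [evalR_proj_one]; norm_num
  · refine ⟨Finset.univ.image (fun i : I => (LinearMap.proj i : Module.Dual ℤ (I → ℤ))),
      (Finset.univ.filter (fun S : Finset I => ¬ P (S : Set I))).image
        (fun S => ∑ i ∈ S, (LinearMap.proj i : Module.Dual ℤ (I → ℤ))), ?_⟩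
    have hsum : ∀ (S : Finset I) (x : ℝ ⊗[ℤ] (I → ℤ)),
        evalR (∑ i ∈ S, (LinearMap.proj i : Module.Dual ℤ (I → ℤ))) x
          = ∑ i ∈ S, evalR (LinearMap.proj i) x := by
      intro S x
      induction x using TensorProduct.induction_on with
      | zero => simp
      | tmul c n =>
        simp only [evalR_tmul, LinearMap.sum_apply, Int.cast_sum, Finset.sum_mul]
      | add x y hx hy => simp only [map_add, hx, hy, Finset.sum_add_distrib]
    ext x
    simp only [orthantCone, Set.mem_ofPred_eq, Finset.mem_image, Finset.mem_univ, true_and,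
      forall_exists_index, forall_apply_eq_imp_iff, Finset.mem_filter, and_imp,
      forall_apply_eq_imp_iff₂, hsum]
    refine and_congr_right fun hx => ⟨fun hZ S hS => ?_, fun h => ?_⟩
    · refine lt_of_le_of_ne (Finset.sum_nonneg fun i _ => hx i) fun h => hS (hP _ _ ?_ hZ)
      intro i hi
      exact (Finset.sum_eq_zero_iff_of_nonneg (fun i _ => hx i)).1 h.symm i hi
    · by_contra hZ
      have := h (Finset.univ.filter fun i => evalR (LinearMap.proj i) x = 0) (by simpa using hZ)
      refine absurd this (not_lt.2 (le_of_eq (Finset.sum_eq_zero fun i hi => ?_)))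
      exact (Finset.mem_filter.1 hi).2

theorem orthantCone_full {I : Type u} [Finite I] {P : Set I → Prop} (h0 : P ∅) :
    Submodule.span ℝ (orthantCone I P) = ⊤ := by
  have : Fintype I := Fintype.ofFinite I
  refine eq_top_iff.2 fun x _ => ?_
  let a : I → ℝ := fun i => evalR (LinearMap.proj i : Module.Dual ℤ (I → ℤ)) x
  obtain ⟨t, ht, hle⟩ : ∃ t : ℝ, 0 < t ∧ ∀ i, |a i| < t := by
    refine ⟨∑ i : I, |a i| + 1, by positivity, fun i => ?_⟩
    have := Finset.single_le_sum (f := fun i : I => |a i|)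
      (fun i _ => abs_nonneg _) (Finset.mem_univ i)
    exact lt_of_le_of_lt this (lt_add_one _)
  have h1 : x + t ⊗ₜ[ℤ] (fun _ => (1 : ℤ)) ∈ orthantCone I P :=
    mem_orthantCone_of_pos h0 fun i => by
      rw [map_add, evalR_proj_one]
      have h3 : -|a i| ≤ evalR (LinearMap.proj i : Module.Dual ℤ (I → ℤ)) x := neg_abs_le (a i)
      linarith [hle i]
  have h2 : t ⊗ₜ[ℤ] (fun _ : I => (1 : ℤ)) ∈ orthantCone I P :=
    mem_orthantCone_of_pos h0 fun i => by
      rw [evalR_proj_one]; exact ht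
  have := Submodule.sub_mem _ (Submodule.subset_span (R := ℝ) h1)
    (Submodule.subset_span (R := ℝ) h2)
  simpa using this

/-- The poic with lattice `ℤ^I` and cone `orthantCone I P`, for a downward closed `P`. -/
def orthant (I : Type u) [Finite I] (P : Set I → Prop) (h0 : P ∅)
    (hP : ∀ S T : Set I, S ⊆ T → P T → P S) : Poic.{u} where
  N := I → ℤ
  cone := orthantCone I P
  isPoic := orthantCone_isPoic h0 hP
  full := orthantCone_full h0

end Poic

/-! ### Poic-complexes, poic-spaces and their morphisms -/

section PoicSpaces

/-- A category is essentially finite if it is equivalent to one with finitely many objects. -/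
def IsEssFinite (C : Type v) [Category.{w} C] : Prop :=
  ∃ (D : Type v) (_ : Category.{w} D), Finite D ∧ Nonempty (C ≌ D)

/-- A functor to poics is a poic-space. -/
structure IsPoicSpace {C : Type v} [Category.{w} C] (X : C ⥤ Poic.{u}) : Prop where
  essFinite : IsEssFinite C
  finiteHom : ∀ x y : C, Finite (x ⟶ y)
  faceEmbedding : ∀ {x y : C} (f : x ⟶ y), Poic.IsFaceEmbedding (X.map f)
  face_exists : ∀ (x : C) (τ : Set (ℝ ⊗[ℤ] (X.obj x).N)), IsFace (X.obj x).cone τ →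
    ∃ (w : C) (f : w ⟶ x), Poic.IsIsoOnto (X.map f) τ
  face_unique : ∀ (x : C) (τ : Set (ℝ ⊗[ℤ] (X.obj x).N)), IsFace (X.obj x).cone τ →
    ∀ (w₁ w₂ : C) (f₁ : w₁ ⟶ x) (f₂ : w₂ ⟶ x), Poic.IsIsoOnto (X.map f₁) τ →
      Poic.IsIsoOnto (X.map f₂) τ → ∃ i : w₁ ≅ w₂, i.hom ≫ f₂ = f₁

/-- A poic-complex is a poic-space whose underlying category is thin. -/
structure IsPoicComplex {C : Type v} [Category.{w} C] (X : C ⥤ Poic.{u}) : Prop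
    extends IsPoicSpace X where
  thin : Quiver.IsThin C

/-- A morphism of poic-spaces (in particular, of poic-complexes): a functor and a natural
transformation such that no cone is mapped into a proper face. -/
@[ext]
structure PoicMor {C : Type v} [Category.{w} C] {D : Type v} [Category.{w} D]
    (X : C ⥤ Poic.{u}) (Y : D ⥤ Poic.{u}) where
  functor : C ⥤ D
  η : X ⟶ functor ⋙ Y
  not_in_proper_face : ∀ (x : C) (τ : Set (ℝ ⊗[ℤ] (Y.obj (functor.obj x)).N)),
    IsFace (Y.obj (functor.obj x)).cone τ →
    Poic.linR (η.app x) '' (X.obj x).cone ⊆ τ → τ = (Y.obj (functor.obj x)).cone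

namespace PoicMor

variable {C D E : Type v} [Category.{w} C] [Category.{w} D] [Category.{w} E]
variable {X : C ⥤ Poic.{u}} {Y : D ⥤ Poic.{u}} {Z : E ⥤ Poic.{u}}

/-- The poic-morphism of `F` at the cone `x`. -/
def at' (F : PoicMor X Y) (x : C) : X.obj x ⟶ Y.obj (F.functor.obj x) := F.η.app x

/-- Composition of morphisms of poic-spaces. -/
def comp (F : PoicMor X Y) (G : PoicMor Y Z) : PoicMor X Z where
  functor := F.functor ⋙ G.functor
  η :=
    { app := fun x => F.at' x ≫ G.at' (F.functor.obj x)
      naturality := by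
        intro x y f
        have h1 := F.η.naturality f
        have h2 := G.η.naturality (F.functor.map f)
        simp only [at', Functor.comp_map] at h1 h2 ⊢
        rw [← Category.assoc, h1, Category.assoc, h2, Category.assoc] }
  not_in_proper_face := by
    intro x τ hτ hsub
    have hsub' : ∀ y ∈ (X.obj x).cone,
        Poic.linR (G.at' (F.functor.obj x)) (Poic.linR (F.at' x) y) ∈ τ := by
      intro y hy
      have := hsub ⟨y, hy, rfl⟩
      rwa [Poic.linR_comp] at this
    refine G.not_in_proper_face (F.functor.obj x) τ hτ ?_
    obtain ⟨-, f, hf, rfl⟩ := hτ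
    have key := F.not_in_proper_face x
      {y ∈ (Y.obj (F.functor.obj x)).cone |
        0 ≤ evalR (f ∘ₗ Poic.lin (G.at' (F.functor.obj x))) y} ?_ ?_
    · rintro _ ⟨y, hy, rfl⟩
      rw [← key] at hy
      refine ⟨Poic.linR_mem _ hy.1, ?_⟩
      have := hy.2
      rw [← evalR_baseChange] at this
      exact this
    · obtain ⟨y, hy⟩ := (X.obj x).isPoic.1
      refine ⟨⟨Poic.linR (F.at' x) y, Poic.linR_mem _ hy, ?_⟩, _, ?_, rfl⟩
      · rw [← evalR_baseChange]
        exact (hsub' y hy).2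
      · intro z hz
        rw [← evalR_baseChange]
        exact hf _ (Poic.linR_mem (G.at' (F.functor.obj x)) hz)
    · rintro _ ⟨y, hy, rfl⟩
      refine ⟨Poic.linR_mem _ hy, ?_⟩
      rw [← evalR_baseChange]
      exact (hsub' y hy).2

/-- Weak properness of a morphism of poic-complexes: for every cone `s` and every face `τ` of the
closure of `P_s(Φ(s))` in `Ψ(P(s))` there is a face `q ⟶ s` which is mapped by `P` onto `τ`, and
which has the same codimension as `τ` whenever `P_s` is injective. -/
def IsWeaklyProper (P : PoicMor X Y) : Prop :=
  ∀ (s : C) (τ : Set (ℝ ⊗[ℤ] (Y.obj (P.functor.obj s)).N)),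
    IsFace (closureIn (Y.obj (P.functor.obj s)).cone
      (Poic.linR (P.at' s) '' (X.obj s).cone)) τ →
    ∃ (q : C) (u : q ⟶ s),
      Poic.linR (P.at' s) '' (Poic.linR (X.map u) '' (X.obj q).cone) = τ ∧
      (Function.Injective (Poic.linR (P.at' s)) →
        (Poic.dim (X.obj s) : ℤ) - Poic.dim (X.obj q) =
          coneDim (Poic.linR (P.at' s) '' (X.obj s).cone) - coneDim τ)

/-- `S : Υ ⟶ Φ` is a subdivision of the poic-complex `Φ`. -/
structure IsSubdivision (S : PoicMor X Y) : Prop where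
  complex : IsPoicComplex X
  essSurj : S.functor.EssSurj
  injective : ∀ t : C, Function.Injective (Poic.lin (S.at' t))
  bijective : ∀ t : C, Poic.dim (X.obj t) = Poic.dim (Y.obj (S.functor.obj t)) →
    Function.Bijective (Poic.lin (S.at' t))
  /-- relative interiors of the cones over `s` cover the relative interior of `Y(s)` -/
  cover : ∀ s : D, relInt (Y.obj s).cone =
    ⋃ (p : C) (i : S.functor.obj p ≅ s),
      Poic.linR (S.at' p ≫ Y.map i.hom) '' relInt (X.obj p).cone
  /-- they are disjoint, and characterize the cones up to isomorphism -/
  disjoint : ∀ (s : D) (p₁ p₂ : C) (i₁ : S.functor.obj p₁ ≅ s) (i₂ : S.functor.obj p₂ ≅ s),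
    ¬ Disjoint (Poic.linR (S.at' p₁ ≫ Y.map i₁.hom) '' relInt (X.obj p₁).cone)
        (Poic.linR (S.at' p₂ ≫ Y.map i₂.hom) '' relInt (X.obj p₂).cone) →
      Nonempty (p₁ ≅ p₂)
  lift : ∀ (t : C) (s : D) (f : s ⟶ S.functor.obj t),
    ∃ (q : C) (h : q ⟶ t) (i : S.functor.obj q ≅ s), i.hom ≫ f = S.functor.map h

/-- Properness: the composition with every subdivision of the source is weakly proper. -/
def IsProper (P : PoicMor X Y) : Prop :=
  ∀ (B : Type v) [Category.{w} B] (W : B ⥤ Poic.{u}) (S : PoicMor W X),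
    S.IsSubdivision → (S.comp P).IsWeaklyProper

/-- The lifting property for isomorphisms: for a cone `x` and an isomorphism `f : F(x) ≅ y` there
is an isomorphism `f' : x ≅ x'` with `F(x') = y` and `F(f') = f`; it is unique up to a unique
isomorphism lying over the identity of `y`. -/
def LiftsIsos (F : PoicMor X Y) : Prop :=
  ∀ (x : C) (y : D) (f : F.functor.obj x ≅ y),
    (∃ (x' : C) (f' : x ≅ x') (h : F.functor.obj x' = y),
      F.functor.map f'.hom ≫ eqToHom h = f.hom) ∧
    ∀ (x₁ x₂ : C) (f₁ : x ≅ x₁) (f₂ : x ≅ x₂) (h₁ : F.functor.obj x₁ = y)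
      (h₂ : F.functor.obj x₂ = y), F.functor.map f₁.hom ≫ eqToHom h₁ = f.hom →
      F.functor.map f₂.hom ≫ eqToHom h₂ = f.hom →
      ∃ i : x₁ ≅ x₂, f₁ ≪≫ i = f₂ ∧ F.functor.map i.hom = eqToHom (h₁.trans h₂.symm) ∧
        ∀ j : x₁ ≅ x₂, F.functor.map j.hom = eqToHom (h₁.trans h₂.symm) → j = i

/-- `π : Φ ⟶ 𝒳` is a poic-fibration. -/
structure IsPoicFibration (π : PoicMor X Y) : Prop where
  complex : IsPoicComplex X
  space : IsPoicSpace Y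
  essSurj : π.functor.EssSurj
  /-- the poic-morphisms identify the relative interiors, with their lattices -/
  bijective : ∀ p : C, Function.Bijective (Poic.lin (π.at' p))
  interior : ∀ p : C, Poic.linR (π.at' p) '' relInt (X.obj p).cone =
    relInt (Y.obj (π.functor.obj p)).cone
  lift : ∀ (p : C) (x : D) (f : π.functor.obj p ⟶ x),
    ∃ (q : C) (h : p ⟶ q) (g : π.functor.obj q ≅ x), π.functor.map h ≫ g.hom = f
  lift_unique : ∀ (p : C) (x : D) (f : π.functor.obj p ⟶ x) (q₁ q₂ : C) (h₁ : p ⟶ q₁)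
    (h₂ : p ⟶ q₂) (g₁ : π.functor.obj q₁ ≅ x) (g₂ : π.functor.obj q₂ ≅ x),
    π.functor.map h₁ ≫ g₁.hom = f → π.functor.map h₂ ≫ g₂.hom = f →
    ∃ k : q₁ ≅ q₂, h₁ ≫ k.hom = h₂ ∧ π.functor.map k.hom ≫ g₂.hom = g₁.hom

end PoicMor

/-- The poic-complex of `N_ℝ`: the functor from the one-object category with value `(N_ℝ, N)`. -/
def wholeComplex (N : Type u) [AddCommGroup N] [Module.Free ℤ N] [Module.Finite ℤ N] :
    Discrete PUnit.{v + 1} ⥤ Poic.{u} :=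
  (Functor.const (Discrete PUnit.{v + 1})).obj (Poic.whole N)

end PoicSpaces

/-! ### Discrete graphs -/

/-- A discrete graph (possibly with legs) whose flags form a finite subset of `U`: a root map
(a retraction onto the set of vertices) and an involution fixing the vertices. -/
structure DGraph (U : Type u) where
  F : Finset U
  r : F → F
  ι : F → F
  r_r : ∀ x, r (r x) = r x
  ι_ι : ∀ x, ι (ι x) = x
  ι_r : ∀ x, ι (r x) = r x

namespace DGraph

variable {U : Type u} (G : DGraph U)

/-- Vertices: the image of the root map, equivalently its fixed points. -/
def IsVertex (x : G.F) : Prop := G.r x = x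

/-- Legs: the one-element orbits of the involution outside the set of vertices. -/
def IsLeg (x : G.F) : Prop := ¬ G.IsVertex x ∧ G.ι x = x

/-- Edges: the two-element orbits `{h, ι h}` of the involution. -/
def IsEdge (e : Sym2 G.F) : Prop := ∃ h, G.ι h ≠ h ∧ e = s(h, G.ι h)

/-- The set of edges. -/
def Edge : Type u := {e : Sym2 G.F // G.IsEdge e}

instance : Finite G.Edge := inferInstanceAs (Finite {e : Sym2 G.F // G.IsEdge e})

instance : Fintype G.Edge := Fintype.ofFinite _

/-- The valency of a vertex. -/
def val (v : G.F) : ℕ := (Finset.univ.filter fun x => G.r x = v).card - 1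

/-- A subgraph, given by its set of flags. -/
def IsSub (K : Finset G.F) : Prop := ∀ x ∈ K, G.r x ∈ K ∧ G.ι x ∈ K

/-- Vertices of a subgraph. -/
def verts (K : Finset G.F) : Finset G.F := K.filter fun x => G.IsVertex x

/-- Edges of a subgraph. -/
def edges (K : Finset G.F) : Finset (Sym2 G.F) :=
  (K.filter fun h => G.ι h ≠ h).image fun h => s(h, G.ι h)

/-- Two vertices are the two ends of a flag of `K`. -/
def Joined (K : Finset G.F) (v w : G.F) : Prop := ∃ h ∈ K, G.r h = v ∧ G.r (G.ι h) = w

/-- A (non-empty) subgraph is connected if any two vertices are joined by a chain of edges. -/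
def IsConn (K : Finset G.F) : Prop :=
  K.Nonempty ∧ ∀ v ∈ K, ∀ w ∈ K, G.IsVertex v → G.IsVertex w →
    Relation.ReflTransGen (G.Joined K) v w

/-- The genus of a connected subgraph. -/
def genus (K : Finset G.F) : ℤ := (G.edges K).card - (G.verts K).card + 1

/-- A legless tree: a connected subgraph of genus zero without legs. -/
def IsLeglessTree (K : Finset G.F) : Prop :=
  G.IsSub K ∧ (∀ x ∈ K, ¬ G.IsLeg x) ∧ G.IsConn K ∧ G.genus K = 0

/-- A set of edges is a forest if every connected legless subgraph all of whose edges belong to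
the set is a tree. -/
def IsForest (S : Set G.Edge) : Prop :=
  ∀ K : Finset G.F, G.IsSub K → (∀ x ∈ K, ¬ G.IsLeg x) → G.IsConn K →
    (∀ e : G.Edge, e.1 ∈ G.edges K → e ∈ S) → G.IsLeglessTree K

variable {G}

theorem isVertex_r (x : G.F) : G.IsVertex (G.r x) := G.r_r x

theorem ι_of_isVertex {x : G.F} (h : G.IsVertex x) : G.ι x = x := by
  have := G.ι_r x; rw [h] at this; exact this

theorem not_isVertex_of_ne {x : G.F} (h : G.ι x ≠ x) : ¬ G.IsVertex x :=
  fun hv => h (ι_of_isVertex hv)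

theorem ι_ne {x : G.F} (h : G.ι x ≠ x) : G.ι (G.ι x) ≠ G.ι x := by
  rw [G.ι_ι]; exact h.symm

/-- The edges of a subgraph are half as many as its edge flags. -/
theorem two_mul_card_edges {K : Finset G.F} (hK : G.IsSub K) :
    2 * (G.edges K).card = (K.filter fun h => G.ι h ≠ h).card := by
  rw [Finset.card_eq_sum_card_fiberwise (t := G.edges K)
    (f := fun h => s(h, G.ι h)) (fun x hx => Finset.mem_image_of_mem _ hx)]
  rw [Finset.sum_const_nat (m := 2), mul_comm]
  intro e he
  obtain ⟨h, hh, rfl⟩ := Finset.mem_image.1 he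
  obtain ⟨hhK, hne⟩ := Finset.mem_filter.1 hh
  have : ((K.filter fun h => G.ι h ≠ h).filter fun x => s(x, G.ι x) = s(h, G.ι h))
      = {h, G.ι h} := by
    ext x
    simp only [Finset.mem_filter, Finset.mem_insert, Finset.mem_singleton]
    constructor
    · rintro ⟨-, hx⟩
      rcases Sym2.eq_iff.1 hx with h1 | h1
      · exact Or.inl h1.1
      · exact Or.inr h1.1
    · rintro (rfl | rfl)
      · exact ⟨⟨hhK, hne⟩, rfl⟩
      · refine ⟨⟨(hK _ hhK).2, ι_ne hne⟩, ?_⟩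
        rw [G.ι_ι, Sym2.eq_swap]
  rw [this, Finset.card_pair hne.symm]

/-- In a connected subgraph, a non-empty subgraph can be enlarged edge by edge: the number of
missing vertices is at most the number of missing edges. -/
theorem missing_le {T : Finset G.F} (hT : G.IsSub T) (hc : G.IsConn T) :
    ∀ (n : ℕ) (K : Finset G.F), G.IsSub K → K.Nonempty → K ⊆ T →
      (G.verts T).card - (G.verts K).card = n →
      2 * (G.verts T).card + (K.filter fun h => G.ι h ≠ h).card ≤
        2 * (G.verts K).card + (T.filter fun h => G.ι h ≠ h).card := by
  intro n
  induction n using Nat.strong_induction_on with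
  | _ n ih =>
  intro K hK hne hKT hn
  by_cases hall : G.verts T ⊆ K
  · have h1 : G.verts T ⊆ G.verts K := fun x hx =>
      Finset.mem_filter.2 ⟨hall hx, (Finset.mem_filter.1 hx).2⟩
    have h2 := Finset.card_le_card h1
    have h3 := Finset.card_le_card (Finset.filter_subset_filter (fun h => G.ι h ≠ h) hKT)
    omega
  · obtain ⟨w, hw, hwK⟩ := Finset.not_subset.1 hall
    obtain ⟨hwT, hwv⟩ := Finset.mem_filter.1 hw
    obtain ⟨x, hx⟩ := hne
    have hrx := (hK x hx).1
    have hchain := hc.2 (G.r x) (hKT hrx) w hwT (isVertex_r x) hwv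
    obtain ⟨h, hhT, hh1, hh2⟩ : ∃ h ∈ T, G.r h ∈ K ∧ G.r (G.ι h) ∉ K := by
      by_contra hcon
      push Not at hcon
      have : ∀ z, Relation.ReflTransGen (G.Joined T) (G.r x) z → z ∈ K := by
        intro z hz
        induction hz with
        | refl => exact hrx
        | tail _ hj ih2 =>
          obtain ⟨h, hh, h1, h2⟩ := hj
          rw [← h2]; exact hcon h hh (by rw [h1]; exact ih2)
      exact hwK (this w hchain)
    have hιT : G.ι h ∈ T := (hT h hhT).2
    have hne' : G.ι h ≠ h := fun he => hh2 (by rw [he]; exact hh1)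
    have hhK : h ∉ K := fun hmem => hh2 (hK _ (hK h hmem).2).1
    have hιK : G.ι h ∉ K := fun hmem => hh2 (hK _ hmem).1
    set v := G.r (G.ι h) with hv
    have hvv : G.IsVertex v := isVertex_r _
    have hvT : v ∈ T := (hT _ hιT).1
    have hvh : v ≠ h := fun he => not_isVertex_of_ne hne' (he ▸ hvv)
    have hvι : v ≠ G.ι h := fun he => not_isVertex_of_ne (ι_ne hne') (he ▸ hvv)
    let K' : Finset G.F := insert v (insert h (insert (G.ι h) K))
    have hK'sub : G.IsSub K' := by
      intro y hy
      simp only [K', Finset.mem_insert] at hy ⊢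
      rcases hy with rfl | rfl | rfl | hy
      · exact ⟨Or.inl hvv, Or.inl (ι_of_isVertex hvv)⟩
      · exact ⟨Or.inr (Or.inr (Or.inr hh1)), Or.inr (Or.inr (Or.inl rfl))⟩
      · exact ⟨Or.inl rfl, Or.inr (Or.inl (G.ι_ι _))⟩
      · exact ⟨Or.inr (Or.inr (Or.inr (hK y hy).1)), Or.inr (Or.inr (Or.inr (hK y hy).2))⟩
    have hK'T : K' ⊆ T := by
      intro y hy
      simp only [K', Finset.mem_insert] at hy
      rcases hy with rfl | rfl | rfl | hy
      · exact hvT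
      · exact hhT
      · exact hιT
      · exact hKT hy
    have hverts : G.verts K' = insert v (G.verts K) := by
      ext y
      simp only [K', verts, Finset.mem_filter, Finset.mem_insert]
      constructor
      · rintro ⟨rfl | rfl | rfl | hy, hyv⟩
        · exact Or.inl rfl
        · exact absurd hyv (not_isVertex_of_ne hne')
        · exact absurd hyv (not_isVertex_of_ne (ι_ne hne'))
        · exact Or.inr ⟨hy, hyv⟩
      · rintro (rfl | ⟨hy, hyv⟩)
        · exact ⟨Or.inl rfl, hvv⟩
        · exact ⟨Or.inr (Or.inr (Or.inr hy)), hyv⟩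
    have hvertcard : (G.verts K').card = (G.verts K).card + 1 := by
      rw [hverts, Finset.card_insert_of_notMem]
      exact fun hmem => hh2 (Finset.mem_filter.1 hmem).1
    have hflags : (K'.filter fun h => G.ι h ≠ h)
        = insert h (insert (G.ι h) (K.filter fun h => G.ι h ≠ h)) := by
      ext y
      simp only [K', Finset.mem_filter, Finset.mem_insert]
      constructor
      · rintro ⟨rfl | rfl | rfl | hy, hyv⟩
        · exact absurd (ι_of_isVertex hvv) hyv
        · exact Or.inl rfl
        · exact Or.inr (Or.inl rfl)
        · exact Or.inr (Or.inr ⟨hy, hyv⟩)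
      · rintro (rfl | rfl | ⟨hy, hyv⟩)
        · exact ⟨Or.inr (Or.inl rfl), hne'⟩
        · exact ⟨Or.inr (Or.inr (Or.inl rfl)), ι_ne hne'⟩
        · exact ⟨Or.inr (Or.inr (Or.inr hy)), hyv⟩
    have hflagcard : (K'.filter fun h => G.ι h ≠ h).card
        = (K.filter fun h => G.ι h ≠ h).card + 2 := by
      rw [hflags, Finset.card_insert_of_notMem, Finset.card_insert_of_notMem]
      · exact fun hmem => hιK (Finset.mem_filter.1 hmem).1
      · intro hmem
        rcases Finset.mem_insert.1 hmem with h1 | h1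
        · exact hne' h1.symm
        · exact hhK (Finset.mem_filter.1 h1).1
    have hvle : (G.verts K').card ≤ (G.verts T).card :=
      Finset.card_le_card (Finset.filter_subset_filter _ hK'T)
    have := ih ((G.verts T).card - (G.verts K').card) (by omega) K' hK'sub
      ⟨v, Finset.mem_insert_self _ _⟩ hK'T rfl
    omega

/-- A connected subgraph has non-negative genus. -/
theorem IsConn.genus_nonneg {K : Finset G.F} (hK : G.IsSub K) (hc : G.IsConn K) :
    0 ≤ G.genus K := by
  obtain ⟨x, hx⟩ := hc.1
  have hv : G.IsVertex (G.r x) := isVertex_r x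
  have hsub : G.IsSub {G.r x} := by
    intro y hy
    rw [Finset.mem_singleton] at hy ⊢
    subst hy
    exact ⟨hv, Finset.mem_singleton.2 (ι_of_isVertex hv)⟩
  have := missing_le hK hc _ {G.r x} hsub ⟨_, Finset.mem_singleton_self _⟩
    (Finset.singleton_subset_iff.2 (hK x hx).1) rfl
  have h1 : (G.verts {G.r x}).card ≤ 1 :=
    (Finset.card_le_card (Finset.filter_subset _ _)).trans (by simp)
  have h2 := two_mul_card_edges hK
  unfold genus
  omega

/-- A non-empty subgraph of a legless tree has fewer edges than vertices. -/
theorem IsLeglessTree.sparse {T K : Finset G.F} (hT : G.IsLeglessTree T) (hK : G.IsSub K)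
    (hne : K.Nonempty) (hKT : K ⊆ T) :
    (K.filter fun h => G.ι h ≠ h).card + 2 ≤ 2 * (G.verts K).card := by
  have h1 := missing_le hT.1 hT.2.2.1 _ K hK hne hKT rfl
  have h2 := two_mul_card_edges hT.1
  have h3 := hT.2.2.2
  unfold genus at h3
  omega

theorem isForest_empty : G.IsForest ∅ := by
  intro K hK hleg hc hS
  refine ⟨hK, hleg, hc, ?_⟩
  have hι : ∀ h ∈ K, G.ι h = h := by
    intro h hh
    by_contra hne
    exact hS ⟨s(h, G.ι h), h, hne, rfl⟩
      (Finset.mem_image.2 ⟨h, Finset.mem_filter.2 ⟨hh, hne⟩, rfl⟩)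
  have hE : G.edges K = ∅ := by
    rw [edges, Finset.filter_eq_empty_iff.2, Finset.image_empty]
    intro h hh; simpa using hι h hh
  obtain ⟨x, hx⟩ := hc.1
  have hone : G.verts K = {G.r x} := by
    ext y
    simp only [verts, Finset.mem_filter, Finset.mem_singleton]
    constructor
    · rintro ⟨hy, hyv⟩
      have := hc.2 (G.r x) (hK x hx).1 y hy (isVertex_r x) hyv
      clear hy hyv
      induction this with
      | refl => rfl
      | tail _ hj ih =>
        obtain ⟨h, hh, h1, h2⟩ := hj
        rw [← h2, hι h hh, h1, ih]
    · rintro rfl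
      exact ⟨(hK x hx).1, isVertex_r x⟩
  simp [genus, hE, hone]

theorem isForest_mono (S T : Set G.Edge) (hST : S ⊆ T) (hT : G.IsForest T) : G.IsForest S :=
  fun K hK hleg hc hS => hT K hK hleg hc fun e he => hST (hS e he)

end DGraph

/-! ### Contractions and the category of marked graphs -/

/-- A contraction of graphs: a map of graphs such that the inverse image of every vertex is a
legless tree, and the inverse image of every edge or leg consists of a single edge or leg (that is,
every flag which is not a vertex has exactly one preimage). -/
structure IsContraction {U : Type u} (G H : DGraph U) (f : G.F → H.F) : Prop where
  map_r : ∀ x, f (G.r x) = H.r (f x)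
  map_ι : ∀ x, f (G.ι x) = H.ι (f x)
  fiber : ∀ v, H.IsVertex v → G.IsLeglessTree (Finset.univ.filter fun x => f x = v)
  flag : ∀ y, ¬ H.IsVertex y → ∃! x, f x = y

namespace IsContraction

open DGraph

variable {U : Type u} {G H : DGraph U} {f : G.F → H.F}

theorem isVertex (hf : IsContraction G H f) {x : G.F} (hx : G.IsVertex x) :
    H.IsVertex (f x) := by
  have := hf.map_r x
  rw [hx] at this
  exact this.symm

theorem ι_fixed_iff (hf : IsContraction G H f) {x : G.F} (hx : ¬ H.IsVertex (f x)) :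
    G.ι x = x ↔ H.ι (f x) = f x := by
  constructor
  · intro h; rw [← hf.map_ι, h]
  · intro h
    exact (hf.flag _ hx).unique (by rw [hf.map_ι, h]) rfl

theorem surjective (hf : IsContraction G H f) (y : H.F) : ∃ x, f x = y := by
  by_cases hy : H.IsVertex y
  · obtain ⟨x, hx⟩ := (hf.fiber y hy).2.2.1.1
    exact ⟨x, (Finset.mem_filter.1 hx).2⟩
  · exact (hf.flag y hy).exists

theorem isSub_image (hf : IsContraction G H f) {K : Finset G.F} (hK : G.IsSub K) :
    H.IsSub (K.image f) := by
  intro y hy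
  obtain ⟨x, hx, rfl⟩ := Finset.mem_image.1 hy
  exact ⟨Finset.mem_image.2 ⟨_, (hK x hx).1, hf.map_r x⟩,
    Finset.mem_image.2 ⟨_, (hK x hx).2, hf.map_ι x⟩⟩

theorem card_le (hf : IsContraction G H f) {K : Finset G.F} (hK : G.IsSub K) :
    (K.filter fun h => G.ι h ≠ h).card + 2 * (H.verts (K.image f)).card ≤
      ((K.image f).filter fun h => H.ι h ≠ h).card + 2 * (G.verts K).card := by
  have h1 : (K.filter fun h => G.ι h ≠ h).card
      = ∑ y ∈ K.image f, ((K.filter fun h => G.ι h ≠ h).filter fun x => f x = y).card :=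
    Finset.card_eq_sum_card_fiberwise
      fun x hx => Finset.mem_image_of_mem f (Finset.mem_filter.1 hx).1
  have h2 : (G.verts K).card
      = ∑ y ∈ K.image f, ((G.verts K).filter fun x => f x = y).card :=
    Finset.card_eq_sum_card_fiberwise
      fun x hx => Finset.mem_image_of_mem f (Finset.mem_filter.1 hx).1
  have h3 : (H.verts (K.image f)).card = ∑ y ∈ K.image f, if H.IsVertex y then 1 else 0 := by
    rw [verts, Finset.card_filter]
  have h4 : ((K.image f).filter fun h => H.ι h ≠ h).card
      = ∑ y ∈ K.image f, if H.ι y ≠ y then 1 else 0 := by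
    rw [Finset.card_filter]
  rw [h1, h2, h3, h4, Finset.mul_sum, Finset.mul_sum, ← Finset.sum_add_distrib,
    ← Finset.sum_add_distrib]
  refine Finset.sum_le_sum fun y hy => ?_
  obtain ⟨x, hx, hxy⟩ := Finset.mem_image.1 hy
  by_cases hv : H.IsVertex y
  · rw [if_pos hv, if_neg (by simpa using ι_of_isVertex hv)]
    have hsub : G.IsSub (K.filter fun x => f x = y) := by
      intro z hz
      obtain ⟨hz1, hz2⟩ := Finset.mem_filter.1 hz
      refine ⟨Finset.mem_filter.2 ⟨(hK z hz1).1, ?_⟩, Finset.mem_filter.2 ⟨(hK z hz1).2, ?_⟩⟩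
      · rw [hf.map_r, hz2]; exact hv
      · rw [hf.map_ι, hz2]; exact ι_of_isVertex hv
    have := (hf.fiber y hv).sparse hsub ⟨x, Finset.mem_filter.2 ⟨hx, hxy⟩⟩
      (Finset.filter_subset_filter _ (Finset.subset_univ _))
    have e1 : ((K.filter fun h => G.ι h ≠ h).filter fun x => f x = y)
        = ((K.filter fun x => f x = y).filter fun h => G.ι h ≠ h) := Finset.filter_comm _ _ _
    have e2 : ((G.verts K).filter fun x => f x = y) = G.verts (K.filter fun x => f x = y) :=
      Finset.filter_comm _ _ _
    rw [e1, e2]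
    omega
  · rw [if_neg hv]
    have hle : ((K.filter fun h => G.ι h ≠ h).filter fun x => f x = y).card ≤
        if H.ι y ≠ y then 1 else 0 := by
      split_ifs with hne
      · refine Finset.card_le_one.2 fun a ha b hb => ?_
        exact (hf.flag y hv).unique (Finset.mem_filter.1 ha).2 (Finset.mem_filter.1 hb).2
      · refine le_of_eq (Finset.card_eq_zero.2 (Finset.filter_eq_empty_iff.2 ?_))
        intro z hz hzy
        subst hzy
        exact (Finset.mem_filter.1 hz).2 ((hf.ι_fixed_iff hv).2 (not_not.1 hne))
    omega

/-- A connected legless subgraph whose image under a contraction is a legless tree is a tree. -/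
theorem tree_of_image (hf : IsContraction G H f) {K : Finset G.F} (hK : G.IsSub K)
    (hleg : ∀ x ∈ K, ¬ G.IsLeg x) (hc : G.IsConn K) (hT : H.IsLeglessTree (K.image f)) :
    G.IsLeglessTree K := by
  refine ⟨hK, hleg, hc, le_antisymm ?_ (hc.genus_nonneg hK)⟩
  have h1 := hf.card_le hK
  have h2 := two_mul_card_edges hK
  have h3 := two_mul_card_edges hT.1
  have h4 := hT.2.2.2
  unfold genus at h4 ⊢
  omega

/-- The inverse image of a legless tree under a contraction is a legless tree. -/
theorem tree_preimage (hf : IsContraction G H f) {K : Finset H.F} (hK : H.IsLeglessTree K) :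
    G.IsLeglessTree (Finset.univ.filter fun x => f x ∈ K) := by
  obtain ⟨hsub, hleg, hc, -⟩ := id hK
  have hmem : ∀ x, x ∈ (Finset.univ.filter fun x => f x ∈ K) ↔ f x ∈ K := by simp
  have himg : (Finset.univ.filter fun x => f x ∈ K).image f = K := by
    ext y
    constructor
    · intro hy
      obtain ⟨x, hx, rfl⟩ := Finset.mem_image.1 hy
      exact (hmem x).1 hx
    · intro hy
      obtain ⟨x, rfl⟩ := hf.surjective y
      exact Finset.mem_image_of_mem f ((hmem x).2 hy)
  refine hf.tree_of_image ?_ ?_ ⟨?_, ?_⟩ (by rw [himg]; exact hK)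
  · intro x hx
    rw [hmem] at hx
    rw [hmem, hmem, hf.map_r, hf.map_ι]
    exact hsub _ hx
  · intro x hx hl
    rw [hmem] at hx
    by_cases hv : H.IsVertex (f x)
    · exact (hf.fiber _ hv).2.1 x (by simp) hl
    · exact hleg _ hx ⟨hv, (hf.ι_fixed_iff hv).1 hl.2⟩
  · obtain ⟨y, hy⟩ := hc.1
    obtain ⟨x, rfl⟩ := hf.surjective y
    exact ⟨x, (hmem x).2 hy⟩
  · intro v hv w hw hvv hwv
    rw [hmem] at hv hw
    have hfib : ∀ a b, G.IsVertex a → G.IsVertex b → f a = f b → f a ∈ K →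
        Relation.ReflTransGen (G.Joined (Finset.univ.filter fun x => f x ∈ K)) a b := by
      intro a b ha hb hab haK
      refine Relation.ReflTransGen.mono ?_ _ _ ((hf.fiber (f a) (hf.isVertex ha)).2.2.1.2 a (by simp) b
        (by simp [hab]) ha hb)
      rintro p q ⟨h, hh, h1, h2⟩
      exact ⟨h, (hmem h).2 (by rw [(Finset.mem_filter.1 hh).2]; exact haK), h1, h2⟩
    have main : ∀ y, Relation.ReflTransGen (H.Joined K) (f v) y → ∀ b, G.IsVertex b → f b = y →
        Relation.ReflTransGen (G.Joined (Finset.univ.filter fun x => f x ∈ K)) v b := by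
      intro y hy
      induction hy with
      | refl => intro b hb hby; exact hfib v b hvv hb hby.symm hv
      | tail _ hj ih =>
        intro b hb hby
        obtain ⟨h, hh, h1, h2⟩ := hj
        obtain ⟨x, rfl⟩ := hf.surjective h
        have s1 := ih (G.r x) (isVertex_r x) (by rw [hf.map_r, h1])
        have s2 : G.Joined (Finset.univ.filter fun x => f x ∈ K) (G.r x) (G.r (G.ι x)) :=
          ⟨x, (hmem x).2 hh, rfl, rfl⟩
        have s3 := hfib (G.r (G.ι x)) b (isVertex_r _) hb
          (by rw [hf.map_r, hf.map_ι, h2, hby])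
          (by rw [hf.map_r, hf.map_ι]; exact (hsub _ (hsub _ hh).2).1)
        exact (s1.tail s2).trans s3
    exact main _ (hc.2 _ hv _ hw (hf.isVertex hvv) (hf.isVertex hwv)) w hwv rfl

theorem comp {G' : DGraph U} {f' : H.F → G'.F} (hf' : IsContraction H G' f')
    (hf : IsContraction G H f) : IsContraction G G' (f' ∘ f) where
  map_r x := by simp [hf.map_r, hf'.map_r]
  map_ι x := by simp [hf.map_ι, hf'.map_ι]
  fiber v hv := by
    have := hf.tree_preimage (hf'.fiber v hv)
    have h2 : (Finset.univ.filter fun x => (f' ∘ f) x = v)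
        = Finset.univ.filter fun x => f x ∈ Finset.univ.filter fun x => f' x = v := by
      ext x; simp
    rw [h2]; exact this
  flag y hy := by
    obtain ⟨z, hz, hzu⟩ := hf'.flag y hy
    have hzv : ¬ H.IsVertex z := fun h => hy (hz ▸ hf'.isVertex h)
    obtain ⟨x, hx, hxu⟩ := hf.flag z hzv
    refine ⟨x, by simp [hx, hz], fun x' hx' => hxu _ (hzu _ hx')⟩

theorem id (G : DGraph U) : IsContraction G G (fun x => x) where
  map_r _ := rfl
  map_ι _ := rfl
  flag y _ := ⟨y, rfl, fun _ h => h⟩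
  fiber v hv := by
    have hmem : ∀ x, x ∈ (Finset.univ.filter fun x : G.F => x = v) ↔ x = v := by simp
    have hS : (Finset.univ.filter fun x : G.F => x = v) = {v} := by ext x; simp
    refine ⟨?_, ?_, ⟨⟨v, by simp⟩, ?_⟩, ?_⟩
    · intro x hx
      rw [hmem] at hx ⊢
      subst hx
      exact ⟨hv, (hmem _).2 (ι_of_isVertex hv)⟩
    · intro x hx hl
      rw [hmem] at hx
      exact hl.1 (hx ▸ hv)
    · intro a ha b hb _ _
      rw [hmem] at ha hb
      rw [ha, hb]
    · rw [hS]
      have h1 : G.edges {v} = ∅ := by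
        rw [edges, Finset.filter_eq_empty_iff.2, Finset.image_empty]
        intro h hh
        rw [Finset.mem_singleton] at hh
        simpa [hh] using ι_of_isVertex hv
      have h2 : G.verts {v} = {v} := by
        rw [verts, Finset.filter_eq_self]
        intro h hh
        rw [Finset.mem_singleton] at hh
        rw [hh]; exact hv
      simp [genus, h1, h2]

end IsContraction

/-- The objects of `𝔾_{g,A}`: connected genus-`g` graphs with `A`-marked legs all of whose vertices
are at least trivalent. -/
structure GCat (U : Type u) {Λ : Type u} (g : ℕ) (A : Finset Λ) extends DGraph U where
  leg : A → F
  leg_injective : Function.Injective leg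
  leg_range : ∀ x, toDGraph.IsLeg x ↔ ∃ a, leg a = x
  conn : toDGraph.IsConn Finset.univ
  genus_eq : toDGraph.genus Finset.univ = g
  stable : ∀ v, toDGraph.IsVertex v → 3 ≤ toDGraph.val v

namespace GCat

variable {U Λ : Type u} {g : ℕ} {A : Finset Λ}

/-- The morphisms of `𝔾_{g,A}`: contractions commuting with the markings. -/
@[ext]
structure Hom (G H : GCat U g A) where
  toFun : G.F → H.F
  contraction : IsContraction G.toDGraph H.toDGraph toFun
  map_leg : ∀ a, toFun (G.leg a) = H.leg a

instance : Category (GCat U g A) where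
  Hom := Hom
  id G := ⟨fun x => x, IsContraction.id _, fun _ => rfl⟩
  comp f k := ⟨k.toFun ∘ f.toFun, k.contraction.comp f.contraction, fun a => by
    simp [f.map_leg, k.map_leg]⟩

/-- The map of flags of a morphism. -/
def fn {G H : GCat U g A} (f : G ⟶ H) : G.F → H.F := Hom.toFun f

theorem fn_contraction {G H : GCat U g A} (f : G ⟶ H) :
    IsContraction G.toDGraph H.toDGraph (fn f) := Hom.contraction f

/-! ### Cones of metrics -/

/-- Pull-back of integral (co)chains on edges along a contraction: a non-contracted edge of `G`
gets the value of its image, a contracted edge gets the value zero. -/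
def pull {G H : GCat U g A} (f : G ⟶ H) : (H.Edge → ℤ) →ₗ[ℤ] (G.Edge → ℤ) where
  toFun δ e := if h : H.IsEdge (Sym2.map (fn f) e.1) then δ ⟨_, h⟩ else 0
  map_add' δ δ' := by
    funext e
    by_cases h : H.IsEdge (Sym2.map (fn f) e.1)
    · simp only [Pi.add_apply, dif_pos h]; rfl
    · simp only [Pi.add_apply, dif_neg h, add_zero]
  map_smul' c δ := by
    funext e
    by_cases h : H.IsEdge (Sym2.map (fn f) e.1)
    · simp only [Pi.smul_apply, dif_pos h]; rfl
    · simp only [Pi.smul_apply, dif_neg h, smul_zero]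

theorem pull_id (G : GCat U g A) : pull (𝟙 G) = LinearMap.id := by
  refine LinearMap.ext fun δ => funext fun e => ?_
  have h : Sym2.map (fn (𝟙 G)) e.1 = e.1 := congrFun Sym2.map_id e.1
  have h' : G.IsEdge (Sym2.map (fn (𝟙 G)) e.1) := by rw [h]; exact e.2
  simp only [pull, LinearMap.coe_mk, AddHom.coe_mk, LinearMap.id_apply]
  rw [dif_pos h']
  congr 1
  exact Subtype.ext h

theorem isEdge_of_map {G H : GCat U g A} (f : G ⟶ H) {e : Sym2 G.F}
    (he : ∃ h, e = s(h, G.ι h)) (h : H.IsEdge (Sym2.map (fn f) e)) : G.IsEdge e := by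
  obtain ⟨x, rfl⟩ := he
  refine ⟨x, fun hx => ?_, rfl⟩
  obtain ⟨y, hy, hye⟩ := h
  rw [hx, Sym2.map_mk] at hye
  rcases Sym2.eq_iff.1 hye with h1 | h1
  · exact hy (h1.2.symm.trans h1.1)
  · exact hy (h1.1.symm.trans h1.2)

theorem map_edge {G H : GCat U g A} (f : G ⟶ H) (e : G.Edge) :
    ∃ h, Sym2.map (fn f) e.1 = s(h, H.ι h) := by
  obtain ⟨_, x, -, rfl⟩ := e
  exact ⟨fn f x, by rw [Sym2.map_mk, (fn_contraction f).map_ι]⟩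

theorem pull_comp {G H K : GCat U g A} (f : G ⟶ H) (k : H ⟶ K) :
    pull (f ≫ k) = pull f ∘ₗ pull k := by
  refine LinearMap.ext fun δ => funext fun e => ?_
  have hm : Sym2.map (fn (f ≫ k)) e.1 = Sym2.map (fn k) (Sym2.map (fn f) e.1) := by
    rw [Sym2.map_map]; rfl
  simp only [pull, LinearMap.coe_mk, AddHom.coe_mk, LinearMap.comp_apply]
  by_cases h : K.IsEdge (Sym2.map (fn (f ≫ k)) e.1)
  · have h1 : H.IsEdge (Sym2.map (fn f) e.1) := isEdge_of_map k (map_edge f e) (hm ▸ h)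
    rw [dif_pos h, dif_pos h1, dif_pos (hm ▸ h)]
    congr 1
    exact Subtype.ext hm
  · rw [dif_neg h]
    by_cases h1 : H.IsEdge (Sym2.map (fn f) e.1)
    · rw [dif_pos h1, dif_neg (hm ▸ h)]
    · rw [dif_neg h1]

/-- The inverse image of a forest, together with the contracted edges, is a forest. -/
theorem isForest_pull {G H : GCat U g A} (f : G ⟶ H) {S : Set H.Edge} (hS : H.IsForest S) :
    G.IsForest {e | ∀ h : H.IsEdge (Sym2.map (fn f) e.1), (⟨_, h⟩ : H.Edge) ∈ S} := by
  intro K hK hleg hc hKS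
  have hf := fn_contraction f
  refine hf.tree_of_image hK hleg hc (hS _ (hf.isSub_image hK) ?_ ⟨hc.1.image _, ?_⟩ ?_)
  · intro y hy hl
    obtain ⟨x, hx, rfl⟩ := Finset.mem_image.1 hy
    exact hleg x hx ⟨fun hv => hl.1 (hf.isVertex hv), (hf.ι_fixed_iff hl.1).2 hl.2⟩
  · intro v hv w hw hvv hwv
    obtain ⟨x, hx, rfl⟩ := Finset.mem_image.1 hv
    obtain ⟨z, hz, rfl⟩ := Finset.mem_image.1 hw
    have := hc.2 _ (hK x hx).1 _ (hK z hz).1 (DGraph.isVertex_r x) (DGraph.isVertex_r z)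
    have h1 : fn f (G.r x) = fn f x := (hf.map_r x).trans hvv
    have h2 : fn f (G.r z) = fn f z := (hf.map_r z).trans hwv
    rw [← h1, ← h2]
    refine Relation.ReflTransGen.lift (fn f) ?_ _ _ this
    rintro a b ⟨h, hh, rfl, rfl⟩
    exact ⟨fn f h, Finset.mem_image_of_mem _ hh, (hf.map_r h).symm, by
      rw [← hf.map_ι, ← hf.map_r]⟩
  · intro e he
    obtain ⟨y, hy, hye⟩ := Finset.mem_image.1 he
    obtain ⟨hyK, hyne⟩ := Finset.mem_filter.1 hy
    obtain ⟨x, hx, rfl⟩ := Finset.mem_image.1 hyK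
    have hxne : G.ι x ≠ x := fun h => hyne (by rw [← hf.map_ι, h])
    have hmap : Sym2.map (fn f) s(x, G.ι x) = e.1 := by
      rw [Sym2.map_mk, hf.map_ι]; exact hye
    have := hKS ⟨s(x, G.ι x), x, hxne, rfl⟩
      (Finset.mem_image.2 ⟨x, Finset.mem_filter.2 ⟨hx, hxne⟩, rfl⟩)
    have h2 := this (hmap.symm ▸ e.2)
    have h3 : (⟨Sym2.map (fn f) s(x, G.ι x), hmap.symm ▸ e.2⟩ : H.Edge) = e := Subtype.ext hmap
    rwa [h3] at h2

/-- The cone of metrics `σ_G`: non-negative lengths on the edges such that the edges of length zero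
form a forest. -/
def coneOfMetrics (G : GCat U g A) : Poic.{u} :=
  Poic.orthant G.Edge G.IsForest DGraph.isForest_empty DGraph.isForest_mono

theorem proj_pull {G H : GCat U g A} (f : G ⟶ H) (e : G.Edge) (x : ℝ ⊗[ℤ] (H.Edge → ℤ)) :
    evalR (LinearMap.proj e : Module.Dual ℤ (G.Edge → ℤ)) (LinearMap.baseChange ℝ (pull f) x)
      = if h : H.IsEdge (Sym2.map (fn f) e.1) then
          evalR (LinearMap.proj ⟨_, h⟩ : Module.Dual ℤ (H.Edge → ℤ)) x else 0 := by
  rw [evalR_baseChange]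
  by_cases h : H.IsEdge (Sym2.map (fn f) e.1)
  · rw [dif_pos h]
    congr 2
    refine LinearMap.ext fun δ => ?_
    simp only [LinearMap.comp_apply, LinearMap.proj_apply, pull, LinearMap.coe_mk, AddHom.coe_mk,
      dif_pos h]
    rfl
  · rw [dif_neg h]
    have : (LinearMap.proj e : Module.Dual ℤ (G.Edge → ℤ)) ∘ₗ pull f = 0 := by
      refine LinearMap.ext fun δ => ?_
      simp [pull, h]
    rw [this]
    simp [evalR]

theorem pull_mem_cone {G H : GCat U g A} (f : G ⟶ H) (x : ℝ ⊗[ℤ] (H.Edge → ℤ))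
    (hx : x ∈ Poic.orthantCone H.Edge H.IsForest) :
    LinearMap.baseChange ℝ (pull f) x ∈ Poic.orthantCone G.Edge G.IsForest := by
  refine ⟨fun e => ?_, ?_⟩
  · rw [proj_pull]
    split_ifs with h
    · exact hx.1 _
    · exact le_rfl
  · refine DGraph.isForest_mono _ _ ?_ (isForest_pull f hx.2)
    intro e he h
    have : evalR (LinearMap.proj e : Module.Dual ℤ (G.Edge → ℤ))
      (LinearMap.baseChange ℝ (pull f) x) = 0 := he
    rw [proj_pull, dif_pos h] at this
    exact this

end GCat

/-- The functor `M^trop_{g,A} : 𝔾_{g,A}^op ⥤ POIC`. -/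
def Mtrop (U : Type u) {Λ : Type u} (g : ℕ) (A : Finset Λ) : (GCat U g A)ᵒᵖ ⥤ Poic.{u} where
  obj G := G.unop.coneOfMetrics
  map f := ⟨GCat.pull f.unop, GCat.pull_mem_cone f.unop⟩
  map_id G := Poic.hom_ext (GCat.pull_id G.unop)
  map_comp f k := Poic.hom_ext (GCat.pull_comp k.unop f.unop)

namespace DGraph

variable {U : Type u} (G : DGraph U)

/-- The length of the edge through the flag `h` (zero if `h` is a vertex or a leg). -/
def flagLen (δ : G.Edge → ℤ) (h : G.F) : ℤ :=
  if hh : G.ι h ≠ h then δ ⟨s(h, G.ι h), h, hh, rfl⟩ else 0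

/-- A walk from the vertex `v` to the vertex `w`: a list of oriented edges. -/
def IsWalk : G.F → G.F → List G.F → Prop
  | v, w, [] => v = w
  | v, w, h :: p => G.r h = v ∧ G.ι h ≠ h ∧ IsWalk (G.r (G.ι h)) w p

/-- A path: a walk without repeated edges. In a tree, any two vertices are joined by exactly one
path, whose length is their distance. -/
def IsPath (v w : G.F) (p : List G.F) : Prop :=
  G.IsWalk v w p ∧ (p.map fun h => s(h, G.ι h)).Nodup

end DGraph

/-! ### The distance map of rational curves -/

section Distance

variable {Λ : Type u}

/-- Two-element subsets of `A`. -/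
abbrev Pairs (A : Finset Λ) : Type u := {p : Finset Λ // p ∈ A.powersetCard 2}

/-- The linear map `ℝ^A → ℝ^(A choose 2)`, `x ↦ (x_i + x_j)_{i,j}`. -/
def sumMap (A : Finset Λ) : (A → ℝ) →ₗ[ℝ] (Pairs A → ℝ) :=
  LinearMap.pi fun p => ∑ i : A, if i.1 ∈ p.1 then LinearMap.proj i else 0

/-- The cokernel `Q_A` of `sumMap A`. -/
abbrev QSpace (A : Finset Λ) : Type u := (Pairs A → ℝ) ⧸ LinearMap.range (sumMap A)

/-- The class in `Q_A` of a vector of pairwise distances. -/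
def QSpace.mk {A : Finset Λ} (x : Pairs A → ℝ) : QSpace A :=
  (LinearMap.range (sumMap A)).mkQ x

/-- The vector `v_I` of pairwise distances of the metric tree with a single edge, of length one,
which separates the legs in `I` from the others. -/
def splitVector (A I : Finset Λ) : Pairs A → ℝ := fun p => if (p.1 ∩ I).card = 1 then 1 else 0

/-- The lattice `N_dist` generated by the classes of the vectors `v_I`, `1 < #I < #A - 1`. -/
def Ndist (A : Finset Λ) : Submodule ℤ (QSpace A) :=
  Submodule.span ℤ ((fun I => QSpace.mk (splitVector A I)) ''
    {I : Finset Λ | I ⊆ A ∧ 1 < I.card ∧ I.card + 1 < A.card})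

instance (A : Finset Λ) : Module.Finite ℤ (Ndist A) := by
  refine Module.Finite.iff_fg.2 (Submodule.fg_span (Set.Finite.image _ ?_))
  exact (A.powerset.finite_toSet).subset fun I hI => by simpa using hI.1

instance (A : Finset Λ) : Module.Free ℤ (Ndist A) := by
  have : Module.IsTorsionFree ℤ (QSpace A) := Module.IsTorsionFree.trans_faithfulSMul ℤ ℝ _
  infer_instance

/-- The projection `ℝ^(A choose 2) → ℝ^(B choose 2)` for `B ⊆ A`. -/
def restrictPairs {A B : Finset Λ} (h : B ⊆ A) (x : Pairs A → ℝ) : Pairs B → ℝ :=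
  fun p => x ⟨p.1, Finset.powersetCard_mono h p.2⟩

/-- The integral linear map `N_dist(A) → N_dist(B)` is induced by the projection. -/
def IsForgetDist {A B : Finset Λ} (h : B ⊆ A) (φ : Ndist A →ₗ[ℤ] Ndist B) : Prop :=
  ∀ (n : Ndist A) (x : Pairs A → ℝ), QSpace.mk x = (n : QSpace A) →
    ((φ n : Ndist B) : QSpace B) = QSpace.mk (restrictPairs h x)

/-- The morphism of poic-complexes `dist_A`: it maps a metric tree to the class of the vector of
distances between its legs. -/
def IsDist {U : Type u} {A : Finset Λ}
    (D : PoicMor (Mtrop U 0 A) (wholeComplex.{u, u} (Ndist A))) : Prop :=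
  ∀ (T : GCat U 0 A) (δ : T.Edge → ℤ), ∃ x : Pairs A → ℝ,
    (∀ (q : Pairs A) (i j : A), q.1 = {i.1, j.1} → ∃ p : List T.F,
      T.IsPath (T.r (T.leg i)) (T.r (T.leg j)) p ∧ x q = ((p.map (T.flagLen δ)).sum : ℤ)) ∧
    (show Ndist A from Poic.lin (D.at' (op T)) δ : QSpace A) = QSpace.mk x

end Distance

/-- The morphism `F` of poic-complexes and the integral linear map `φ` form a morphism of linear
poic-complexes `Φ_X ⟶ Ψ_Y`. -/
def IsLinearMor {C D : Type u} [Category.{u} C] [Category.{u} D] {Φ : C ⥤ Poic.{u}}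
    {Ψ : D ⥤ Poic.{u}} {N M : Type u} [AddCommGroup N] [Module.Free ℤ N] [Module.Finite ℤ N]
    [AddCommGroup M] [Module.Free ℤ M] [Module.Finite ℤ M]
    (X : PoicMor Φ (wholeComplex.{u, u} N)) (Y : PoicMor Ψ (wholeComplex.{u, u} M))
    (F : PoicMor Φ Ψ) (φ : N →ₗ[ℤ] M) : Prop :=
  ∀ (p : C) (n : (Φ.obj p).N),
    φ (Poic.lin (X.at' p) n) = (Poic.lin (Y.at' (F.functor.obj p)) (Poic.lin (F.at' p) n) : M)

/-- The square of morphisms `ρ ∘ fc = fs ∘ π` commutes, up to a natural isomorphism. -/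
def IsCommSquare {C D C' D' : Type u} [Category.{u} C] [Category.{u} D] [Category.{u} C']
    [Category.{u} D'] {Φ : C ⥤ Poic.{u}} {X : D ⥤ Poic.{u}} {Ψ : C' ⥤ Poic.{u}}
    {Y : D' ⥤ Poic.{u}} (π : PoicMor Φ X) (ρ : PoicMor Ψ Y) (fc : PoicMor Φ Ψ)
    (fs : PoicMor X Y) : Prop :=
  ∃ θ : (fc.comp ρ).functor ≅ (π.comp fs).functor,
    ∀ p : C, (fc.comp ρ).at' p ≫ Y.map (θ.hom.app p) = (π.comp fs).at' p

/-- `(fc, fs, φ)` is a weakly proper morphism from the linear poic-fibration `π : Φ_X ⟶ 𝒳` to the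
linear poic-fibration `ρ : Ψ_Y ⟶ 𝒴`. -/
structure IsWeaklyProperFibrationMor {C D C' D' : Type u} [Category.{u} C] [Category.{u} D]
    [Category.{u} C'] [Category.{u} D'] {Φ : C ⥤ Poic.{u}} {X : D ⥤ Poic.{u}}
    {Ψ : C' ⥤ Poic.{u}} {Y : D' ⥤ Poic.{u}} {N M : Type u} [AddCommGroup N] [Module.Free ℤ N]
    [Module.Finite ℤ N] [AddCommGroup M] [Module.Free ℤ M] [Module.Finite ℤ M]
    (π : PoicMor Φ X) (linΦ : PoicMor Φ (wholeComplex.{u, u} N)) (ρ : PoicMor Ψ Y)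
    (linΨ : PoicMor Ψ (wholeComplex.{u, u} M)) (fc : PoicMor Φ Ψ) (fs : PoicMor X Y)
    (φ : N →ₗ[ℤ] M) : Prop where
  fibration_source : π.IsPoicFibration
  fibration_target : ρ.IsPoicFibration
  square : IsCommSquare π ρ fc fs
  linear : IsLinearMor linΦ linΨ fc φ
  weaklyProper : fc.IsWeaklyProper
  lifts : fs.LiftsIsos

/-! ### Spanning trees -/

section SpanningTree

variable {U Λ : Type u}

/-- The set `A ⊔ {1,…,g,1*,…,g*}`; the elements `i`, `i*` are `(i, false)`, `(i, true)`. -/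
def legSet (g : ℕ) (A : Finset Λ) : Finset (Λ ⊕ Fin g × Bool) :=
  A.disjSum Finset.univ

theorem inl_mem_legSet {g : ℕ} {A : Finset Λ} {a : Λ} (ha : a ∈ A) :
    Sum.inl a ∈ legSet g A := Finset.inl_mem_disjSum.2 ha

theorem inr_mem_legSet {g : ℕ} {A : Finset Λ} (i : Fin g × Bool) :
    Sum.inr i ∈ legSet g A := Finset.inr_mem_disjSum.2 (Finset.mem_univ i)

theorem legSet_mono {g : ℕ} {A B : Finset Λ} (h : B ⊆ A) : legSet g B ⊆ legSet g A :=
  Finset.disjSum_mono h (Finset.Subset.refl _)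

namespace GCat

variable {g : ℕ} {A : Finset Λ}

/-- The `a`-leg of a tree, for `a ∈ A`. -/
def oldLeg (T : GCat U 0 (legSet g A)) (a : A) : T.F := T.leg ⟨Sum.inl a.1, inl_mem_legSet a.2⟩

/-- The `i`-leg or `i*`-leg of a tree. -/
def newLeg (T : GCat U 0 (legSet g A)) (i : Fin g × Bool) : T.F :=
  T.leg ⟨Sum.inr i, inr_mem_legSet i⟩

/-- Sets of vanishing coordinates of points of `σ_T × ℝ_{>0}^g`. -/
def STzero (T : GCat U 0 (legSet g A)) (S : Set (T.Edge ⊕ Fin g)) : Prop :=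
  T.IsForest (Sum.inl ⁻¹' S) ∧ ∀ i, Sum.inr i ∉ S

/-- The poic `σ_T × ℝ_{>0}^g`, with lattice `ℤ^(E(T) ⊔ {1,…,g})`. -/
def STcone (T : GCat U 0 (legSet g A)) : Poic.{u} :=
  Poic.orthant (T.Edge ⊕ Fin g) T.STzero
    ⟨DGraph.isForest_empty, fun _ h => h⟩
    (fun _ _ hST hT => ⟨DGraph.isForest_mono _ _ (Set.preimage_mono hST) hT.1,
      fun i hi => hT.2 i (hST hi)⟩)

/-- `ι_f × id` on lattices, for a contraction `f`. -/
def pullST {T T' : GCat U 0 (legSet g A)} (f : T ⟶ T') :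
    (T'.Edge ⊕ Fin g → ℤ) →ₗ[ℤ] (T.Edge ⊕ Fin g → ℤ) where
  toFun δ := Sum.elim (pull f (δ ∘ Sum.inl)) (δ ∘ Sum.inr)
  map_add' δ δ' := by
    funext e
    rcases e with e | i
    · exact congrFun (map_add (pull f) (δ ∘ Sum.inl) (δ' ∘ Sum.inl)) e
    · rfl
  map_smul' c δ := by
    funext e
    rcases e with e | i
    · exact congrFun (map_smul (pull f) c (δ ∘ Sum.inl)) e
    · rfl

/-- The projection `σ_T × ℝ_{>0}^g → σ_T` on lattices. -/
def projST (T : GCat U 0 (legSet g A)) : (T.Edge ⊕ Fin g → ℤ) →ₗ[ℤ] (T.Edge → ℤ) :=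
  LinearMap.funLeft ℤ ℤ Sum.inl

theorem projST_mem (T : GCat U 0 (legSet g A)) (x : ℝ ⊗[ℤ] (T.Edge ⊕ Fin g → ℤ))
    (hx : x ∈ Poic.orthantCone (T.Edge ⊕ Fin g) T.STzero) :
    LinearMap.baseChange ℝ T.projST x ∈ Poic.orthantCone T.Edge T.IsForest := by
  have h : ∀ e : T.Edge, evalR (LinearMap.proj e : Module.Dual ℤ (T.Edge → ℤ))
      (LinearMap.baseChange ℝ T.projST x)
      = evalR (LinearMap.proj (Sum.inl e) : Module.Dual ℤ (T.Edge ⊕ Fin g → ℤ)) x := by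
    intro e
    rw [evalR_baseChange]
    rfl
  refine ⟨fun e => ?_, ?_⟩
  · rw [h]; exact hx.1 _
  · refine DGraph.isForest_mono _ _ ?_ hx.2.1
    intro e he
    have he' : evalR (LinearMap.proj e : Module.Dual ℤ (T.Edge → ℤ))
      (LinearMap.baseChange ℝ T.projST x) = 0 := he
    rw [h] at he'
    exact he'

theorem pullST_mem {T T' : GCat U 0 (legSet g A)} (f : T ⟶ T')
    (x : ℝ ⊗[ℤ] (T'.Edge ⊕ Fin g → ℤ))
    (hx : x ∈ Poic.orthantCone (T'.Edge ⊕ Fin g) T'.STzero) :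
    LinearMap.baseChange ℝ (pullST f) x ∈ Poic.orthantCone (T.Edge ⊕ Fin g) T.STzero := by
  have h0 : T.projST ∘ₗ pullST f = pull f ∘ₗ T'.projST := rfl
  have hl : ∀ e : T.Edge, evalR (LinearMap.proj (Sum.inl e) : Module.Dual ℤ (T.Edge ⊕ Fin g → ℤ))
      (LinearMap.baseChange ℝ (pullST f) x)
      = evalR (LinearMap.proj e : Module.Dual ℤ (T.Edge → ℤ))
        (LinearMap.baseChange ℝ (pull f) (LinearMap.baseChange ℝ T'.projST x)) := by
    intro e
    rw [evalR_baseChange, evalR_baseChange, evalR_baseChange]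
    rfl
  have hr : ∀ i : Fin g,
      evalR (LinearMap.proj (Sum.inr i) : Module.Dual ℤ (T.Edge ⊕ Fin g → ℤ))
      (LinearMap.baseChange ℝ (pullST f) x)
      = evalR (LinearMap.proj (Sum.inr i) : Module.Dual ℤ (T'.Edge ⊕ Fin g → ℤ)) x := by
    intro i
    rw [evalR_baseChange]
    rfl
  have hp := pull_mem_cone f _ (T'.projST_mem x hx)
  refine ⟨?_, ?_, ?_⟩
  · rintro (e | i)
    · rw [hl]; exact hp.1 e
    · rw [hr]; exact hx.1 _
  · refine DGraph.isForest_mono _ _ ?_ hp.2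
    intro e he
    have he' : evalR (LinearMap.proj (Sum.inl e) : Module.Dual ℤ (T.Edge ⊕ Fin g → ℤ))
      (LinearMap.baseChange ℝ (pullST f) x) = 0 := he
    rw [hl] at he'
    exact he'
  · intro i hi
    have hi' : evalR (LinearMap.proj (Sum.inr i) : Module.Dual ℤ (T.Edge ⊕ Fin g → ℤ))
      (LinearMap.baseChange ℝ (pullST f) x) = 0 := hi
    rw [hr] at hi'
    exact hx.2.2 i hi'

theorem projST_surj (T : GCat U 0 (legSet g A)) (y : ℝ ⊗[ℤ] (T.Edge → ℤ))
    (hy : y ∈ Poic.orthantCone T.Edge T.IsForest) :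
    ∃ x ∈ Poic.orthantCone (T.Edge ⊕ Fin g) T.STzero,
      LinearMap.baseChange ℝ T.projST x = y := by
  let s : (T.Edge → ℤ) →ₗ[ℤ] (T.Edge ⊕ Fin g → ℤ) :=
    LinearMap.pi (Sum.elim (fun e => LinearMap.proj e) (fun _ => 0))
  let o : T.Edge ⊕ Fin g → ℤ := Sum.elim (fun _ => 0) (fun _ => 1)
  have hs : T.projST ∘ₗ s = LinearMap.id := rfl
  have ho : T.projST o = 0 := rfl
  have hl : ∀ e : T.Edge,
      evalR (LinearMap.proj (Sum.inl e) : Module.Dual ℤ (T.Edge ⊕ Fin g → ℤ))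
        (LinearMap.baseChange ℝ s y + (1 : ℝ) ⊗ₜ[ℤ] o)
      = evalR (LinearMap.proj e : Module.Dual ℤ (T.Edge → ℤ)) y := by
    intro e
    have : (LinearMap.proj (Sum.inl e) : Module.Dual ℤ (T.Edge ⊕ Fin g → ℤ)) ∘ₗ s
      = LinearMap.proj e := rfl
    rw [map_add, evalR_baseChange, evalR_tmul, this]
    simp [o]
  have hr : ∀ i : Fin g,
      evalR (LinearMap.proj (Sum.inr i) : Module.Dual ℤ (T.Edge ⊕ Fin g → ℤ))
        (LinearMap.baseChange ℝ s y + (1 : ℝ) ⊗ₜ[ℤ] o) = 1 := by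
    intro i
    have : (LinearMap.proj (Sum.inr i) : Module.Dual ℤ (T.Edge ⊕ Fin g → ℤ)) ∘ₗ s = 0 := rfl
    rw [map_add, evalR_baseChange, evalR_tmul, this]
    simp [o, evalR]
  refine ⟨LinearMap.baseChange ℝ s y + (1 : ℝ) ⊗ₜ[ℤ] o, ⟨?_, ?_, ?_⟩, ?_⟩
  · rintro (e | i)
    · rw [hl]; exact hy.1 e
    · rw [hr]; exact zero_le_one
  · refine DGraph.isForest_mono _ _ ?_ hy.2
    intro e he
    have he' : evalR (LinearMap.proj (Sum.inl e) : Module.Dual ℤ (T.Edge ⊕ Fin g → ℤ))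
        (LinearMap.baseChange ℝ s y + (1 : ℝ) ⊗ₜ[ℤ] o) = 0 := he
    rw [hl] at he'
    exact he'
  · intro i hi
    have hi' : evalR (LinearMap.proj (Sum.inr i) : Module.Dual ℤ (T.Edge ⊕ Fin g → ℤ))
        (LinearMap.baseChange ℝ s y + (1 : ℝ) ⊗ₜ[ℤ] o) = 0 := hi
    rw [hr] at hi'
    exact one_ne_zero hi'
  · have : LinearMap.baseChange ℝ T.projST (LinearMap.baseChange ℝ s y) = y := by
      rw [← LinearMap.comp_apply, ← LinearMap.baseChange_comp, hs, LinearMap.baseChange_id]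
      rfl
    rw [map_add, this, LinearMap.baseChange_tmul, ho, TensorProduct.tmul_zero, add_zero]

end GCat

/-- The poic-complex `ST_{g,A} : 𝔾_{0,A ⊔ {1,…,g,1*,…,g*}}^op ⥤ POIC`, `T ↦ σ_T × ℝ_{>0}^g`. -/
def STcomplex (U : Type u) (g : ℕ) (A : Finset Λ) : (GCat U 0 (legSet g A))ᵒᵖ ⥤ Poic.{u} where
  obj T := T.unop.STcone
  map f := ⟨GCat.pullST f.unop, GCat.pullST_mem f.unop⟩
  map_id T := Poic.hom_ext (LinearMap.ext fun δ => by
    funext e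
    rcases e with e | i
    · exact congrFun (LinearMap.congr_fun (GCat.pull_id T.unop) (δ ∘ Sum.inl)) e
    · rfl)
  map_comp f k := Poic.hom_ext (LinearMap.ext fun δ => by
    funext e
    rcases e with e | i
    · exact congrFun (LinearMap.congr_fun (GCat.pull_comp k.unop f.unop) (δ ∘ Sum.inl)) e
    · rfl)

/-- The natural projection `ST_{g,A} ⟶ M^trop_{0, A ⊔ {1,…,g,1*,…,g*}}`. -/
def STproj (U : Type u) (g : ℕ) (A : Finset Λ) :
    PoicMor (STcomplex U g A) (Mtrop U 0 (legSet g A)) where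
  functor := 𝟭 _
  η :=
    { app := fun T => ⟨T.unop.projST, T.unop.projST_mem⟩
      naturality := fun _ _ _ => rfl }
  not_in_proper_face := by
    intro T τ hτ hsub
    obtain ⟨-, f, hf, rfl⟩ := hτ
    refine Set.Subset.antisymm (fun y hy => hy.1) fun y hy => ?_
    obtain ⟨x, hx, rfl⟩ := T.unop.projST_surj y hy
    exact hsub ⟨x, hx, rfl⟩

/-- The morphism of poic-spaces `st_{g,A} : ST_{g,A} ⟶ M^trop_{g,A}`: on graphs it joins the
`i`-leg and the `i*`-leg to a new edge, whose length is the `i`-th coordinate of `ℝ_{>0}^g`. -/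
structure IsSpanningTree {g : ℕ} {A : Finset Λ} (π : PoicMor (STcomplex U g A) (Mtrop U g A)) :
    Prop where
  flags : ∀ T : GCat U 0 (legSet g A), (π.functor.obj (op T)).unop.F = T.F
  root : ∀ (T : GCat U 0 (legSet g A)) (x : (π.functor.obj (op T)).unop.F) (y : T.F),
    x.1 = y.1 → ((π.functor.obj (op T)).unop.r x).1 = (T.r y).1
  involution_new : ∀ (T : GCat U 0 (legSet g A)) (x : (π.functor.obj (op T)).unop.F)
    (i : Fin g) (b : Bool), x.1 = (T.newLeg (i, b)).1 →
      ((π.functor.obj (op T)).unop.ι x).1 = (T.newLeg (i, !b)).1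
  involution_old : ∀ (T : GCat U 0 (legSet g A)) (x : (π.functor.obj (op T)).unop.F) (y : T.F),
    x.1 = y.1 → (∀ i, y ≠ T.newLeg i) → ((π.functor.obj (op T)).unop.ι x).1 = (T.ι y).1
  marking : ∀ (T : GCat U 0 (legSet g A)) (a : A),
    ((π.functor.obj (op T)).unop.leg a).1 = (T.oldLeg a).1
  map : ∀ (T T' : GCat U 0 (legSet g A)) (f : T ⟶ T') (x : (π.functor.obj (op T)).unop.F)
    (y : T.F), x.1 = y.1 → (GCat.fn (π.functor.map f.op).unop x).1 = (GCat.fn f y).1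
  length_new : ∀ (T : GCat U 0 (legSet g A)) (δ : T.Edge ⊕ Fin g → ℤ)
    (x : (π.functor.obj (op T)).unop.F) (i : Fin g) (b : Bool), x.1 = (T.newLeg (i, b)).1 →
      (π.functor.obj (op T)).unop.flagLen (Poic.lin (π.at' (op T)) δ) x = δ (Sum.inr i)
  length_old : ∀ (T : GCat U 0 (legSet g A)) (δ : T.Edge ⊕ Fin g → ℤ)
    (x : (π.functor.obj (op T)).unop.F) (y : T.F), x.1 = y.1 → (∀ i, y ≠ T.newLeg i) →
      (π.functor.obj (op T)).unop.flagLen (Poic.lin (π.at' (op T)) δ) x =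
        T.flagLen (δ ∘ Sum.inl) y

end SpanningTree

/-! ### Forgetting a marked leg -/

section Forget

variable {U Λ : Type u} {g : ℕ} {A B : Finset Λ}

namespace GCat

/-- The vertex `V_a` incident to the `a`-leg. -/
def legVertex (G : GCat U g A) (a : A) : G.F := G.r (G.leg a)

/-- `V_a` is trivalent and incident to two edges, `f₁` and `f₂` being their flags at `V_a`. -/
def TwoEdges (G : GCat U g A) (a : A) (f₁ f₂ : G.F) : Prop :=
  f₁ ≠ f₂ ∧ G.ι f₁ ≠ f₁ ∧ G.ι f₂ ≠ f₂ ∧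
    ∀ x, G.r x = G.legVertex a ↔ x = G.leg a ∨ x = f₁ ∨ x = f₂ ∨ x = G.legVertex a

/-- `V_a` is trivalent and incident to one edge (with flag `f` at `V_a`) and an additional leg
`l`. -/
def EdgeAndLeg (G : GCat U g A) (a : A) (l f : G.F) : Prop :=
  G.IsLeg l ∧ l ≠ G.leg a ∧ G.ι f ≠ f ∧
    ∀ x, G.r x = G.legVertex a ↔ x = G.leg a ∨ x = l ∨ x = f ∨ x = G.legVertex a

/-- `G'` is the graph `ft_a G` obtained from `G` by forgetting the `a`-leg and stabilizing. -/
structure IsForget (G : GCat U g A) (a : A) (G' : GCat U g B) : Prop where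
  marking : ∀ (b' : B) (b : A), b'.1 = b.1 → (G'.leg b').1 = (G.leg b).1
  /-- if `V_a` has valency more than three, the leg is removed -/
  flags₁ : 3 < G.val (G.legVertex a) → ∀ u, u ∈ G'.F ↔ ∃ y : G.F, y.1 = u ∧ y ≠ G.leg a
  struct₁ : 3 < G.val (G.legVertex a) → ∀ (x : G'.F) (y : G.F), x.1 = y.1 →
    (G'.r x).1 = (G.r y).1 ∧ (G'.ι x).1 = (G.ι y).1
  /-- if `V_a` is trivalent with two edges, it is removed and the two edges are merged -/
  flags₂ : ∀ f₁ f₂, G.TwoEdges a f₁ f₂ →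
    ∀ u, u ∈ G'.F ↔ ∃ y : G.F, y.1 = u ∧ G.r y ≠ G.legVertex a
  struct₂ : ∀ f₁ f₂, G.TwoEdges a f₁ f₂ → ∀ (x : G'.F) (y : G.F), x.1 = y.1 →
    (G'.r x).1 = (G.r y).1 ∧
    (G'.ι x).1 = (if y = G.ι f₁ then G.ι f₂ else if y = G.ι f₂ then G.ι f₁ else G.ι y).1
  /-- if `V_a` is trivalent with an edge and a leg `l`, the edge is removed and `l` is moved to
  the other end of the edge -/
  flags₃ : ∀ l f, G.EdgeAndLeg a l f → ∀ u, u ∈ G'.F ↔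
    ∃ y : G.F, y.1 = u ∧ y ≠ G.leg a ∧ y ≠ f ∧ y ≠ G.ι f ∧ y ≠ G.legVertex a
  struct₃ : ∀ l f, G.EdgeAndLeg a l f → ∀ (x : G'.F) (y : G.F), x.1 = y.1 →
    (G'.r x).1 = (if y = l then G.r (G.ι f) else G.r y).1 ∧ (G'.ι x).1 = (G.ι y).1

/-- The flag `y` of `G` is the end away from `V_a` of an edge which is contracted by `k`, where
`V_a` is trivalent with two edges, and `f₂` is the flag at `V_a` of the other edge. -/
def IsContractedEnd {G H : GCat U g A} (k : G ⟶ H) (a : A) (y f₂ : G.F) : Prop :=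
  ∃ f₁, G.TwoEdges a f₁ f₂ ∧ y = G.ι f₁ ∧ H.IsVertex (fn k f₁)

end GCat

/-- The functor `ft_a : 𝔾_{g,A}^op ⥤ 𝔾_{g,B}^op`, `B = A \ {a}`. On morphisms `ft_a k` is given
by `k`, except that at an end of a merged edge half of which is contracted it is given by `k` at the
corresponding flag of the other half. -/
structure IsForgetFunctor (a : A) (F : (GCat U g A)ᵒᵖ ⥤ (GCat U g B)ᵒᵖ) : Prop where
  obj : ∀ G : GCat U g A, G.IsForget a (F.obj (op G)).unop
  map : ∀ (G H : GCat U g A) (k : G ⟶ H) (x : (F.obj (op G)).unop.F) (y : G.F), x.1 = y.1 →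
    (∀ f₂, GCat.IsContractedEnd k a y f₂ →
      (GCat.fn (F.map k.op).unop x).1 = (GCat.fn k f₂).1) ∧
    ((¬ ∃ f₂, GCat.IsContractedEnd k a y f₂) →
      (GCat.fn (F.map k.op).unop x).1 = (GCat.fn k y).1)

/-- `δ'` is the metric induced on `ft_a G` by `δ`: the length of a merged edge is the sum of the two
lengths, other edges keep their length. -/
def IsForgetMetric (G : GCat U g A) (G' : GCat U g B) (δ : G.Edge → ℤ) (δ' : G'.Edge → ℤ) :
    Prop :=
  ∀ (x : G'.F) (y z : G.F), x.1 = y.1 → (G'.ι x).1 = z.1 → G'.ι x ≠ x →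
    G'.flagLen δ' x = if G.ι y = z then G.flagLen δ y else G.flagLen δ y + G.flagLen δ z

/-- The morphism of poic-spaces `ft_a : M^trop_{g,A} ⟶ M^trop_{g,B}`, `B = A \ {a}`. -/
structure IsForgetMor (a : A) (F : PoicMor (Mtrop U g A) (Mtrop U g B)) : Prop where
  functor : IsForgetFunctor a F.functor
  metric : ∀ (G : GCat U g A) (δ : G.Edge → ℤ),
    IsForgetMetric G (F.functor.obj (op G)).unop δ (Poic.lin (F.at' (op G)) δ)

/-- The entry `(i, e)` of the matrix `M(T, a)`: it is one if `V_a` is trivalent and incident to the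
edge `e` and to the `i`-leg or the `i*`-leg. -/
def forgetMatrix (T : GCat U 0 (legSet g A)) (a : A) (i : Fin g) (e : T.Edge) : ℤ :=
  if T.val (T.r (T.oldLeg a)) = 3 ∧ (∃ b, T.r (T.newLeg (i, b)) = T.r (T.oldLeg a)) ∧
    ∃ h ∈ e.1, T.r h = T.r (T.oldLeg a) then 1 else 0

/-- The morphism of poic-complexes `ST_{g,A} ⟶ ST_{g,B}`, `B = A \ {a}`, given by the functor `ft_a`
and the matrices `(η_{ft_a} 0; M(T,a) Id)`. -/
structure IsForgetST (a : A) (F : PoicMor (STcomplex U g A) (STcomplex U g B)) : Prop where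
  functor : IsForgetFunctor (A := legSet g A) (B := legSet g B)
    ⟨Sum.inl a.1, inl_mem_legSet a.2⟩ F.functor
  metric : ∀ (T : GCat U 0 (legSet g A)) (δ : T.Edge ⊕ Fin g → ℤ),
    IsForgetMetric T (F.functor.obj (op T)).unop (δ ∘ Sum.inl)
      ((show (F.functor.obj (op T)).unop.Edge ⊕ Fin g → ℤ from
        Poic.lin (F.at' (op T)) δ) ∘ Sum.inl)
  extra : ∀ (T : GCat U 0 (legSet g A)) (δ : T.Edge ⊕ Fin g → ℤ) (i : Fin g),
    (show (F.functor.obj (op T)).unop.Edge ⊕ Fin g → ℤ from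
      Poic.lin (F.at' (op T)) δ) (Sum.inr i) =
        δ (Sum.inr i) + ∑ e : T.Edge, forgetMatrix T a i e * δ (Sum.inl e)

end Forget

end

/-!
The proof consists of a description of `ft_a` that treats the three cases of its construction
alike, and of a few facts on cones, trees and splits.

*Cones.* All cones of stable graphs and of spanning trees are orthants from which those faces are
removed on which the vanishing coordinates form a set of a kind that is not allowed, where the
allowed sets are closed under passage to subsets. The faces of such a cone are its loci of
vanishing of allowed sets of coordinates (`Poic.isFace_orthantCone_iff`), and a contraction of a
forest induces an isomorphism onto the face where its lengths vanish. Since every forest can be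
contracted (`exists_contraction`) and contractions of the same edges are isomorphic
(`exists_iso_of_contracted`), stable graphs form a poic-space. Here a forest is a set of edges
none of which has ends that are joined by its other edges (`DGraph.isForest_iff`).

*Forgetting a mark.* The graph `ft_a G` is a quotient of `G`: remove the `a`-leg, and contract one
edge at the vertex `V_a` of this leg if `V_a` is trivalent (`GCat.IsQuot`). The construction
chooses names for its flags in a way that a quotient does not see; `GCat.nameOf` records the
names, and a flag `x` of `ft_a G` lies over the flags `h` of `G` whose name is `x` (`GCat.Over`).
A contraction `ft_a k` is characterized by being compatible with `k` through this relation
wherever `k` does not contract (`GCat.IsForgetHom`). It exists since quotients for `G` and `H` can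
be chosen compatibly (`GCat.exists_compatible`), and its uniqueness gives functoriality. The
length of an edge of `ft_a G` is the sum of the lengths of the edges over which it lies, which
gives naturality.

*Two marks.* After forgetting two marks, the flags that are removed and the pairs of flags that
are identified are given by `GCat.Dead` and `GCat.Merge`, which refer to the set of the two marks
only. Together with the names of the flags that remain, this determines the resulting graph, its
contractions and its lengths (`GCat.IsForgetRel`), independently of the order.

*Isomorphisms and properness.* An isomorphism is a renaming of flags. A renaming of the flags of
`ft_a G` extends to `G`, with new names for the other flags, and it determines the extension up to
those names. In genus zero all sets of edges are forests, so the cones are closed orthants and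
have the origin as a face. This passes to subdivisions. The images of such cones under linear maps
are polyhedral by Fourier-Motzkin elimination, hence closed, and a face of an image is cut out by
a functional that pulls back to the source (`PoicMor.isProper_of_isFace_zero`,
`PoicMor.isWeaklyProper_of_closed`).

*Distances.* An edge of a tree separates the marks into two parts. Two legs are on different sides
of the edge if and only if the walk between them uses it, so the class of the distance vector is
the sum over the edges of their lengths times the classes of their splits
(`GCat.two_smul_distLin`, where every edge is counted once for each of its two flags). A leg
contributes a split that vanishes in the quotient, and the split of an edge of `ft_a T` is the
restriction of the splits of the edges over which it lies; hence `p_a` corresponds to `ft_a`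
(`GCat.forgetDist_distLin`).

*Spanning trees.* Joining the legs `i` and `i*` identifies trees with graphs with a numbering of
the edges outside a spanning tree. Every graph has a spanning tree, and contractions that keep the
numbered edges are contractions of the tree, so this is a poic-fibration. Joining legs commutes
with `ft_a` up to an isomorphism, as both composites are quotients of the tree by the same edge
(`GCat.exists_iso_glue_forget`). The matrix `M(T,a)` accounts for the edge at `V_a` that is merged
with a joined leg (`GCat.flagLen_glueLen_forgetST`).
-/

noncomputable section

/-! ### Linear images of polyhedral cones -/

section Polyhedral

variable {V W : Type*} [AddCommGroup V] [Module ℝ V] [AddCommGroup W] [Module ℝ W]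

/-- One step of Fourier–Motzkin elimination: the sum of a polyhedral cone and a line is again
polyhedral. -/
theorem exists_eliminate (C : Finset (V →ₗ[ℝ] ℝ)) (k : V) :
    ∃ C' : Finset (V →ₗ[ℝ] ℝ), ∀ x : V,
      (∃ t : ℝ, ∀ f ∈ C, 0 ≤ f (x + t • k)) ↔ ∀ f ∈ C', 0 ≤ f x := by
  refine ⟨C.filter (fun f => f k = 0) ∪
    ((C.filter (fun f => 0 < f k)) ×ˢ (C.filter (fun f => f k < 0))).image
      (fun p => p.1 k • p.2 - p.2 k • p.1), fun x => ⟨?_, ?_⟩⟩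
  · rintro ⟨t, ht⟩ f hf
    rcases Finset.mem_union.1 hf with hf | hf
    · obtain ⟨hfC, hf0⟩ := Finset.mem_filter.1 hf
      have := ht f hfC
      simpa [hf0] using this
    · obtain ⟨⟨p, q⟩, hpq, rfl⟩ := Finset.mem_image.1 hf
      obtain ⟨hp, hq⟩ := Finset.mem_product.1 hpq
      obtain ⟨hpC, hp0⟩ := Finset.mem_filter.1 hp
      obtain ⟨hqC, hq0⟩ := Finset.mem_filter.1 hq
      have h1 := ht p hpC
      have h2 := ht q hqC
      simp only [map_add, map_smul, smul_eq_mul] at h1 h2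
      simp only [LinearMap.sub_apply, LinearMap.smul_apply, smul_eq_mul]
      have h3 := mul_nonneg hp0.le h2
      have h4 := mul_nonneg (neg_nonneg.2 hq0.le) h1
      simp only at *
      linarith
  · intro h
    have hpq : ∀ p ∈ C, 0 < p k → ∀ q ∈ C, q k < 0 → -p x / p k ≤ q x / -q k := by
      intro p hp hp0 q hq hq0
      have := h (p k • q - q k • p) (Finset.mem_union_right _ (Finset.mem_image.2
        ⟨(p, q), Finset.mem_product.2 ⟨Finset.mem_filter.2 ⟨hp, hp0⟩,
          Finset.mem_filter.2 ⟨hq, hq0⟩⟩, rfl⟩))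
      simp only [LinearMap.sub_apply, LinearMap.smul_apply, smul_eq_mul] at this
      rw [div_le_div_iff₀ hp0 (by linarith)]
      linarith
    -- any `t` between the lower bounds and the upper bounds works
    obtain ⟨t, ht1, ht2⟩ : ∃ t : ℝ, (∀ p ∈ C, 0 < p k → -p x / p k ≤ t) ∧
        ∀ q ∈ C, q k < 0 → t ≤ q x / -q k := by
      by_cases hne : (C.filter fun f => 0 < f k).Nonempty
      · obtain ⟨p, hp, hmax⟩ := Finset.exists_max_image _ (fun f => -f x / f k) hne
        obtain ⟨hpC, hp0⟩ := Finset.mem_filter.1 hp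
        exact ⟨-p x / p k, fun q hq hq0 => hmax q (Finset.mem_filter.2 ⟨hq, hq0⟩),
          fun q hq hq0 => hpq p hpC hp0 q hq hq0⟩
      · have hno : ∀ p ∈ C, ¬ 0 < p k := fun p hp hp0 => hne ⟨p, Finset.mem_filter.2 ⟨hp, hp0⟩⟩
        by_cases hne' : (C.filter fun f => f k < 0).Nonempty
        · obtain ⟨q, hq, hmin⟩ := Finset.exists_min_image _ (fun f => f x / -f k) hne'
          exact ⟨q x / -q k, fun p hp hp0 => absurd hp0 (hno p hp),
            fun f hf hf0 => hmin f (Finset.mem_filter.2 ⟨hf, hf0⟩)⟩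
        · exact ⟨0, fun p hp hp0 => absurd hp0 (hno p hp),
            fun f hf hf0 => absurd ⟨f, Finset.mem_filter.2 ⟨hf, hf0⟩⟩ hne'⟩
    refine ⟨t, fun f hf => ?_⟩
    simp only [map_add, map_smul, smul_eq_mul]
    rcases lt_trichotomy (f k) 0 with h0 | h0 | h0
    · have := ht2 f hf h0
      rw [le_div_iff₀ (by linarith)] at this
      linarith
    · have := h f (Finset.mem_union_left _ (Finset.mem_filter.2 ⟨hf, h0⟩))
      rw [h0]; linarith
    · have := ht1 f hf h0
      rw [div_le_iff₀ h0] at this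
      linarith

/-- The sum of a polyhedral cone and a finite-dimensional subspace is polyhedral. -/
theorem exists_eliminate_span (C : Finset (V →ₗ[ℝ] ℝ)) (S : Finset V) :
    ∃ C' : Finset (V →ₗ[ℝ] ℝ), ∀ x : V,
      (∃ y ∈ Submodule.span ℝ (S : Set V), ∀ f ∈ C, 0 ≤ f (x + y)) ↔ ∀ f ∈ C', 0 ≤ f x := by
  induction S using Finset.induction_on with
  | empty => exact ⟨C, fun x => by simp⟩
  | insert k S _ ih =>
    obtain ⟨C₁, h₁⟩ := ih
    obtain ⟨C₂, h₂⟩ := exists_eliminate C₁ k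
    refine ⟨C₂, fun x => ?_⟩
    rw [← h₂]
    constructor
    · rintro ⟨y, hy, h⟩
      rw [Finset.coe_insert, Submodule.mem_span_insert] at hy
      obtain ⟨t, z, hz, rfl⟩ := hy
      exact ⟨t, (h₁ _).1 ⟨z, hz, by simpa [add_assoc] using h⟩⟩
    · rintro ⟨t, ht⟩
      obtain ⟨z, hz, h⟩ := (h₁ _).2 ht
      refine ⟨t • k + z, ?_, by simpa [add_assoc] using h⟩
      rw [Finset.coe_insert, Submodule.mem_span_insert]
      exact ⟨t, z, hz, rfl⟩

/-- The image of a polyhedral cone under a linear map is closed. -/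
theorem isClosed_image_polyhedral [FiniteDimensional ℝ V] (L : V →ₗ[ℝ] W)
    (C : Finset (V →ₗ[ℝ] ℝ)) :
    @IsClosed W (moduleTopology ℝ W) (L '' {x | ∀ f ∈ C, 0 ≤ f x}) := by
  let : TopologicalSpace W := moduleTopology ℝ W
  have : IsModuleTopology ℝ W := ⟨rfl⟩
  obtain ⟨S, hS⟩ := (IsNoetherian.noetherian (LinearMap.ker L) : (LinearMap.ker L).FG)
  obtain ⟨C', hC'⟩ := exists_eliminate_span C S
  rw [hS] at hC'
  -- the inequalities of the sum with the kernel of `L` descend to the range of `L`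
  have hdesc : ∀ f ∈ C', ∃ g : W →ₗ[ℝ] ℝ, ∀ x, g (L x) = f x := by
    intro f hf
    have hker : ∀ y ∈ LinearMap.ker L, 0 ≤ f y := fun y hy =>
      (hC' y).1 ⟨-y, neg_mem hy, by simp⟩ f hf
    have hmem : f ∈ (LinearMap.ker L).dualAnnihilator := by
      rw [Submodule.mem_dualAnnihilator]
      intro y hy
      have h1 := hker y hy
      have h2 := hker (-y) (neg_mem hy)
      rw [map_neg] at h2
      linarith
    rw [← LinearMap.range_dualMap_eq_dualAnnihilator_ker] at hmem
    obtain ⟨g, rfl⟩ := hmem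
    exact ⟨g, fun x => rfl⟩
  have himg : L '' {x | ∀ f ∈ C, 0 ≤ f x} =
      (⋂ φ ∈ (LinearMap.range L).dualAnnihilator, {y | φ y = 0}) ∩
      ⋂ g ∈ {g : W →ₗ[ℝ] ℝ | ∃ f ∈ C', ∀ x, g (L x) = f x}, {y | 0 ≤ g y} := by
    ext y
    simp only [Set.mem_inter_iff, Set.mem_iInter, Set.mem_ofPred_eq]
    constructor
    · rintro ⟨x, hx, rfl⟩
      refine ⟨fun φ hφ => (Submodule.mem_dualAnnihilator φ).1 hφ _ ⟨x, rfl⟩, ?_⟩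
      rintro g ⟨f, hf, hg⟩
      rw [hg]
      exact (hC' x).1 ⟨0, zero_mem _, by simpa using hx⟩ f hf
    · rintro ⟨h1, h2⟩
      have hy : y ∈ LinearMap.range L := by
        by_contra hy
        obtain ⟨φ, hφ1, hφ2⟩ := Submodule.exists_le_ker_of_notMem hy
        exact hφ1 (h1 φ ((Submodule.mem_dualAnnihilator φ).2 fun z hz => hφ2 hz))
      obtain ⟨x, rfl⟩ := hy
      obtain ⟨z, hz, hxz⟩ := (hC' x).2 fun f hf => by
        obtain ⟨g, hg⟩ := hdesc f hf
        rw [← hg]; exact h2 g ⟨f, hf, hg⟩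
      refine ⟨x + z, hxz, ?_⟩
      rw [map_add, LinearMap.mem_ker.1 hz, add_zero]
  rw [himg]
  refine IsClosed.inter (isClosed_biInter fun φ _ => ?_) (isClosed_biInter fun g _ => ?_)
  · exact isClosed_eq (IsModuleTopology.continuous_of_linearMap φ) continuous_const
  · exact isClosed_le continuous_const (IsModuleTopology.continuous_of_linearMap g)

end Polyhedral

/-! ### Coordinates on orthants -/

section Coordinates

variable {I J : Type u}

/-- The `i`-th coordinate of a point of `(ℤ^I)_ℝ`. -/
abbrev coord (i : I) : (ℝ ⊗[ℤ] (I → ℤ)) →ₗ[ℝ] ℝ :=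
  evalR (LinearMap.proj i : Module.Dual ℤ (I → ℤ))

theorem coord_eq [Fintype I] (i : I) (x : ℝ ⊗[ℤ] (I → ℤ)) :
    coord i x = TensorProduct.piScalarRight ℤ ℝ ℝ I x i := by
  induction x using TensorProduct.induction_on with
  | zero => simp
  | tmul c n =>
    rw [evalR_tmul, TensorProduct.piScalarRight_apply, TensorProduct.piScalarRightHom_tmul]
    simp
  | add x y hx hy => simp only [map_add, hx, hy, Pi.add_apply]

theorem coord_ext [Finite I] {x y : ℝ ⊗[ℤ] (I → ℤ)} (h : ∀ i, coord i x = coord i y) :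
    x = y := by
  have := Fintype.ofFinite I
  apply (TensorProduct.piScalarRight ℤ ℝ ℝ I).injective
  funext i
  rw [← coord_eq, ← coord_eq, h]

theorem exists_coord [Finite I] (a : I → ℝ) :
    ∃ x : ℝ ⊗[ℤ] (I → ℤ), ∀ i, coord i x = a i := by
  have := Fintype.ofFinite I
  exact ⟨(TensorProduct.piScalarRight ℤ ℝ ℝ I).symm a, fun i => by simp [coord_eq]⟩

theorem coord_one_tmul (i : I) (n : I → ℤ) : coord i ((1 : ℝ) ⊗ₜ[ℤ] n) = n i := by
  simp [coord, evalR_tmul]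

theorem evalR_eq_sum [Fintype I] (f : Module.Dual ℤ (I → ℤ)) (x : ℝ ⊗[ℤ] (I → ℤ)) :
    evalR f x = ∑ i, (f (Pi.single i 1) : ℝ) * coord i x := by
  induction x using TensorProduct.induction_on with
  | zero => simp
  | tmul c n =>
    have : f n = ∑ i, n i * f (Pi.single i 1) := by
      conv_lhs => rw [← Finset.univ_sum_single n]
      rw [map_sum]
      refine Finset.sum_congr rfl fun i _ => ?_
      rw [← smul_eq_mul, ← map_smul, ← Pi.single_smul, smul_eq_mul, mul_one]
    simp only [evalR_tmul, this, Int.cast_sum, Int.cast_mul, Finset.sum_mul, LinearMap.proj_apply]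
    exact Finset.sum_congr rfl fun i _ => by ring
  | add x y hx hy => simp only [map_add, hx, hy, mul_add, Finset.sum_add_distrib]

namespace Poic

variable {P : Set I → Prop}

/-- The faces of a partially open orthant are cut out by the vanishing of admissible sets of
coordinates. -/
theorem isFace_orthantCone_iff [Finite I] (h0 : P ∅) (hP : ∀ S T : Set I, S ⊆ T → P T → P S)
    (τ : Set (ℝ ⊗[ℤ] (I → ℤ))) :
    IsFace (orthantCone I P) τ ↔
      ∃ S : Set I, P S ∧ τ = {x ∈ orthantCone I P | ∀ i ∈ S, coord i x = 0} := by
  have := Fintype.ofFinite I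
  constructor
  · rintro ⟨⟨z, hz⟩, f, hf, rfl⟩
    have hle : ∀ i, f (Pi.single i 1) ≤ 0 := by
      intro i
      by_contra hi
      have hi : (1 : ℝ) ≤ f (Pi.single i 1) := by exact_mod_cast (not_le.1 hi)
      -- a large `i`-th coordinate would make the functional positive
      set M : ℝ := 1 + ∑ k, |(f (Pi.single k 1) : ℝ)| with hM
      have hM0 : 0 ≤ ∑ k, |(f (Pi.single k 1) : ℝ)| := Finset.sum_nonneg fun k _ => abs_nonneg _
      obtain ⟨x, hx⟩ := exists_coord (fun k : I => if k = i then 1 + M else 1)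
      have hxp : x ∈ orthantCone I P := mem_orthantCone_of_pos h0 fun k => by
        show 0 < coord k x
        rw [hx]; split_ifs <;> linarith
      have h1 := hf x hxp
      rw [evalR_eq_sum] at h1
      have h2 : ∑ k, (f (Pi.single k 1) : ℝ) * coord k x
          = f (Pi.single i 1) * M + ∑ k, (f (Pi.single k 1) : ℝ) := by
        have : ∀ k, (f (Pi.single k 1) : ℝ) * coord k x
            = (if k = i then (f (Pi.single i 1) : ℝ) * M else 0) + f (Pi.single k 1) := by
          intro k; rw [hx]; split_ifs with h
          · subst h; ring
          · ring
        simp only [this, Finset.sum_add_distrib, Finset.sum_ite_eq', Finset.mem_univ, if_true]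
      have h3 : -∑ k, |(f (Pi.single k 1) : ℝ)| ≤ ∑ k, (f (Pi.single k 1) : ℝ) := by
        rw [← Finset.sum_neg_distrib]
        exact Finset.sum_le_sum fun k _ => neg_abs_le _
      have h4 : M ≤ f (Pi.single i 1) * M := le_mul_of_one_le_left (by linarith) hi
      linarith
    have hkey : ∀ x ∈ orthantCone I P, 0 ≤ evalR f x ↔
        ∀ i ∈ {i | f (Pi.single i 1) ≠ 0}, coord i x = 0 := by
      intro x hx
      have hterm : ∀ i ∈ Finset.univ, (f (Pi.single i 1) : ℝ) * coord i x ≤ 0 := fun i _ =>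
        mul_nonpos_of_nonpos_of_nonneg (by exact_mod_cast hle i) (hx.1 i)
      rw [evalR_eq_sum]
      constructor
      · intro h i hi
        have := (Finset.sum_eq_zero_iff_of_nonpos hterm).1
          (le_antisymm (Finset.sum_nonpos hterm) h) i (Finset.mem_univ i)
        rcases mul_eq_zero.1 this with h1 | h1
        · exact absurd (by exact_mod_cast h1) hi
        · exact h1
      · intro h
        refine le_of_eq (Finset.sum_eq_zero fun i _ => ?_).symm
        by_cases hi : f (Pi.single i 1) = 0
        · simp [hi]
        · rw [h i hi, mul_zero]
    refine ⟨{i | f (Pi.single i 1) ≠ 0}, hP _ _ ?_ hz.1.2, ?_⟩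
    · exact fun i hi => (hkey z hz.1).1 hz.2 i hi
    · ext x
      exact and_congr_right fun hx => hkey x hx
  · rintro ⟨S, hS, rfl⟩
    refine ⟨?_, -∑ i ∈ Finset.univ.filter (· ∈ S), LinearMap.proj i, ?_, ?_⟩
    · obtain ⟨x, hx⟩ := exists_coord (fun i : I => if i ∈ S then 0 else 1)
      have hS' : {i : I | coord i x = 0} = S := by
        ext i; simp [hx]
      refine ⟨x, ⟨fun i => ?_, ?_⟩, fun i hi => by rw [hx, if_pos hi]⟩
      · show 0 ≤ coord i x
        rw [hx]; split_ifs <;> norm_num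
      · show P {i : I | coord i x = 0}
        rw [hS']; exact hS
    all_goals
      have hev : ∀ x : ℝ ⊗[ℤ] (I → ℤ), evalR (-∑ i ∈ Finset.univ.filter (· ∈ S),
          (LinearMap.proj i : Module.Dual ℤ (I → ℤ))) x
          = -∑ i ∈ Finset.univ.filter (· ∈ S), coord i x := by
        intro x
        have hs : ∀ k : I, (-∑ i ∈ Finset.univ.filter (· ∈ S),
            (LinearMap.proj i : Module.Dual ℤ (I → ℤ))) (Pi.single k 1) =
            if k ∈ S then -1 else 0 := by
          intro k
          simp only [LinearMap.neg_apply, LinearMap.sum_apply, LinearMap.proj_apply,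
            Pi.single_apply, Finset.sum_ite_eq', Finset.mem_filter,
            Finset.mem_univ, true_and]
          split_ifs <;> rfl
        rw [evalR_eq_sum]
        simp only [hs]
        rw [Finset.sum_filter, ← Finset.sum_neg_distrib]
        refine Finset.sum_congr rfl fun k _ => ?_
        split_ifs <;> simp
    · intro x hx
      rw [hev, neg_nonpos]
      exact Finset.sum_nonneg fun i _ => hx.1 i
    · ext x
      refine and_congr_right fun hx => ?_
      have hnn : ∀ i ∈ Finset.univ.filter (· ∈ S), 0 ≤ coord i x := fun i _ => hx.1 i
      rw [hev, neg_nonneg]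
      constructor
      · exact fun h => (Finset.sum_eq_zero fun i hi => h i (Finset.mem_filter.1 hi).2).le
      · exact fun h i hi => (Finset.sum_eq_zero_iff_of_nonneg hnn).1
          (le_antisymm h (Finset.sum_nonneg hnn)) i (Finset.mem_filter.2 ⟨Finset.mem_univ _, hi⟩)

theorem relInt_orthantCone [Finite I] (h0 : P ∅) (hP : ∀ S T : Set I, S ⊆ T → P T → P S) :
    relInt (orthantCone I P) = {x | ∀ i, 0 < coord i x} := by
  ext x
  constructor
  · rintro ⟨hx, h⟩ i
    refine lt_of_le_of_ne (hx.1 i) fun hi => ?_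
    have hPi : P {i} := hP _ _ (by rintro _ rfl; exact hi.symm) hx.2
    have := h _ ((isFace_orthantCone_iff h0 hP _).2 ⟨{i}, hPi, rfl⟩)
      ⟨hx, by rintro _ rfl; exact hi.symm⟩
    obtain ⟨y, hy⟩ := exists_coord (fun _ : I => (1 : ℝ))
    have hyc : y ∈ orthantCone I P := mem_orthantCone_of_pos h0 fun k => by
      show 0 < coord k y
      rw [hy]; exact one_pos
    rw [← this] at hyc
    have := hyc.2 i rfl
    rw [hy] at this
    exact one_ne_zero this
  · intro hx
    refine ⟨mem_orthantCone_of_pos h0 hx, fun τ hτ hxτ => ?_⟩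
    obtain ⟨S, -, rfl⟩ := (isFace_orthantCone_iff h0 hP _).1 hτ
    refine Set.Subset.antisymm (fun y hy => hy.1) fun y hy => ⟨hy, fun i hi => ?_⟩
    exact absurd (hxτ.2 i hi) (hx i).ne'

/-- A face of a partially open orthant which contains a point with positive coordinates is
everything. -/
theorem eq_orthantCone_of_pos_mem [Finite I] (h0 : P ∅)
    (hP : ∀ S T : Set I, S ⊆ T → P T → P S) {τ : Set (ℝ ⊗[ℤ] (I → ℤ))}
    (hτ : IsFace (orthantCone I P) τ) {x : ℝ ⊗[ℤ] (I → ℤ)} (hx : x ∈ τ)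
    (hpos : ∀ i, 0 < coord i x) : τ = orthantCone I P := by
  have : x ∈ relInt (orthantCone I P) := by rw [relInt_orthantCone h0 hP]; exact hpos
  exact this.2 τ hτ hx

end Poic

/-- An integral linear map which is the extension by zero of functions along an injective map of
index sets. -/
structure IsCoordEmb (L : (I → ℤ) →ₗ[ℤ] (J → ℤ)) (j : I → J) : Prop where
  inj : Function.Injective j
  apply : ∀ δ i, L δ (j i) = δ i
  apply_of_notMem : ∀ δ k, k ∉ Set.range j → L δ k = 0

namespace IsCoordEmb

variable {L : (I → ℤ) →ₗ[ℤ] (J → ℤ)} {j : I → J}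

theorem coord_apply (h : IsCoordEmb L j) (i : I) (x : ℝ ⊗[ℤ] (I → ℤ)) :
    coord (j i) (LinearMap.baseChange ℝ L x) = coord i x := by
  rw [coord, evalR_baseChange]
  congr 2
  exact LinearMap.ext fun δ => h.apply δ i

theorem coord_of_notMem (h : IsCoordEmb L j) {k : J} (hk : k ∉ Set.range j)
    (x : ℝ ⊗[ℤ] (I → ℤ)) : coord k (LinearMap.baseChange ℝ L x) = 0 := by
  rw [coord, evalR_baseChange]
  have : (LinearMap.proj k : Module.Dual ℤ (J → ℤ)) ∘ₗ L = 0 :=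
    LinearMap.ext fun δ => h.apply_of_notMem δ k hk
  rw [this]; simp [evalR]

variable {P : Set I → Prop} {Q : Set J → Prop}

theorem injective [Finite I] (h : IsCoordEmb L j) :
    Function.Injective (LinearMap.baseChange ℝ L) := by
  intro x y hxy
  refine coord_ext fun i => ?_
  rw [← h.coord_apply, hxy, h.coord_apply]

variable [Finite I] [Finite J]

/-- A coordinate embedding maps an orthant onto the face of the other orthant where the
remaining coordinates vanish. -/
theorem image_orthantCone (h : IsCoordEmb L j)
    (hPQ : ∀ S : Set I, P S ↔ Q (j '' S ∪ (Set.range j)ᶜ)) :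
    LinearMap.baseChange ℝ L '' Poic.orthantCone I P =
      {y ∈ Poic.orthantCone J Q | ∀ k ∈ (Set.range j)ᶜ, coord k y = 0} := by
  have hzero : ∀ x, (∀ k ∈ (Set.range j)ᶜ, coord k x = 0) →
      {k : J | coord k x = 0} = j '' {i | coord (j i) x = 0} ∪ (Set.range j)ᶜ := by
    intro x hx
    ext k
    simp only [Set.mem_union, Set.mem_image, Set.mem_ofPred_eq]
    constructor
    · intro hk
      by_cases hkr : k ∈ Set.range j
      · obtain ⟨i, rfl⟩ := hkr
        exact Or.inl ⟨i, hk, rfl⟩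
      · exact Or.inr hkr
    · rintro (⟨i, hi, rfl⟩ | hk)
      · exact hi
      · exact hx k hk
  ext y
  constructor
  · rintro ⟨x, hx, rfl⟩
    have h1 : ∀ k ∈ (Set.range j)ᶜ, coord k (LinearMap.baseChange ℝ L x) = 0 :=
      fun k hk => h.coord_of_notMem hk x
    refine ⟨⟨fun k => ?_, ?_⟩, h1⟩
    · by_cases hk : k ∈ Set.range j
      · obtain ⟨i, rfl⟩ := hk
        rw [h.coord_apply]; exact hx.1 i
      · exact (h1 k hk).ge
    · have h2 := hzero _ h1
      simp only [h.coord_apply] at h2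
      show Q {k : J | coord k (LinearMap.baseChange ℝ L x) = 0}
      rw [h2]
      exact (hPQ _).1 hx.2
  · rintro ⟨hy, hy0⟩
    obtain ⟨x, hx⟩ := exists_coord (fun i : I => coord (j i) y)
    refine ⟨x, ⟨fun i => ?_, ?_⟩, coord_ext fun k => ?_⟩
    · show 0 ≤ coord i x
      rw [hx]; exact hy.1 _
    · show P {i : I | coord i x = 0}
      rw [hPQ]
      have h2 := hzero y hy0
      simp only [hx]
      rw [← h2]
      exact hy.2
    · by_cases hk : k ∈ Set.range j
      · obtain ⟨i, rfl⟩ := hk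
        rw [h.coord_apply, hx]
      · rw [h.coord_of_notMem hk, hy0 k hk]

theorem isFaceEmbedding {h0 hP h0' hQ} {f : Poic.orthant I P h0 hP ⟶ Poic.orthant J Q h0' hQ}
    (h : IsCoordEmb (Poic.lin f) j) (hPQ : ∀ S : Set I, P S ↔ Q (j '' S ∪ (Set.range j)ᶜ)) :
    Poic.IsFaceEmbedding f := by
  refine ⟨h.injective, (Poic.isFace_orthantCone_iff h0' hQ _).2 ⟨(Set.range j)ᶜ, ?_,
    h.image_orthantCone hPQ⟩⟩
  have := (hPQ ∅).1 h0
  rwa [Set.image_empty, Set.empty_union] at this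

/-- A coordinate embedding identifies an orthant, with its lattice, with a face. -/
theorem isIsoOnto {h0 hP h0' hQ} {f : Poic.orthant I P h0 hP ⟶ Poic.orthant J Q h0' hQ}
    (h : IsCoordEmb (Poic.lin f) j) (hPQ : ∀ S : Set I, P S ↔ Q (j '' S ∪ (Set.range j)ᶜ)) :
    Poic.IsIsoOnto f {y ∈ Poic.orthantCone J Q | ∀ k ∈ (Set.range j)ᶜ, coord k y = 0} := by
  refine ⟨h.injective, h.image_orthantCone hPQ, fun n hn => ?_⟩
  have hn' : ∀ k ∈ (Set.range j)ᶜ, coord k ((1 : ℝ) ⊗ₜ[ℤ] (show J → ℤ from n)) = 0 := by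
    intro k hk
    have : Submodule.span ℝ {y ∈ Poic.orthantCone J Q | ∀ k ∈ (Set.range j)ᶜ, coord k y = 0} ≤
        LinearMap.ker (coord k) := Submodule.span_le.2 fun y hy => hy.2 k hk
    exact this hn
  refine ⟨fun i => (show J → ℤ from n) (j i), funext fun k => ?_⟩
  by_cases hk : k ∈ Set.range j
  · obtain ⟨i, rfl⟩ := hk
    exact h.apply _ i
  · have := hn' k hk
    rw [coord_one_tmul] at this
    exact (h.apply_of_notMem _ k hk).trans (by exact_mod_cast this.symm)

/-- The face onto which a coordinate embedding maps determines the vanishing coordinates. -/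
theorem range_eq {h0 hP h0' hQ} {f : Poic.orthant I P h0 hP ⟶ Poic.orthant J Q h0' hQ}
    (h : IsCoordEmb (Poic.lin f) j) {τ : Set (ℝ ⊗[ℤ] (J → ℤ))} (hf : Poic.IsIsoOnto f τ) :
    Set.range j = {k | ∃ y ∈ τ, coord k y ≠ 0} := by
  have hτ := hf.2.1
  ext k
  constructor
  · rintro ⟨i, rfl⟩
    obtain ⟨x, hx⟩ := exists_coord (fun _ : I => (1 : ℝ))
    have hxc : x ∈ Poic.orthantCone I P := Poic.mem_orthantCone_of_pos h0 fun k => by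
      show 0 < coord k x
      rw [hx]; exact one_pos
    refine ⟨Poic.linR f x, hτ ▸ ⟨x, hxc, rfl⟩, ?_⟩
    have : coord (j i) (Poic.linR f x) = coord i x := h.coord_apply i x
    rw [this, hx]; exact one_ne_zero
  · rintro ⟨y, hy, hk⟩
    rw [← hτ] at hy
    obtain ⟨x, -, rfl⟩ := hy
    by_contra hkr
    exact hk (h.coord_of_notMem hkr x)

end IsCoordEmb

end Coordinates

/-! ### A criterion for weak properness -/

namespace Poic

theorem linR_injective {σ ξ : Poic.{u}} {f : σ ⟶ ξ} (h : Function.Injective (lin f)) :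
    Function.Injective (linR f) :=
  Module.Flat.lTensor_preserves_injective_linearMap (M := ℝ) (lin f) h

theorem coneDim_image {σ ξ : Poic.{u}} {f : σ ⟶ ξ} (h : Function.Injective (linR f))
    (K : Set (ℝ ⊗[ℤ] σ.N)) : coneDim (linR f '' K) = coneDim K := by
  unfold coneDim
  rw [Submodule.span_image]
  exact LinearEquiv.finrank_eq (Submodule.equivMapOfInjective (linR f) h _).symm

end Poic

namespace PoicMor

variable {C D : Type v} [Category.{w} C] [Category.{w} D] {X : C ⥤ Poic.{u}} {Y : D ⥤ Poic.{u}}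

/-- If the images of the cones are closed, then a face of such an image is the image of the face cut
out by the pulled back functional. -/
theorem isWeaklyProper_of_closed (F : PoicMor X Y) (hX : IsPoicSpace X)
    (h : ∀ s : C, closureIn (Y.obj (F.functor.obj s)).cone
      (Poic.linR (F.at' s) '' (X.obj s).cone) = Poic.linR (F.at' s) '' (X.obj s).cone) :
    F.IsWeaklyProper := by
  intro s τ hτ
  rw [h s] at hτ
  obtain ⟨⟨y, hy⟩, f, hf, rfl⟩ := hτ
  have hface : IsFace (X.obj s).cone
      {x ∈ (X.obj s).cone | 0 ≤ evalR (f ∘ₗ Poic.lin (F.at' s)) x} := by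
    refine ⟨?_, f ∘ₗ Poic.lin (F.at' s), fun x hx => ?_, rfl⟩
    · obtain ⟨⟨x, hx, rfl⟩, hy2⟩ := hy
      refine ⟨x, hx, ?_⟩
      rw [← evalR_baseChange]; exact hy2
    · rw [← evalR_baseChange]; exact hf _ ⟨x, hx, rfl⟩
  obtain ⟨q, u, hinj, himg, -⟩ := hX.face_exists s _ hface
  have hτ : Poic.linR (F.at' s) '' (Poic.linR (X.map u) '' (X.obj q).cone) =
      {x ∈ Poic.linR (F.at' s) '' (X.obj s).cone | 0 ≤ evalR f x} := by
    rw [himg]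
    ext z
    constructor
    · rintro ⟨x, ⟨hx, hx2⟩, rfl⟩
      rw [← evalR_baseChange] at hx2
      exact ⟨⟨x, hx, rfl⟩, hx2⟩
    · rintro ⟨⟨x, hx, rfl⟩, hz⟩
      refine ⟨x, ⟨hx, ?_⟩, rfl⟩
      rw [← evalR_baseChange]; exact hz
  refine ⟨q, u, hτ, fun hi => ?_⟩
  rw [← hτ, Poic.coneDim_image hi, Poic.coneDim_image hi, Poic.coneDim_image hinj]
  rfl

end PoicMor

/-! ### Reachability in graphs -/

/-- `v` and `w` are joined by a chain of flags satisfying `Q`, for a root map `r` and an involution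
`ι` on a type of flags. -/
def FlagReach {X : Type*} (r ι : X → X) (Q : X → Prop) : X → X → Prop :=
  Relation.ReflTransGen fun v w => ∃ h, Q h ∧ r h = v ∧ r (ι h) = w

namespace FlagReach

variable {X Y : Type*} {r ι : X → X} {r' ι' : Y → Y} {Q Q' : X → Prop} {R : Y → Prop} {v w z : X}

theorem refl (v : X) : FlagReach r ι Q v v := Relation.ReflTransGen.refl

theorem trans (h : FlagReach r ι Q v w) (h' : FlagReach r ι Q w z) : FlagReach r ι Q v z :=
  Relation.ReflTransGen.trans h h'

theorem step {h : X} (hQ : Q h) : FlagReach r ι Q (r h) (r (ι h)) :=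
  Relation.ReflTransGen.single ⟨h, hQ, rfl, rfl⟩

theorem of_eq (h : v = w) : FlagReach r ι Q v w := h ▸ refl v

theorem map (φ : X → Y) (H : ∀ h, Q h → FlagReach r' ι' R (φ (r h)) (φ (r (ι h))))
    (h : FlagReach r ι Q v w) : FlagReach r' ι' R (φ v) (φ w) := by
  induction h with
  | refl => exact refl _
  | tail _ hs ih =>
    obtain ⟨h, hh, rfl, rfl⟩ := hs
    exact ih.trans (H h hh)

theorem bind (H : ∀ h, Q h → FlagReach r ι Q' (r h) (r (ι h))) (h : FlagReach r ι Q v w) :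
    FlagReach r ι Q' v w := h.map id H

theorem mono (H : ∀ h, Q h → Q' h) (h : FlagReach r ι Q v w) : FlagReach r ι Q' v w :=
  h.bind fun x hx => step (H x hx)

theorem symm (hι : ∀ x, ι (ι x) = x) (hQ : ∀ x, Q x → Q (ι x)) (h : FlagReach r ι Q v w) :
    FlagReach r ι Q w v := by
  induction h with
  | refl => exact refl _
  | tail _ hs ih =>
    obtain ⟨h, hh, rfl, rfl⟩ := hs
    refine trans ?_ ih
    have := step (r := r) (ι := ι) (hQ h hh)
    rwa [hι] at this

/-- A property of vertices that is preserved by all flags in `Q` is preserved by reachability. -/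
theorem induct {c : X → Prop} (hc : ∀ h, Q h → (c (r h) ↔ c (r (ι h))))
    (h : FlagReach r ι Q v w) : c v ↔ c w := by
  induction h with
  | refl => exact Iff.rfl
  | tail _ hs ih =>
    obtain ⟨h, hh, rfl, rfl⟩ := hs
    exact ih.trans (hc h hh)

end FlagReach

/-! ### Stable graphs on arbitrary types of flags -/

/-- The axioms of a connected stable graph of genus `g` with legs marked by `A`, for a root map and
an involution on an arbitrary type of flags. The genus formula and the valency condition are
expressed through flags: the number of edges is half the number of flags moved by `ι`, and a vertex
has valency at least three if it is the root of three other flags. -/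
structure IsStableGraph {Λ : Type u} (g : ℕ) (A : Finset Λ) {X : Type u} (r ι : X → X)
    (leg : A → X) : Prop where
  r_r : ∀ x, r (r x) = r x
  ι_ι : ∀ x, ι (ι x) = x
  ι_r : ∀ x, ι (r x) = r x
  leg_inj : Function.Injective leg
  leg_range : ∀ x, (¬ r x = x ∧ ι x = x) ↔ ∃ a, leg a = x
  nonempty : Nonempty X
  conn : ∀ v w, r v = v → r w = w → FlagReach r ι (fun _ => True) v w
  genus : Nat.card {h : X // ι h ≠ h} + 2 = 2 * g + 2 * Nat.card {v : X // r v = v}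
  stable : ∀ v, r v = v → ∃ p q s, p ≠ q ∧ p ≠ s ∧ q ≠ s ∧ r p ≠ p ∧ r q ≠ q ∧ r s ≠ s ∧
    r p = v ∧ r q = v ∧ r s = v

theorem IsStableGraph.congr {Λ : Type u} {g : ℕ} {A : Finset Λ} {X Y : Type u} {r ι : X → X}
    {leg : A → X} {r' ι' : Y → Y} {leg' : A → Y} (h : IsStableGraph g A r ι leg) (φ : X ≃ Y)
    (hr : ∀ x, r' (φ x) = φ (r x)) (hι : ∀ x, ι' (φ x) = φ (ι x)) (hl : ∀ a, leg' a = φ (leg a)) :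
    IsStableGraph g A r' ι' leg' := by
  have hfix : ∀ x, r' (φ x) = φ x ↔ r x = x := fun x => by rw [hr, φ.apply_eq_iff_eq]
  have hfix' : ∀ x, ι' (φ x) = φ x ↔ ι x = x := fun x => by rw [hι, φ.apply_eq_iff_eq]
  refine ⟨φ.forall_congr_right.1 fun x => by simp [hr, h.r_r],
    φ.forall_congr_right.1 fun x => by simp [hι, h.ι_ι],
    φ.forall_congr_right.1 fun x => by simp [hι, hr, h.ι_r], fun a b hab => ?_,
    φ.forall_congr_right.1 fun x => ?_, h.nonempty.map φ,
    φ.forall_congr_right.1 fun v => φ.forall_congr_right.1 fun w hv hw => ?_, ?_,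
    φ.forall_congr_right.1 fun v hv => ?_⟩
  · rw [hl, hl] at hab
    exact h.leg_inj (φ.injective hab)
  · rw [hfix, hfix', h.leg_range]
    exact exists_congr fun a => by rw [hl, φ.apply_eq_iff_eq]
  · refine (h.conn v w ((hfix v).1 hv) ((hfix w).1 hw)).map φ fun x _ => ?_
    rw [← hr, ← hr, ← hι]
    exact FlagReach.step trivial
  · have h1 : Nat.card {v : X // r v = v} = Nat.card {v : Y // r' v = v} :=
      Nat.card_congr (φ.subtypeEquiv fun x => (hfix x).symm)
    have h2 : Nat.card {v : X // ι v ≠ v} = Nat.card {v : Y // ι' v ≠ v} :=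
      Nat.card_congr (φ.subtypeEquiv fun x => (not_congr (hfix' x)).symm)
    rw [← h1, ← h2]
    exact h.genus
  · obtain ⟨p, q, s, h1, h2, h3, h4, h5, h6, h7, h8, h9⟩ := h.stable v ((hfix v).1 hv)
    refine ⟨φ p, φ q, φ s, ?_, ?_, ?_, ?_, ?_, ?_, ?_, ?_, ?_⟩ <;>
      simp only [hr, ne_eq, φ.apply_eq_iff_eq] <;> assumption

namespace DGraph

variable {U : Type u} (G : DGraph U)

/-- Reachability through flags satisfying `Q`. -/
abbrev Reach (Q : G.F → Prop) : G.F → G.F → Prop := FlagReach G.r G.ι Q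

variable {G}

theorem val_eq (v : G.F) (hv : G.IsVertex v) :
    G.val v = (Finset.univ.filter fun x => G.r x = v ∧ x ≠ v).card := by
  have : (Finset.univ.filter fun x => G.r x = v)
      = insert v (Finset.univ.filter fun x => G.r x = v ∧ x ≠ v) := by
    ext x
    simp only [Finset.mem_filter, Finset.mem_univ, true_and, Finset.mem_insert]
    constructor
    · intro h
      by_cases hx : x = v
      · exact Or.inl hx
      · exact Or.inr ⟨h, hx⟩
    · rintro (rfl | h)
      · exact hv
      · exact h.1
  rw [val, this, Finset.card_insert_of_notMem (by simp)]
  rfl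

theorem three_le_val_iff {v : G.F} (hv : G.IsVertex v) : 3 ≤ G.val v ↔
    ∃ p q s, p ≠ q ∧ p ≠ s ∧ q ≠ s ∧ G.r p ≠ p ∧ G.r q ≠ q ∧ G.r s ≠ s ∧
      G.r p = v ∧ G.r q = v ∧ G.r s = v := by
  rw [val_eq v hv]
  constructor
  · intro h
    obtain ⟨p, q, s, hp, hq, hs, h1, h2, h3⟩ := Finset.two_lt_card_iff.1 h
    simp only [Finset.mem_filter, Finset.mem_univ, true_and] at hp hq hs
    exact ⟨p, q, s, h1, h2, h3, hp.1 ▸ hp.2.symm, hq.1 ▸ hq.2.symm, hs.1 ▸ hs.2.symm,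
      hp.1, hq.1, hs.1⟩
  · rintro ⟨p, q, s, h1, h2, h3, h4, h5, h6, h7, h8, h9⟩
    refine Finset.two_lt_card_iff.2 ⟨p, q, s, ?_, ?_, ?_, h1, h2, h3⟩ <;>
      simp only [Finset.mem_filter, Finset.mem_univ, true_and]
    · exact ⟨h7, fun h => h4 (h7.trans h.symm)⟩
    · exact ⟨h8, fun h => h5 (h8.trans h.symm)⟩
    · exact ⟨h9, fun h => h6 (h9.trans h.symm)⟩

theorem card_vertices : Nat.card {v : G.F // G.r v = v} =
    (Finset.univ.filter fun x => G.IsVertex x).card := by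
  show Nat.card {v : G.F // G.IsVertex v} = _
  rw [Nat.card_eq_fintype_card]
  exact Fintype.card_subtype fun x => G.IsVertex x

theorem card_edge_flags : Nat.card {h : G.F // G.ι h ≠ h} =
    (Finset.univ.filter fun h => G.ι h ≠ h).card := by
  rw [Nat.card_eq_fintype_card]
  exact Fintype.card_subtype fun h => G.ι h ≠ h

theorem genus_univ_iff (g : ℕ) : G.genus Finset.univ = g ↔
    Nat.card {h : G.F // G.ι h ≠ h} + 2 = 2 * g + 2 * Nat.card {v : G.F // G.r v = v} := by
  have h := two_mul_card_edges (G := G) (K := Finset.univ) fun x _ => ⟨Finset.mem_univ _,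
    Finset.mem_univ _⟩
  rw [card_vertices, card_edge_flags, ← h]
  unfold genus verts
  omega

end DGraph

namespace GCat

variable {U Λ : Type u} {g : ℕ} {A : Finset Λ}

theorem isStableGraph (G : GCat U g A) : IsStableGraph g A G.r G.ι G.leg where
  r_r := G.r_r
  ι_ι := G.ι_ι
  ι_r := G.ι_r
  leg_inj := G.leg_injective
  leg_range := G.leg_range
  nonempty := ⟨G.conn.1.choose⟩
  conn v w hv hw := by
    refine Relation.ReflTransGen.mono ?_ _ _
      (G.conn.2 v (Finset.mem_univ _) w (Finset.mem_univ _) hv hw)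
    rintro a b ⟨h, -, h1, h2⟩
    exact ⟨h, trivial, h1, h2⟩
  genus := (DGraph.genus_univ_iff g).1 G.genus_eq
  stable v hv := (DGraph.three_le_val_iff hv).1 (G.stable v hv)

/-- The object of `𝔾_{g,A}` given by a graph that satisfies the axioms of a stable graph. -/
def ofStable (D : DGraph U) (leg : A → D.F) (h : IsStableGraph g A D.r D.ι leg) :
    GCat U g A where
  toDGraph := D
  leg := leg
  leg_injective := h.leg_inj
  leg_range := h.leg_range
  conn := by
    obtain ⟨x⟩ := h.nonempty
    refine ⟨⟨x, Finset.mem_univ _⟩, fun v _ w _ hv hw => ?_⟩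
    refine Relation.ReflTransGen.mono ?_ _ _ (h.conn v w hv hw)
    rintro a b ⟨h, -, h1, h2⟩
    exact ⟨h, Finset.mem_univ _, h1, h2⟩
  genus_eq := (DGraph.genus_univ_iff g).2 h.genus
  stable v hv := (DGraph.three_le_val_iff hv).2 (h.stable v hv)

section OfEmb

variable {X : Type u} [Finite X] (e : X ↪ U) {r ι : X → X} {leg : A → X}

/-- The finite set of names of the flags of a graph realized in `U`. -/
def embFlags : Finset U := (Set.finite_range e).toFinset

/-- A type of flags is identified with its realization in `U`. -/
def embEquiv : X ≃ embFlags e :=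
  Equiv.ofBijective (fun x => ⟨e x, by simp [embFlags]⟩) ⟨fun x y h => e.injective
    (congrArg Subtype.val h), fun ⟨y, hy⟩ => by
      obtain ⟨x, rfl⟩ := by simpa [embFlags] using hy
      exact ⟨x, rfl⟩⟩

/-- The realization in `U`, along an injection, of a stable graph on a finite type of flags. -/
def ofEmb (h : IsStableGraph g A r ι leg) : GCat U g A :=
  ofStable
    { F := embFlags e
      r := fun x => embEquiv e (r ((embEquiv e).symm x))
      ι := fun x => embEquiv e (ι ((embEquiv e).symm x))
      r_r := fun x => by simp [h.r_r]
      ι_ι := fun x => by simp [h.ι_ι]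
      ι_r := fun x => by simp [h.ι_r] }
    (fun a => embEquiv e (leg a))
    (h.congr (embEquiv e) (fun x => by simp) (fun x => by simp) fun a => rfl)

variable (h : IsStableGraph g A r ι leg)

/-- The identification of the flags of a graph with those of its realization in `U`. -/
def toEmb : X ≃ (ofEmb e h).F := embEquiv e

theorem ofEmb_r (x : X) : (ofEmb e h).r (toEmb e h x) = toEmb e h (r x) := by
  show embEquiv e (r ((embEquiv e).symm (embEquiv e x))) = _
  rw [Equiv.symm_apply_apply]; rfl

theorem ofEmb_ι (x : X) : (ofEmb e h).ι (toEmb e h x) = toEmb e h (ι x) := by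
  show embEquiv e (ι ((embEquiv e).symm (embEquiv e x))) = _
  rw [Equiv.symm_apply_apply]; rfl

theorem ofEmb_leg (a : A) : (ofEmb e h).leg a = toEmb e h (leg a) := rfl

end OfEmb

/-! ### Morphisms of stable graphs -/

theorem conn' (G : GCat U g A) {v w : G.F} (hv : G.IsVertex v) (hw : G.IsVertex w) :
    G.Reach (fun _ => True) v w := G.isStableGraph.conn v w hv hw

theorem card_flags (G : GCat U g A) : (Finset.univ.filter fun h => G.ι h ≠ h).card + 2 =
    2 * g + 2 * (Finset.univ.filter fun v => G.IsVertex v).card := by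
  rw [← DGraph.card_vertices, ← DGraph.card_edge_flags]
  exact G.isStableGraph.genus

theorem exists_flag (G : GCat U g A) {v : G.F} (hv : G.IsVertex v) :
    ∃ h, ¬ G.IsVertex h ∧ G.r h = v := by
  obtain ⟨p, _, _, _, _, _, h4, _, _, h7, _⟩ := G.isStableGraph.stable v hv
  exact ⟨p, h4, h7⟩

/-- A map of flags which commutes with the root maps, the involutions and the markings is a
contraction as soon as the flags that are not vertices have exactly one preimage and the inverse
images of vertices are connected: that the latter are trees follows by comparing genera. -/
def homMk {G H : GCat U g A} (f : G.F → H.F) (map_r : ∀ x, f (G.r x) = H.r (f x))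
    (map_ι : ∀ x, f (G.ι x) = H.ι (f x)) (map_leg : ∀ a, f (G.leg a) = H.leg a)
    (flag : ∀ y, ¬ H.IsVertex y → ∃! x, f x = y)
    (fiber : ∀ v w, G.IsVertex v → G.IsVertex w → f v = f w →
      G.Reach (fun h => H.IsVertex (f h)) v w) : G ⟶ H :=
  Hom.mk f
    { map_r := map_r
      map_ι := map_ι
      flag := flag
      fiber := by
        let K : H.F → Finset G.F := fun y => Finset.univ.filter fun x => f x = y
        have hK : ∀ y x, x ∈ K y ↔ f x = y := fun y x => by simp [K]
        have hsub : ∀ y, H.IsVertex y → G.IsSub (K y) := by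
          intro y hy x hx
          rw [hK] at hx
          refine ⟨(hK _ _).2 ?_, (hK _ _).2 ?_⟩
          · rw [map_r, hx]; exact hy
          · rw [map_ι, hx]; exact DGraph.ι_of_isVertex hy
        have hleg : ∀ y, H.IsVertex y → ∀ x ∈ K y, ¬ G.IsLeg x := by
          intro y hy x hx hl
          obtain ⟨a, rfl⟩ := (G.leg_range x).1 hl
          rw [hK, map_leg] at hx
          exact ((H.leg_range _).2 ⟨a, rfl⟩).1 (hx ▸ hy)
        have hconn : ∀ y, H.IsVertex y → G.IsConn (K y) := by
          intro y hy
          refine ⟨?_, fun v hv w hw hvv hwv => ?_⟩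
          · obtain ⟨h, hh, rfl⟩ := H.exists_flag hy
            obtain ⟨x, rfl, -⟩ := flag h hh
            exact ⟨G.r x, (hK _ _).2 (map_r x)⟩
          · rw [hK] at hv hw
            have hr := fiber v w hvv hwv (hv.trans hw.symm)
            -- the whole chain stays in the fibre
            have key : ∀ z, G.Reach (fun h => H.IsVertex (f h)) v z →
                f z = y ∧ Relation.ReflTransGen (G.Joined (K y)) v z := by
              intro z hz
              induction hz with
              | refl => exact ⟨hv, .refl⟩
              | tail _ hs ih =>
                obtain ⟨h, hh, rfl, rfl⟩ := hs
                have hh' : H.r (f h) = f h := hh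
                have h1 : f h = y := by rw [← ih.1, map_r, hh']
                refine ⟨?_, ih.2.tail ⟨h, (hK _ _).2 h1, rfl, rfl⟩⟩
                rw [map_r, map_ι, DGraph.ι_of_isVertex hh, hh', h1]
            exact (key w hr).2
        have hι : ∀ y, ¬ H.IsVertex y → ∀ x, f x = y → (G.ι x ≠ x ↔ H.ι y ≠ y) := by
          rintro _ hy x rfl
          rw [← map_ι, not_iff_not]
          exact ⟨fun h => by rw [h], fun h => (flag _ hy).unique h rfl⟩
        have hv : ∀ y, ¬ H.IsVertex y → ∀ x, f x = y → ¬ G.IsVertex x := by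
          rintro _ hy x rfl hx
          exact hy (by
            have := map_r x
            rw [hx] at this
            exact this.symm)
        -- compare the Euler characteristics fibrewise
        have hsum : ∑ y, (((K y).filter fun h => G.ι h ≠ h).card : ℤ)
            = (Finset.univ.filter fun h => G.ι h ≠ h).card := by
          rw [Finset.card_eq_sum_card_fiberwise (t := Finset.univ) (f := f)
            (fun _ _ => Finset.mem_coe.2 (Finset.mem_univ _))]
          push_cast
          refine Finset.sum_congr rfl fun y _ => ?_
          congr 2
          exact Finset.filter_comm _ _ _
        have hsum' : ∑ y, ((G.verts (K y)).card : ℤ)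
            = (Finset.univ.filter fun v => G.IsVertex v).card := by
          rw [Finset.card_eq_sum_card_fiberwise (t := Finset.univ) (f := f)
            (fun _ _ => Finset.mem_coe.2 (Finset.mem_univ _))]
          push_cast
          refine Finset.sum_congr rfl fun y _ => ?_
          congr 2
          exact Finset.filter_comm _ _ _
        have hnn : ∀ y ∈ (Finset.univ : Finset H.F),
            0 ≤ (((K y).filter fun h => G.ι h ≠ h).card : ℤ) - 2 * (G.verts (K y)).card
              + 2 * (if H.IsVertex y then 1 else 0) - (if H.ι y ≠ y then 1 else 0) := by
          intro y _
          by_cases hy : H.IsVertex y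
          · have h1 := (hconn y hy).genus_nonneg (hsub y hy)
            have h2 := DGraph.two_mul_card_edges (hsub y hy)
            rw [if_pos hy, if_neg (by simpa using DGraph.ι_of_isVertex hy)]
            unfold DGraph.genus at h1
            omega
          · obtain ⟨x, hx, hxu⟩ := flag y hy
            have h1 : K y = {x} := by
              ext z
              rw [hK, Finset.mem_singleton]
              exact ⟨fun h => hxu z h, fun h => h ▸ hx⟩
            have h2 : G.verts (K y) = ∅ := by
              rw [DGraph.verts, h1, Finset.filter_singleton, if_neg (hv y hy x hx)]
            rw [h2, if_neg hy, h1, Finset.filter_singleton]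
            by_cases h3 : H.ι y ≠ y
            · rw [if_pos h3, if_pos ((hι y hy x hx).2 h3)]; simp
            · rw [if_neg h3, if_neg fun h4 => h3 ((hι y hy x hx).1 h4)]; simp
        have hzero : ∑ y, ((((K y).filter fun h => G.ι h ≠ h).card : ℤ)
            - 2 * (G.verts (K y)).card
              + 2 * (if H.IsVertex y then 1 else 0) - (if H.ι y ≠ y then 1 else 0)) = 0 := by
          rw [Finset.sum_sub_distrib, Finset.sum_add_distrib, Finset.sum_sub_distrib,
            ← Finset.mul_sum, ← Finset.mul_sum, hsum, hsum', Finset.sum_boole, Finset.sum_boole]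
          have h1 := G.card_flags
          have h2 := H.card_flags
          omega
        intro y hy
        refine ⟨hsub y hy, hleg y hy, hconn y hy, ?_⟩
        have h1 := (Finset.sum_eq_zero_iff_of_nonneg hnn).1 hzero y (Finset.mem_univ _)
        have h2 := DGraph.two_mul_card_edges (hsub y hy)
        rw [if_pos hy, if_neg (by simpa using DGraph.ι_of_isVertex hy)] at h1
        show G.genus (K y) = 0
        unfold DGraph.genus
        omega }
    map_leg

@[simp] theorem fn_homMk {G H : GCat U g A} (f : G.F → H.F) (h1 h2 h3 h4 h5) :
    fn (homMk f h1 h2 h3 h4 h5) = f := rfl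

@[simp] theorem fn_id (G : GCat U g A) (x : G.F) : fn (𝟙 G) x = x := rfl

@[simp] theorem fn_comp {G H K : GCat U g A} (f : G ⟶ H) (k : H ⟶ K) (x : G.F) :
    fn (f ≫ k) x = fn k (fn f x) := rfl

theorem hom_ext_fn {G H : GCat U g A} {f k : G ⟶ H} (h : ∀ x, fn f x = fn k x) : f = k :=
  Hom.ext (funext h)

theorem fn_r {G H : GCat U g A} (f : G ⟶ H) (x : G.F) : fn f (G.r x) = H.r (fn f x) :=
  (fn_contraction f).map_r x

theorem fn_ι {G H : GCat U g A} (f : G ⟶ H) (x : G.F) : fn f (G.ι x) = H.ι (fn f x) :=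
  (fn_contraction f).map_ι x

theorem fn_leg {G H : GCat U g A} (f : G ⟶ H) (a : A) : fn f (G.leg a) = H.leg a :=
  Hom.map_leg f a

theorem fn_vertex {G H : GCat U g A} (f : G ⟶ H) {x : G.F} (hx : G.IsVertex x) :
    H.IsVertex (fn f x) := (fn_contraction f).isVertex hx

theorem fn_surj {G H : GCat U g A} (f : G ⟶ H) (y : H.F) : ∃ x, fn f x = y :=
  (fn_contraction f).surjective y

theorem fn_inj {G H : GCat U g A} (f : G ⟶ H) {x y : G.F} (hx : ¬ H.IsVertex (fn f x))
    (hxy : fn f x = fn f y) : x = y :=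
  ((fn_contraction f).flag _ hx).unique rfl hxy.symm

theorem fn_ι_eq_iff {G H : GCat U g A} (f : G ⟶ H) {x : G.F} (hx : ¬ H.IsVertex (fn f x)) :
    G.ι x = x ↔ H.ι (fn f x) = fn f x := (fn_contraction f).ι_fixed_iff hx

theorem isVertex_ι {G : GCat U g A} {x : G.F} : G.IsVertex (G.ι x) ↔ G.IsVertex x := by
  constructor
  · intro h
    have := DGraph.ι_of_isVertex h
    rw [G.ι_ι] at this
    rwa [← this] at h
  · intro h
    rw [DGraph.ι_of_isVertex h]; exact h

theorem fn_ι_vertex {G H : GCat U g A} (f : G ⟶ H) {x : G.F} :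
    H.IsVertex (fn f (G.ι x)) ↔ H.IsVertex (fn f x) := by
  rw [fn_ι, isVertex_ι]

/-- The vertices in a fibre of a contraction are joined by contracted edges. -/
theorem reach_fiber {G H : GCat U g A} (f : G ⟶ H) {v w : G.F} (hv : G.IsVertex v)
    (hw : G.IsVertex w) (hvw : fn f v = fn f w) : G.Reach (fun h => H.IsVertex (fn f h)) v w := by
  have hT := (fn_contraction f).fiber (fn f v) (fn_vertex f hv)
  refine Relation.ReflTransGen.mono ?_ _ _ (hT.2.2.1.2 v (by simp) w (by simp [hvw]) hv hw)
  rintro a b ⟨h, hh, h1, h2⟩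
  refine ⟨h, ?_, h1, h2⟩
  show H.IsVertex (fn f h)
  rw [(Finset.mem_filter.1 hh).2]
  exact fn_vertex f hv

/-- A contracted flag has the same image as its root. -/
theorem fn_eq_of_vertex {G H : GCat U g A} (f : G ⟶ H) {x : G.F} (hx : H.IsVertex (fn f x)) :
    fn f (G.r x) = fn f x := (fn_r f x).trans hx

theorem fn_leg_not_vertex {G H : GCat U g A} (f : G ⟶ H) (a : A) :
    ¬ H.IsVertex (fn f (G.leg a)) := by
  rw [fn_leg]; exact ((H.leg_range _).2 ⟨a, rfl⟩).1

/-- A contraction which contracts at least the flags that `f` contracts factors through `f`. -/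
theorem exists_factor {G H K : GCat U g A} (f : G ⟶ H) (k : G ⟶ K)
    (h : ∀ x, H.IsVertex (fn f x) → K.IsVertex (fn k x)) : ∃ l : H ⟶ K, f ≫ l = k := by
  have hfib : ∀ x y, fn f x = fn f y → fn k x = fn k y := by
    intro x y hxy
    by_cases hx : H.IsVertex (fn f x)
    · have hr := reach_fiber f (DGraph.isVertex_r x) (DGraph.isVertex_r y)
        (by rw [fn_r, fn_r, hxy])
      have key : ∀ z, G.Reach (fun h => H.IsVertex (fn f h)) (G.r x) z →
          fn k z = fn k (G.r x) := by
        intro z hz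
        induction hz with
        | refl => rfl
        | tail _ hs ih =>
          obtain ⟨p, hp, rfl, rfl⟩ := hs
          rw [← ih, fn_r, fn_r, fn_ι, DGraph.ι_of_isVertex (h p hp)]
      rw [← fn_eq_of_vertex k (h x hx), ← fn_eq_of_vertex k (h y (hxy ▸ hx)), key _ hr]
    · rw [fn_inj f hx hxy]
  choose s hs using fn_surj f
  have hl : ∀ x, fn k (s (fn f x)) = fn k x := fun x => hfib _ _ (hs _)
  refine ⟨homMk (fun y => fn k (s y)) ?_ ?_ ?_ ?_ ?_, hom_ext_fn fun x => hl x⟩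
  · intro y
    obtain ⟨x, rfl⟩ := fn_surj f y
    rw [← fn_r, hl, hl, fn_r]
  · intro y
    obtain ⟨x, rfl⟩ := fn_surj f y
    rw [← fn_ι, hl, hl, fn_ι]
  · intro a
    rw [← fn_leg f, hl, fn_leg]
  · intro y hy
    obtain ⟨x, rfl⟩ := fn_surj k y
    refine ⟨fn f x, hl x, fun z hz => ?_⟩
    obtain ⟨x', rfl⟩ := fn_surj f z
    simp only [hl] at hz
    rw [fn_inj k (hz ▸ hy) hz]
  · intro v w hv hw hvw
    obtain ⟨x, rfl⟩ := fn_surj f v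
    obtain ⟨y, rfl⟩ := fn_surj f w
    have hx : fn f (G.r x) = fn f x := fn_eq_of_vertex f hv
    have hy : fn f (G.r y) = fn f y := fn_eq_of_vertex f hw
    simp only [hl] at hvw
    have := reach_fiber k (DGraph.isVertex_r x) (DGraph.isVertex_r y)
      (by rw [fn_r, fn_r, hvw])
    rw [← hx, ← hy]
    refine this.map (fn f) fun p hp => ?_
    rw [fn_r, fn_r, fn_ι]
    exact FlagReach.step (Q := fun h => K.IsVertex (fn k (s h))) (by rw [hl]; exact hp)

/-- A contraction is determined by the flags that it does not contract. -/
theorem hom_ext_of_flags {G H : GCat U g A} {f k : G ⟶ H}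
    (h : ∀ x, ¬ H.IsVertex (fn f x) → fn k x = fn f x) : f = k := by
  have hinv : ∀ x, H.IsVertex (fn f x) → H.IsVertex (fn k x) := by
    intro x hx
    by_contra hk
    obtain ⟨y, hy⟩ := fn_surj f (fn k x)
    have h1 := h y (hy ▸ hk)
    rw [hy] at h1
    rw [fn_inj k hk h1.symm, hy] at hx
    exact hk hx
  obtain ⟨l, rfl⟩ := exists_factor f k hinv
  have hl : ∀ y, fn l y = y := by
    have hflag : ∀ y, ¬ H.IsVertex y → fn l y = y := by
      intro y hy
      obtain ⟨x, rfl⟩ := fn_surj f y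
      exact h x hy
    intro y
    by_cases hy : H.IsVertex y
    · obtain ⟨p, hp, rfl⟩ := H.exists_flag hy
      rw [fn_r, hflag p hp]
    · exact hflag y hy
  exact hom_ext_fn fun x => by rw [fn_comp, hl]

/-- The isomorphism given by a bijection of flags. -/
def isoMk {G H : GCat U g A} (f : G.F ≃ H.F) (map_r : ∀ x, f (G.r x) = H.r (f x))
    (map_ι : ∀ x, f (G.ι x) = H.ι (f x)) (map_leg : ∀ a, f (G.leg a) = H.leg a) : G ≅ H where
  hom := homMk f map_r map_ι map_leg
    (fun y _ => ⟨f.symm y, by simp, fun x hx => by simp [← hx]⟩)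
    (fun v w _ _ h => FlagReach.of_eq (f.injective h))
  inv := homMk f.symm (fun x => by
      obtain ⟨y, rfl⟩ := f.surjective x
      rw [← map_r]; simp) (fun x => by
      obtain ⟨y, rfl⟩ := f.surjective x
      rw [← map_ι]; simp) (fun a => by rw [← map_leg]; simp)
    (fun y _ => ⟨f y, by simp, fun x hx => by simp [← hx]⟩)
    (fun v w _ _ h => FlagReach.of_eq (f.symm.injective h))
  hom_inv_id := hom_ext_fn fun x => f.symm_apply_apply x
  inv_hom_id := hom_ext_fn fun x => f.apply_symm_apply x

/-- The bijection of flags underlying an isomorphism. -/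
def flagEquiv {G H : GCat U g A} (i : G ≅ H) : G.F ≃ H.F where
  toFun := fn i.hom
  invFun := fn i.inv
  left_inv x := by rw [← fn_comp, i.hom_inv_id, fn_id]
  right_inv x := by rw [← fn_comp, i.inv_hom_id, fn_id]

theorem isVertex_iso {G H : GCat U g A} (i : G ≅ H) {x : G.F} :
    H.IsVertex (fn i.hom x) ↔ G.IsVertex x := by
  refine ⟨fun h => ?_, fn_vertex _⟩
  have := fn_vertex i.inv h
  rwa [← fn_comp, i.hom_inv_id, fn_id] at this

/-- A graph realized in `U` along an injection of the flags of `G` is isomorphic to `G`. -/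
def isoOfEmb (G : GCat U g A) (e : G.F ↪ U) : G ≅ ofEmb e G.isStableGraph :=
  isoMk (toEmb e _) (fun x => (ofEmb_r e _ x).symm) (fun x => (ofEmb_ι e _ x).symm) fun _ => rfl

theorem fn_isoOfEmb (G : GCat U g A) (e : G.F ↪ U) (x : G.F) :
    (fn (isoOfEmb G e).hom x).1 = e x := rfl

/-! ### Equality of graphs and of morphisms in terms of the names of flags -/

/-- Two graphs with the same flags, the same maps and the same marking are equal. -/
theorem ext_names {G H : GCat U g A} (hF : ∀ u, u ∈ G.F ↔ u ∈ H.F)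
    (hr : ∀ (x : G.F) (y : H.F), x.1 = y.1 → (G.r x).1 = (H.r y).1)
    (hι : ∀ (x : G.F) (y : H.F), x.1 = y.1 → (G.ι x).1 = (H.ι y).1)
    (hl : ∀ a, (G.leg a).1 = (H.leg a).1) : G = H := by
  rcases G with ⟨⟨F, r, ι, _, _, _⟩, leg, _, _, _, _, _⟩
  rcases H with ⟨⟨F', r', ι', _, _, _⟩, leg', _, _, _, _, _⟩
  obtain rfl : F = F' := Finset.ext hF
  obtain rfl : r = r' := funext fun x => Subtype.ext (hr x x rfl)
  obtain rfl : ι = ι' := funext fun x => Subtype.ext (hι x x rfl)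
  obtain rfl : leg = leg' := funext fun a => Subtype.ext (hl a)
  rfl

theorem fn_eqToHom_unop {G H : (GCat U g A)ᵒᵖ} (h : G = H) (x : H.unop.F) :
    (fn (eqToHom h).unop x).1 = x.1 := by
  subst h; rfl

end GCat

/-! ### Edges, spanning trees and forests -/

namespace DGraph

variable {U : Type u} {G : DGraph U}

/-- The edge through a flag which is moved by the involution. -/
def edgeOf (h : G.F) (hh : G.ι h ≠ h) : G.Edge := ⟨s(h, G.ι h), h, hh, rfl⟩

theorem exists_edgeOf (e : G.Edge) : ∃ h hh, e = edgeOf h hh := by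
  obtain ⟨_, h, hh, rfl⟩ := e
  exact ⟨h, hh, rfl⟩

theorem edgeOf_eq_iff {h h' : G.F} {hh : G.ι h ≠ h} {hh' : G.ι h' ≠ h'} :
    edgeOf h hh = edgeOf h' hh' ↔ h = h' ∨ h = G.ι h' := by
  constructor
  · intro h1
    rcases Sym2.eq_iff.1 (congrArg Subtype.val h1) with h1 | h1
    · exact Or.inl h1.1
    · exact Or.inr h1.1
  · rintro (rfl | rfl)
    · rfl
    · exact Subtype.ext (Sym2.eq_iff.2 (Or.inr ⟨rfl, G.ι_ι _⟩))

theorem edgeOf_ι {h : G.F} (hh : G.ι h ≠ h) : edgeOf (G.ι h) (ι_ne hh) = edgeOf h hh :=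
  edgeOf_eq_iff.2 (Or.inr rfl)

theorem flagLen_of_ne (δ : G.Edge → ℤ) {h : G.F} (hh : G.ι h ≠ h) :
    G.flagLen δ h = δ (edgeOf h hh) := dif_pos hh

theorem flagLen_of_eq (δ : G.Edge → ℤ) {h : G.F} (hh : G.ι h = h) : G.flagLen δ h = 0 :=
  dif_neg (not_not.2 hh)

theorem flagLen_ι (δ : G.Edge → ℤ) (h : G.F) : G.flagLen δ (G.ι h) = G.flagLen δ h := by
  by_cases hh : G.ι h = h
  · rw [hh]
  · rw [flagLen_of_ne δ hh, flagLen_of_ne δ (ι_ne hh), edgeOf_ι]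

theorem ext_flagLen {δ δ' : G.Edge → ℤ} (h : ∀ x, G.ι x ≠ x → G.flagLen δ x = G.flagLen δ' x) :
    δ = δ' := by
  funext e
  obtain ⟨x, hx, rfl⟩ := exists_edgeOf e
  rw [← flagLen_of_ne δ, ← flagLen_of_ne δ', h x hx]

/-- The flag `x` belongs to an edge in `S`. -/
def FlagIn (S : Set G.Edge) (x : G.F) : Prop := ∃ hx, edgeOf x hx ∈ S

theorem FlagIn.ι {S : Set G.Edge} {x : G.F} (h : FlagIn S x) : FlagIn S (G.ι x) := by
  obtain ⟨hx, h⟩ := h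
  exact ⟨ι_ne hx, by rwa [edgeOf_ι]⟩

theorem Joined.symm {K : Finset G.F} (hK : G.IsSub K) {v w : G.F} (h : G.Joined K v w) :
    G.Joined K w v := by
  obtain ⟨x, hx, rfl, rfl⟩ := h
  exact ⟨G.ι x, (hK x hx).2, rfl, by rw [G.ι_ι]⟩

/-- Steps of a chain along flags fixed by the involution can be left out. -/
theorem reach_of_joined {K : Finset G.F} {Q : G.F → Prop}
    (hQ : ∀ x ∈ K, G.ι x ≠ x → Q x) {v w : G.F}
    (h : Relation.ReflTransGen (G.Joined K) v w) : G.Reach Q v w := by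
  induction h with
  | refl => exact FlagReach.refl _
  | tail _ hs ih =>
    obtain ⟨x, hx, rfl, rfl⟩ := hs
    refine ih.trans ?_
    by_cases hne : G.ι x = x
    · exact FlagReach.of_eq (by rw [hne])
    · exact FlagReach.step (hQ x hx hne)

/-- A connected subgraph contains a tree with the same vertices. -/
theorem exists_spanning_tree {K : Finset G.F} (hK : G.IsSub K) (hc : G.IsConn K) :
    ∃ T ⊆ K, G.IsLeglessTree T ∧ ∀ v ∈ K, G.IsVertex v → v ∈ T := by
  obtain ⟨x, hx⟩ := hc.1
  have hv : G.IsVertex (G.r x) := isVertex_r x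
  have hι0 : G.ι (G.r x) = G.r x := ι_of_isVertex hv
  have hroot : G.IsLeglessTree {G.r x} := by
    refine ⟨?_, ?_, ⟨⟨_, Finset.mem_singleton_self _⟩, ?_⟩, ?_⟩
    · intro y hy
      rw [Finset.mem_singleton] at hy ⊢
      subst hy
      exact ⟨hv, Finset.mem_singleton.2 hι0⟩
    · intro y hy hl
      rw [Finset.mem_singleton] at hy
      exact hl.1 (hy ▸ hv)
    · intro a ha b hb _ _
      rw [Finset.mem_singleton.1 ha, Finset.mem_singleton.1 hb]
    · have h1 : G.edges {G.r x} = ∅ := by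
        rw [edges, Finset.filter_singleton, if_neg (by simpa using hι0), Finset.image_empty]
      have h2 : G.verts {G.r x} = {G.r x} := by
        rw [verts, Finset.filter_singleton, if_pos hv]
      simp [genus, h1, h2]
  -- a tree with the largest possible number of flags has all the vertices
  obtain ⟨T, hT, hmax⟩ := Finset.exists_max_image (K.powerset.filter fun T => G.IsLeglessTree T)
    Finset.card ⟨{G.r x}, Finset.mem_filter.2 ⟨Finset.mem_powerset.2
      (Finset.singleton_subset_iff.2 (hK x hx).1), hroot⟩⟩
  obtain ⟨hTK, hT⟩ := Finset.mem_filter.1 hT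
  rw [Finset.mem_powerset] at hTK
  refine ⟨T, hTK, hT, ?_⟩
  by_contra hcon
  push Not at hcon
  obtain ⟨w, hwK, hwv, hwT⟩ := hcon
  obtain ⟨hsub, hleg, hconn, hgen⟩ := id hT
  obtain ⟨y, hy⟩ := hconn.1
  have hry := (hsub y hy).1
  obtain ⟨h, hhK, hh1, hh2⟩ : ∃ h ∈ K, G.r h ∈ T ∧ G.r (G.ι h) ∉ T := by
    by_contra hno
    push Not at hno
    have : ∀ z, Relation.ReflTransGen (G.Joined K) (G.r y) z → z ∈ T := by
      intro z hz
      induction hz with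
      | refl => exact hry
      | tail _ hj ih2 =>
        obtain ⟨h, hh, h1, h2⟩ := hj
        rw [← h2]; exact hno h hh (by rw [h1]; exact ih2)
    exact hwT (this w (hc.2 _ (hTK hry) _ hwK (isVertex_r y) hwv))
  have hne : G.ι h ≠ h := fun he => hh2 (by rw [he]; exact hh1)
  have hhT : h ∉ T := fun hmem => hh2 (hsub _ (hsub h hmem).2).1
  have hιT : G.ι h ∉ T := fun hmem => hh2 (hsub _ hmem).1
  set v := G.r (G.ι h) with hvdef
  have hvv : G.IsVertex v := isVertex_r _
  let T' : Finset G.F := insert v (insert h (insert (G.ι h) T))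
  have hmem : ∀ z, z ∈ T' ↔ z = v ∨ z = h ∨ z = G.ι h ∨ z ∈ T := by
    intro z; simp only [T', Finset.mem_insert]
  have hT'K : T' ⊆ K := by
    intro z hz
    rcases (hmem z).1 hz with rfl | rfl | rfl | hz
    · exact (hK _ (hK h hhK).2).1
    · exact hhK
    · exact (hK h hhK).2
    · exact hTK hz
  have hsub' : G.IsSub T' := fun z hz => by
    rw [hmem] at hz
    rw [hmem, hmem]
    have := hsub z
    grind [G.ι_ι, ι_of_isVertex, IsVertex]
  have htree : G.IsLeglessTree T' := by
    have hleg' : ∀ z ∈ T', ¬ G.IsLeg z := by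
      intro z hz hl
      rcases (hmem z).1 hz with rfl | rfl | rfl | hz
      · exact hl.1 hvv
      · exact hne hl.2
      · exact ι_ne hne hl.2
      · exact hleg z hz hl
    have hmono : ∀ a b, Relation.ReflTransGen (G.Joined T) a b →
        Relation.ReflTransGen (G.Joined T') a b := by
      refine Relation.ReflTransGen.mono ?_
      rintro a b ⟨p, hp, h1, h2⟩
      exact ⟨p, (hmem p).2 (Or.inr (Or.inr (Or.inr hp))), h1, h2⟩
    have hto : ∀ a ∈ T', G.IsVertex a →
        Relation.ReflTransGen (G.Joined T') (G.r h) a ∧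
        Relation.ReflTransGen (G.Joined T') a (G.r h) := by
      intro a ha hav
      rcases (hmem a).1 ha with rfl | rfl | rfl | ha
      · have hj : G.Joined T' (G.r h) v := ⟨h, (hmem h).2 (Or.inr (Or.inl rfl)), rfl, rfl⟩
        exact ⟨.single hj, .single (hj.symm hsub')⟩
      · exact absurd hav (not_isVertex_of_ne hne)
      · exact absurd hav (not_isVertex_of_ne (ι_ne hne))
      · exact ⟨hmono _ _ (hconn.2 _ hh1 _ ha (isVertex_r h) hav),
          hmono _ _ (hconn.2 _ ha _ hh1 hav (isVertex_r h))⟩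
    have hconn' : G.IsConn T' := ⟨⟨v, (hmem v).2 (Or.inl rfl)⟩, fun a ha b hb hav hbv =>
      (hto a ha hav).2.trans (hto b hb hbv).1⟩
    refine ⟨hsub', hleg', hconn', ?_⟩
    have hvT : v ∉ T := hh2
    have h1 : G.verts T' = insert v (G.verts T) := by
      ext z
      simp only [verts, Finset.mem_filter, Finset.mem_insert, hmem]
      grind [ι_ne, ι_of_isVertex]
    have h2 : (T'.filter fun z => G.ι z ≠ z) =
        insert h (insert (G.ι h) (T.filter fun z => G.ι z ≠ z)) := by
      ext z
      simp only [Finset.mem_filter, Finset.mem_insert, hmem]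
      grind [ι_ne, ι_of_isVertex]
    have h3 := two_mul_card_edges hsub'
    have h4 := two_mul_card_edges hsub
    rw [h2, Finset.card_insert_of_notMem, Finset.card_insert_of_notMem] at h3
    · unfold genus at hgen ⊢
      rw [h1, Finset.card_insert_of_notMem (s := G.verts T)
        fun hm => hvT (Finset.mem_filter.1 hm).1]
      push_cast
      omega
    · exact fun hm => hιT (Finset.mem_filter.1 hm).1
    · intro hm
      rcases Finset.mem_insert.1 hm with h5 | h5
      · exact hne h5.symm
      · exact hhT (Finset.mem_filter.1 h5).1
  have h1 := hmax T' (Finset.mem_filter.2 ⟨Finset.mem_powerset.2 hT'K, htree⟩)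
  have h2 : T ⊂ T' := Finset.ssubset_iff_of_subset
    (fun z hz => (hmem z).2 (Or.inr (Or.inr (Or.inr hz)))) |>.2 ⟨v, (hmem v).2 (Or.inl rfl), hh2⟩
  have h3 := Finset.card_lt_card h2
  omega

/-- A set of edges is a forest if and only if the ends of each of its edges are not joined by its
other edges. -/
theorem isForest_iff (S : Set G.Edge) : G.IsForest S ↔ ∀ h : G.F, FlagIn S h →
    ¬ G.Reach (fun x => FlagIn S x ∧ x ≠ h ∧ x ≠ G.ι h) (G.r h) (G.r (G.ι h)) := by
  constructor
  · rintro hS h ⟨hne, hhS⟩ hreach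
    let Q : G.F → Prop := fun x => FlagIn S x ∧ x ≠ h ∧ x ≠ G.ι h
    have hQι : ∀ x, Q x → Q (G.ι x) := fun x hx => ⟨hx.1.ι, fun he => hx.2.2 (by
      rw [← he, G.ι_ι]), fun he => hx.2.1 (by rw [← G.ι_ι x, he, G.ι_ι])⟩
    -- the connected component of the edge, with and without this edge
    let K : Finset G.F := Finset.univ.filter fun x =>
      (G.IsVertex x ∨ FlagIn S x) ∧ G.Reach Q (G.r h) (G.r x)
    let K₁ : Finset G.F := Finset.univ.filter fun x =>
      (G.IsVertex x ∨ Q x) ∧ G.Reach Q (G.r h) (G.r x)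
    have hmem : ∀ x, x ∈ K ↔ (G.IsVertex x ∨ FlagIn S x) ∧ G.Reach Q (G.r h) (G.r x) := by
      simp [K]
    have hmem₁ : ∀ x, x ∈ K₁ ↔ (G.IsVertex x ∨ Q x) ∧ G.Reach Q (G.r h) (G.r x) := by
      simp [K₁]
    have hιι : ∀ x, FlagIn S x → G.Reach Q (G.r x) (G.r (G.ι x)) := by
      intro x hx
      by_cases h1 : x = h
      · subst h1; exact hreach
      by_cases h2 : x = G.ι h
      · subst h2; rw [G.ι_ι]; exact hreach.symm G.ι_ι hQι
      · exact FlagReach.step (Q := Q) ⟨hx, h1, h2⟩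
    have hsub : G.IsSub K := by
      intro x hx
      rw [hmem] at hx
      rw [hmem, hmem, G.r_r]
      refine ⟨⟨Or.inl (isVertex_r x), hx.2⟩, ?_⟩
      rcases hx.1 with h1 | h1
      · rw [ι_of_isVertex h1]; exact ⟨Or.inl h1, hx.2⟩
      · exact ⟨Or.inr h1.ι, hx.2.trans (hιι x h1)⟩
    have hsub₁ : G.IsSub K₁ := by
      intro x hx
      rw [hmem₁] at hx
      rw [hmem₁, hmem₁, G.r_r]
      refine ⟨⟨Or.inl (isVertex_r x), hx.2⟩, ?_⟩
      rcases hx.1 with h1 | h1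
      · rw [ι_of_isVertex h1]; exact ⟨Or.inl h1, hx.2⟩
      · exact ⟨Or.inr (hQι x h1), hx.2.trans (FlagReach.step h1)⟩
    have hchain : ∀ z, G.Reach Q (G.r h) z →
        G.Reach Q (G.r h) z ∧ Relation.ReflTransGen (G.Joined K₁) (G.r h) z := by
      intro z hz
      induction hz with
      | refl => exact ⟨FlagReach.refl _, .refl⟩
      | tail _ hs ih =>
        obtain ⟨p, hp, rfl, rfl⟩ := hs
        exact ⟨ih.1.trans (FlagReach.step hp),
          ih.2.tail ⟨p, (hmem₁ p).2 ⟨Or.inr hp, ih.1⟩, rfl, rfl⟩⟩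
    have hback : ∀ a b, Relation.ReflTransGen (G.Joined K₁) a b →
        Relation.ReflTransGen (G.Joined K₁) b a := by
      intro a b hab
      induction hab with
      | refl => exact .refl
      | tail _ hs ih => exact .head (hs.symm hsub₁) ih
    have hconn₁ : G.IsConn K₁ := by
      refine ⟨⟨G.r h, (hmem₁ _).2 ⟨Or.inl (isVertex_r h), FlagReach.of_eq (G.r_r h).symm⟩⟩, ?_⟩
      intro a ha b hb hav hbv
      have ha := ((hmem₁ a).1 ha).2
      have hb := ((hmem₁ b).1 hb).2
      rw [hav] at ha
      rw [hbv] at hb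
      exact (hback _ _ (hchain a ha).2).trans (hchain b hb).2
    have hK₁K : K₁ ⊆ K := fun x hx => by
      rw [hmem₁] at hx
      exact (hmem x).2 ⟨hx.1.imp_right fun h => h.1, hx.2⟩
    have hconn : G.IsConn K := by
      refine ⟨hconn₁.1.mono hK₁K, fun a ha b hb hav hbv => ?_⟩
      refine Relation.ReflTransGen.mono ?_ _ _ (hconn₁.2 a ((hmem₁ a).2 ⟨Or.inl hav,
        ((hmem a).1 ha).2⟩) b ((hmem₁ b).2 ⟨Or.inl hbv, ((hmem b).1 hb).2⟩) hav hbv)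
      rintro p q ⟨x, hx, h1, h2⟩
      exact ⟨x, hK₁K hx, h1, h2⟩
    have htree := hS K hsub (by
        rintro x hx ⟨h1, h2⟩
        rcases ((hmem x).1 hx).1 with h3 | ⟨h3, -⟩
        · exact h1 h3
        · exact h3 h2) hconn (by
        intro e he
        obtain ⟨x, hx, hxe⟩ := Finset.mem_image.1 he
        obtain ⟨hxK, hxne⟩ := Finset.mem_filter.1 hx
        rcases ((hmem x).1 hxK).1 with h3 | ⟨h3, h4⟩
        · exact absurd (ι_of_isVertex h3) hxne
        · have : e = edgeOf x h3 := Subtype.ext hxe.symm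
          rwa [this])
    have hcard : (K.filter fun x => G.ι x ≠ x) =
        insert h (insert (G.ι h) (K₁.filter fun x => G.ι x ≠ x)) := by
      ext x
      have hQ : Q x ↔ FlagIn S x ∧ x ≠ h ∧ x ≠ G.ι h := Iff.rfl
      have hhS' : FlagIn S h := ⟨hne, hhS⟩
      have := hhS'.ι
      have := FlagReach.refl (r := G.r) (ι := G.ι) (Q := Q) (G.r h)
      simp only [Finset.mem_filter, Finset.mem_insert, hmem, hmem₁]
      grind [ι_ne, ι_of_isVertex]
    have hverts : G.verts K = G.verts K₁ := by
      ext x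
      simp only [verts, Finset.mem_filter, hmem, hmem₁]
      tauto
    have h1 := hconn₁.genus_nonneg hsub₁
    have h2 := htree.2.2.2
    have h3 := two_mul_card_edges hsub
    have h4 := two_mul_card_edges hsub₁
    rw [hcard, Finset.card_insert_of_notMem, Finset.card_insert_of_notMem] at h3
    · unfold genus at h1 h2
      rw [hverts] at h2
      omega
    · intro hm
      rcases ((hmem₁ _).1 (Finset.mem_filter.1 hm).1).1 with h5 | h5
      · exact not_isVertex_of_ne (ι_ne hne) h5
      · exact h5.2.2 rfl
    · intro hm
      rcases Finset.mem_insert.1 hm with h5 | h5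
      · exact hne h5.symm
      · rcases ((hmem₁ _).1 (Finset.mem_filter.1 h5).1).1 with h5 | h5
        · exact not_isVertex_of_ne hne h5
        · exact h5.2.1 rfl
  · intro hbr K hK hleg hc hS
    obtain ⟨T, hTK, hT, hTv⟩ := exists_spanning_tree hK hc
    refine ⟨hK, hleg, hc, ?_⟩
    have hin : ∀ x ∈ K, G.ι x ≠ x → FlagIn S x := fun x hx hne => ⟨hne, hS (edgeOf x hne)
      (Finset.mem_image.2 ⟨x, Finset.mem_filter.2 ⟨hx, hne⟩, rfl⟩)⟩
    have h1 : (K.filter fun x => G.ι x ≠ x) = T.filter fun x => G.ι x ≠ x := by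
      ext x
      simp only [Finset.mem_filter]
      refine ⟨fun ⟨hx, hne⟩ => ⟨?_, hne⟩, fun ⟨hx, hne⟩ => ⟨hTK hx, hne⟩⟩
      by_contra hxT
      have hx' : G.ι x ∉ T := fun h => hxT (by
        have := (hT.1 _ h).2
        rwa [G.ι_ι] at this)
      refine hbr x (hin x hx hne) (reach_of_joined ?_ (hT.2.2.1.2 (G.r x)
        (hTv _ (hK x hx).1 (isVertex_r x)) (G.r (G.ι x))
        (hTv _ (hK _ (hK x hx).2).1 (isVertex_r _)) (isVertex_r _) (isVertex_r _)))
      intro y hy hyne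
      exact ⟨hin y (hTK hy) hyne, fun h => hxT (h ▸ hy), fun h => hx' (h ▸ hy)⟩
    have h2 : G.verts K = G.verts T := by
      ext x
      simp only [verts, Finset.mem_filter]
      exact ⟨fun ⟨hx, hv⟩ => ⟨hTv x hx hv, hv⟩, fun ⟨hx, hv⟩ => ⟨hTK hx, hv⟩⟩
    have h3 := two_mul_card_edges hK
    have h4 := two_mul_card_edges hT.1
    have h5 := hT.2.2.2
    rw [h1] at h3
    unfold genus at h5 ⊢
    rw [h2]
    omega

end DGraph

namespace GCat

open DGraph

variable {U Λ : Type u} {g : ℕ} {A : Finset Λ}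

/-! ### The maps of cones induced by contractions -/

theorem flagLen_pull {G H : GCat U g A} (f : G ⟶ H) (δ : H.Edge → ℤ) (x : G.F) :
    G.flagLen (pull f δ) x = H.flagLen δ (fn f x) := by
  by_cases hx : G.ι x = x
  · rw [flagLen_of_eq _ hx, flagLen_of_eq _ (by rw [← fn_ι, hx])]
  · rw [flagLen_of_ne _ hx]
    have hmap : Sym2.map (fn f) (edgeOf x hx).1 = s(fn f x, H.ι (fn f x)) := by
      rw [← fn_ι]; rfl
    by_cases hy : H.ι (fn f x) = fn f x
    · rw [flagLen_of_eq _ hy]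
      refine dif_neg ?_
      rw [hmap]
      rintro ⟨z, hz, hze⟩
      rcases Sym2.eq_iff.1 hze with h1 | h1
      · exact hz (h1.1 ▸ hy)
      · exact ι_ne hz (h1.1 ▸ hy)
    · rw [flagLen_of_ne _ hy]
      have hE : H.IsEdge (Sym2.map (fn f) (edgeOf x hx).1) := by
        rw [hmap]; exact (edgeOf _ hy).2
      refine (dif_pos hE).trans ?_
      congr 1
      exact Subtype.ext hmap

theorem exists_edgePre {G H : GCat U g A} (f : G ⟶ H) (e : H.Edge) :
    ∃ e' : G.Edge, ∃ x hx hy, e' = edgeOf x hx ∧ e = edgeOf (fn f x) hy := by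
  obtain ⟨y, hy, rfl⟩ := exists_edgeOf e
  obtain ⟨x, rfl⟩ := fn_surj f y
  have hx : G.ι x ≠ x := fun h => hy (by rw [← fn_ι, h])
  exact ⟨edgeOf x hx, x, hx, hy, rfl, rfl⟩

/-- The edge of the source of a contraction over an edge of the target. -/
def edgePre {G H : GCat U g A} (f : G ⟶ H) (e : H.Edge) : G.Edge := (exists_edgePre f e).choose

theorem edgePre_edgeOf {G H : GCat U g A} (f : G ⟶ H) {x : G.F} (hx : G.ι x ≠ x)
    (hy : H.ι (fn f x) ≠ fn f x) : edgePre f (edgeOf (fn f x) hy) = edgeOf x hx := by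
  obtain ⟨z, hz, hz', h1, h2⟩ := (exists_edgePre f (edgeOf (fn f x) hy)).choose_spec
  rw [edgePre, h1, edgeOf_eq_iff]
  have hv : ¬ H.IsVertex (fn f z) := not_isVertex_of_ne hz'
  rcases edgeOf_eq_iff.1 h2 with h3 | h3
  · exact Or.inl (fn_inj f hv h3.symm)
  · refine Or.inr ?_
    have : fn f z = fn f (G.ι x) := by rw [fn_ι, h3, H.ι_ι]
    exact fn_inj f hv this

theorem edgeOf_mem_range_edgePre {G H : GCat U g A} (f : G ⟶ H) {x : G.F} (hx : G.ι x ≠ x) :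
    edgeOf x hx ∈ Set.range (edgePre f) ↔ ¬ H.IsVertex (fn f x) := by
  constructor
  · rintro ⟨e, he⟩
    obtain ⟨y, hy, rfl⟩ := exists_edgeOf e
    obtain ⟨z, rfl⟩ := fn_surj f y
    have hz : G.ι z ≠ z := fun h => hy (by rw [← fn_ι, h])
    rw [edgePre_edgeOf f hz hy, edgeOf_eq_iff] at he
    rcases he with rfl | rfl
    · exact not_isVertex_of_ne hy
    · rw [fn_ι] at hy
      exact fun h => hy (by rw [ι_of_isVertex h, ι_of_isVertex h])
  · intro h
    have hy : H.ι (fn f x) ≠ fn f x := fun h1 => hx ((fn_ι_eq_iff f h).2 h1)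
    exact ⟨edgeOf _ hy, edgePre_edgeOf f hx hy⟩

end GCat

namespace GCat

open DGraph

variable {U Λ : Type u} {g : ℕ} {A B : Finset Λ}

theorem isCoordEmb_pull {G H : GCat U g A} (f : G ⟶ H) : IsCoordEmb (pull f) (edgePre f) := by
  have happ : ∀ δ i, pull f δ (edgePre f i) = δ i := by
    intro δ e
    obtain ⟨y, hy, rfl⟩ := exists_edgeOf e
    obtain ⟨x, rfl⟩ := fn_surj f y
    have hx : G.ι x ≠ x := fun h => hy (by rw [← fn_ι, h])
    rw [edgePre_edgeOf f hx hy, ← flagLen_of_ne (pull f δ), ← flagLen_of_ne δ, flagLen_pull]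
  refine ⟨fun e e' h => ?_, happ, fun δ k hk => ?_⟩
  · by_contra hne
    have h1 := happ (Pi.single e 1) e
    rw [h, happ, Pi.single_eq_same, Pi.single_eq_of_ne (Ne.symm hne)] at h1
    exact zero_ne_one h1
  · obtain ⟨x, hx, rfl⟩ := exists_edgeOf k
    rw [edgeOf_mem_range_edgePre, not_not] at hk
    rw [← flagLen_of_ne (pull f δ), flagLen_pull, flagLen_of_eq _ (ι_of_isVertex hk)]

/-- Chains in the target of a contraction lift to chains that may also use contracted flags. -/
theorem lift_reach {G H : GCat U g A} (f : G ⟶ H) {Q : H.F → Prop} {v w : G.F}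
    (hv : G.IsVertex v) (hw : G.IsVertex w) (h : H.Reach Q (fn f v) (fn f w)) :
    G.Reach (fun x => H.IsVertex (fn f x) ∨ Q (fn f x)) v w := by
  have hfib : ∀ a b, G.IsVertex a → G.IsVertex b → fn f a = fn f b →
      G.Reach (fun x => H.IsVertex (fn f x) ∨ Q (fn f x)) a b := fun a b ha hb hab =>
    (reach_fiber f ha hb hab).mono fun _ => Or.inl
  have main : ∀ y, H.Reach Q (fn f v) y → ∀ b, G.IsVertex b → fn f b = y →
      G.Reach (fun x => H.IsVertex (fn f x) ∨ Q (fn f x)) v b := by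
    intro y hy
    induction hy with
    | refl => exact fun b hb hby => hfib v b hv hb hby.symm
    | tail _ hs ih =>
      intro b hb hby
      obtain ⟨h, hh, h1, rfl⟩ := hs
      obtain ⟨x, rfl⟩ := fn_surj f h
      refine (ih (G.r x) (isVertex_r x) (by rw [fn_r, h1])).trans
        (FlagReach.trans (FlagReach.step (Or.inr hh)) (hfib _ b (isVertex_r _) hb ?_))
      rw [fn_r, fn_ι, hby]
  exact main _ h w hw rfl

/-- A set of edges of the target of a contraction is a forest if and only if its inverse image,
together with the contracted edges, is a forest. -/
theorem isForest_iff_pull {G H : GCat U g A} (f : G ⟶ H) (S : Set H.Edge) :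
    H.IsForest S ↔ G.IsForest (edgePre f '' S ∪ (Set.range (edgePre f))ᶜ) := by
  have hinj := (isCoordEmb_pull f).inj
  have hflag : ∀ x, FlagIn (edgePre f '' S ∪ (Set.range (edgePre f))ᶜ) x ↔
      G.ι x ≠ x ∧ (H.IsVertex (fn f x) ∨ FlagIn S (fn f x)) := by
    intro x
    constructor
    · rintro ⟨hx, h⟩
      refine ⟨hx, ?_⟩
      by_cases hv : H.IsVertex (fn f x)
      · exact Or.inl hv
      · right
        have hy : H.ι (fn f x) ≠ fn f x := fun h1 => hx ((fn_ι_eq_iff f hv).2 h1)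
        refine ⟨hy, ?_⟩
        rcases h with ⟨e, he, hex⟩ | h
        · rw [← edgePre_edgeOf f hx hy] at hex
          rwa [← hinj hex]
        · exact absurd ((edgeOf_mem_range_edgePre f hx).2 hv) h
    · rintro ⟨hx, h | ⟨hy, h⟩⟩
      · exact ⟨hx, Or.inr fun h1 => (edgeOf_mem_range_edgePre f hx).1 h1 h⟩
      · exact ⟨hx, Or.inl ⟨_, h, edgePre_edgeOf f hx hy⟩⟩
  constructor
  · intro hS
    refine isForest_mono _ _ ?_ (isForest_pull f hS)
    intro e he hE
    obtain ⟨x, hx, rfl⟩ := exists_edgeOf e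
    have hmap : Sym2.map (fn f) (edgeOf x hx).1 = s(fn f x, H.ι (fn f x)) := by
      rw [← fn_ι]; rfl
    have hy : H.ι (fn f x) ≠ fn f x := by
      rw [hmap] at hE
      obtain ⟨z, hz, hze⟩ := hE
      rcases Sym2.eq_iff.1 hze with h1 | h1
      · rw [h1.1]; exact hz
      · rw [h1.1]; exact ι_ne hz
    have h2 : (⟨_, hE⟩ : H.Edge) = edgeOf (fn f x) hy := Subtype.ext hmap
    rw [h2]
    rcases ((hflag x).1 ⟨hx, he⟩).2 with h3 | h3
    · exact absurd (ι_of_isVertex h3) hy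
    · exact h3.choose_spec
  · rw [isForest_iff, isForest_iff]
    intro hS y hy hreach
    obtain ⟨x, rfl⟩ := fn_surj f y
    obtain ⟨hy1, hy2⟩ := id hy
    have hx : G.ι x ≠ x := fun h => hy1 (by rw [← fn_ι, h])
    have hv : ¬ H.IsVertex (fn f x) := not_isVertex_of_ne hy1
    refine hS x ((hflag x).2 ⟨hx, Or.inr hy⟩) ?_
    rw [← fn_ι, ← fn_r, ← fn_r] at hreach
    refine (lift_reach f (isVertex_r _) (isVertex_r _) hreach).bind fun p hp => ?_
    by_cases hp0 : G.ι p = p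
    · exact FlagReach.of_eq (by rw [hp0])
    refine FlagReach.step ⟨(hflag p).2 ⟨hp0, hp.imp_right fun h => h.1⟩, ?_, ?_⟩
    · rintro rfl
      rcases hp with h | h
      · exact hv h
      · exact h.2.1 rfl
    · rintro rfl
      rcases hp with h | h
      · exact hv (fn_ι_vertex f |>.1 h)
      · exact h.2.2 rfl

/-! ### Contracting an edge -/

section Contract

/-- The flags that remain when the edge of `f` is contracted into its end away from the root of `f`,
and the legs whose marks are not in `B` are removed. -/
def Remains (G : GCat U g A) (B : Finset Λ) (f x : G.F) : Prop :=
  x ≠ f ∧ x ≠ G.ι f ∧ x ≠ G.r f ∧ ∀ a : A, a.1 ∉ B → x ≠ G.leg a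

variable {G : GCat U g A} {f : G.F} (hf : G.r f ≠ G.r (G.ι f))

theorem ι_ne_of_roots (hf : G.r f ≠ G.r (G.ι f)) : G.ι f ≠ f := fun h => hf (by rw [h])

theorem leg_not_vertex (G : GCat U g A) (a : A) : ¬ G.IsVertex (G.leg a) :=
  ((G.leg_range _).2 ⟨a, rfl⟩).1

theorem ι_leg (G : GCat U g A) (a : A) : G.ι (G.leg a) = G.leg a :=
  ((G.leg_range _).2 ⟨a, rfl⟩).2

theorem remains_of_vertex (hf : G.r f ≠ G.r (G.ι f)) {v : G.F} (hv : G.IsVertex v) :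
    G.Remains B f v ↔ v ≠ G.r f := by
  refine ⟨fun h => h.2.2.1, fun h => ⟨?_, ?_, h, ?_⟩⟩
  · rintro rfl; exact not_isVertex_of_ne (ι_ne_of_roots hf) hv
  · rintro rfl; exact not_isVertex_of_ne (ι_ne (ι_ne_of_roots hf)) hv
  · rintro a - rfl; exact G.leg_not_vertex a hv

theorem Remains.ι {x : G.F} (h : G.Remains B f x) : G.Remains B f (G.ι x) := by
  refine ⟨?_, ?_, ?_, ?_⟩
  · rintro he; exact h.2.1 (by rw [← he, G.ι_ι])
  · rintro he; exact h.1 (by rw [← G.ι_ι x, he, G.ι_ι])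
  · rintro he
    have := G.ι_ι x
    rw [he, ι_of_isVertex (isVertex_r f)] at this
    exact h.2.2.1 this.symm
  · rintro a ha he
    have := G.ι_ι x
    rw [he, G.ι_leg] at this
    exact h.2.2.2 a ha this.symm

theorem remains_leg (hf : G.r f ≠ G.r (G.ι f)) (hBA : B ⊆ A) (b : B) :
    G.Remains B f (G.leg ⟨b.1, hBA b.2⟩) := by
  refine ⟨?_, ?_, ?_, ?_⟩
  · intro h; exact ι_ne_of_roots hf (by rw [← h, G.ι_leg])
  · intro h; exact ι_ne (ι_ne_of_roots hf) (by rw [← h, G.ι_leg])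
  · intro h; exact G.leg_not_vertex _ (h ▸ isVertex_r f)
  · intro a ha h
    exact ha (by rw [← G.leg_injective h]; exact b.2)

/-- The contraction map: the edge and the removed legs go to the remaining end of the edge. -/
def squeeze (B : Finset Λ) (x : G.F) : {x // G.Remains B f x} :=
  if h : G.Remains B f x then ⟨x, h⟩ else
    ⟨G.r (G.ι f), (remains_of_vertex hf (isVertex_r _)).2 hf.symm⟩

theorem squeeze_of {x : G.F} (h : G.Remains B f x) : squeeze hf B x = ⟨x, h⟩ := dif_pos h

theorem squeeze_of_not {x : G.F} (h : ¬ G.Remains B f x) : squeeze hf B x =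
    ⟨G.r (G.ι f), (remains_of_vertex hf (isVertex_r _)).2 hf.symm⟩ := dif_neg h

theorem squeeze_root_end : squeeze hf B (G.r f) = squeeze hf B (G.r (G.ι f)) := by
  rw [squeeze_of_not hf fun h => h.2.2.1 rfl, squeeze_of]

/-- The root map after the contraction. -/
def sqRoot (B : Finset Λ) (x : {x // G.Remains B f x}) : {x // G.Remains B f x} :=
  squeeze hf B (G.r x.1)

/-- The involution after the contraction. -/
def sqInv (B : Finset Λ) (x : {x // G.Remains B f x}) : {x // G.Remains B f x} :=
  ⟨G.ι x.1, x.2.ι⟩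

theorem squeeze_r (hleg : ∀ a : A, a.1 ∉ B → G.r (G.leg a) = G.r f) (x : G.F) :
    squeeze hf B (G.r x) = sqRoot hf B (squeeze hf B x) := by
  unfold sqRoot
  by_cases hx : G.Remains B f x
  · rw [squeeze_of hf hx]
  · have h1 : squeeze hf B (G.r (squeeze hf B x).1) = squeeze hf B (G.r (G.ι f)) := by
      rw [squeeze_of_not hf hx]
      show squeeze hf B (G.r (G.r (G.ι f))) = _
      rw [G.r_r]
    rw [h1]
    by_cases h2 : x = f
    · rw [h2, squeeze_root_end]
    by_cases h3 : x = G.ι f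
    · rw [h3]
    by_cases h4 : x = G.r f
    · rw [h4, G.r_r, squeeze_root_end]
    have : ∃ a : A, a.1 ∉ B ∧ x = G.leg a := by
      by_contra hcon
      push Not at hcon
      exact hx ⟨h2, h3, h4, hcon⟩
    obtain ⟨a, ha, rfl⟩ := this
    rw [hleg a ha, squeeze_root_end]

theorem squeeze_ι (x : G.F) : squeeze hf B (G.ι x) = sqInv B (squeeze hf B x) := by
  by_cases hx : G.Remains B f x
  · rw [squeeze_of hf hx, squeeze_of hf hx.ι]; rfl
  · have hx' : ¬ G.Remains B f (G.ι x) := fun h => hx (by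
      have := h.ι
      rwa [G.ι_ι] at this)
    rw [squeeze_of_not hf hx, squeeze_of_not hf hx']
    exact Subtype.ext (ι_of_isVertex (isVertex_r _)).symm

/-- A remaining flag is a vertex after the contraction if and only if it was one before. -/
theorem sqRoot_eq_iff (x : {x // G.Remains B f x}) : sqRoot hf B x = x ↔ G.IsVertex x.1 := by
  unfold sqRoot
  constructor
  · intro h
    by_cases hx : G.Remains B f (G.r x.1)
    · rw [squeeze_of hf hx] at h
      exact congrArg Subtype.val h
    · rw [squeeze_of_not hf hx] at h
      rw [← congrArg Subtype.val h]
      exact isVertex_r _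
  · intro h
    have hx : G.Remains B f (G.r x.1) := by rw [h]; exact x.2
    rw [squeeze_of hf hx]
    exact Subtype.ext h

theorem squeeze_vertex_iff (x : G.F) :
    G.IsVertex (squeeze hf B x).1 ↔ G.IsVertex x ∨ ¬ G.Remains B f x := by
  by_cases h : G.Remains B f x
  · rw [squeeze_of hf h]
    exact ⟨Or.inl, fun h1 => h1.resolve_right (not_not.2 h)⟩
  · rw [squeeze_of_not hf h]
    exact ⟨fun _ => Or.inr h, fun _ => isVertex_r _⟩

theorem squeeze_flag {y : {x // G.Remains B f x}} (hy : ¬ G.IsVertex y.1) :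
    ∃! x, squeeze hf B x = y := by
  refine ⟨y.1, squeeze_of hf y.2, fun z (hz : squeeze hf B z = y) => ?_⟩
  by_cases h : G.Remains B f z
  · rw [squeeze_of hf h] at hz
    exact congrArg Subtype.val hz
  · rw [squeeze_of_not hf h] at hz
    exact absurd (congrArg Subtype.val hz ▸ isVertex_r _) hy

/-- Vertices that are identified are joined by contracted flags. -/
theorem squeeze_fiber {v w : G.F} (hv : G.IsVertex v) (hw : G.IsVertex w)
    (hvw : squeeze hf B v = squeeze hf B w) :
    G.Reach (fun h => G.IsVertex (squeeze hf B h).1) v w := by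
  have hstep : G.Reach (fun h => G.IsVertex (squeeze hf B h).1)
      (G.r f) (G.r (G.ι f)) := FlagReach.step (by
    rw [squeeze_vertex_iff]
    exact Or.inr fun h => h.1 rfl)
  have hstep' : G.Reach (fun h => G.IsVertex (squeeze hf B h).1)
      (G.r (G.ι f)) (G.r f) := hstep.symm G.ι_ι fun x hx => by
    rw [squeeze_ι]
    exact isVertex_ι.2 hx
  by_cases h1 : v = G.r f
  · by_cases h2 : w = G.r f
    · exact FlagReach.of_eq (h1.trans h2.symm)
    · rw [h1, squeeze_of_not hf (fun h => h.2.2.1 rfl),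
        squeeze_of hf ((remains_of_vertex hf hw).2 h2)] at hvw
      rw [h1, ← Subtype.mk.inj hvw]
      exact hstep
  · by_cases h2 : w = G.r f
    · rw [h2, squeeze_of_not hf (fun h => h.2.2.1 rfl),
        squeeze_of hf ((remains_of_vertex hf hv).2 h1)] at hvw
      rw [h2, Subtype.mk.inj hvw]
      exact hstep'
    · rw [squeeze_of hf ((remains_of_vertex hf hv).2 h1),
        squeeze_of hf ((remains_of_vertex hf hw).2 h2)] at hvw
      exact FlagReach.of_eq (Subtype.mk.inj hvw)

/-- Contracting an edge of a stable graph, and possibly removing legs at one of its ends, gives a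
stable graph if the valency of the new vertex is large enough. -/
theorem isStableGraph_contract (hBA : B ⊆ A) (hleg : ∀ a : A, a.1 ∉ B → G.r (G.leg a) = G.r f)
    (hp : ∃ p, G.r p = G.r f ∧ ¬ G.IsVertex p ∧ p ≠ f ∧ ∀ a : A, a.1 ∉ B → p ≠ G.leg a) :
    IsStableGraph g B (sqRoot hf B) (sqInv B)
      (fun b => ⟨G.leg ⟨b.1, hBA b.2⟩, remains_leg hf hBA b⟩) := by
  have hne := ι_ne_of_roots hf
  have hcard : ∀ p : G.F → Prop,
      Nat.card {x : {x // G.Remains B f x} // p x.1} =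
        (Finset.univ.filter fun x => G.Remains B f x ∧ p x).card := by
    intro p
    rw [Nat.card_congr (Equiv.subtypeSubtypeEquivSubtypeInter (G.Remains B f) p),
      Nat.card_eq_fintype_card, Fintype.card_subtype]
  refine ⟨fun x => ?_, fun x => Subtype.ext (G.ι_ι _), fun x => ?_, fun a b hab => ?_, fun x => ?_,
    ⟨squeeze hf B f⟩, fun v w hv hw => ?_, ?_, fun v hv => ?_⟩
  · rw [sqRoot_eq_iff]
    unfold sqRoot
    by_cases hx : G.Remains B f (G.r x.1)
    · rw [squeeze_of hf hx]; exact isVertex_r _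
    · rw [squeeze_of_not hf hx]; exact isVertex_r _
  · have hv : G.IsVertex (sqRoot hf B x).1 := by
      unfold sqRoot
      by_cases hx : G.Remains B f (G.r x.1)
      · rw [squeeze_of hf hx]; exact isVertex_r _
      · rw [squeeze_of_not hf hx]; exact isVertex_r _
    exact Subtype.ext (ι_of_isVertex hv)
  · exact Subtype.ext (Subtype.mk.inj (G.leg_injective (Subtype.mk.inj hab)))
  · rw [sqRoot_eq_iff]
    constructor
    · rintro ⟨h1, h2⟩
      obtain ⟨a, ha⟩ := (G.leg_range x.1).1 ⟨h1, congrArg Subtype.val h2⟩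
      have haB : a.1 ∈ B := by
        by_contra haB
        exact x.2.2.2.2 a haB ha.symm
      exact ⟨⟨a.1, haB⟩, Subtype.ext ha⟩
    · rintro ⟨b, rfl⟩
      exact ⟨G.leg_not_vertex _, Subtype.ext (G.ι_leg _)⟩
  · have hv' := (sqRoot_eq_iff hf v).1 hv
    have hw' := (sqRoot_eq_iff hf w).1 hw
    have := (G.conn' hv' hw').map (r' := sqRoot hf B) (ι' := sqInv B) (R := fun _ => True)
      (squeeze hf B) fun h _ => by
        rw [squeeze_r hf hleg, squeeze_r hf hleg, squeeze_ι]
        exact FlagReach.step trivial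
    rwa [squeeze_of hf v.2, squeeze_of hf w.2] at this
  · have h1 : Nat.card {x : {x // G.Remains B f x} // sqRoot hf B x = x} =
        (Finset.univ.filter fun x => G.Remains B f x ∧ G.IsVertex x).card := by
      rw [← hcard]
      exact Nat.card_congr (Equiv.subtypeEquivRight fun x => sqRoot_eq_iff hf x)
    have h2 : Nat.card {x : {x // G.Remains B f x} // sqInv B x ≠ x} =
        (Finset.univ.filter fun x => G.Remains B f x ∧ G.ι x ≠ x).card := by
      refine (Nat.card_congr (Equiv.subtypeEquivRight fun x => not_congr ?_)).trans
        ((hcard fun x => G.ι x ≠ x).trans ?_)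
      · exact ⟨fun h => congrArg Subtype.val h, fun h => Subtype.ext h⟩
      · congr
    have h3 : (Finset.univ.filter fun x => G.IsVertex x) =
        insert (G.r f) (Finset.univ.filter fun x => G.Remains B f x ∧ G.IsVertex x) := by
      ext x
      simp only [Finset.mem_filter, Finset.mem_univ, true_and, Finset.mem_insert]
      grind [remains_of_vertex hf, isVertex_r f]
    have h4 : (Finset.univ.filter fun x => G.ι x ≠ x) = insert f (insert (G.ι f)
        (Finset.univ.filter fun x => G.Remains B f x ∧ G.ι x ≠ x)) := by
      ext x
      simp only [Finset.mem_filter, Finset.mem_univ, true_and, Finset.mem_insert, Remains]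
      grind [ι_ne, ι_of_isVertex, isVertex_r f, ι_leg]
    have h5 := G.card_flags
    rw [h3, h4, Finset.card_insert_of_notMem, Finset.card_insert_of_notMem,
      Finset.card_insert_of_notMem] at h5
    · rw [h1, h2]; omega
    all_goals simp [Remains, hne.symm]
  · have hv' := (sqRoot_eq_iff hf v).1 hv
    -- a flag away from the edge keeps its root
    have hkeep : ∀ p, ¬ G.IsVertex p → G.r p ≠ G.r f → p ≠ G.ι f → ∃ h : G.Remains B f p,
        sqRoot hf B ⟨p, h⟩ ≠ ⟨p, h⟩ ∧ (sqRoot hf B ⟨p, h⟩).1 = G.r p := by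
      intro p hpv hpr hpf
      have h : G.Remains B f p := ⟨fun h => hpr (by rw [h]), hpf,
        fun h => hpv (h ▸ isVertex_r f), fun a ha h => hpr (by rw [h, hleg a ha])⟩
      refine ⟨h, fun h1 => hpv ((sqRoot_eq_iff hf _).1 h1), ?_⟩
      unfold sqRoot
      rw [squeeze_of hf ((remains_of_vertex hf (isVertex_r _)).2 hpr)]
    obtain ⟨p, q, s, h1, h2, h3, h4, h5, h6, h7, h8, h9⟩ := G.isStableGraph.stable v.1 hv'
    by_cases hvf : v.1 = G.r (G.ι f)
    · -- the new vertex: two flags at this end and one flag at the other end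
      obtain ⟨p', hp1, hp2, hp3, hp4⟩ := hp
      have hp' : G.Remains B f p' := ⟨hp3, fun h => hf (by rw [← hp1, h]),
        fun h => hp2 (h ▸ isVertex_r f), hp4⟩
      have hpr : sqRoot hf B ⟨p', hp'⟩ = v := by
        unfold sqRoot
        rw [hp1, squeeze_of_not hf fun h => h.2.2.1 rfl]
        exact Subtype.ext hvf.symm
      obtain ⟨a, b, hab, ha0, hb0, ha, hb, haf, hbf⟩ : ∃ a b, a ≠ b ∧ ¬ G.IsVertex a ∧
          ¬ G.IsVertex b ∧ G.r a = v.1 ∧ G.r b = v.1 ∧ a ≠ G.ι f ∧ b ≠ G.ι f := by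
        by_cases hpf : p = G.ι f
        · exact ⟨q, s, h3, h5, h6, h8, h9, hpf ▸ h1.symm, hpf ▸ h2.symm⟩
        · by_cases hqf : q = G.ι f
          · exact ⟨p, s, h2, h4, h6, h7, h9, hpf, hqf ▸ h3.symm⟩
          · exact ⟨p, q, h1, h4, h5, h7, h8, hpf, hqf⟩
      have hvr : v.1 ≠ G.r f := fun h => hf (by rw [← h, hvf])
      obtain ⟨ha', ha1, ha2⟩ := hkeep a ha0 (by rw [ha]; exact hvr) haf
      obtain ⟨hb', hb1, hb2⟩ := hkeep b hb0 (by rw [hb]; exact hvr) hbf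
      refine ⟨⟨a, ha'⟩, ⟨b, hb'⟩, ⟨p', hp'⟩, ?_, ?_, ?_, ha1, hb1, ?_, Subtype.ext (ha2.trans ha),
        Subtype.ext (hb2.trans hb), hpr⟩
      · exact fun h => hab (congrArg Subtype.val h)
      · exact fun h => hvr (by rw [← ha, Subtype.mk.inj h, hp1])
      · exact fun h => hvr (by rw [← hb, Subtype.mk.inj h, hp1])
      · exact fun h => hp2 ((sqRoot_eq_iff hf _).1 h)
    · have hvr : v.1 ≠ G.r f := v.2.2.2.1
      have hf' : ∀ p, G.r p = v.1 → p ≠ G.ι f := fun p hp h => hvf (by rw [← hp, h])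
      obtain ⟨hp', hp1, hp2⟩ := hkeep p h4 (by rw [h7]; exact hvr) (hf' p h7)
      obtain ⟨hq', hq1, hq2⟩ := hkeep q h5 (by rw [h8]; exact hvr) (hf' q h8)
      obtain ⟨hs', hs1, hs2⟩ := hkeep s h6 (by rw [h9]; exact hvr) (hf' s h9)
      exact ⟨⟨p, hp'⟩, ⟨q, hq'⟩, ⟨s, hs'⟩, fun h => h1 (congrArg Subtype.val h),
        fun h => h2 (congrArg Subtype.val h), fun h => h3 (congrArg Subtype.val h), hp1, hq1, hs1,
        Subtype.ext (hp2.trans h7), Subtype.ext (hq2.trans h8), Subtype.ext (hs2.trans h9)⟩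

end Contract

theorem exists_third_flag (G : GCat U g A) (f : G.F) :
    ∃ p, G.r p = G.r f ∧ ¬ G.IsVertex p ∧ p ≠ f := by
  obtain ⟨p, q, s, h1, h2, h3, h4, h5, h6, h7, h8, h9⟩ :=
    G.isStableGraph.stable (G.r f) (isVertex_r f)
  by_cases hp : p = f
  · exact ⟨q, h8, h5, fun h => h1 (hp.trans h.symm)⟩
  · exact ⟨p, h7, h4, hp⟩

/-- The contraction of an edge with two different ends. -/
theorem exists_contract_edge (G : GCat U g A) (f : G.F) (hf : G.r f ≠ G.r (G.ι f)) :
    ∃ (H : GCat U g A) (k : G ⟶ H), ∀ x, H.IsVertex (fn k x) ↔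
      G.IsVertex x ∨ x = f ∨ x = G.ι f := by
  have hne := ι_ne_of_roots hf
  have hA : ∀ a : A, a.1 ∉ A → G.r (G.leg a) = G.r f := fun a ha => absurd a.2 ha
  obtain ⟨p, hp1, hp2, hp3⟩ := G.exists_third_flag f
  have hst := isStableGraph_contract hf (Finset.Subset.refl A) hA
    ⟨p, hp1, hp2, hp3, fun a ha => absurd a.2 ha⟩
  let e : {x // G.Remains A f x} ↪ U :=
    ⟨fun x => x.1.1, fun x y h => Subtype.ext (Subtype.ext h)⟩
  have hvert : ∀ x, (ofEmb e hst).IsVertex (toEmb e hst x) ↔ G.IsVertex x.1 := by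
    intro x
    rw [← sqRoot_eq_iff hf]
    unfold IsVertex
    rw [ofEmb_r, (toEmb e hst).apply_eq_iff_eq]
  refine ⟨ofEmb e hst, homMk (fun x => toEmb e hst (squeeze hf A x)) (fun x => ?_) (fun x => ?_)
    (fun a => ?_) (fun y hy => ?_) (fun v w hv hw hvw => ?_), fun x => ?_⟩
  · rw [ofEmb_r, squeeze_r hf hA]
  · rw [ofEmb_ι, squeeze_ι]
  · rw [ofEmb_leg, squeeze_of hf (remains_leg hf (Finset.Subset.refl A) a)]
  · obtain ⟨x, rfl⟩ := (toEmb e hst).surjective y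
    rw [hvert] at hy
    simp only [(toEmb e hst).apply_eq_iff_eq]
    exact squeeze_flag hf hy
  · simp only [hvert]
    exact squeeze_fiber hf hv hw ((toEmb e hst).injective hvw)
  · rw [fn_homMk, hvert, squeeze_vertex_iff]
    refine or_congr_right' fun hx => ?_
    unfold Remains
    constructor
    · intro h
      by_contra hcon
      push Not at hcon
      refine h ⟨hcon.1, hcon.2, ?_, fun a ha => absurd a.2 ha⟩
      rintro rfl; exact hx (isVertex_r f)
    · rintro (h | h) h'
      · exact h'.1 h
      · exact h'.2.1 h

/-- Every forest can be contracted. -/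
theorem exists_contraction : ∀ (n : ℕ) (G : GCat U g A) (S : Set G.Edge), S.ncard = n →
    G.IsForest S → ∃ (H : GCat U g A) (k : G ⟶ H), (Set.range (edgePre k))ᶜ = S := by
  intro n
  induction n with
  | zero =>
    intro G S hn _
    rw [Set.ncard_eq_zero] at hn
    refine ⟨G, 𝟙 G, ?_⟩
    rw [hn, Set.compl_empty_iff, Set.eq_univ_iff_forall]
    intro e
    obtain ⟨x, hx, rfl⟩ := exists_edgeOf e
    rw [edgeOf_mem_range_edgePre]
    exact not_isVertex_of_ne hx
  | succ n ih =>
    intro G S hn hS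
    obtain ⟨e, he⟩ : S.Nonempty := by
      rw [← Set.ncard_pos]; omega
    obtain ⟨f, hf, rfl⟩ := exists_edgeOf e
    have hroots : G.r f ≠ G.r (G.ι f) := fun h =>
      (isForest_iff S).1 hS f ⟨hf, he⟩ (FlagReach.of_eq h)
    obtain ⟨G₁, k₁, hk₁⟩ := exists_contract_edge G f hroots
    have hr : (Set.range (edgePre k₁))ᶜ = {edgeOf f hf} := by
      ext e'
      obtain ⟨x, hx, rfl⟩ := exists_edgeOf e'
      rw [Set.mem_compl_iff, edgeOf_mem_range_edgePre, not_not, hk₁, Set.mem_singleton_iff,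
        edgeOf_eq_iff]
      exact ⟨fun h => h.resolve_left (not_isVertex_of_ne hx), Or.inr⟩
    have hS₁ : edgePre k₁ '' (edgePre k₁ ⁻¹' S) = S \ {edgeOf f hf} := by
      rw [Set.image_preimage_eq_inter_range, ← hr, Set.sdiff_eq, compl_compl]
    have hn₁ : (edgePre k₁ ⁻¹' S).ncard = n := by
      rw [← Set.ncard_image_of_injective _ (isCoordEmb_pull k₁).inj, hS₁,
        Set.ncard_sdiff_singleton_of_mem he, hn]
      rfl
    obtain ⟨H, k₂, hk₂⟩ := ih G₁ (edgePre k₁ ⁻¹' S) hn₁ (by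
      rw [isForest_iff_pull k₁, hS₁, hr, Set.sdiff_union_self,
        Set.union_eq_self_of_subset_right (Set.singleton_subset_iff.2 he)]
      exact hS)
    refine ⟨H, k₁ ≫ k₂, ?_⟩
    ext e'
    obtain ⟨x, hx, rfl⟩ := exists_edgeOf e'
    rw [Set.mem_compl_iff, edgeOf_mem_range_edgePre, not_not, fn_comp]
    by_cases hv : G₁.IsVertex (fn k₁ x)
    · refine ⟨fun _ => ?_, fun _ => fn_vertex k₂ hv⟩
      have : edgeOf x hx ∈ (Set.range (edgePre k₁))ᶜ := fun h =>
        (edgeOf_mem_range_edgePre k₁ hx).1 h hv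
      rw [hr, Set.mem_singleton_iff] at this
      rw [this]; exact he
    · have hy : G₁.ι (fn k₁ x) ≠ fn k₁ x := fun h => hx ((fn_ι_eq_iff k₁ hv).2 h)
      rw [← edgePre_edgeOf k₁ hx hy, ← Set.mem_preimage, ← hk₂, Set.mem_compl_iff,
        edgeOf_mem_range_edgePre, not_not]

end GCat

/-! ### Moduli of stable graphs as poic-spaces -/

namespace GCat

open DGraph

variable {U Λ : Type u} {g : ℕ} {A : Finset Λ}

/-- The number of flags of a stable graph is bounded in terms of its genus and its markings. -/
theorem card_le (G : GCat U g A) : Fintype.card G.F ≤ 8 * g + 4 * A.card := by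
  have h1 := G.card_flags
  have h2 : (Finset.univ.filter fun x => G.IsLeg x).card = A.card := by
    have : (Finset.univ.filter fun x => G.IsLeg x) = Finset.univ.image G.leg := by
      ext x
      simp [G.leg_range]
    rw [this, Finset.card_image_of_injective _ G.leg_injective]
    simp
  have h3 : Fintype.card G.F = (Finset.univ.filter fun x => G.IsVertex x).card +
      (Finset.univ.filter fun x => ¬ G.IsVertex x).card :=
    (Finset.card_filter_add_card_filter_not _).symm
  have h4 : (Finset.univ.filter fun x => ¬ G.IsVertex x) =
      (Finset.univ.filter fun x => G.IsLeg x) ∪ (Finset.univ.filter fun x => G.ι x ≠ x) := by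
    ext x
    simp only [Finset.mem_filter, Finset.mem_univ, true_and, Finset.mem_union]
    constructor
    · intro h
      by_cases hx : G.ι x = x
      · exact Or.inl ⟨h, hx⟩
      · exact Or.inr hx
    · rintro (h | h)
      · exact h.1
      · exact not_isVertex_of_ne h
  have h5 : (Finset.univ.filter fun x => ¬ G.IsVertex x).card = A.card +
      (Finset.univ.filter fun x => G.ι x ≠ x).card := by
    rw [h4, Finset.card_union_of_disjoint, h2]
    rw [Finset.disjoint_left]
    intro x hx hx'
    exact (Finset.mem_filter.1 hx').2 (Finset.mem_filter.1 hx).2.2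
  have h6 : 3 * (Finset.univ.filter fun x => G.IsVertex x).card ≤
      (Finset.univ.filter fun x => ¬ G.IsVertex x).card := by
    rw [Finset.card_eq_sum_card_fiberwise (s := Finset.univ.filter fun x => ¬ G.IsVertex x)
      (t := Finset.univ.filter fun x => G.IsVertex x) (f := G.r)
      (fun x _ => Finset.mem_coe.2 (Finset.mem_filter.2 ⟨Finset.mem_univ _, isVertex_r x⟩)),
      mul_comm]
    refine Finset.card_nsmul_le_sum _ _ 3 fun v hv => ?_
    have hv := (Finset.mem_filter.1 hv).2
    have := G.stable v hv
    rw [val_eq v hv] at this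
    refine this.trans (Finset.card_le_card fun x hx => ?_)
    simp only [Finset.mem_filter, Finset.mem_univ, true_and] at hx ⊢
    exact ⟨fun h => hx.2 (h.symm.trans hx.1), hx.1⟩
  omega

/-- Two graphs are isomorphic if they have the same tables of roots, opposite flags and markings
after a numbering of their flags. -/
theorem exists_iso_of_tables {n : ℕ} {G H : GCat U g A} (c : G.F ↪ Fin n) (d : H.F ↪ Fin n)
    (hr : ∀ i j, (∃ x, c x = i ∧ c (G.r x) = j) ↔ ∃ x, d x = i ∧ d (H.r x) = j)
    (hι : ∀ i j, (∃ x, c x = i ∧ c (G.ι x) = j) ↔ ∃ x, d x = i ∧ d (H.ι x) = j)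
    (hl : ∀ a j, c (G.leg a) = j ↔ d (H.leg a) = j) : Nonempty (G ≅ H) := by
  have h1 : ∀ x, ∃ y, d y = c x := fun x => by
    obtain ⟨y, hy, -⟩ := (hr (c x) (c (G.r x))).1 ⟨x, rfl, rfl⟩
    exact ⟨y, hy⟩
  have h2 : ∀ y, ∃ x, c x = d y := fun y => by
    obtain ⟨x, hx, -⟩ := (hr (d y) (d (H.r y))).2 ⟨y, rfl, rfl⟩
    exact ⟨x, hx⟩
  choose f hf using h1
  choose k hk using h2
  refine ⟨isoMk ⟨f, k, fun x => c.injective (by rw [hk, hf]), fun y => d.injective (by rw [hf, hk])⟩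
    (fun x => ?_) (fun x => ?_) fun a => ?_⟩
  · obtain ⟨y, hy, hy'⟩ := (hr (c x) (c (G.r x))).1 ⟨x, rfl, rfl⟩
    obtain rfl : f x = y := d.injective (by rw [hf, hy])
    exact d.injective ((hf _).trans hy'.symm)
  · obtain ⟨y, hy, hy'⟩ := (hι (c x) (c (G.ι x))).1 ⟨x, rfl, rfl⟩
    obtain rfl : f x = y := d.injective (by rw [hf, hy])
    exact d.injective ((hf _).trans hy'.symm)
  · exact d.injective ((hf _).trans ((hl a _).1 rfl).symm)

/-- As the number of flags is bounded, there are only finitely many tables of roots, opposite flags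
and markings. -/
theorem isEssFinite (U : Type u) {Λ : Type u} (g : ℕ) (A : Finset Λ) :
    IsEssFinite (GCat U g A)ᵒᵖ := by
  let n := 8 * g + 4 * A.card
  have hc : ∀ G : GCat U g A, Nonempty (G.F ↪ Fin n) := fun G =>
    Function.Embedding.nonempty_of_card_le (by simpa using G.card_le)
  let c := fun G => (hc G).some
  let code : Skeleton (GCat U g A)ᵒᵖ →
      Set (Fin n × Fin n) × Set (Fin n × Fin n) × Set (A × Fin n) := fun x =>
    let G := ((fromSkeleton (GCat U g A)ᵒᵖ).obj x).unop
    ({p | ∃ x, c G x = p.1 ∧ c G (G.r x) = p.2}, {p | ∃ x, c G x = p.1 ∧ c G (G.ι x) = p.2},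
      {p | c G (G.leg p.1) = p.2})
  refine ⟨Skeleton (GCat U g A)ᵒᵖ, inferInstance, Finite.of_injective code fun x y hxy => ?_,
    ⟨(skeletonEquivalence _).symm⟩⟩
  have h1 := congrArg Prod.fst hxy
  have h2 := congrArg (fun p => p.2.1) hxy
  have h3 := congrArg (fun p => p.2.2) hxy
  obtain ⟨i⟩ := exists_iso_of_tables (c _) (c _) (fun i j => Set.ext_iff.1 h1 (i, j))
    (fun i j => Set.ext_iff.1 h2 (i, j)) (fun a j => Set.ext_iff.1 h3 (a, j))
  exact skeleton_skeletal _ ⟨(fromSkeleton (GCat U g A)ᵒᵖ).preimageIso i.symm.op⟩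

instance finite_hom (G H : GCat U g A) : Finite (G ⟶ H) :=
  Finite.of_injective (fun f => fn f) fun _ _ h => hom_ext_fn fun x => congrFun h x

instance finite_hom_op (G H : (GCat U g A)ᵒᵖ) : Finite (G ⟶ H) :=
  Finite.of_injective (fun f => f.unop) fun _ _ h => Quiver.Hom.unop_inj h

/-- Two contractions of a graph which contract the same edges are isomorphic. -/
theorem exists_iso_of_contracted {G H K : GCat U g A} (f : G ⟶ H) (k : G ⟶ K)
    (h : ∀ x, G.ι x ≠ x → (H.IsVertex (fn f x) ↔ K.IsVertex (fn k x))) :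
    ∃ i : H ≅ K, f ≫ i.hom = k := by
  have h' : ∀ x, H.IsVertex (fn f x) ↔ K.IsVertex (fn k x) := by
    intro x
    by_cases hx : G.ι x = x
    · by_cases hv : G.IsVertex x
      · exact ⟨fun _ => fn_vertex k hv, fun _ => fn_vertex f hv⟩
      · obtain ⟨a, rfl⟩ := (G.leg_range x).1 ⟨hv, hx⟩
        exact ⟨fun h => absurd h (fn_leg_not_vertex f a), fun h => absurd h (fn_leg_not_vertex k a)⟩
    · exact h x hx
  obtain ⟨i, hi⟩ := exists_factor f k fun x => (h' x).1
  obtain ⟨j, hj⟩ := exists_factor k f fun x => (h' x).2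
  refine ⟨⟨i, j, hom_ext_fn fun y => ?_, hom_ext_fn fun y => ?_⟩, hi⟩
  · obtain ⟨x, rfl⟩ := fn_surj f y
    rw [← fn_comp, ← Category.assoc, hi, hj, fn_id]
  · obtain ⟨x, rfl⟩ := fn_surj k y
    rw [← fn_comp, ← Category.assoc, hj, hi, fn_id]

theorem exists_iso_of_range_eq {G H K : GCat U g A} (f : G ⟶ H) (k : G ⟶ K)
    (h : Set.range (edgePre f) = Set.range (edgePre k)) : ∃ i : H ≅ K, f ≫ i.hom = k :=
  exists_iso_of_contracted f k fun x hx => by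
    rw [← not_iff_not, ← edgeOf_mem_range_edgePre f hx, ← edgeOf_mem_range_edgePre k hx, h]

/-- The coordinate of an edge or of a new leg over such a coordinate of a contracted tree. -/
def edgePreST {T T' : GCat U 0 (legSet g A)} (f : T ⟶ T') : T'.Edge ⊕ Fin g → T.Edge ⊕ Fin g :=
  Sum.map (edgePre f) id

theorem isCoordEmb_pullST {T T' : GCat U 0 (legSet g A)} (f : T ⟶ T') :
    IsCoordEmb (pullST f) (edgePreST f) := by
  have h := isCoordEmb_pull f
  refine ⟨Sum.map_injective.2 ⟨h.inj, Function.injective_id⟩, ?_, ?_⟩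
  · rintro δ (e | i)
    · exact h.apply _ e
    · rfl
  · rintro δ (e | i) hk
    · exact h.apply_of_notMem _ e fun ⟨e', he'⟩ => hk ⟨Sum.inl e', congrArg Sum.inl he'⟩
    · exact absurd ⟨Sum.inr i, rfl⟩ hk

theorem mem_range_edgePreST {T T' : GCat U 0 (legSet g A)} (f : T ⟶ T') (e : T.Edge) :
    Sum.inl e ∈ Set.range (edgePreST f) ↔ e ∈ Set.range (edgePre f) := by
  simp [edgePreST]

theorem stzero_empty (T : GCat U 0 (legSet g A)) : T.STzero ∅ :=
  ⟨DGraph.isForest_empty, fun _ h => h⟩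

theorem stzero_mono {T : GCat U 0 (legSet g A)} (S S' : Set (T.Edge ⊕ Fin g)) (h : S ⊆ S')
    (hS' : T.STzero S') : T.STzero S :=
  ⟨DGraph.isForest_mono _ _ (Set.preimage_mono h) hS'.1, fun i hi => hS'.2 i (h hi)⟩

theorem stzero_iff_pullST {T T' : GCat U 0 (legSet g A)} (f : T ⟶ T') (S : Set (T'.Edge ⊕ Fin g)) :
    T'.STzero S ↔ T.STzero (edgePreST f '' S ∪ (Set.range (edgePreST f))ᶜ) := by
  unfold STzero
  rw [isForest_iff_pull f]
  refine and_congr (iff_of_eq (congrArg _ ?_)) (forall_congr' fun i => not_congr ?_)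
  · ext e
    simp [edgePreST]
  · simp [edgePreST]

end GCat

open GCat DGraph

variable {U Λ : Type u} {g : ℕ} {A : Finset Λ}

/-- A face of `σ_G` is the locus where the lengths of a forest vanish. It is the image of the cone
of the graph where this forest is contracted. -/
theorem isPoicSpace_Mtrop (U : Type u) {Λ : Type u} (g : ℕ) (A : Finset Λ) :
    IsPoicSpace (Mtrop U g A) where
  essFinite := GCat.isEssFinite U g A
  finiteHom _ _ := inferInstance
  faceEmbedding {x y} f :=
    IsCoordEmb.isFaceEmbedding (h0 := isForest_empty) (hP := isForest_mono)
      (h0' := isForest_empty) (hQ := isForest_mono)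
      (f := (Mtrop U g A).map f) (isCoordEmb_pull f.unop)
      (isForest_iff_pull f.unop)
  face_exists x τ hτ := by
    obtain ⟨S, hS, rfl⟩ := (Poic.isFace_orthantCone_iff DGraph.isForest_empty DGraph.isForest_mono
      _).1 hτ
    obtain ⟨H, k, rfl⟩ := exists_contraction _ x.unop S rfl hS
    exact ⟨op H, k.op, IsCoordEmb.isIsoOnto (h0 := isForest_empty) (hP := isForest_mono)
      (h0' := isForest_empty) (hQ := isForest_mono)
      (f := (Mtrop U g A).map k.op) (isCoordEmb_pull k)
      (isForest_iff_pull k)⟩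
  face_unique x τ hτ w₁ w₂ f₁ f₂ h₁ h₂ := by
    have e₁ := IsCoordEmb.range_eq (h0 := isForest_empty) (hP := isForest_mono)
      (h0' := isForest_empty) (hQ := isForest_mono)
      (f := (Mtrop U g A).map f₁) (isCoordEmb_pull f₁.unop) h₁
    have e₂ := IsCoordEmb.range_eq (h0 := isForest_empty) (hP := isForest_mono)
      (h0' := isForest_empty) (hQ := isForest_mono)
      (f := (Mtrop U g A).map f₂) (isCoordEmb_pull f₂.unop) h₂
    obtain ⟨i, hi⟩ := exists_iso_of_range_eq f₂.unop f₁.unop (e₂.trans e₁.symm)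
    exact ⟨i.op, Quiver.Hom.unop_inj hi⟩

theorem isPoicSpace_STcomplex (U : Type u) {Λ : Type u} (g : ℕ) (A : Finset Λ) :
    IsPoicSpace (STcomplex U g A) where
  essFinite := GCat.isEssFinite U 0 (legSet g A)
  finiteHom _ _ := inferInstance
  faceEmbedding {x y} f :=
    IsCoordEmb.isFaceEmbedding (h0 := stzero_empty _) (hP := stzero_mono)
      (h0' := stzero_empty _) (hQ := stzero_mono)
      (f := (STcomplex U g A).map f) (isCoordEmb_pullST f.unop)
      (stzero_iff_pullST f.unop)
  face_exists x τ hτ := by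
    obtain ⟨S, hS, rfl⟩ := (Poic.isFace_orthantCone_iff (stzero_empty x.unop) stzero_mono _).1 hτ
    obtain ⟨H, k, hk⟩ := exists_contraction _ x.unop (Sum.inl ⁻¹' S) rfl hS.1
    obtain rfl : (Set.range (edgePreST k))ᶜ = S := by
      ext e
      rcases e with e | i
      · rw [Set.mem_compl_iff, mem_range_edgePreST, ← Set.mem_compl_iff, hk]; rfl
      · exact ⟨fun h => absurd ⟨Sum.inr i, rfl⟩ h, fun h => absurd h (hS.2 i)⟩
    exact ⟨op H, k.op, IsCoordEmb.isIsoOnto (h0 := stzero_empty _) (hP := stzero_mono)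
      (h0' := stzero_empty _) (hQ := stzero_mono) (f := (STcomplex U g A).map k.op)
      (isCoordEmb_pullST k) (stzero_iff_pullST k)⟩
  face_unique x τ hτ w₁ w₂ f₁ f₂ h₁ h₂ := by
    have e₁ := IsCoordEmb.range_eq (h0 := stzero_empty _) (hP := stzero_mono)
      (h0' := stzero_empty _) (hQ := stzero_mono)
      (f := (STcomplex U g A).map f₁) (isCoordEmb_pullST f₁.unop) h₁
    have e₂ := IsCoordEmb.range_eq (h0 := stzero_empty _) (hP := stzero_mono)
      (h0' := stzero_empty _) (hQ := stzero_mono)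
      (f := (STcomplex U g A).map f₂) (isCoordEmb_pullST f₂.unop) h₂
    obtain ⟨i, hi⟩ := exists_iso_of_range_eq f₂.unop f₁.unop (by
      ext e
      rw [← mem_range_edgePreST, ← mem_range_edgePreST, e₁, e₂])
    exact ⟨i.op, Quiver.Hom.unop_inj hi⟩

/-! ### Trees and their splits -/

namespace GCat

open DGraph

variable {U Λ : Type u} {A : Finset Λ}

theorem isForest_of_genus_zero (T : GCat U 0 A) (S : Set T.Edge) : T.IsForest S := by
  intro K hK hleg hc _
  refine ⟨hK, hleg, hc, le_antisymm ?_ (hc.genus_nonneg hK)⟩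
  have h1 := missing_le (G := T.toDGraph) (T := Finset.univ)
    (fun x _ => ⟨Finset.mem_univ _, Finset.mem_univ _⟩) T.conn _ K hK hc.1
    (Finset.subset_univ _) rfl
  have h2 := T.card_flags
  have h3 := two_mul_card_edges hK
  unfold genus
  unfold verts at h1 ⊢
  omega

/-- In a tree, the two ends of an edge are not joined by the other edges. -/
theorem not_reach_ends (T : GCat U 0 A) {h : T.F} (hh : T.ι h ≠ h) :
    ¬ T.Reach (fun x => x ≠ h ∧ x ≠ T.ι h) (T.r h) (T.r (T.ι h)) := by
  intro hr
  refine (isForest_iff _).1 (T.isForest_of_genus_zero Set.univ) h ⟨hh, trivial⟩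
    (hr.bind fun x hx => ?_)
  by_cases hx' : T.ι x = x
  · exact FlagReach.of_eq (by rw [hx'])
  · exact FlagReach.step ⟨⟨hx', trivial⟩, hx⟩

/-- The vertex `v` lies on the side of the edge of `h` opposite to the root of `h`. -/
def Side {g : ℕ} (T : GCat U g A) (h v : T.F) : Prop :=
  T.Reach (fun x => x ≠ h ∧ x ≠ T.ι h) (T.r (T.ι h)) v

theorem side_r_iff {g : ℕ} (T : GCat U g A) {h p : T.F} (h1 : p ≠ h) (h2 : p ≠ T.ι h) :
    T.Side h (T.r p) ↔ T.Side h (T.r (T.ι p)) := by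
  constructor
  · exact fun hs => hs.trans (FlagReach.step ⟨h1, h2⟩)
  · intro hs
    refine hs.trans ?_
    have := FlagReach.step (r := T.r) (ι := T.ι) (Q := fun x => x ≠ h ∧ x ≠ T.ι h) (h := T.ι p)
      ⟨fun he => h2 (by rw [← he, T.ι_ι]), fun he => h1 (by rw [← T.ι_ι p, he, T.ι_ι])⟩
    rwa [T.ι_ι] at this

/-- An edge of a tree divides the vertices into exactly two sides. -/
theorem side_ι (T : GCat U 0 A) {h v : T.F} (hh : T.ι h ≠ h) (hv : T.IsVertex v) :
    T.Side (T.ι h) v ↔ ¬ T.Side h v := by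
  have hor : ∀ w, T.Reach (fun _ => True) (T.r h) w → T.Side h w ∨ T.Side (T.ι h) w := by
    intro w hw
    induction hw with
    | refl => exact Or.inr (FlagReach.of_eq (by rw [T.ι_ι]))
    | tail _ hs ih =>
      obtain ⟨p, -, rfl, rfl⟩ := hs
      by_cases h1 : p = h
      · exact Or.inl (FlagReach.of_eq (by rw [h1]))
      by_cases h2 : p = T.ι h
      · exact Or.inr (FlagReach.of_eq (by rw [h2]))
      refine ih.imp (side_r_iff T h1 h2).1 (side_r_iff T h2 (by rwa [T.ι_ι])).1
  constructor
  · intro h1 h2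
    refine T.not_reach_ends hh (FlagReach.trans (w := v) ?_ ?_)
    · unfold Side at h1
      rw [T.ι_ι] at h1
      exact h1.mono fun x hx => hx.symm
    · refine h2.symm T.ι_ι fun x hx => ⟨fun he => hx.2 ?_, fun he => hx.1 ?_⟩
      · rw [← he, T.ι_ι]
      · rw [← T.ι_ι x, he, T.ι_ι]
  · exact fun h1 => (hor v (T.conn' (isVertex_r h) hv)).resolve_left h1

theorem side_r_ι {g : ℕ} (T : GCat U g A) (h : T.F) : T.Side h (T.r (T.ι h)) := FlagReach.refl _

theorem not_side_r (T : GCat U 0 A) {h : T.F} (hh : T.ι h ≠ h) : ¬ T.Side h (T.r h) := by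
  rw [← side_ι T hh (isVertex_r h)]
  exact FlagReach.of_eq (by rw [T.ι_ι])

/-- A non-empty set of vertices of a stable tree has at least three outgoing flags: legs, or flags
of edges which leave the set. -/
theorem three_le_card_outgoing (T : GCat U 0 A) (c : T.F → Prop) {v : T.F} (hv : T.IsVertex v)
    (hc : c v) (O : Finset T.F) (hO : ∀ p, c (T.r p) → ¬ T.IsVertex p →
      (T.ι p = p ∨ ¬ c (T.r (T.ι p))) → p ∈ O) : 3 ≤ O.card := by
  refine le_trans ?_ (Finset.card_le_card (s := Finset.univ.filter fun p => c (T.r p) ∧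
    ¬ T.IsVertex p ∧ (T.ι p = p ∨ ¬ c (T.r (T.ι p)))) fun p hp => by
      obtain ⟨-, h1, h2, h3⟩ := Finset.mem_filter.1 hp
      exact hO p h1 h2 h3)
  set K : Finset T.F := Finset.univ.filter fun p => c (T.r p) ∧
    (T.IsVertex p ∨ (T.ι p ≠ p ∧ c (T.r (T.ι p)))) with hKdef
  have hKm : ∀ p, p ∈ K ↔ c (T.r p) ∧ (T.IsVertex p ∨ (T.ι p ≠ p ∧ c (T.r (T.ι p)))) := by
    simp [hKdef]
  have hK : T.IsSub K := by
    intro x hx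
    rw [hKm] at hx
    rw [hKm, hKm, T.r_r]
    refine ⟨⟨hx.1, Or.inl (isVertex_r x)⟩, ?_⟩
    rcases hx.2 with h | h
    · rw [ι_of_isVertex h]; exact ⟨hx.1, Or.inl h⟩
    · rw [T.ι_ι]; exact ⟨h.2, Or.inr ⟨h.1.symm, hx.1⟩⟩
  have h1 := missing_le (G := T.toDGraph) (T := Finset.univ)
    (fun x _ => ⟨Finset.mem_univ _, Finset.mem_univ _⟩) T.conn _ K hK
    ⟨v, (hKm v).2 ⟨by rw [show T.r v = v from hv]; exact hc, Or.inl hv⟩⟩ (Finset.subset_univ _) rfl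
  have h2 := T.card_flags
  have h3 : 3 * (T.verts K).card ≤
      (Finset.univ.filter fun p => c (T.r p) ∧ ¬ T.IsVertex p).card := by
    rw [Finset.card_eq_sum_card_fiberwise
      (s := Finset.univ.filter fun p => c (T.r p) ∧ ¬ T.IsVertex p) (t := T.verts K) (f := T.r),
      mul_comm]
    · refine Finset.card_nsmul_le_sum _ _ 3 fun w hw => ?_
      obtain ⟨hw1, hw2⟩ := Finset.mem_filter.1 hw
      have := T.stable w hw2
      rw [val_eq w hw2] at this
      refine this.trans (Finset.card_le_card fun x hx => ?_)
      simp only [Finset.mem_filter, Finset.mem_univ, true_and] at hx ⊢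
      refine ⟨⟨?_, fun h => hx.2 (h.symm.trans hx.1)⟩, hx.1⟩
      have := ((hKm w).1 hw1).1
      rwa [hx.1, ← show T.r w = w from hw2]
    · intro x hx
      have hx := (Finset.mem_filter.1 hx).2
      refine Finset.mem_coe.2 (Finset.mem_filter.2 ⟨(hKm _).2 ⟨?_, Or.inl (isVertex_r x)⟩,
        isVertex_r x⟩)
      rw [T.r_r]; exact hx.1
  have h4 : (Finset.univ.filter fun p => c (T.r p) ∧ ¬ T.IsVertex p) =
      (K.filter fun h => T.ι h ≠ h) ∪ (Finset.univ.filter fun p => c (T.r p) ∧ ¬ T.IsVertex p ∧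
      (T.ι p = p ∨ ¬ c (T.r (T.ι p)))) := by
    ext p
    simp only [Finset.mem_filter, Finset.mem_univ, true_and, Finset.mem_union, hKm]
    grind [ι_of_isVertex]
  have h5 := Finset.card_union_le (K.filter fun h => T.ι h ≠ h)
    (Finset.univ.filter fun p => c (T.r p) ∧ ¬ T.IsVertex p ∧ (T.ι p = p ∨ ¬ c (T.r (T.ι p))))
  rw [← h4] at h5
  have h6 : 1 ≤ (T.verts K).card := Finset.card_pos.2 ⟨v, Finset.mem_filter.2 ⟨(hKm v).2
    ⟨by rw [show T.r v = v from hv]; exact hc, Or.inl hv⟩, hv⟩⟩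
  unfold verts at h1 h3 h6
  omega

/-- The marks of the legs on the side of the edge of `h` opposite to the root of `h`. -/
def split {g : ℕ} (T : GCat U g A) (h : T.F) : Finset Λ :=
  A.filter fun a => ∃ ha : a ∈ A, T.Side h (T.r (T.leg ⟨a, ha⟩))

theorem mem_split {g : ℕ} (T : GCat U g A) (h : T.F) (a : A) :
    a.1 ∈ T.split h ↔ T.Side h (T.r (T.leg a)) := by
  unfold split
  rw [Finset.mem_filter]
  exact ⟨fun h => h.2.choose_spec, fun h => ⟨a.2, a.2, h⟩⟩

theorem split_subset {g : ℕ} (T : GCat U g A) (h : T.F) : T.split h ⊆ A := Finset.filter_subset _ _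

theorem split_ι (T : GCat U 0 A) {h : T.F} (hh : T.ι h ≠ h) : T.split (T.ι h) = A \ T.split h := by
  ext a
  by_cases ha : a ∈ A
  · rw [Finset.mem_sdiff, T.mem_split _ ⟨a, ha⟩, T.mem_split _ ⟨a, ha⟩,
      side_ι T hh (isVertex_r _)]
    exact ⟨fun h => ⟨ha, h⟩, fun h => h.2⟩
  · exact ⟨fun h => absurd (split_subset _ _ h) ha, fun h => absurd (Finset.mem_sdiff.1 h).1 ha⟩

/-- If no leg lies on the sides of `h` but not of `h'`, then no vertex does. -/
theorem side_of_side (T : GCat U 0 A) {h h' : T.F} (hh : T.ι h ≠ h)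
    (hs : T.split h = T.split h') {v : T.F} (hv : T.IsVertex v) (h1 : T.Side h v) :
    T.Side h' v := by
  by_contra h2
  have h5 := T.three_le_card_outgoing (fun v => T.Side h v ∧ ¬ T.Side h' v) hv ⟨h1, h2⟩
    {T.ι h, h'} (by
    rintro p ⟨hp1, hp1'⟩ hp2 hp3
    rw [Finset.mem_insert, Finset.mem_singleton]
    by_contra hcon
    push Not at hcon
    have h5 : p ≠ h := by rintro rfl; exact T.not_side_r hh hp1
    have h6 : p ≠ T.ι h' := by rintro rfl; exact hp1' (T.side_r_ι h')
    have h7 := hp3.resolve_right (not_not.2 ⟨(T.side_r_iff h5 hcon.1).1 hp1,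
      fun h => hp1' ((T.side_r_iff hcon.2 h6).2 h)⟩)
    obtain ⟨a, rfl⟩ := (T.leg_range p).1 ⟨hp2, h7⟩
    rw [← mem_split, ← hs, mem_split] at hp1'
    exact hp1' hp1)
  have h6 := Finset.card_le_two (a := T.ι h) (b := h')
  omega

/-- The edges of a stable tree, with orientations, are determined by their splits. -/
theorem split_injective (T : GCat U 0 A) {h h' : T.F} (hh : T.ι h ≠ h) (hh' : T.ι h' ≠ h')
    (hs : T.split h = T.split h') : h = h' := by
  by_contra hne
  have h1 : T.Side h (T.r (T.ι h')) := T.side_of_side hh' hs.symm (isVertex_r _) (T.side_r_ι h')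
  have h2 : ¬ T.Side h (T.r h') := fun h3 =>
    T.not_side_r hh' (T.side_of_side hh hs (isVertex_r _) h3)
  by_cases h3 : h' = T.ι h
  · rw [h3] at h2
    exact h2 (T.side_r_ι h)
  · exact h2 ((T.side_r_iff (Ne.symm hne) h3).2 h1)

/-- A map of flags that may contract edges to vertices and is injective on the other flags maps the
sides of an edge that it does not contract to the sides of the image. -/
theorem side_map {B : Finset Λ} {T : GCat U 0 A} {T' : GCat U 0 B} {f : T.F → T'.F}
    (hr : ∀ x, f (T.r x) = T'.r (f x)) (hι : ∀ x, f (T.ι x) = T'.ι (f x))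
    (hinj : ∀ {x y}, ¬ T'.IsVertex (f x) → f x = f y → x = y) {h v : T.F}
    (hh : T'.ι (f h) ≠ f h) (hv : T.IsVertex v) : T'.Side (f h) (f v) ↔ T.Side h v := by
  have key : ∀ h, T'.ι (f h) ≠ f h → T.Side h v → T'.Side (f h) (f v) := by
    intro h hh hs
    have hn : ¬ T'.IsVertex (f h) := not_isVertex_of_ne hh
    have hn' : ¬ T'.IsVertex (f (T.ι h)) := by rwa [hι, isVertex_ι]
    unfold Side
    rw [← hι, ← hr]
    refine FlagReach.map f (fun x hx => ?_) hs
    rw [hr, hr, hι x]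
    exact FlagReach.step (Q := fun x => x ≠ f h ∧ x ≠ f (T.ι h))
      ⟨fun h1 => hx.1 (hinj hn h1.symm).symm, fun h1 => hx.2 (hinj hn' h1.symm).symm⟩
  refine ⟨fun h1 => ?_, key h hh⟩
  have hh0 : T.ι h ≠ h := fun h2 => hh (by rw [← hι, h2])
  by_contra h2
  rw [← side_ι T hh0 hv] at h2
  have h3 := key (T.ι h) (by rw [hι]; exact ι_ne hh) h2
  rw [hι, side_ι T' hh (by unfold DGraph.IsVertex; rw [← hr, hv])] at h3
  exact h3 h1

theorem split_fn {T T' : GCat U 0 A} (f : T ⟶ T') {h : T.F} (hh : T'.ι (fn f h) ≠ fn f h) :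
    T'.split (fn f h) = T.split h := by
  ext a
  by_cases ha : a ∈ A
  · rw [T.mem_split _ ⟨a, ha⟩, T'.mem_split _ ⟨a, ha⟩, ← fn_leg f, ← fn_r,
      side_map (fn_r f) (fn_ι f) (fn_inj f) hh (isVertex_r _)]
  · exact ⟨fun h => absurd (split_subset _ _ h) ha, fun h => absurd (split_subset _ _ h) ha⟩

instance subsingleton_hom (T T' : GCat U 0 A) : Subsingleton (T ⟶ T') := by
  refine ⟨fun f k => hom_ext_of_flags fun x hx => ?_⟩
  by_cases hy : T'.ι (fn f x) = fn f x
  · obtain ⟨a, rfl⟩ := (T.leg_range x).1 ⟨fun h => hx (fn_vertex f h), (fn_ι_eq_iff f hx).2 hy⟩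
    rw [fn_leg, fn_leg]
  · obtain ⟨z, hz⟩ := fn_surj k (fn f x)
    have hz' : T'.ι (fn k z) ≠ fn k z := by rwa [hz]
    have hs : T.split z = T.split x := by rw [← split_fn k hz', hz, split_fn f hy]
    have := T.split_injective (fun h => hz' (by rw [← fn_ι, h]))
      (fun h => hy (by rw [← fn_ι, h])) hs
    rw [← this, hz, this]

theorem isThin_op : Quiver.IsThin (GCat U 0 A)ᵒᵖ := fun _ _ =>
  ⟨fun f k => Quiver.Hom.unop_inj (Subsingleton.elim f.unop k.unop)⟩

end GCat

theorem isPoicComplex_Mtrop_zero (U : Type u) {Λ : Type u} (A : Finset Λ) :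
    IsPoicComplex (Mtrop U 0 A) :=
  { isPoicSpace_Mtrop U 0 A with thin := GCat.isThin_op }

theorem isPoicComplex_STcomplex (U : Type u) {Λ : Type u} (g : ℕ) (A : Finset Λ) :
    IsPoicComplex (STcomplex U g A) :=
  { isPoicSpace_STcomplex U g A with thin := GCat.isThin_op }

/-! ### Distances between the legs of a tree -/

section Splits

variable {Λ : Type u} {A B : Finset Λ}

theorem card_pair_inter_eq_one {i j : Λ} (hij : i ≠ j) (I : Finset Λ) :
    (({i, j} : Finset Λ) ∩ I).card = 1 ↔ ¬ (i ∈ I ↔ j ∈ I) := by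
  by_cases hi : i ∈ I <;> by_cases hj : j ∈ I <;>
    simp [Finset.insert_inter_of_mem, Finset.insert_inter_of_notMem, Finset.singleton_inter_of_mem,
      Finset.singleton_inter_of_notMem, hi, hj, hij]

theorem exists_pair (q : Pairs A) : ∃ i j : A, i ≠ j ∧ q.1 = {i.1, j.1} := by
  obtain ⟨h1, h2⟩ := Finset.mem_powersetCard.1 q.2
  obtain ⟨i, j, hij, h⟩ := Finset.card_eq_two.1 h2
  exact ⟨⟨i, h1 (by simp [h])⟩, ⟨j, h1 (by simp [h])⟩, fun he => hij (congrArg Subtype.val he), h⟩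

theorem ne_of_pair {q : Pairs A} {i j : A} (h : q.1 = {i.1, j.1}) : i ≠ j := by
  rintro rfl
  have h2 := (Finset.mem_powersetCard.1 q.2).2
  rw [h] at h2
  simp at h2

theorem splitVector_pair {q : Pairs A} {i j : A} (h : q.1 = {i.1, j.1}) (I : Finset Λ) :
    splitVector A I q = if (i.1 ∈ I ↔ j.1 ∈ I) then 0 else 1 := by
  have hij : i.1 ≠ j.1 := fun he => ne_of_pair h (Subtype.ext he)
  unfold splitVector
  rw [h]
  by_cases hI : i.1 ∈ I ↔ j.1 ∈ I
  · rw [if_pos hI, if_neg fun h1 => (card_pair_inter_eq_one hij I).1 h1 hI]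
  · rw [if_neg hI, if_pos ((card_pair_inter_eq_one hij I).2 hI)]

theorem splitVector_sdiff (I : Finset Λ) : splitVector A (A \ I) = splitVector A I := by
  funext q
  obtain ⟨i, j, -, h⟩ := exists_pair q
  rw [splitVector_pair h, splitVector_pair h]
  congr 1
  simp only [Finset.mem_sdiff, i.2, j.2, true_and, not_iff_not]

theorem splitVector_congr {I J : Finset Λ} (h : ∀ i ∈ A, i ∈ I ↔ i ∈ J) :
    splitVector A I = splitVector A J := by
  funext q
  obtain ⟨i, j, -, hq⟩ := exists_pair q
  rw [splitVector_pair hq, splitVector_pair hq]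
  simp only [h _ i.2, h _ j.2]

theorem sumMap_pair (y : A → ℝ) {q : Pairs A} {i j : A} (h : q.1 = {i.1, j.1}) :
    sumMap A y q = y i + y j := by
  have h1 : sumMap A y q = ∑ k : A, if k ∈ ({i, j} : Finset A) then y k else 0 := by
    unfold sumMap
    rw [LinearMap.pi_apply, LinearMap.sum_apply]
    refine Finset.sum_congr rfl fun k _ => ?_
    have : k.1 ∈ q.1 ↔ k ∈ ({i, j} : Finset A) := by
      rw [h, Finset.mem_insert, Finset.mem_singleton, Finset.mem_insert, Finset.mem_singleton]
      exact or_congr Subtype.ext_iff.symm Subtype.ext_iff.symm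
    by_cases hk : k.1 ∈ q.1
    · rw [if_pos hk, if_pos (this.1 hk)]; rfl
    · rw [if_neg hk, if_neg fun h => hk (this.2 h)]; rfl
  rw [h1, Finset.sum_ite_mem, Finset.univ_inter, Finset.sum_pair (ne_of_pair h)]

theorem mk_splitVector_of_card_le_one {I : Finset Λ} (hI : I.card ≤ 1) :
    QSpace.mk (splitVector A I) = 0 := by
  unfold QSpace.mk
  rw [Submodule.mkQ_apply, Submodule.Quotient.mk_eq_zero]
  refine ⟨fun i => if i.1 ∈ I then 1 else 0, funext fun q => ?_⟩
  obtain ⟨i, j, hij, hq⟩ := exists_pair q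
  have hij' : i.1 ≠ j.1 := fun he => hij (Subtype.ext he)
  rw [splitVector_pair hq, sumMap_pair _ hq]
  by_cases hi : i.1 ∈ I <;> by_cases hj : j.1 ∈ I
  · exact absurd (Finset.card_le_one.1 hI _ hi _ hj) hij'
  all_goals simp [hi, hj]

theorem mk_splitVector_mem_Ndist {I : Finset Λ} (hI : I ⊆ A) :
    QSpace.mk (splitVector A I) ∈ Ndist A := by
  by_cases h1 : I.card ≤ 1
  · rw [mk_splitVector_of_card_le_one h1]
    exact Submodule.zero_mem _
  by_cases h2 : (A \ I).card ≤ 1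
  · rw [← splitVector_sdiff, mk_splitVector_of_card_le_one h2]
    exact Submodule.zero_mem _
  rw [Finset.card_sdiff_of_subset hI] at h2
  exact Submodule.subset_span ⟨I, ⟨hI, by omega, by omega⟩, rfl⟩

/-- The linear map `Q_A → Q_B` induced by the coordinate projection. -/
def restrictQ (h : B ⊆ A) : QSpace A →ₗ[ℝ] QSpace B :=
  Submodule.mapQ _ _ (LinearMap.funLeft ℝ ℝ fun p : Pairs B =>
    ⟨p.1, Finset.powersetCard_mono h p.2⟩)
    (by
      rintro _ ⟨x, rfl⟩
      refine ⟨fun i => x ⟨i.1, h i.2⟩, funext fun q => ?_⟩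
      obtain ⟨i, j, hij, hq⟩ := exists_pair q
      rw [LinearMap.funLeft_apply, sumMap_pair _ hq,
        sumMap_pair (q := ⟨q.1, _⟩) (i := ⟨i.1, h i.2⟩) (j := ⟨j.1, h j.2⟩) x hq])

theorem restrictQ_mk (h : B ⊆ A) (x : Pairs A → ℝ) :
    restrictQ h (QSpace.mk x) = QSpace.mk (restrictPairs h x) := rfl

theorem restrictQ_mk_splitVector (h : B ⊆ A) (I : Finset Λ) :
    restrictQ h (QSpace.mk (splitVector A I)) = QSpace.mk (splitVector B (I ∩ B)) := by
  rw [restrictQ_mk]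
  congr 1
  have : restrictPairs h (splitVector A I) = splitVector B I := rfl
  rw [this]
  exact splitVector_congr fun i hi => by simp [hi]

theorem restrictQ_mem_Ndist (h : B ⊆ A) {n : QSpace A} (hn : n ∈ Ndist A) :
    restrictQ h n ∈ Ndist B := by
  induction hn using Submodule.span_induction with
  | mem x hx =>
    obtain ⟨I, -, rfl⟩ := hx
    show restrictQ h (QSpace.mk (splitVector A I)) ∈ _
    rw [restrictQ_mk_splitVector]
    exact mk_splitVector_mem_Ndist Finset.inter_subset_right
  | zero => rw [map_zero]; exact Submodule.zero_mem _
  | add x y _ _ hx hy => rw [map_add]; exact Submodule.add_mem _ hx hy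
  | smul c x _ hx => rw [map_zsmul]; exact Submodule.smul_mem _ _ hx

/-- The map of lattices `N_dist(A) → N_dist(B)` induced by the coordinate projection. -/
def forgetDist (h : B ⊆ A) : Ndist A →ₗ[ℤ] Ndist B :=
  ((restrictQ h).restrictScalars ℤ).restrict fun _ hn => restrictQ_mem_Ndist h hn

theorem coe_forgetDist (h : B ⊆ A) (n : Ndist A) :
    ((forgetDist h n : Ndist B) : QSpace B) = restrictQ h n := rfl

theorem isForgetDist_forgetDist (h : B ⊆ A) : IsForgetDist h (forgetDist h) := by
  intro n x hx
  rw [coe_forgetDist, ← hx, restrictQ_mk]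

end Splits

namespace DGraph

variable {U : Type u} {G : DGraph U}

theorem exists_isWalk {v w : G.F} (h : G.Reach (fun _ => True) v w) : ∃ p, G.IsWalk v w p := by
  induction h using Relation.ReflTransGen.head_induction_on with
  | refl => exact ⟨[], rfl⟩
  | head hs _ ih =>
    obtain ⟨x, -, rfl, rfl⟩ := hs
    obtain ⟨p, hp⟩ := ih
    by_cases hx : G.ι x = x
    · rw [hx] at hp; exact ⟨p, hp⟩
    · exact ⟨x :: p, rfl, hx, hp⟩

theorem IsWalk.suffix {w h : G.F} {q : List G.F} : ∀ {v : G.F} {p : List G.F},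
    G.IsWalk v w (p ++ h :: q) → G.IsWalk (G.r h) w (h :: q)
  | _, [], hp => ⟨rfl, hp.2⟩
  | _, _ :: _, hp => IsWalk.suffix hp.2.2

/-- A walk which repeats an edge can be shortened. -/
theorem exists_isPath {w : G.F} : ∀ (p : List G.F) {v : G.F}, G.IsWalk v w p →
    ∃ p', G.IsPath v w p'
  | [], _, hp => ⟨[], hp, List.nodup_nil⟩
  | h :: p, v, hp => by
    obtain ⟨rfl, hh, hp⟩ := hp
    obtain ⟨p', hp', hnd⟩ := exists_isPath p hp
    by_cases hmem : s(h, G.ι h) ∈ p'.map fun h => s(h, G.ι h)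
    · obtain ⟨x, hx, hxh⟩ := List.mem_map.1 hmem
      obtain ⟨l, q, rfl⟩ := List.append_of_mem hx
      have h1 := hp'.suffix
      rw [List.map_append] at hnd
      have h2 := (List.nodup_append.1 hnd).2.1
      rcases Sym2.eq_iff.1 hxh with h3 | h3
      · obtain rfl := h3.1
        exact ⟨x :: q, h1, h2⟩
      · obtain rfl := h3.1
        have h4 := h1.2.2
        rw [G.ι_ι] at h4
        exact ⟨q, h4, (List.nodup_cons.1 h2).2⟩
    · exact ⟨h :: p', ⟨rfl, hh, hp'⟩, List.nodup_cons.2 ⟨hmem, hnd⟩⟩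

theorem sum_flagLen_eq (δ : G.Edge → ℤ) {w : G.F} : ∀ (p : List G.F) {v : G.F}, G.IsWalk v w p →
    (p.map (G.flagLen δ)).sum =
      ∑ e : G.Edge, δ e * ((p.map fun h => s(h, G.ι h)).count e.1 : ℤ)
  | [], _, _ => by simp
  | h :: p, v, hp => by
    obtain ⟨-, hh, hp⟩ := hp
    rw [List.map_cons, List.sum_cons, sum_flagLen_eq δ p hp, flagLen_of_ne δ hh,
      ← Fintype.sum_ite_eq' (edgeOf h hh) δ, ← Finset.sum_add_distrib]
    refine Finset.sum_congr rfl fun e _ => ?_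
    rw [List.map_cons, List.count_cons]
    by_cases he : e = edgeOf h hh
    · subst he
      rw [if_pos rfl, if_pos (by simp [edgeOf])]
      push_cast; ring
    · rw [if_neg he, if_neg]
      · push_cast; ring
      · intro h1
        exact he (Subtype.ext (eq_of_beq h1).symm)

/-- A sum over the flags of edges counts every edge twice. -/
theorem sum_flags_eq {M : Type*} [AddCommGroup M] (F : G.F → M) (E : G.Edge → M)
    (h0 : ∀ h, G.ι h = h → F h = 0) (h1 : ∀ h hh, F h = E (edgeOf h hh)) :
    ∑ h, F h = 2 • ∑ e, E e := by
  have h2 : ∑ h, F h = ∑ h : {h : G.F // G.ι h ≠ h}, E (edgeOf h.1 h.2) := by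
    rw [← Finset.sum_filter_add_sum_filter_not Finset.univ (fun h => G.ι h ≠ h),
      Finset.sum_eq_zero (s := Finset.univ.filter fun h => ¬ G.ι h ≠ h), add_zero,
      ← Finset.sum_subtype_eq_sum_filter, Finset.subtype_univ]
    · exact Finset.sum_congr rfl fun h _ => h1 h.1 h.2
    · intro h hh
      exact h0 h (not_not.1 (Finset.mem_filter.1 hh).2)
  rw [h2, ← Finset.sum_fiberwise_of_maps_to (t := Finset.univ)
    (g := fun h : {h : G.F // G.ι h ≠ h} => edgeOf h.1 h.2) fun _ _ => Finset.mem_univ _,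
    Finset.smul_sum]
  refine Finset.sum_congr rfl fun e _ => ?_
  obtain ⟨x, hx, rfl⟩ := exists_edgeOf e
  have h3 : (Finset.univ.filter fun h : {h : G.F // G.ι h ≠ h} => edgeOf h.1 h.2 = edgeOf x hx) =
      {⟨x, hx⟩, ⟨G.ι x, ι_ne hx⟩} := by
    ext h
    simp only [Finset.mem_filter, Finset.mem_univ, true_and, Finset.mem_insert,
      Finset.mem_singleton, edgeOf_eq_iff, Subtype.ext_iff]
  rw [h3, Finset.sum_pair fun h => hx (Subtype.mk.inj h).symm, edgeOf_ι, two_smul]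

end DGraph

namespace GCat

open DGraph

variable {U Λ : Type u} {A : Finset Λ}

/-- A walk in a tree changes the side of an edge whenever it passes through this edge. -/
theorem side_iff_of_walk (T : GCat U 0 A) {h : T.F} (hh : T.ι h ≠ h) {w : T.F} :
    ∀ (p : List T.F) {v : T.F}, T.IsVertex v → T.IsVertex w → T.IsWalk v w p →
      ((T.Side h v ↔ T.Side h w) ↔ Even ((p.map fun h => s(h, T.ι h)).count s(h, T.ι h)))
  | [], _, _, _, hp => by
    obtain rfl : _ = w := hp
    simp
  | x :: p, v, hv, hw, hp => by
    obtain ⟨rfl, hx, hp⟩ := hp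
    have ih := side_iff_of_walk T hh p (isVertex_r _) hw hp
    rw [List.map_cons, List.count_cons]
    by_cases he : s(x, T.ι x) = s(h, T.ι h)
    · rw [if_pos (by simpa using he), Nat.even_add_one, ← ih]
      have : T.Side h (T.r x) ↔ ¬ T.Side h (T.r (T.ι x)) := by
        rcases Sym2.eq_iff.1 he with h1 | h1
        · rw [h1.1]
          exact ⟨fun h2 => absurd h2 (T.not_side_r hh), fun h2 => absurd (T.side_r_ι h) h2⟩
        · rw [h1.2, h1.1]
          exact ⟨fun _ => T.not_side_r hh, fun _ => T.side_r_ι h⟩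
      rw [this]
      tauto
    · rw [if_neg (by simpa using he), add_zero, ← ih, T.side_r_iff]
      · rintro rfl; exact he rfl
      · rintro rfl; exact he (by rw [T.ι_ι, Sym2.eq_swap])

/-- The number of times a path in a tree passes through an edge. -/
theorem count_of_path (T : GCat U 0 A) {h : T.F} (hh : T.ι h ≠ h) {v w : T.F} {p : List T.F}
    (hv : T.IsVertex v) (hw : T.IsVertex w) (hp : T.IsPath v w p) :
    (p.map fun h => s(h, T.ι h)).count s(h, T.ι h) =
      if (T.Side h v ↔ T.Side h w) then 0 else 1 := by
  have h1 := T.side_iff_of_walk hh p hv hw hp.1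
  have h2 := List.nodup_iff_count_le_one.1 hp.2 s(h, T.ι h)
  by_cases h3 : T.Side h v ↔ T.Side h w
  · rw [if_pos h3]
    obtain ⟨m, hm⟩ := h1.1 h3
    omega
  · rw [if_neg h3]
    have h4 : ¬ Even _ := fun h => h3 (h1.2 h)
    have h5 : (p.map fun h => s(h, T.ι h)).count s(h, T.ι h) ≠ 0 := fun h => h4 (by rw [h]; simp)
    omega

/-- The class of the distance vector of an edge of length one. -/
def edgeDist (T : GCat U 0 A) (e : T.Edge) : Ndist A :=
  ⟨QSpace.mk (splitVector A (T.split (exists_edgeOf e).choose)),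
    mk_splitVector_mem_Ndist (split_subset _ _)⟩

theorem splitVector_split_congr (T : GCat U 0 A) {h h' : T.F} (hh : T.ι h ≠ h) (hh' : T.ι h' ≠ h')
    (he : edgeOf h hh = edgeOf h' hh') :
    splitVector A (T.split h) = splitVector A (T.split h') := by
  rcases edgeOf_eq_iff.1 he with rfl | rfl
  · rfl
  · rw [T.split_ι hh', splitVector_sdiff]

theorem splitVector_edge (T : GCat U 0 A) {h : T.F} (hh : T.ι h ≠ h) :
    splitVector A (T.split (exists_edgeOf (edgeOf h hh)).choose) = splitVector A (T.split h) := by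
  obtain ⟨hh', he⟩ := (exists_edgeOf (edgeOf h hh)).choose_spec
  exact (T.splitVector_split_congr hh hh' he).symm

theorem coe_edgeDist (T : GCat U 0 A) {h : T.F} (hh : T.ι h ≠ h) :
    (T.edgeDist (edgeOf h hh) : QSpace A) = QSpace.mk (splitVector A (T.split h)) := by
  show QSpace.mk _ = _
  rw [splitVector_edge]

/-- The distance map on the lattice of a tree. -/
def distLin (T : GCat U 0 A) : (T.Edge → ℤ) →ₗ[ℤ] Ndist A :=
  Fintype.linearCombination ℤ T.edgeDist

theorem distLin_apply (T : GCat U 0 A) (δ : T.Edge → ℤ) :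
    T.distLin δ = ∑ e, δ e • T.edgeDist e := Fintype.linearCombination_apply ..

theorem two_smul_distLin (T : GCat U 0 A) (δ : T.Edge → ℤ) :
    (2 • T.distLin δ : QSpace A) =
      ∑ h, T.flagLen δ h • QSpace.mk (splitVector A (T.split h)) := by
  rw [sum_flags_eq _ fun e => δ e • (T.edgeDist e : QSpace A)]
  · rw [distLin_apply]
    push_cast
    rfl
  · intro h hh
    rw [flagLen_of_eq δ hh, zero_smul]
  · intro h hh
    rw [flagLen_of_ne δ hh, coe_edgeDist]

theorem edgeDist_edgePre {T T' : GCat U 0 A} (f : T ⟶ T') (e : T'.Edge) :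
    T.edgeDist (edgePre f e) = T'.edgeDist e := by
  obtain ⟨y, hy, rfl⟩ := exists_edgeOf e
  obtain ⟨x, rfl⟩ := fn_surj f y
  have hx : T.ι x ≠ x := fun h => hy (by rw [← fn_ι, h])
  refine Subtype.ext ?_
  rw [edgePre_edgeOf f hx hy, coe_edgeDist, coe_edgeDist, split_fn f hy]

theorem distLin_pull {T T' : GCat U 0 A} (f : T ⟶ T') (δ : T'.Edge → ℤ) :
    T.distLin (pull f δ) = T'.distLin δ := by
  have h := isCoordEmb_pull f
  rw [distLin_apply, distLin_apply]
  refine (Fintype.sum_of_injective (edgePre f) h.inj _ _ (fun e he => ?_) fun e => ?_).symm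
  · rw [h.apply_of_notMem _ _ he, zero_smul]
  · rw [h.apply, edgeDist_edgePre]

end GCat

theorem isFace_univ {N : Type u} [AddCommGroup N] {τ : Set (ℝ ⊗[ℤ] N)} (h : IsFace Set.univ τ) :
    τ = Set.univ := by
  obtain ⟨-, f, hf, rfl⟩ := h
  refine Set.eq_univ_iff_forall.2 fun x => ⟨trivial, ?_⟩
  have := hf (-x) trivial
  rw [map_neg] at this
  linarith

/-- The distance map of rational curves. -/
def distMor (U : Type u) {Λ : Type u} (A : Finset Λ) :
    PoicMor (Mtrop U 0 A) (wholeComplex.{u, u} (Ndist A)) where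
  functor := (Functor.const _).obj ⟨PUnit.unit⟩
  η :=
    { app := fun T => ⟨T.unop.distLin, fun _ _ => trivial⟩
      naturality := fun T T' f => Poic.hom_ext (LinearMap.ext fun δ => by
        exact GCat.distLin_pull f.unop δ) }
  not_in_proper_face _ _ hτ _ := isFace_univ hτ

theorem isDist_distMor (U : Type u) {Λ : Type u} (A : Finset Λ) : IsDist (distMor U A) := by
  intro T δ
  refine ⟨fun q => ∑ e : T.Edge, δ e * splitVector A (T.split (DGraph.exists_edgeOf e).choose) q,
    fun q i j hq => ?_, ?_⟩
  · have hr := T.conn' (DGraph.isVertex_r (T.leg i)) (DGraph.isVertex_r (T.leg j))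
    obtain ⟨p, hp⟩ := DGraph.exists_isWalk hr
    obtain ⟨p, hp⟩ := DGraph.exists_isPath p hp
    refine ⟨p, hp, ?_⟩
    rw [DGraph.sum_flagLen_eq δ p hp.1]
    push_cast
    refine Finset.sum_congr rfl fun e _ => ?_
    obtain ⟨h, hh, rfl⟩ := DGraph.exists_edgeOf e
    congr 1
    rw [T.splitVector_edge hh, splitVector_pair hq]
    simp only [T.mem_split]
    have := T.count_of_path hh (DGraph.isVertex_r _) (DGraph.isVertex_r _) hp
    show _ = ((_ : ℕ) : ℝ)
    rw [show (DGraph.edgeOf h hh).1 = s(h, T.ι h) from rfl, this]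
    split_ifs <;> simp
  · show (T.distLin δ : QSpace A) = _
    rw [GCat.distLin_apply]
    have : (fun q => ∑ e : T.Edge, (δ e : ℝ) *
        splitVector A (T.split (DGraph.exists_edgeOf e).choose) q) =
        ∑ e : T.Edge, (δ e : ℝ) • splitVector A (T.split (DGraph.exists_edgeOf e).choose) := by
      funext q
      rw [Finset.sum_apply]
      rfl
    rw [this]
    unfold QSpace.mk
    rw [map_sum]
    push_cast
    refine Finset.sum_congr rfl fun e _ => ?_
    rw [map_smul, Int.cast_smul_eq_zsmul]
    rfl

/-! ### The vertex of a marked leg -/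

namespace GCat

open DGraph

variable {U Λ : Type u} {g : ℕ} {A B : Finset Λ} {G H : GCat U g A} {a : A} {f p f' p' : G.F}

/-- The vertex `V_a` is trivalent, and the flags there are the `a`-leg, the flag `f` of an edge, and
a flag `p` of an edge or a leg. -/
structure IsTri (G : GCat U g A) (a : A) (f p : G.F) : Prop where
  ι_ne : G.ι f ≠ f
  ne : f ≠ p
  ne_leg : p ≠ G.leg a
  not_vertex : ¬ G.IsVertex p
  iff : ∀ x, G.r x = G.legVertex a ↔ x = G.leg a ∨ x = f ∨ x = p ∨ x = G.legVertex a

theorem isVertex_legVertex (G : GCat U g A) (a : A) : G.IsVertex (G.legVertex a) := isVertex_r _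

theorem TwoEdges.isTri (h : G.TwoEdges a f p) : G.IsTri a f p where
  ι_ne := h.2.1
  ne := h.1
  ne_leg he := h.2.2.1 (by rw [he, G.ι_leg])
  not_vertex := not_isVertex_of_ne h.2.2.1
  iff := h.2.2.2

theorem EdgeAndLeg.isTri (h : G.EdgeAndLeg a p f) : G.IsTri a f p where
  ι_ne := h.2.2.1
  ne he := h.2.2.1 (by rw [he]; exact h.1.2)
  ne_leg := h.2.1
  not_vertex := h.1.1
  iff x := by rw [h.2.2.2]; tauto

namespace IsTri

theorem twoEdges (h : G.IsTri a f p) (hp : G.ι p ≠ p) : G.TwoEdges a f p :=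
  ⟨h.ne, h.ι_ne, hp, h.iff⟩

theorem edgeAndLeg (h : G.IsTri a f p) (hp : G.ι p = p) : G.EdgeAndLeg a p f :=
  ⟨⟨h.not_vertex, hp⟩, h.ne_leg, h.ι_ne, fun x => by rw [h.iff]; tauto⟩

theorem swap (h : G.IsTri a f p) (hp : G.ι p ≠ p) : G.IsTri a p f where
  ι_ne := hp
  ne := h.ne.symm
  ne_leg he := h.ι_ne (by rw [he, G.ι_leg])
  not_vertex := not_isVertex_of_ne h.ι_ne
  iff x := by rw [h.iff]; tauto

theorem r_f (h : G.IsTri a f p) : G.r f = G.legVertex a := (h.iff f).2 (Or.inr (Or.inl rfl))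

theorem r_p (h : G.IsTri a f p) : G.r p = G.legVertex a :=
  (h.iff p).2 (Or.inr (Or.inr (Or.inl rfl)))

theorem f_ne_leg (h : G.IsTri a f p) : f ≠ G.leg a := fun he => h.ι_ne (by rw [he, G.ι_leg])

theorem f_not_vertex (h : G.IsTri a f p) : ¬ G.IsVertex f := not_isVertex_of_ne h.ι_ne

theorem unique (h : G.IsTri a f p) (h' : G.IsTri a f' p') :
    (f' = f ∧ p' = p) ∨ (f' = p ∧ p' = f) := by
  have h1 := (h.iff f').1 h'.r_f
  have h2 := (h.iff p').1 h'.r_p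
  have h3 : f' ≠ G.legVertex a := fun he => h'.f_not_vertex (he ▸ G.isVertex_legVertex a)
  have h4 : p' ≠ G.legVertex a := fun he => h'.not_vertex (he ▸ G.isVertex_legVertex a)
  have h5 := h'.f_ne_leg
  have h6 := h'.ne_leg
  have h7 := h'.ne
  rcases h1 with h1 | h1 | h1 | h1 <;> rcases h2 with h2 | h2 | h2 | h2 <;>
    first
    | exact absurd h1 h5 | exact absurd h2 h6 | exact absurd h1 h3 | exact absurd h2 h4
    | exact absurd (h1.trans h2.symm) h7 | exact Or.inl ⟨h1, h2⟩ | exact Or.inr ⟨h1, h2⟩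

theorem val_le (h : G.IsTri a f p) : ¬ 3 < G.val (G.legVertex a) := by
  rw [val_eq _ (G.isVertex_legVertex a), not_lt]
  have : (Finset.univ.filter fun x => G.r x = G.legVertex a ∧ x ≠ G.legVertex a) ⊆
      {G.leg a, f, p} := by
    intro x hx
    obtain ⟨-, h1, h2⟩ := Finset.mem_filter.1 hx
    simp only [Finset.mem_insert, Finset.mem_singleton]
    rcases (h.iff x).1 h1 with h3 | h3 | h3 | h3
    · exact Or.inl h3
    · exact Or.inr (Or.inl h3)
    · exact Or.inr (Or.inr h3)
    · exact absurd h3 h2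
  exact (Finset.card_le_card this).trans Finset.card_le_three

end IsTri

/-- If all flags at the vertex `v` end at `v`, then there is no other vertex. -/
theorem root_eq_of_closed (G : GCat U g A) {v : G.F} (hv : G.IsVertex v)
    (h : ∀ x, G.r x = v → G.r (G.ι x) = v) (x : G.F) : G.r x = v := by
  refine (FlagReach.induct (c := fun w => w = v) (fun y _ => ⟨h y, fun hy => ?_⟩)
    (G.conn' hv (isVertex_r x))).1 rfl
  have := h _ hy
  rwa [G.ι_ι] at this

/-- The edges at the trivalent vertex `V_a` are not loops, because the graph has more than one
vertex. -/
theorem IsTri.root_ne (hst : 3 < 2 * g + A.card) (h : G.IsTri a f p) :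
    G.r (G.ι f) ≠ G.legVertex a := by
  intro hf
  have h1 : G.ι f = p := by
    rcases (h.iff _).1 hf with h1 | h1 | h1 | h1
    · exact absurd (by rw [← G.ι_ι f, h1, G.ι_leg]) h.f_ne_leg
    · exact absurd h1 h.ι_ne
    · exact h1
    · have := isVertex_ι.1 (h1 ▸ G.isVertex_legVertex a)
      exact absurd this h.f_not_vertex
  have h2 := G.root_eq_of_closed (G.isVertex_legVertex a) fun x hx => by
    rcases (h.iff x).1 hx with rfl | rfl | rfl | rfl
    · rw [G.ι_leg]; rfl
    · exact hf
    · rw [← h1, G.ι_ι]; exact h.r_f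
    · rw [ι_of_isVertex (G.isVertex_legVertex a)]; exact hx
  have h3 : A.card = 1 := by
    refine Finset.card_eq_one.2 ⟨a.1, Finset.eq_singleton_iff_unique_mem.2 ⟨a.2, fun b hb => ?_⟩⟩
    have : G.leg ⟨b, hb⟩ = G.leg a := by
      rcases (h.iff _).1 (h2 (G.leg ⟨b, hb⟩)) with h3 | h3 | h3 | h3
      · exact h3
      · exact absurd (by rw [← h3, G.ι_leg]) h.ι_ne
      · exact absurd (by rw [← G.ι_ι f, h1, ← h3, G.ι_leg]) h.ne
      · exact absurd (h3 ▸ G.isVertex_legVertex a) (G.leg_not_vertex _)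
    exact congrArg Subtype.val (G.leg_injective this)
  have h4 : (Finset.univ.filter fun x => G.ι x ≠ x).card ≤ 2 := by
    refine (Finset.card_le_card (t := {f, p}) fun x hx => ?_).trans Finset.card_le_two
    have hx := (Finset.mem_filter.1 hx).2
    rw [Finset.mem_insert, Finset.mem_singleton]
    rcases (h.iff x).1 (h2 x) with h3 | h3 | h3 | h3
    · exact absurd (by rw [h3, G.ι_leg]) hx
    · exact Or.inl h3
    · exact Or.inr h3
    · exact absurd (by rw [h3, ι_of_isVertex (G.isVertex_legVertex a)]) hx
  have h5 : 1 ≤ (Finset.univ.filter fun x => G.IsVertex x).card :=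
    Finset.card_pos.2 ⟨G.legVertex a, by simpa using G.isVertex_legVertex a⟩
  have := G.card_flags
  omega

/-- If `V_a` is trivalent, then at least one of the other flags there belongs to an edge. -/
theorem exists_isTri (hst : 3 < 2 * g + A.card) (G : GCat U g A) (a : A)
    (hv : ¬ 3 < G.val (G.legVertex a)) : ∃ f p, G.IsTri a f p := by
  set S := Finset.univ.filter fun x => G.r x = G.legVertex a ∧ x ≠ G.legVertex a with hS
  have hmem : ∀ x, x ∈ S ↔ G.r x = G.legVertex a ∧ x ≠ G.legVertex a := by simp [hS]
  have hcard : S.card = 3 := by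
    have h1 := G.stable _ (G.isVertex_legVertex a)
    have h2 : G.val (G.legVertex a) = S.card := by
      rw [val_eq _ (G.isVertex_legVertex a)]
    omega
  have ha : G.leg a ∈ S := (hmem _).2 ⟨rfl, fun h =>
    G.leg_not_vertex a (h ▸ G.isVertex_legVertex a)⟩
  have h2 : (S.erase (G.leg a)).card = 2 := by rw [Finset.card_erase_of_mem ha, hcard]
  obtain ⟨x, y, hxy, hSxy⟩ := Finset.card_eq_two.1 h2
  have hx : x ∈ S.erase (G.leg a) := by rw [hSxy]; simp
  have hy : y ∈ S.erase (G.leg a) := by rw [hSxy]; simp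
  have hnv : ∀ z ∈ S.erase (G.leg a), ¬ G.IsVertex z := fun z hz hzv => by
    obtain ⟨-, h⟩ := Finset.mem_erase.1 hz
    exact ((hmem z).1 h).2 (hzv.symm.trans ((hmem z).1 h).1)
  have hiff : ∀ z, G.r z = G.legVertex a ↔ z = G.leg a ∨ z = x ∨ z = y ∨ z = G.legVertex a := by
    intro z
    have h3 : z ∈ S.erase (G.leg a) ↔ z = x ∨ z = y := by rw [hSxy]; simp
    rw [Finset.mem_erase, hmem] at h3
    by_cases h4 : z = G.legVertex a
    · rw [h4]; exact ⟨fun _ => Or.inr (Or.inr (Or.inr rfl)), fun _ => G.r_r _⟩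
    by_cases h5 : z = G.leg a
    · rw [h5]; exact ⟨fun _ => Or.inl rfl, fun _ => rfl⟩
    simp only [h4, h5, ne_eq, not_false_eq_true, true_and, and_true, or_false, false_or] at h3 ⊢
    exact h3
  by_cases hιx : G.ι x = x
  · by_cases hιy : G.ι y = y
    · exfalso
      have hall := G.root_eq_of_closed (G.isVertex_legVertex a) fun z hz => by
        rcases (hiff z).1 hz with rfl | rfl | rfl | rfl
        · rw [G.ι_leg]; rfl
        · rw [hιx]; exact hz
        · rw [hιy]; exact hz
        · rw [ι_of_isVertex (G.isVertex_legVertex a)]; exact hz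
      have hno : (Finset.univ.filter fun z => G.ι z ≠ z) = ∅ := by
        refine Finset.filter_eq_empty_iff.2 fun z _ hz => hz ?_
        rcases (hiff z).1 (hall z) with rfl | rfl | rfl | rfl
        · rw [G.ι_leg]
        · exact hιx
        · exact hιy
        · exact ι_of_isVertex (G.isVertex_legVertex a)
      have h5 : 1 ≤ (Finset.univ.filter fun x => G.IsVertex x).card :=
        Finset.card_pos.2 ⟨G.legVertex a, by simpa using G.isVertex_legVertex a⟩
      have h6 := G.card_flags
      rw [hno, Finset.card_empty] at h6
      have h7 : A.card ≤ S.card := by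
        have : Fintype.card A ≤ Fintype.card S := Fintype.card_le_of_injective
          (fun b => (⟨G.leg b, (hmem _).2 ⟨hall _, fun h => G.leg_not_vertex b
            (h ▸ G.isVertex_legVertex a)⟩⟩ : S))
          fun b c h => G.leg_injective (congrArg Subtype.val h)
        simpa using this
      omega
    · exact ⟨y, x, hιy, hxy.symm, (Finset.mem_erase.1 hx).1, hnv x hx, fun z => by
        rw [hiff]; tauto⟩
  · exact ⟨x, y, hιx, hxy, (Finset.mem_erase.1 hy).1, hnv y hy, hiff⟩

/-! ### The names of flags after forgetting a mark -/

/-- The flag whose name is used for the flag of `ft_a G` over the flag `h` of `G`: of the two flags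
that are merged when `V_a` lies on two edges, it is the one away from `V_a`; a leg that is moved
along an edge lies over this edge. -/
def nameOf (G : GCat U g A) (a : A) (h : G.F) : G.F :=
  if H : ∃ f, G.TwoEdges a f h then G.ι H.choose
  else if H : ∃ l f, G.EdgeAndLeg a l f ∧ (h = f ∨ h = G.ι f) then H.choose else h

theorem nameOf_of_val (hv : 3 < G.val (G.legVertex a)) (h : G.F) : G.nameOf a h = h := by
  unfold nameOf
  rw [dif_neg fun ⟨f, hf⟩ => hf.isTri.val_le hv, dif_neg fun ⟨l, f, hf, _⟩ => hf.isTri.val_le hv]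

namespace IsTri

theorem nameOf_two (t : G.IsTri a f p) (hp : G.ι p ≠ p) (h : G.F) :
    G.nameOf a h = if h = p then G.ι f else if h = f then G.ι p else h := by
  unfold nameOf
  by_cases H : ∃ f, G.TwoEdges a f h
  · rw [dif_pos H]
    rcases t.unique H.choose_spec.isTri with ⟨h1, h2⟩ | ⟨h1, h2⟩
    · rw [h1, if_pos h2]
    · rw [h1, if_neg fun h3 => t.ne (h2.symm.trans h3), if_pos h2]
  · rw [dif_neg H, if_neg, if_neg, dif_neg]
    · rintro ⟨l, f', hl, -⟩
      rcases t.unique hl.isTri with ⟨-, h2⟩ | ⟨-, h2⟩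
      · rw [h2] at hl; exact hp hl.1.2
      · rw [h2] at hl; exact t.ι_ne hl.1.2
    · rintro rfl; exact H ⟨p, (t.swap hp).twoEdges t.ι_ne⟩
    · rintro rfl; exact H ⟨f, t.twoEdges hp⟩

theorem nameOf_leg (t : G.IsTri a f p) (hp : G.ι p = p) (h : G.F) :
    G.nameOf a h = if h = f ∨ h = G.ι f then p else h := by
  unfold nameOf
  rw [dif_neg]
  · by_cases H : ∃ l f, G.EdgeAndLeg a l f ∧ (h = f ∨ h = G.ι f)
    · rw [dif_pos H]
      obtain ⟨f', hl, hf'⟩ := H.choose_spec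
      rcases t.unique hl.isTri with ⟨h1, h2⟩ | ⟨h1, h2⟩
      · rw [if_pos (by rwa [h1] at hf'), h2]
      · exact absurd (by rw [h1]; exact hp) hl.2.2.1
    · rw [dif_neg H, if_neg fun h1 => H ⟨p, f, t.edgeAndLeg hp, h1⟩]
  · rintro ⟨f', h1⟩
    rcases t.unique h1.isTri with ⟨-, h2⟩ | ⟨h2, -⟩
    · rw [h2] at h1; exact h1.2.2.1 hp
    · rw [h2] at h1; exact h1.2.1 hp

theorem ι_f_ne (hst : 3 < 2 * g + A.card) (t : G.IsTri a f p) : G.ι f ≠ p := fun h =>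
  t.root_ne hst (by rw [h]; exact t.r_p)

theorem nameOf_p (t : G.IsTri a f p) : G.nameOf a p = if G.ι p = p then p else G.ι f := by
  by_cases hp : G.ι p = p
  · rw [if_pos hp, t.nameOf_leg hp, if_neg]
    rintro (h | h)
    · exact t.ne h.symm
    · exact t.ne (by rw [← G.ι_ι f, ← h, hp])
  · rw [if_neg hp, t.nameOf_two hp, if_pos rfl]

theorem nameOf_ι_f (hst : 3 < 2 * g + A.card) (t : G.IsTri a f p) :
    G.nameOf a (G.ι f) = G.nameOf a p := by
  rw [t.nameOf_p]
  by_cases hp : G.ι p = p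
  · rw [if_pos hp, t.nameOf_leg hp, if_pos (Or.inr rfl)]
  · rw [if_neg hp, t.nameOf_two hp, if_neg (t.ι_f_ne hst), if_neg t.ι_ne]

theorem nameOf_ι_p (hst : 3 < 2 * g + A.card) (t : G.IsTri a f p) :
    G.nameOf a (G.ι p) = G.nameOf a f := by
  by_cases hp : G.ι p = p
  · rw [hp, t.nameOf_p, if_pos hp, t.nameOf_leg hp, if_pos (Or.inl rfl)]
  · exact (t.swap hp).nameOf_ι_f hst

theorem nameOf_of_ne (t : G.IsTri a f p) {h : G.F} (h1 : h ≠ f) (h2 : h ≠ G.ι f) (h3 : h ≠ p) :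
    G.nameOf a h = h := by
  by_cases hp : G.ι p = p
  · rw [t.nameOf_leg hp, if_neg (by tauto)]
  · rw [t.nameOf_two hp, if_neg h3, if_neg h1]

end IsTri

theorem nameOf_cases (hst : 3 < 2 * g + A.card) (G : GCat U g A) (a : A) :
    (3 < G.val (G.legVertex a)) ∨ ∃ f p, G.IsTri a f p := by
  by_cases h : 3 < G.val (G.legVertex a)
  · exact Or.inl h
  · exact Or.inr (G.exists_isTri hst a h)

theorem nameOf_vertex_iff (hst : 3 < 2 * g + A.card) (h : G.F) :
    G.IsVertex (G.nameOf a h) ↔ G.IsVertex h := by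
  rcases G.nameOf_cases hst a with hv | ⟨f, p, t⟩
  · rw [nameOf_of_val hv]
  have hf := t.f_not_vertex
  have hf' : ¬ G.IsVertex (G.ι f) := fun h => hf (isVertex_ι.1 h)
  have hp := t.not_vertex
  have hp' : ¬ G.IsVertex (G.ι p) := fun h => hp (isVertex_ι.1 h)
  by_cases hιp : G.ι p = p
  · rw [t.nameOf_leg hιp]
    split_ifs with h1
    · rcases h1 with rfl | rfl <;> tauto
    · rfl
  · rw [t.nameOf_two hιp]
    split_ifs with h1 h2
    · subst h1; tauto
    · subst h2; tauto
    · rfl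

theorem nameOf_leg (hst : 3 < 2 * g + A.card) (b : A) : G.nameOf a (G.leg b) = G.leg b := by
  rcases G.nameOf_cases hst a with h | ⟨f, p, t⟩
  · exact nameOf_of_val h _
  · by_cases hp : G.leg b = p
    · rw [hp, t.nameOf_p, if_pos (by rw [← hp, G.ι_leg])]
    · refine t.nameOf_of_ne ?_ ?_ hp
      · rintro rfl; exact t.ι_ne (G.ι_leg b)
      · intro h
        have h2 : f = G.leg b := (G.ι_ι f).symm.trans (by rw [← h, G.ι_leg])
        exact t.ι_ne (by rw [h2, G.ι_leg])

/-- Flags with the same name have opposite flags with the same name. -/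
theorem nameOf_ι_congr (hst : 3 < 2 * g + A.card) {h h' : G.F}
    (hh : G.nameOf a h = G.nameOf a h') : G.nameOf a (G.ι h) = G.nameOf a (G.ι h') := by
  have key : ∀ h : G.F, G.nameOf a (G.ι (G.nameOf a h)) = G.nameOf a (G.ι h) := by
    intro h
    rcases G.nameOf_cases hst a with hv | ⟨f, p, t⟩
    · rw [nameOf_of_val hv h]
    by_cases h1 : h = f
    · subst h1
      rw [t.nameOf_ι_f hst]
      by_cases hp : G.ι p = p
      · rw [t.nameOf_leg hp h, if_pos (Or.inl rfl), hp]
      · rw [t.nameOf_two hp h, if_neg t.ne, if_pos rfl, G.ι_ι]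
    by_cases h2 : h = G.ι f
    · subst h2
      rw [t.nameOf_ι_f hst, t.nameOf_p, G.ι_ι]
      split_ifs with hp
      · rw [t.nameOf_ι_p hst]
      · rw [G.ι_ι]
    by_cases h3 : h = p
    · subst h3
      rw [t.nameOf_p, t.nameOf_ι_p hst]
      split_ifs with hp
      · rw [t.nameOf_ι_p hst]
      · rw [G.ι_ι]
    rw [t.nameOf_of_ne h1 h2 h3]
  rw [← key h, hh, key]

end GCat

/-! ### Forgetting a mark on objects -/

/-- The set `B` arises from `A` by removing `a`. -/
abbrev IsErase {α : Type*} (B A : Finset α) (a : α) : Prop := ∀ x, x ∈ B ↔ x ∈ A ∧ x ≠ a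

namespace GCat

open DGraph

variable {U Λ : Type u} {g : ℕ} {A B : Finset Λ} {G H : GCat U g A} {a : A} {f p : G.F}

/-- The map `c` presents `G'` as the graph obtained from `G` by removing the `a`-leg and contracting
the edges with flags in `E`, the remaining flags being named by `nameOf`. -/
structure IsQuot (G : GCat U g A) (a : A) (G' : GCat U g B) (E : G.F → Prop) (c : G.F → G'.F) :
    Prop where
  map_r : ∀ x, c (G.r x) = G'.r (c x)
  map_ι : ∀ x, c (G.ι x) = G'.ι (c x)
  map_leg : ∀ (b' : B) (b : A), b'.1 = b.1 → c (G.leg b) = G'.leg b'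
  vertex_iff : ∀ x, G'.IsVertex (c x) ↔ G.IsVertex x ∨ x = G.leg a ∨ E x
  flag : ∀ y, ¬ G'.IsVertex y → ∃! x, c x = y
  fiber : ∀ v w, G.IsVertex v → G.IsVertex w → c v = c w →
    G.Reach (fun h => G'.IsVertex (c h)) v w
  name : ∀ x, ¬ G'.IsVertex (c x) → (c x).1 = (G.nameOf a x).1
  name_vertex : ∀ v, G.IsVertex v → (v ≠ G.legVertex a ∨ ∀ x, ¬ E x) → (c v).1 = v.1

/-- If `V_a` is trivalent, then `ft_a G` arises from the contraction of an edge at `V_a`. -/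
theorem exists_quot_of_isTri (hst : 3 < 2 * g + A.card) (hB : IsErase B A a.1)
    (t : G.IsTri a f p) : ∃ G' : GCat U g B, G.IsForget a G' ∧
      ∃ c, G.IsQuot a G' (fun x => x = f ∨ x = G.ι f) c := by
  have hroot := t.root_ne hst
  have hrf := t.r_f
  have hf : G.r f ≠ G.r (G.ι f) := fun h => hroot (by rw [← h, hrf])
  have hBA : B ⊆ A := fun x hx => ((hB x).1 hx).1
  have hmark : ∀ b : A, b.1 ∉ B → b = a := fun b hb => by
    by_contra hne
    exact hb ((hB _).2 ⟨b.2, fun h => hne (Subtype.ext h)⟩)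
  have haB : a.1 ∉ B := fun h => ((hB _).1 h).2 rfl
  have hleg : ∀ b : A, b.1 ∉ B → G.r (G.leg b) = G.r f := fun b hb => by
    rw [hmark b hb, hrf]; rfl
  have hR : ∀ x, G.Remains B f x ↔ x ≠ f ∧ x ≠ G.ι f ∧ x ≠ G.legVertex a ∧ x ≠ G.leg a := by
    intro x
    unfold Remains
    rw [hrf]
    refine and_congr_right fun _ => and_congr_right fun _ => and_congr_right fun _ =>
      ⟨fun h => h a haB, fun h b hb => ?_⟩
    rw [hmark b hb]; exact h
  have hιfp := t.ι_f_ne hst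
  have hpV : p ≠ G.legVertex a := fun h => t.not_vertex (h ▸ G.isVertex_legVertex a)
  have hpR : G.Remains B f p := (hR p).2 ⟨t.ne.symm, hιfp.symm, hpV, t.ne_leg⟩
  -- a merged edge is named by its ends away from `V_a`
  have he : Function.Injective fun x : {x // G.Remains B f x} =>
      if x.1 = p ∧ G.ι p ≠ p then (G.ι f).1 else x.1.1 := by
    intro x y hxy
    refine Subtype.ext ?_
    dsimp only at hxy
    have hx := ((hR _).1 x.2).2.1
    have hy := ((hR _).1 y.2).2.1
    split_ifs at hxy with h1 h2 h2
    · rw [h1.1, h2.1]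
    · exact absurd (Subtype.ext hxy).symm hy
    · exact absurd (Subtype.ext hxy) hx
    · exact Subtype.ext hxy
  let e : {x // G.Remains B f x} ↪ U := ⟨_, he⟩
  have e_def : ∀ x, e x = if x.1 = p ∧ G.ι p ≠ p then (G.ι f).1 else x.1.1 := fun _ => rfl
  have hs := isStableGraph_contract hf hBA hleg ⟨p, by rw [t.r_p, hrf], t.not_vertex, t.ne.symm,
    fun b hb => by rw [hmark b hb]; exact t.ne_leg⟩
  let G' : GCat U g B := ofEmb e hs
  let c : G.F → G'.F := fun x => toEmb e hs (squeeze hf B x)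
  have hcR : ∀ x (h : G.Remains B f x), (c x).1 = if x = p ∧ G.ι p ≠ p then (G.ι f).1 else x.1 :=
    fun x h => by
      show e (squeeze hf B x) = _
      rw [squeeze_of hf h, e_def]
  have hcr : ∀ x, c (G.r x) = G'.r (c x) := fun x => by
    show toEmb e hs _ = (ofEmb e hs).r (toEmb e hs _)
    rw [ofEmb_r, squeeze_r hf hleg]
  have hcι : ∀ x, c (G.ι x) = G'.ι (c x) := fun x => by
    show toEmb e hs _ = (ofEmb e hs).ι (toEmb e hs _)
    rw [ofEmb_ι, squeeze_ι hf]
  have hcleg : ∀ (b' : B) (b : A), b'.1 = b.1 → c (G.leg b) = G'.leg b' := fun b' b h => by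
    obtain rfl : b = ⟨b'.1, hBA b'.2⟩ := Subtype.ext h.symm
    show toEmb e hs _ = (ofEmb e hs).leg b'
    rw [ofEmb_leg, squeeze_of hf (remains_leg hf hBA b')]
  have hcsurj : ∀ y : G'.F, ∃ x, G.Remains B f x ∧ c x = y := fun y => by
    obtain ⟨z, rfl⟩ := (toEmb e hs).surjective y
    exact ⟨z.1, z.2, by show toEmb e hs _ = _; rw [squeeze_of hf z.2]⟩
  have hmem : ∀ u, u ∈ G'.F ↔ ∃ x, G.Remains B f x ∧ (c x).1 = u := fun u => by
    constructor
    · intro hu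
      obtain ⟨x, hx, hxu⟩ := hcsurj ⟨u, hu⟩
      exact ⟨x, hx, congrArg Subtype.val hxu⟩
    · rintro ⟨x, -, rfl⟩
      exact (c x).2
  have hvert : ∀ x, G'.IsVertex (c x) ↔ G.IsVertex (squeeze hf B x).1 := fun x => by
    rw [← sqRoot_eq_iff hf]
    show (ofEmb e hs).r (toEmb e hs _) = toEmb e hs _ ↔ _
    rw [ofEmb_r, (toEmb e hs).apply_eq_iff_eq]
  have hcV : c (G.legVertex a) = c (G.r (G.ι f)) := by
    show toEmb e hs _ = toEmb e hs _
    rw [← hrf, squeeze_root_end]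
  have hcvert : ∀ v, G.IsVertex v → v ≠ G.legVertex a → (c v).1 = v.1 := fun v hv hne => by
    rw [hcR v ((remains_of_vertex hf hv).2 (by rwa [hrf])), if_neg]
    rintro ⟨rfl, -⟩
    exact t.not_vertex hv
  have htwo : ∀ {f₁ f₂}, G.TwoEdges a f₁ f₂ → G.ι p ≠ p := fun h12 => by
    rcases t.unique h12.isTri with ⟨-, h2⟩ | ⟨h1, -⟩
    · rw [← h2]; exact h12.2.2.1
    · rw [← h1]; exact h12.2.1
  have hone : ∀ {l f'}, G.EdgeAndLeg a l f' → f' = f ∧ l = p := fun hl => by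
    rcases t.unique hl.isTri with h | ⟨h1, h2⟩
    · exact h
    · rw [h2] at hl; exact absurd hl.1.2 t.ι_ne
  refine ⟨G', ⟨?_, ?_, ?_, ?_, ?_, ?_, ?_⟩, c, ⟨hcr, hcι, hcleg, ?_, ?_, ?_, ?_, ?_⟩⟩
  · intro b' b h
    rw [← hcleg b' b h]
    obtain rfl : b = ⟨b'.1, hBA b'.2⟩ := Subtype.ext h.symm
    rw [hcR _ (remains_leg hf hBA b'), if_neg]
    rintro ⟨h1, h2⟩
    exact h2 (by rw [← h1, G.ι_leg])
  · exact fun h => absurd h t.val_le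
  · exact fun h => absurd h t.val_le
  · intro f₁ f₂ h12 u
    have hιp := htwo h12
    rw [hmem]
    constructor
    · rintro ⟨x, hx, rfl⟩
      rw [hcR x hx]
      by_cases hxp : x = p
      · exact ⟨G.ι f, by rw [if_pos ⟨hxp, hιp⟩], hroot⟩
      · refine ⟨x, by rw [if_neg fun h => hxp h.1], fun h => ?_⟩
        have := (hR x).1 hx
        have := (t.iff x).1 h
        tauto
    · rintro ⟨y, rfl, hy⟩
      have h1 := mt (t.iff y).2 hy
      push Not at h1
      by_cases h2 : y = G.ι f
      · exact ⟨p, hpR, by rw [hcR p hpR, if_pos ⟨rfl, hιp⟩, h2]⟩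
      · have hyR := (hR y).2 ⟨h1.2.1, h2, h1.2.2.2, h1.1⟩
        exact ⟨y, hyR, by rw [hcR y hyR, if_neg fun h => h1.2.2.1 h.1]⟩
  · intro f₁ f₂ h12 x y hxy
    have hιp := htwo h12
    have hif : (if y = G.ι f₁ then G.ι f₂ else if y = G.ι f₂ then G.ι f₁ else G.ι y) =
        if y = G.ι f then G.ι p else if y = G.ι p then G.ι f else G.ι y := by
      rcases t.unique h12.isTri with ⟨h1, h2⟩ | ⟨h1, h2⟩
      · rw [h1, h2]
      · rw [h1, h2]
        by_cases h3 : y = G.ι p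
        · have : y ≠ G.ι f := fun h => t.ne (by rw [← G.ι_ι f, ← h, h3, G.ι_ι])
          rw [if_pos h3, if_neg this, if_pos h3]
        · rw [if_neg h3, if_neg h3]
    rw [hif]
    obtain ⟨z, hz, rfl⟩ := hcsurj x
    rw [← hcr, ← hcι]
    have hιz : G.Remains B f (G.ι z) := hz.ι
    rw [hcR z hz] at hxy
    rw [hcR (G.ι z) hιz]
    by_cases hzp : z = p
    · rw [if_pos ⟨hzp, hιp⟩] at hxy
      obtain rfl : G.ι f = y := Subtype.ext hxy
      rw [if_pos rfl, hzp, if_neg fun h => hιp h.1, t.r_p, hcV,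
        hcvert _ (isVertex_r _) hroot]
      exact ⟨rfl, rfl⟩
    · rw [if_neg fun h => hzp h.1] at hxy
      obtain rfl : z = y := Subtype.ext hxy
      have hzR := (hR z).1 hz
      have hrz : G.r z ≠ G.legVertex a := fun h => by have := (t.iff z).1 h; tauto
      rw [if_neg hzR.2.1, hcvert _ (isVertex_r _) hrz]
      refine ⟨rfl, ?_⟩
      by_cases hzp' : G.ι z = p
      · rw [if_pos ⟨hzp', hιp⟩, if_pos (by rw [← hzp', G.ι_ι])]
      · rw [if_neg fun h => hzp' h.1, if_neg fun h => hzp' (by rw [h, G.ι_ι])]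
  · intro l f' hl u
    obtain ⟨rfl, rfl⟩ := hone hl
    rw [hmem]
    have hnp : ∀ x : G.F, ¬ (x = l ∧ G.ι l ≠ l) := fun x h => h.2 hl.1.2
    constructor
    · rintro ⟨x, hx, rfl⟩
      rw [hcR x hx, if_neg (hnp x)]
      have := (hR x).1 hx
      exact ⟨x, rfl, this.2.2.2, this.1, this.2.1, this.2.2.1⟩
    · rintro ⟨y, rfl, h1, h2, h3, h4⟩
      have hy := (hR y).2 ⟨h2, h3, h4, h1⟩
      exact ⟨y, hy, by rw [hcR y hy, if_neg (hnp y)]⟩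
  · intro l f' hl x y hxy
    obtain ⟨rfl, rfl⟩ := hone hl
    have hnp : ∀ x : G.F, ¬ (x = l ∧ G.ι l ≠ l) := fun x h => h.2 hl.1.2
    obtain ⟨z, hz, rfl⟩ := hcsurj x
    have hιz : G.Remains B f' (G.ι z) := hz.ι
    rw [← hcr, ← hcι, hcR _ hιz, if_neg (hnp _)]
    rw [hcR _ hz, if_neg (hnp _)] at hxy
    obtain rfl : z = y := Subtype.ext hxy
    refine ⟨?_, rfl⟩
    split_ifs with h
    · rw [h, t.r_p, hcV, hcvert _ (isVertex_r _) hroot]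
    · have hzR := (hR z).1 hz
      exact hcvert _ (isVertex_r _) fun h => by have := (t.iff z).1 h; tauto
  · intro x
    rw [hvert, squeeze_vertex_iff, hR]
    have hV := G.isVertex_legVertex a
    by_cases h1 : x = f <;> by_cases h2 : x = G.ι f <;> by_cases h3 : x = G.leg a <;>
      by_cases h4 : x = G.legVertex a <;> simp [h1, h2, h3, h4, hV]
  · intro y hy
    obtain ⟨z, hz, rfl⟩ := hcsurj y
    rw [hvert] at hy
    obtain ⟨x, hx, hxu⟩ := squeeze_flag hf hy
    refine ⟨x, ?_, fun x' hx' => hxu x' ?_⟩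
    · show toEmb e hs _ = toEmb e hs _
      rw [hx]
    · exact (toEmb e hs).injective hx'
  · intro v w hv hw hvw
    refine (squeeze_fiber hf hv hw ((toEmb e hs).injective hvw)).mono fun h hh => ?_
    exact (hvert h).2 hh
  · intro x hx
    rw [hvert, squeeze_vertex_iff, not_or, not_not] at hx
    have hxR := (hR x).1 hx.2
    rw [hcR x hx.2]
    by_cases hιp : G.ι p = p
    · rw [if_neg fun h => h.2 hιp, t.nameOf_leg hιp, if_neg (by tauto)]
    · rw [t.nameOf_two hιp, if_neg hxR.1]
      by_cases hxp : x = p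
      · rw [if_pos ⟨hxp, hιp⟩, if_pos hxp]
      · rw [if_neg fun h => hxp h.1, if_neg hxp]
  · intro v hv h
    refine hcvert v hv (h.resolve_right fun h => h f (Or.inl rfl))

/-- If `V_a` has valency more than three, then the leg can simply be removed. -/
theorem exists_quot_of_val (hB : IsErase B A a.1)
    (hval : 3 < G.val (G.legVertex a)) : ∃ G' : GCat U g B, G.IsForget a G' ∧
      ∃ c, G.IsQuot a G' (fun _ => False) c := by
  have hBA : B ⊆ A := fun x hx => ((hB x).1 hx).1
  have hι : ∀ x : {x // x ≠ G.leg a}, G.ι x.1 ≠ G.leg a := fun x h =>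
    x.2 (by rw [← G.ι_ι x.1, h, G.ι_leg])
  have hr : ∀ x, G.r x ≠ G.leg a := fun x h => G.leg_not_vertex a (h ▸ isVertex_r x)
  have hl : ∀ b : B, G.leg ⟨b.1, hBA b.2⟩ ≠ G.leg a := fun b h =>
    ((hB _).1 b.2).2 (congrArg Subtype.val (G.leg_injective h))
  let r' : {x // x ≠ G.leg a} → {x // x ≠ G.leg a} := fun x => ⟨G.r x.1, hr _⟩
  let ι' : {x // x ≠ G.leg a} → {x // x ≠ G.leg a} := fun x => ⟨G.ι x.1, hι x⟩
  let l' : B → {x // x ≠ G.leg a} := fun b => ⟨G.leg ⟨b.1, hBA b.2⟩, hl b⟩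
  have hV : ∀ x : {x // x ≠ G.leg a}, r' x = x ↔ G.IsVertex x.1 := fun x =>
    ⟨fun h => congrArg Subtype.val h, fun h => Subtype.ext h⟩
  have hs : IsStableGraph g B r' ι' l' := by
    refine ⟨fun x => Subtype.ext (G.r_r _), fun x => Subtype.ext (G.ι_ι _),
      fun x => Subtype.ext (G.ι_r _), fun b b' h => ?_, fun x => ?_, ⟨⟨_, hr (G.leg a)⟩⟩,
      ?_, ?_, ?_⟩
    · exact Subtype.ext (Subtype.mk.inj (G.leg_injective (Subtype.mk.inj h)))
    · rw [hV, Subtype.ext_iff]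
      refine Iff.trans (G.leg_range x.1) ⟨?_, ?_⟩
      · rintro ⟨b, hb⟩
        refine ⟨⟨b.1, (hB _).2 ⟨b.2, fun h => x.2 ?_⟩⟩, Subtype.ext hb⟩
        rw [← hb, show b = a from Subtype.ext h]
      · rintro ⟨b, rfl⟩
        exact ⟨_, rfl⟩
    · intro v w hv hw
      let q : G.F → {x // x ≠ G.leg a} := fun x => if h : x = G.leg a then r' v else ⟨x, h⟩
      have hq : ∀ x (h : x ≠ G.leg a), q x = ⟨x, h⟩ := fun x h => dif_neg h
      have := (G.conn' ((hV v).1 hv) ((hV w).1 hw)).map (r' := r') (ι' := ι')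
        (R := fun _ => True) q fun h _ => ?_
      · rwa [hq _ v.2, hq _ w.2] at this
      · rw [hq _ (hr _), hq _ (hr _)]
        by_cases hh : h = G.leg a
        · exact FlagReach.of_eq (Subtype.ext (by rw [hh, G.ι_leg]))
        · exact FlagReach.step (r := r') (ι := ι') (h := ⟨h, hh⟩) trivial
    · have e1 : {h : {x // x ≠ G.leg a} // ι' h ≠ h} ≃ {h : G.F // G.ι h ≠ h} :=
        { toFun := fun h => ⟨h.1.1, fun hh => h.2 (Subtype.ext hh)⟩
          invFun := fun h => ⟨⟨h.1, fun hh => h.2 (by rw [hh, G.ι_leg])⟩,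
            fun hh => h.2 (congrArg Subtype.val hh)⟩
          left_inv := fun h => rfl
          right_inv := fun h => rfl }
      have e2 : {h : {x // x ≠ G.leg a} // r' h = h} ≃ {h : G.F // G.r h = h} :=
        { toFun := fun h => ⟨h.1.1, congrArg Subtype.val h.2⟩
          invFun := fun h => ⟨⟨h.1, fun hh => G.leg_not_vertex a (hh ▸ h.2)⟩, Subtype.ext h.2⟩
          left_inv := fun h => rfl
          right_inv := fun h => rfl }
      rw [Nat.card_congr e1, Nat.card_congr e2]
      exact G.isStableGraph.genus
    · intro v hv
      have hv' := (hV v).1 hv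
      set S := Finset.univ.filter fun x => G.r x = v.1 ∧ x ≠ v.1
      have hS : 2 < (S.erase (G.leg a)).card := by
        have h1 : G.val v.1 = S.card := val_eq _ hv'
        by_cases hva : v.1 = G.legVertex a
        · have := Finset.pred_card_le_card_erase (s := S) (a := G.leg a)
          rw [← hva] at hval
          omega
        · have := G.stable _ hv'
          rw [Finset.erase_eq_of_notMem fun h => hva (Finset.mem_filter.1 h).2.1.symm]
          omega
      have hnv : ∀ z ∈ S.erase (G.leg a), z ≠ G.leg a ∧ G.r z ≠ z ∧ G.r z = v.1 := fun z hz => by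
        obtain ⟨hz1, hz2⟩ := Finset.mem_erase.1 hz
        obtain ⟨-, hz2, hz3⟩ := Finset.mem_filter.1 hz2
        exact ⟨hz1, fun h => hz3 (h.symm.trans hz2), hz2⟩
      obtain ⟨p, q, s, hp, hq, hs, h1, h2, h3⟩ := Finset.two_lt_card_iff.1 hS
      obtain ⟨p1, h4, h7⟩ := hnv p hp
      obtain ⟨q1, h5, h8⟩ := hnv q hq
      obtain ⟨s1, h6, h9⟩ := hnv s hs
      have hne : ∀ {x y : G.F} (hx : x ≠ G.leg a) (hy : y ≠ G.leg a), x ≠ y →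
          (⟨x, hx⟩ : {x // x ≠ G.leg a}) ≠ ⟨y, hy⟩ := fun _ _ h h' => h (Subtype.mk.inj h')
      exact ⟨⟨p, p1⟩, ⟨q, q1⟩, ⟨s, s1⟩, hne _ _ h1, hne _ _ h2, hne _ _ h3,
        fun h => h4 (Subtype.mk.inj h), fun h => h5 (Subtype.mk.inj h),
        fun h => h6 (Subtype.mk.inj h), Subtype.ext h7, Subtype.ext h8, Subtype.ext h9⟩
  let e : {x // x ≠ G.leg a} ↪ U := ⟨fun x => x.1.1, fun x y h => Subtype.ext (Subtype.ext h)⟩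
  let G' : GCat U g B := ofEmb e hs
  let q : G.F → {x // x ≠ G.leg a} := fun x => if h : x = G.leg a then ⟨G.legVertex a, hr _⟩ else
    ⟨x, h⟩
  have hq : ∀ x (h : x ≠ G.leg a), q x = ⟨x, h⟩ := fun x h => dif_neg h
  have hqa : q (G.leg a) = ⟨G.legVertex a, hr _⟩ := dif_pos rfl
  let c : G.F → G'.F := fun x => toEmb e hs (q x)
  have hcx : ∀ x, x ≠ G.leg a → (c x).1 = x.1 := fun x h => by
    show e (q x) = _
    rw [hq x h]; rfl
  have hcr : ∀ x, c (G.r x) = G'.r (c x) := fun x => by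
    show toEmb e hs _ = (ofEmb e hs).r (toEmb e hs _)
    rw [ofEmb_r, hq _ (hr x)]
    by_cases hx : x = G.leg a
    · rw [hx, hqa]; exact congrArg _ (Subtype.ext (G.r_r _).symm)
    · rw [hq x hx]
  have hcι : ∀ x, c (G.ι x) = G'.ι (c x) := fun x => by
    show toEmb e hs _ = (ofEmb e hs).ι (toEmb e hs _)
    rw [ofEmb_ι]
    by_cases hx : x = G.leg a
    · rw [hx, G.ι_leg, hqa]; exact congrArg _ (Subtype.ext (G.ι_r _).symm)
    · rw [hq x hx, hq _ (hι ⟨x, hx⟩)]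
  have hcleg : ∀ (b' : B) (b : A), b'.1 = b.1 → c (G.leg b) = G'.leg b' := fun b' b h => by
    obtain rfl : b = ⟨b'.1, hBA b'.2⟩ := Subtype.ext h.symm
    show toEmb e hs _ = (ofEmb e hs).leg b'
    rw [ofEmb_leg, hq _ (hl b')]
  have hcsurj : ∀ y : G'.F, ∃ x, x ≠ G.leg a ∧ c x = y := fun y => by
    obtain ⟨z, rfl⟩ := (toEmb e hs).surjective y
    exact ⟨z.1, z.2, by show toEmb e hs _ = _; rw [hq _ z.2]⟩
  have hvert : ∀ x, G'.IsVertex (c x) ↔ G.IsVertex x ∨ x = G.leg a := fun x => by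
    show (ofEmb e hs).r (toEmb e hs _) = toEmb e hs _ ↔ _
    rw [ofEmb_r, (toEmb e hs).apply_eq_iff_eq, hV]
    by_cases hx : x = G.leg a
    · rw [hx, hqa]; simpa using G.isVertex_legVertex a
    · rw [hq x hx]; simp [hx]
  have habs : ∀ {f₁ f₂} {P : Prop}, G.IsTri a f₁ f₂ → P := fun h => absurd hval h.val_le
  refine ⟨G', ⟨?_, ?_, ?_, fun _ _ h => habs h.isTri, fun _ _ h => habs h.isTri,
    fun _ _ h => habs h.isTri, fun _ _ h => habs h.isTri⟩, c, hcr, hcι, hcleg, ?_, ?_, ?_, ?_, ?_⟩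
  · intro b' b h
    rw [← hcleg b' b h]
    refine hcx _ fun h' => ((hB _).1 b'.2).2 ?_
    rw [h, G.leg_injective h']
  · intro _ u
    constructor
    · intro hu
      obtain ⟨x, hx, hxu⟩ := hcsurj ⟨u, hu⟩
      exact ⟨x, by rw [← hcx x hx, hxu], hx⟩
    · rintro ⟨y, rfl, hy⟩
      rw [← hcx y hy]; exact (c y).2
  · intro _ x y hxy
    obtain ⟨z, hz, rfl⟩ := hcsurj x
    rw [hcx z hz] at hxy
    obtain rfl : z = y := Subtype.ext hxy
    rw [← hcr, ← hcι, hcx _ (hr _), hcx _ (hι ⟨z, hz⟩)]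
    exact ⟨rfl, rfl⟩
  · intro x
    rw [hvert, or_false]
  · intro y hy
    obtain ⟨z, hz, rfl⟩ := hcsurj y
    refine ⟨z, rfl, fun x hx => ?_⟩
    have h1 : q x = q z := (toEmb e hs).injective hx
    rw [hvert, not_or] at hy
    by_cases hxa : x = G.leg a
    · rw [hxa, hqa, hq z hz] at h1
      exact absurd ((Subtype.mk.inj h1) ▸ G.isVertex_legVertex a) hy.1
    · rw [hq x hxa, hq z hz] at h1
      exact Subtype.mk.inj h1
  · intro v w hv hw hvw
    have h1 : q v = q w := (toEmb e hs).injective hvw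
    rw [hq v fun h => G.leg_not_vertex a (h ▸ hv), hq w fun h => G.leg_not_vertex a (h ▸ hw)] at h1
    exact FlagReach.of_eq (Subtype.mk.inj h1)
  · intro x hx
    rw [hvert, not_or] at hx
    rw [nameOf_of_val hval, hcx x hx.2]
  · intro v hv _
    exact hcx v fun h => G.leg_not_vertex a (h ▸ hv)

/-- The graph `ft_a G` is determined by its description. -/
theorem IsForget.unique (hst : 3 < 2 * g + A.card) {G₁ G₂ : GCat U g B}
    (hB : IsErase B A a.1) (h₁ : G.IsForget a G₁) (h₂ : G.IsForget a G₂) :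
    G₁ = G₂ := by
  have hleg : ∀ b : B, (G₁.leg b).1 = (G₂.leg b).1 := fun b => by
    rw [h₁.marking b ⟨b.1, ((hB _).1 b.2).1⟩ rfl, h₂.marking b ⟨b.1, ((hB _).1 b.2).1⟩ rfl]
  rcases G.nameOf_cases hst a with hv | ⟨f, p, t⟩
  · refine ext_names (fun u => by rw [h₁.flags₁ hv, h₂.flags₁ hv]) (fun x y hxy => ?_)
      (fun x y hxy => ?_) hleg
    all_goals
      obtain ⟨z, hz, -⟩ := (h₁.flags₁ hv _).1 x.2
      have e1 := h₁.struct₁ hv x z hz.symm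
      have e2 := h₂.struct₁ hv y z (hxy.symm.trans hz.symm)
    · rw [e1.1, e2.1]
    · rw [e1.2, e2.2]
  · by_cases hp : G.ι p = p
    · have hl := t.edgeAndLeg hp
      refine ext_names (fun u => by rw [h₁.flags₃ _ _ hl, h₂.flags₃ _ _ hl]) (fun x y hxy => ?_)
        (fun x y hxy => ?_) hleg
      all_goals
        obtain ⟨z, hz, -⟩ := (h₁.flags₃ _ _ hl _).1 x.2
        have e1 := h₁.struct₃ _ _ hl x z hz.symm
        have e2 := h₂.struct₃ _ _ hl y z (hxy.symm.trans hz.symm)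
      · rw [e1.1, e2.1]
      · rw [e1.2, e2.2]
    · have hl := t.twoEdges hp
      refine ext_names (fun u => by rw [h₁.flags₂ _ _ hl, h₂.flags₂ _ _ hl]) (fun x y hxy => ?_)
        (fun x y hxy => ?_) hleg
      all_goals
        obtain ⟨z, hz, -⟩ := (h₁.flags₂ _ _ hl _).1 x.2
        have e1 := h₁.struct₂ _ _ hl x z hz.symm
        have e2 := h₂.struct₂ _ _ hl y z (hxy.symm.trans hz.symm)
      · rw [e1.1, e2.1]
      · rw [e1.2, e2.2]

theorem exists_isForget (hst : 3 < 2 * g + A.card) (hB : IsErase B A a.1)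
    (G : GCat U g A) : ∃ G' : GCat U g B, G.IsForget a G' := by
  rcases G.nameOf_cases hst a with hv | ⟨f, p, t⟩
  · obtain ⟨G', h, -⟩ := exists_quot_of_val hB hv
    exact ⟨G', h⟩
  · obtain ⟨G', h, -⟩ := exists_quot_of_isTri hst hB t
    exact ⟨G', h⟩

theorem IsForget.exists_quot_val (hst : 3 < 2 * g + A.card) (hB : IsErase B A a.1)
    {G' : GCat U g B} (h : G.IsForget a G') (hv : 3 < G.val (G.legVertex a)) :
    ∃ c, G.IsQuot a G' (fun _ => False) c := by
  obtain ⟨G₁, h₁, c, hc⟩ := exists_quot_of_val hB hv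
  obtain rfl := h.unique hst hB h₁
  exact ⟨c, hc⟩

theorem IsForget.exists_quot_tri (hst : 3 < 2 * g + A.card) (hB : IsErase B A a.1)
    {G' : GCat U g B} (h : G.IsForget a G') (t : G.IsTri a f p) :
    ∃ c, G.IsQuot a G' (fun x => x = f ∨ x = G.ι f) c := by
  obtain ⟨G₁, h₁, c, hc⟩ := exists_quot_of_isTri hst hB t
  obtain rfl := h.unique hst hB h₁
  exact ⟨c, hc⟩

end GCat

/-! ### Flags over flags -/

namespace GCat

open DGraph

variable {U Λ : Type u} {g : ℕ} {A B : Finset Λ} {G H : GCat U g A} {a : A} {f p : G.F}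

/-- The flag `x` of `ft_a G` lies over the flag `h` of `G`. -/
def Over (G : GCat U g A) (a : A) {G' : GCat U g B} (x : G'.F) (h : G.F) : Prop :=
  x.1 = (G.nameOf a h).1

theorem Over.unique {G' : GCat U g B} {x y : G'.F} {h : G.F} (hx : G.Over a x h)
    (hy : G.Over a y h) : x = y := Subtype.ext (hx.trans hy.symm)

theorem Over.congr {G' : GCat U g B} {x : G'.F} {h h' : G.F} (hx : G.Over a x h)
    (hh : G.nameOf a h = G.nameOf a h') : G.Over a x h' := by
  unfold Over at hx ⊢; rw [hx, hh]

theorem Over.nameOf_eq {G' : GCat U g B} {x : G'.F} {h h' : G.F} (hx : G.Over a x h)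
    (hx' : G.Over a x h') : G.nameOf a h = G.nameOf a h' := Subtype.ext (hx.symm.trans hx')

/-- The ways to present `ft_a G` as a quotient of `G`: if `V_a` is trivalent, an edge at `V_a` is
chosen and contracted. -/
inductive QuotData (G : GCat U g A) (a : A) (G' : GCat U g B) (c : G.F → G'.F) : Prop
  | big (hv : 3 < G.val (G.legVertex a)) (hc : G.IsQuot a G' (fun _ => False) c) : QuotData G a G' c
  | tri (f p : G.F) (t : G.IsTri a f p) (hc : G.IsQuot a G' (fun x => x = f ∨ x = G.ι f) c) :
      QuotData G a G' c

theorem QuotData.isQuot {G' : GCat U g B} {c : G.F → G'.F} (q : G.QuotData a G' c) :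
    ∃ E, G.IsQuot a G' E c := by
  rcases q with ⟨_, hc⟩ | ⟨f, p, _, hc⟩ <;> exact ⟨_, hc⟩

theorem IsForget.exists_quotData (hst : 3 < 2 * g + A.card) (hB : IsErase B A a.1)
    {G' : GCat U g B} (h : G.IsForget a G') : ∃ c, G.QuotData a G' c := by
  rcases G.nameOf_cases hst a with hv | ⟨f, p, t⟩
  · obtain ⟨c, hc⟩ := h.exists_quot_val hst hB hv
    exact ⟨c, .big hv hc⟩
  · obtain ⟨c, hc⟩ := h.exists_quot_tri hst hB t
    exact ⟨c, .tri f p t hc⟩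

namespace IsForget

variable {G' : GCat U g B}

/-- The names that occur in `ft_a G` are names of flags over themselves, and neither `V_a`, if it is
trivalent, nor the `a`-leg occur. -/
theorem name_mem (hst : 3 < 2 * g + A.card) (h : G.IsForget a G') {x : G'.F} {y : G.F}
    (hxy : x.1 = y.1) : y ≠ G.leg a ∧ G.nameOf a y = y ∧
      (y = G.legVertex a → 3 < G.val (G.legVertex a)) := by
  have hx := x.2
  rcases G.nameOf_cases hst a with hv | ⟨f, p, t⟩
  · obtain ⟨z, hz, hz'⟩ := (h.flags₁ hv _).1 x.2
    obtain rfl : z = y := Subtype.ext (hz.trans hxy)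
    exact ⟨hz', nameOf_of_val hv _, fun _ => hv⟩
  · by_cases hp : G.ι p = p
    · obtain ⟨z, hz, h1, h2, h3, h4⟩ := (h.flags₃ _ _ (t.edgeAndLeg hp) _).1 x.2
      obtain rfl : z = y := Subtype.ext (hz.trans hxy)
      exact ⟨h1, by rw [t.nameOf_leg hp, if_neg (by tauto)], fun h => absurd h h4⟩
    · obtain ⟨z, hz, h1⟩ := (h.flags₂ _ _ (t.twoEdges hp) _).1 x.2
      obtain rfl : z = y := Subtype.ext (hz.trans hxy)
      have h2 := mt (t.iff z).2 h1
      push Not at h2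
      exact ⟨h2.1, by rw [t.nameOf_two hp, if_neg h2.2.2.1, if_neg h2.2.1],
        fun h => absurd h h2.2.2.2⟩

theorem over_of_name (hst : 3 < 2 * g + A.card) (h : G.IsForget a G') {x : G'.F} {y : G.F}
    (hxy : x.1 = y.1) : G.Over a x y := by
  unfold Over; rw [hxy, (h.name_mem hst hxy).2.1]

theorem over_ne_leg (hst : 3 < 2 * g + A.card) (h : G.IsForget a G') {x : G'.F} {y : G.F}
    (hxy : G.Over a x y) : y ≠ G.leg a := by
  rintro rfl
  exact (h.name_mem hst (x := x) (y := G.leg a) (by rw [hxy, nameOf_leg hst])).1 rfl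

/-- Every flag of `ft_a G` carries the name of a flag of `G`. -/
theorem exists_name (hst : 3 < 2 * g + A.card) (h : G.IsForget a G') (x : G'.F) :
    ∃ y : G.F, x.1 = y.1 := by
  rcases G.nameOf_cases hst a with hv | ⟨f, p, t⟩
  · obtain ⟨z, hz, hz'⟩ := (h.flags₁ hv _).1 x.2
    exact ⟨z, hz.symm⟩
  · by_cases hp : G.ι p = p
    · obtain ⟨z, hz, -⟩ := (h.flags₃ _ _ (t.edgeAndLeg hp) _).1 x.2
      exact ⟨z, hz.symm⟩
    · obtain ⟨z, hz, -⟩ := (h.flags₂ _ _ (t.twoEdges hp) _).1 x.2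
      exact ⟨z, hz.symm⟩

theorem exists_over (hst : 3 < 2 * g + A.card) (h : G.IsForget a G') (x : G'.F) :
    ∃ y : G.F, G.Over a x y := by
  obtain ⟨y, hy⟩ := h.exists_name hst x
  exact ⟨y, h.over_of_name hst hy⟩

end IsForget

theorem QuotData.over {G' : GCat U g B} {c : G.F → G'.F} (q : G.QuotData a G' c) {x : G.F}
    (hx : ¬ G'.IsVertex (c x)) : G.Over a (c x) x := by
  obtain ⟨E, hc⟩ := q.isQuot
  exact hc.name x hx

namespace IsForget

variable {G' : GCat U g B} (hst : 3 < 2 * g + A.card) (hB : IsErase B A a.1)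

theorem name_isVertex_iff (hst : 3 < 2 * g + A.card) (hB : IsErase B A a.1)
    (h : G.IsForget a G') {x : G'.F} {y : G.F} (hxy : x.1 = y.1) :
    G'.IsVertex x ↔ G.IsVertex y := by
  obtain ⟨c, q⟩ := h.exists_quotData hst hB
  obtain ⟨E, hc⟩ := q.isQuot
  constructor
  · intro hx
    by_contra hy
    -- a vertex of the quotient is the image of a vertex which keeps its name
    obtain ⟨v, hv, hcv⟩ : ∃ v, G.IsVertex v ∧ c v = x ∧ (c v).1 = v.1 := by
      by_cases hex : ∃ z, c z = x
      · obtain ⟨z, hz⟩ := hex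
        have hr : c (G.r z) = x := by rw [hc.map_r, hz]; exact hx
        rcases q with ⟨hv, hc'⟩ | ⟨f, p, t, hc'⟩
        · exact ⟨G.r z, isVertex_r z, hr, hc'.name_vertex _ (isVertex_r z) (Or.inr fun _ h => h)⟩
        · by_cases hzV : G.r z = G.legVertex a
          · refine ⟨G.r (G.ι f), isVertex_r _, ?_,
              hc'.name_vertex _ (isVertex_r _) (Or.inl (t.root_ne hst))⟩
            have h1 : c f = x := by
              have h2 : G'.IsVertex (c f) := (hc'.vertex_iff f).2 (Or.inr (Or.inr (Or.inl rfl)))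
              have h3 : c (G.r f) = c f := (hc'.map_r f).trans h2
              rw [← h3, t.r_f, ← hzV, hr]
            rw [hc'.map_r, hc'.map_ι, h1, ι_of_isVertex hx]; exact hx
          · exact ⟨G.r z, isVertex_r z, hr, hc'.name_vertex _ (isVertex_r z) (Or.inl hzV)⟩
      · exfalso
        -- the map `c` is surjective on vertices because every vertex has a flag
        obtain ⟨k, hk, hkx⟩ := G'.exists_flag hx
        obtain ⟨z, hz, -⟩ := hc.flag k hk
        exact hex ⟨G.r z, by rw [hc.map_r, hz, hkx]⟩
    have : v = y := Subtype.ext (by rw [← hxy, ← hcv.1, hcv.2])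
    exact hy (this ▸ hv)
  · intro hy
    by_contra hx
    obtain ⟨z, hz, -⟩ := hc.flag x hx
    subst hz
    have h1 : G.nameOf a z = y := Subtype.ext ((hc.name z hx).symm.trans hxy)
    have h2 := (nameOf_vertex_iff hst (a := a) z).1 (by rw [h1]; exact hy)
    exact hx ((hc.vertex_iff z).2 (Or.inl h2))

theorem over_isVertex_iff (hst : 3 < 2 * g + A.card) (hB : IsErase B A a.1)
    (h : G.IsForget a G') {x : G'.F} {y : G.F} (hxy : G.Over a x y) :
    G'.IsVertex x ↔ G.IsVertex y := by
  rw [h.name_isVertex_iff hst hB hxy, nameOf_vertex_iff hst]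

/-- Every flag of `G` which is not a vertex and not the `a`-leg has a flag over it. -/
theorem exists_of_flag (hst : 3 < 2 * g + A.card) (hB : IsErase B A a.1)
    (h : G.IsForget a G') {y : G.F} (hy : ¬ G.IsVertex y) (hya : y ≠ G.leg a) :
    ∃ x : G'.F, G.Over a x y := by
  rcases G.nameOf_cases hst a with hv | ⟨f, p, t⟩
  · obtain ⟨c, hc⟩ := h.exists_quot_val hst hB hv
    exact ⟨c y, hc.name y fun hcy => by rcases (hc.vertex_iff y).1 hcy with h | h | h <;> tauto⟩
  · obtain ⟨c, hc⟩ := h.exists_quot_tri hst hB t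
    by_cases hyE : y = f ∨ y = G.ι f
    · have hcy : ∀ z, (z = p ∨ z = G.ι p) → ¬ G'.IsVertex (c z) := by
        intro z hz hcz
        rcases (hc.vertex_iff z).1 hcz with h1 | h1 | h1 | h1
        · rcases hz with rfl | rfl
          · exact t.not_vertex h1
          · exact t.not_vertex (isVertex_ι.1 h1)
        · rcases hz with rfl | rfl
          · exact t.ne_leg h1
          · exact t.ne_leg (by rw [← G.ι_ι p, h1, G.ι_leg])
        · rcases hz with rfl | rfl
          · exact t.ne h1.symm
          · exact t.ι_f_ne hst (by rw [← h1, G.ι_ι])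
        · rcases hz with rfl | rfl
          · exact t.ι_f_ne hst h1.symm
          · exact t.ne (by rw [← G.ι_ι f, ← h1, G.ι_ι])
      rcases hyE with rfl | rfl
      · have := hc.name _ (hcy (G.ι p) (Or.inr rfl))
        exact ⟨_, by unfold Over; rw [this, t.nameOf_ι_p hst]⟩
      · have := hc.name _ (hcy p (Or.inl rfl))
        exact ⟨_, by unfold Over; rw [this, t.nameOf_ι_f hst]⟩
    · refine ⟨c y, hc.name y fun hcy => ?_⟩
      rcases (hc.vertex_iff y).1 hcy with h | h | h <;> tauto

theorem over_ι (hst : 3 < 2 * g + A.card) (hB : IsErase B A a.1)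
    (h : G.IsForget a G') {x : G'.F} {y : G.F} (hxy : G.Over a x y) :
    G.Over a (G'.ι x) (G.ι y) := by
  by_cases hx : G'.IsVertex x
  · rw [ι_of_isVertex hx, ι_of_isVertex ((h.over_isVertex_iff hst hB hxy).1 hx)]
    exact hxy
  · obtain ⟨c, q⟩ := h.exists_quotData hst hB
    obtain ⟨E, hc⟩ := q.isQuot
    obtain ⟨z, rfl, -⟩ := hc.flag x hx
    rw [← hc.map_ι]
    have h1 : ¬ G'.IsVertex (c (G.ι z)) := by rw [hc.map_ι, isVertex_ι]; exact hx
    exact (q.over h1).congr (nameOf_ι_congr hst ((q.over hx).nameOf_eq hxy))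

theorem over_leg (hst : 3 < 2 * g + A.card) (h : G.IsForget a G') {b' : B} {b : A}
    (hb : b'.1 = b.1) : G.Over a (G'.leg b') (G.leg b) := by
  unfold Over
  rw [nameOf_leg hst, h.marking b' b hb]

end IsForget

/-! ### Contractions at the vertex of a marked leg -/

/-- A vertex of a stable graph which is the image of `n` vertices under a contraction has valency at
least `n + 2`. -/
theorem card_fiber_add_two_le (k : G ⟶ H) {w : H.F} (hw : H.IsVertex w) :
    (Finset.univ.filter fun v => G.IsVertex v ∧ fn k v = w).card + 2 ≤ H.val w := by
  have hT := (fn_contraction k).fiber w hw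
  set K := Finset.univ.filter fun x => fn k x = w with hK
  have hKm : ∀ x, x ∈ K ↔ fn k x = w := by simp [hK]
  have h1 := two_mul_card_edges hT.1
  have h2 := hT.2.2.2
  unfold genus at h2
  have h3 : G.verts K = Finset.univ.filter fun v => G.IsVertex v ∧ fn k v = w := by
    ext x
    simp only [verts, Finset.mem_filter, hKm, Finset.mem_univ, true_and]
    tauto
  rw [h3] at h2
  set S := Finset.univ.filter fun x => fn k (G.r x) = w ∧ ¬ G.IsVertex x with hS
  have h4 : (Finset.univ.filter fun v => G.IsVertex v ∧ fn k v = w).card * 3 ≤ S.card := by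
    rw [Finset.card_eq_sum_card_fiberwise (s := S) (f := G.r)
      (t := Finset.univ.filter fun v => G.IsVertex v ∧ fn k v = w)]
    · rw [← smul_eq_mul]
      refine Finset.card_nsmul_le_sum _ _ _ fun v hv => ?_
      obtain ⟨-, hv, hvw⟩ := Finset.mem_filter.1 hv
      refine (G.stable v hv).trans ?_
      rw [val_eq v hv]
      refine Finset.card_le_card fun x hx => ?_
      obtain ⟨-, hx1, hx2⟩ := Finset.mem_filter.1 hx
      refine Finset.mem_filter.2 ⟨Finset.mem_filter.2 ⟨Finset.mem_univ _, by rw [hx1, hvw],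
        fun h => hx2 (h.symm.trans hx1)⟩, hx1⟩
    · intro x hx
      have hx1 : fn k (G.r x) = w := (Finset.mem_filter.1 (Finset.mem_coe.1 hx)).2.1
      exact Finset.mem_coe.2 (Finset.mem_filter.2 ⟨Finset.mem_univ _, isVertex_r x, hx1⟩)
  have h5 : S.card ≤ (K.filter fun h => G.ι h ≠ h).card + H.val w := by
    rw [val_eq w hw, ← Finset.card_filter_add_card_filter_not (s := S) (fun x => fn k x = w)]
    refine Nat.add_le_add (Finset.card_le_card fun x hx => ?_)
      (Finset.card_le_card_of_injOn (fn k) (fun x hx => ?_) fun x hx y hy hxy => ?_)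
    · obtain ⟨hx1, hx2⟩ := Finset.mem_filter.1 hx
      obtain ⟨-, hx3, hx4⟩ := Finset.mem_filter.1 hx1
      exact Finset.mem_filter.2 ⟨(hKm x).2 hx2, fun h => hT.2.1 x ((hKm x).2 hx2) ⟨hx4, h⟩⟩
    · obtain ⟨hx1, hx2⟩ := Finset.mem_filter.1 hx
      obtain ⟨-, hx3, hx4⟩ := Finset.mem_filter.1 hx1
      exact Finset.mem_filter.2 ⟨Finset.mem_univ _, by rw [← fn_r, hx3], hx2⟩
    · obtain ⟨hx1, hx2⟩ := Finset.mem_filter.1 hx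
      obtain ⟨-, hx3, hx4⟩ := Finset.mem_filter.1 hx1
      refine fn_inj k (fun hv => hx2 ?_) hxy
      rw [← hx3, fn_r]; exact hv.symm
  omega

theorem fn_legVertex (k : G ⟶ H) : fn k (G.legVertex a) = H.legVertex a := by
  unfold legVertex
  rw [fn_r, fn_leg]

/-- Nothing is contracted to a trivalent vertex `V_a`. -/
theorem IsTri.eq_legVertex {h q : H.F} (t : H.IsTri a h q) (k : G ⟶ H) {x : G.F}
    (hx : fn k x = H.legVertex a) : x = G.legVertex a := by
  have hw := H.isVertex_legVertex a
  have h1 := card_fiber_add_two_le k hw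
  have h2 := t.val_le
  have h4 : ∀ v, G.IsVertex v → fn k v = H.legVertex a → v = G.legVertex a := fun v hv hvw =>
    Finset.card_le_one.1 (show (Finset.univ.filter fun v => G.IsVertex v ∧
      fn k v = H.legVertex a).card ≤ 1 by omega) v (by simp [hv, hvw]) _
      (by simp [G.isVertex_legVertex a, fn_legVertex])
  have hT := (fn_contraction k).fiber _ hw
  have h5 : (G.verts (Finset.univ.filter fun x => fn k x = H.legVertex a)).card ≤ 1 := by
    refine (Finset.card_le_card (t := {G.legVertex a}) fun v hv => ?_).trans (by simp)
    obtain ⟨hv1, hv2⟩ := Finset.mem_filter.1 hv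
    exact Finset.mem_singleton.2 (h4 v hv2 (Finset.mem_filter.1 hv1).2)
  by_cases hxv : G.IsVertex x
  · exact h4 x hxv hx
  · have hxK : x ∈ Finset.univ.filter fun x => fn k x = H.legVertex a := by simp [hx]
    have hne : G.ι x ≠ x := fun h => hT.2.1 x hxK ⟨hxv, h⟩
    have h6 : 1 ≤ (G.edges (Finset.univ.filter fun x => fn k x = H.legVertex a)).card :=
      Finset.card_pos.2 ⟨s(x, G.ι x), Finset.mem_image_of_mem _ (Finset.mem_filter.2 ⟨hxK, hne⟩)⟩
    have h7 := hT.2.2.2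
    unfold genus at h7
    omega

/-- If `V_a` is trivalent in a contraction of `G`, then it is already trivalent in `G`. -/
theorem IsTri.lift {h q : H.F} (t : H.IsTri a h q) (k : G ⟶ H) :
    ∃ f p, G.IsTri a f p ∧ fn k f = h ∧ fn k p = q := by
  obtain ⟨f, rfl⟩ := fn_surj k h
  obtain ⟨p, rfl⟩ := fn_surj k q
  have hf : ¬ H.IsVertex (fn k f) := t.f_not_vertex
  have hp : ¬ H.IsVertex (fn k p) := t.not_vertex
  refine ⟨f, p, ⟨fun h => t.ι_ne ((fn_ι_eq_iff k hf).1 h), fun h => t.ne (by rw [h]),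
    fun h => t.ne_leg (by rw [h, fn_leg]), fun h => hp (fn_vertex k h), fun x => ?_⟩, rfl, rfl⟩
  have h1 : G.r x = G.legVertex a ↔ H.r (fn k x) = H.legVertex a := by
    rw [← fn_r]
    exact ⟨fun h => by rw [h, fn_legVertex], fun h => t.eq_legVertex k h⟩
  rw [h1, t.iff]
  refine or_congr ⟨fun h => ?_, fun h => by rw [h, fn_leg]⟩
    (or_congr ⟨fun h => ?_, fun h => by rw [h]⟩
    (or_congr ⟨fun h => ?_, fun h => by rw [h]⟩ ⟨fun h => t.eq_legVertex k h,
      fun h => by rw [h, fn_legVertex]⟩))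
  · exact (fn_inj k (fn_leg_not_vertex k a) (by rw [h, fn_leg])).symm
  · exact (fn_inj k hf h.symm).symm
  · exact (fn_inj k hp h.symm).symm

/-- If `V_a` is trivalent in `G` and no edge at `V_a` is contracted, then `V_a` stays trivalent. -/
theorem IsTri.descend (t : G.IsTri a f p) (k : G ⟶ H) (hf : ¬ H.IsVertex (fn k f))
    (hp : ¬ H.IsVertex (fn k p)) : H.IsTri a (fn k f) (fn k p) := by
  have key : ∀ x, fn k x = H.legVertex a → x = G.legVertex a := by
    have hclosed : ∀ h, H.IsVertex (fn k h) → G.r h = G.legVertex a → h = G.legVertex a := by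
      intro h hh hr
      rcases (t.iff h).1 hr with rfl | rfl | rfl | h1
      · exact absurd hh (fn_leg_not_vertex k a)
      · exact absurd hh hf
      · exact absurd hh hp
      · exact h1
    intro x hx
    have hxv : H.IsVertex (fn k x) := hx ▸ H.isVertex_legVertex a
    have hreach := reach_fiber k (G.isVertex_legVertex a) (isVertex_r x)
      (by rw [fn_legVertex, fn_r, hx]; exact (H.isVertex_legVertex a).symm)
    have := (FlagReach.induct (c := fun w => w = G.legVertex a) (fun h hh =>
      ⟨fun h1 => by
        rw [hclosed h hh h1, ι_of_isVertex (G.isVertex_legVertex a)]; exact G.isVertex_legVertex a,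
      fun h1 => by
        have h2 := hclosed _ ((fn_ι_vertex k).2 hh) h1
        have h3 : h = G.legVertex a := by
          rw [← G.ι_ι h, h2, ι_of_isVertex (G.isVertex_legVertex a)]
        rw [h3]; exact G.isVertex_legVertex a⟩) hreach).1 rfl
    exact hclosed x hxv this
  refine ⟨fun h => t.ι_ne ((fn_ι_eq_iff k hf).2 h), fun h => t.ne (fn_inj k hf h), fun h => ?_, hp,
    fun y => ?_⟩
  · rw [← fn_leg k] at h
    exact t.ne_leg (fn_inj k hp h)
  · obtain ⟨x, rfl⟩ := fn_surj k y
    constructor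
    · intro h
      rw [← fn_r] at h
      rcases (t.iff x).1 (key _ h) with rfl | rfl | rfl | rfl
      · exact Or.inl (fn_leg k a)
      · exact Or.inr (Or.inl rfl)
      · exact Or.inr (Or.inr (Or.inl rfl))
      · exact Or.inr (Or.inr (Or.inr (fn_legVertex k)))
    · rintro (h | h | h | h)
      · rw [h]; rfl
      · rw [h, ← fn_r, t.r_f, fn_legVertex]
      · rw [h, ← fn_r, t.r_p, fn_legVertex]
      · rw [h]; exact H.isVertex_legVertex a

/-- Contractions to a graph in which `V_a` is trivalent commute with `nameOf`. -/
theorem IsTri.fn_nameOf {h q : H.F} (t : H.IsTri a h q) (k : G ⟶ H) (x : G.F) :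
    fn k (G.nameOf a x) = H.nameOf a (fn k x) := by
  obtain ⟨f, p, t', rfl, rfl⟩ := t.lift k
  have hf := t.f_not_vertex
  have hp := t.not_vertex
  have hιf : ¬ H.IsVertex (fn k (G.ι f)) := fun h => hf ((fn_ι_vertex k).1 h)
  have e : ∀ {y z : G.F}, ¬ H.IsVertex (fn k z) → (fn k y = fn k z ↔ y = z) := fun hz =>
    ⟨fun h => (fn_inj k hz h.symm).symm, fun h => by rw [h]⟩
  by_cases hιp : G.ι p = p
  · rw [t'.nameOf_leg hιp, t.nameOf_leg ((fn_ι_eq_iff k hp).1 hιp)]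
    have h1 : (fn k x = fn k f ∨ fn k x = H.ι (fn k f)) ↔ (x = f ∨ x = G.ι f) := by
      rw [← fn_ι, e hf, e hιf]
    simp only [h1]
    split_ifs <;> rfl
  · rw [t'.nameOf_two hιp, t.nameOf_two fun h => hιp ((fn_ι_eq_iff k hp).2 h)]
    simp only [e hf, e hp]
    split_ifs
    · exact fn_ι k f
    · exact fn_ι k p
    · rfl

end GCat

/-! ### Forgetting a mark on contractions -/

namespace GCat

open DGraph

variable {U Λ : Type u} {g : ℕ} {A B : Finset Λ} {G H K : GCat U g A} {a : A}
  {G' H' K' : GCat U g B}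

namespace IsQuot

variable {E : G.F → Prop} {c : G.F → G'.F}

theorem surjective (hc : G.IsQuot a G' E c) (y : G'.F) : ∃ x, c x = y := by
  by_cases hy : G'.IsVertex y
  · obtain ⟨h, hh, hr⟩ := G'.exists_flag hy
    obtain ⟨x, hx, -⟩ := hc.flag h hh
    exact ⟨G.r x, by rw [hc.map_r, hx, hr]⟩
  · exact (hc.flag y hy).exists

theorem isVertex (hc : G.IsQuot a G' E c) {x : G.F} (hx : G.IsVertex x) : G'.IsVertex (c x) :=
  (hc.vertex_iff x).2 (Or.inl hx)

theorem inj (hc : G.IsQuot a G' E c) {x y : G.F} (hx : ¬ G'.IsVertex (c x)) (hxy : c x = c y) :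
    x = y := (hc.flag _ hx).unique rfl hxy.symm

/-- A map that is constant along the flags contracted by a quotient map factors through it. -/
theorem factors {X : Type*} (hc : G.IsQuot a G' E c) (d : G.F → X)
    (h1 : ∀ z, G'.IsVertex (c z) → d (G.r z) = d z)
    (h2 : ∀ z, G'.IsVertex (c z) → d (G.ι z) = d z) {x y : G.F} (hxy : c x = c y) :
    d x = d y := by
  by_cases hx : G'.IsVertex (c x)
  · rw [← h1 x hx, ← h1 y (hxy ▸ hx)]
    refine ((FlagReach.induct (c := fun w => d w = d (G.r x)) (fun z hz => ?_)
      (hc.fiber _ _ (isVertex_r x) (isVertex_r y) (by rw [hc.map_r, hc.map_r, hxy]))).1 rfl).symm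
    have hz' : G'.IsVertex (c (G.ι z)) := by rw [hc.map_ι, isVertex_ι]; exact hz
    rw [h1 z hz, h1 _ hz', h2 z hz]
  · rw [hc.inj hx hxy]

/-- A contraction induces a contraction of quotients if it is compatible with the contracted
flags. -/
theorem exists_hom {E' : H.F → Prop} {d : H.F → H'.F} (hBA : B ⊆ A) (hc : G.IsQuot a G' E c)
    (hd : H.IsQuot a H' E' d) (k : G ⟶ H)
    (h : ∀ x, G'.IsVertex (c x) → H'.IsVertex (d (fn k x))) :
    ∃ k' : G' ⟶ H', ∀ x, fn k' (c x) = d (fn k x) := by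
  choose s hs using hc.surjective
  have hk : ∀ x, d (fn k (s (c x))) = d (fn k x) := fun x =>
    hc.factors (fun z => d (fn k z)) (fun z hz => by rw [fn_r, hd.map_r]; exact h z hz)
      (fun z hz => by rw [fn_ι, hd.map_ι, ι_of_isVertex (h z hz)]) (hs _)
  refine ⟨homMk (fun y => d (fn k (s y))) (fun y => ?_) (fun y => ?_) (fun b => ?_) (fun y hy => ?_)
    (fun v w hv hw hvw => ?_), fun x => ?_⟩
  · obtain ⟨x, rfl⟩ := hc.surjective y
    rw [← hc.map_r, hk, hk, fn_r, hd.map_r]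
  · obtain ⟨x, rfl⟩ := hc.surjective y
    rw [← hc.map_ι, hk, hk, fn_ι, hd.map_ι]
  · rw [← hc.map_leg b ⟨b.1, hBA b.2⟩ rfl, hk, fn_leg, hd.map_leg b ⟨b.1, hBA b.2⟩ rfl]
  · obtain ⟨z, rfl, hz⟩ := hd.flag y hy
    obtain ⟨x, rfl⟩ := fn_surj k z
    refine ⟨c x, hk x, fun x' hx' => ?_⟩
    obtain ⟨x', rfl⟩ := hc.surjective x'
    have h1 := hz (fn k x') ((hk x').symm.trans hx')
    rw [fn_inj k (fun hv => hy (hd.isVertex hv)) h1.symm]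
  · obtain ⟨v, rfl⟩ := hc.surjective v
    obtain ⟨w, rfl⟩ := hc.surjective w
    simp only [hk] at hvw
    rw [← show c (G.r v) = c v from (hc.map_r v).trans hv,
      ← show c (G.r w) = c w from (hc.map_r w).trans hw]
    have hvw' : d (fn k (G.r v)) = d (fn k (G.r w)) := by
      rw [fn_r, fn_r, hd.map_r, hd.map_r, hvw]
    have h1 := hd.fiber _ _ (fn_vertex k (isVertex_r v)) (fn_vertex k (isVertex_r w)) hvw'
    refine (lift_reach k (isVertex_r v) (isVertex_r w) h1).map c fun z hz => ?_
    have hz' : H'.IsVertex (d (fn k z)) := hz.elim (fun h => hd.isVertex h) fun h => h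
    by_cases hcz : G'.IsVertex (c z)
    · refine FlagReach.of_eq ?_
      rw [hc.map_r, hc.map_r, hc.map_ι, ι_of_isVertex hcz]
    · rw [hc.map_r, hc.map_r, hc.map_ι]
      refine FlagReach.step ?_
      rw [hk]; exact hz'
  · rw [fn_homMk, hk]

end IsQuot

/-- The quotients of `G` and of a contraction of `G` can be presented compatibly. -/
theorem exists_compatible (hst : 3 < 2 * g + A.card) (hB : IsErase B A a.1)
    (hG : G.IsForget a G') (hH : H.IsForget a H') (k : G ⟶ H) :
    ∃ c d, G.QuotData a G' c ∧ H.QuotData a H' d ∧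
      (∀ x, G'.IsVertex (c x) → H'.IsVertex (d (fn k x))) ∧
      ∀ x, ¬ H.IsVertex (fn k x) → H'.IsVertex (d (fn k x)) → G'.IsVertex (c x) := by
  rcases H.nameOf_cases hst a with hvH | ⟨h, q, t⟩
  · obtain ⟨d, hd⟩ := hH.exists_quot_val hst hB hvH
    have h2 : ∀ {E : G.F → Prop} {c : G.F → G'.F}, G.IsQuot a G' E c →
        ∀ x, ¬ H.IsVertex (fn k x) → H'.IsVertex (d (fn k x)) → G'.IsVertex (c x) := by
      intro E c hc x hx hdx
      rcases (hd.vertex_iff _).1 hdx with h1 | h1 | h1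
      · exact absurd h1 hx
      · have : x = G.leg a := fn_inj k hx (by rw [h1, fn_leg])
        exact (hc.vertex_iff x).2 (Or.inr (Or.inl this))
      · exact h1.elim
    rcases G.nameOf_cases hst a with hvG | ⟨f, p, t⟩
    · obtain ⟨c, hc⟩ := hG.exists_quot_val hst hB hvG
      refine ⟨c, d, .big hvG hc, .big hvH hd, fun x hx => ?_, h2 hc⟩
      rcases (hc.vertex_iff x).1 hx with h1 | h1 | h1
      · exact hd.isVertex (fn_vertex k h1)
      · exact (hd.vertex_iff _).2 (Or.inr (Or.inl (by rw [h1, fn_leg])))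
      · exact h1.elim
    · obtain ⟨f, p, t, hf⟩ : ∃ f p, G.IsTri a f p ∧ H.IsVertex (fn k f) := by
        by_cases hf : H.IsVertex (fn k f)
        · exact ⟨f, p, t, hf⟩
        · by_cases hp : H.IsVertex (fn k p)
          · refine ⟨p, f, t.swap fun h => ?_, hp⟩
            exact ((fn_contraction k).fiber _ hp).2.1 p (by simp) ⟨t.not_vertex, h⟩
          · exact absurd hvH (t.descend k hf hp).val_le
      obtain ⟨c, hc⟩ := hG.exists_quot_tri hst hB t
      refine ⟨c, d, .tri f p t hc, .big hvH hd, fun x hx => ?_, h2 hc⟩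
      rcases (hc.vertex_iff x).1 hx with h1 | h1 | rfl | rfl
      · exact hd.isVertex (fn_vertex k h1)
      · exact (hd.vertex_iff _).2 (Or.inr (Or.inl (by rw [h1, fn_leg])))
      · exact hd.isVertex hf
      · exact hd.isVertex ((fn_ι_vertex k).2 hf)
  · obtain ⟨f, p, t', rfl, rfl⟩ := t.lift k
    obtain ⟨d, hd⟩ := hH.exists_quot_tri hst hB t
    obtain ⟨c, hc⟩ := hG.exists_quot_tri hst hB t'
    refine ⟨c, d, .tri _ _ t' hc, .tri _ _ t hd, fun x hx => ?_, fun x hx hdx => ?_⟩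
    · rcases (hc.vertex_iff x).1 hx with h1 | h1 | rfl | rfl
      · exact hd.isVertex (fn_vertex k h1)
      · exact (hd.vertex_iff _).2 (Or.inr (Or.inl (by rw [h1, fn_leg])))
      · exact (hd.vertex_iff _).2 (Or.inr (Or.inr (Or.inl rfl)))
      · exact (hd.vertex_iff _).2 (Or.inr (Or.inr (Or.inr (fn_ι k f))))
    · refine (hc.vertex_iff x).2 ?_
      rcases (hd.vertex_iff _).1 hdx with h1 | h1 | h1 | h1
      · exact absurd h1 hx
      · exact Or.inr (Or.inl (fn_inj k hx (by rw [h1, fn_leg])))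
      · exact Or.inr (Or.inr (Or.inl (fn_inj k hx h1)))
      · exact Or.inr (Or.inr (Or.inr (fn_inj k hx (by rw [h1, fn_ι]))))

/-- The contraction `k'` is induced by `k`: if `x` lies over `h` and `h` is not contracted by `k`,
then `k' x` lies over `k h`. -/
def IsForgetHom (a : A) (k : G ⟶ H) (k' : G' ⟶ H') : Prop :=
  ∀ x h, G.Over a x h → ¬ H.IsVertex (fn k h) → H.Over a (fn k' x) (fn k h)

/-- A contraction of quotients induced by `k` is compatible with flags over flags. -/
theorem QuotData.isForgetHom (hst : 3 < 2 * g + A.card) (hB : IsErase B A a.1)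
    (hG : G.IsForget a G') {c : G.F → G'.F} {d : H.F → H'.F} (qc : G.QuotData a G' c)
    (qd : H.QuotData a H' d) {k : G ⟶ H}
    (h1 : ∀ x, G'.IsVertex (c x) → H'.IsVertex (d (fn k x)))
    (h2 : ∀ x, ¬ H.IsVertex (fn k x) → H'.IsVertex (d (fn k x)) → G'.IsVertex (c x))
    {k' : G' ⟶ H'} (hk : ∀ x, fn k' (c x) = d (fn k x)) : IsForgetHom a k k' := by
  intro x h hx hkh
  have hh : ¬ G.IsVertex h := fun hv => hkh (fn_vertex k hv)
  have hxv : ¬ G'.IsVertex x := fun hv => hh ((hG.over_isVertex_iff hst hB hx).1 hv)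
  obtain ⟨E, hc⟩ := qc.isQuot
  obtain ⟨z, rfl, -⟩ := hc.flag x hxv
  have hzname := (qc.over hxv).nameOf_eq hx
  have hzx : ¬ H.IsVertex (fn k z) → H.Over a (fn k' (c z)) (fn k z) := fun hkz => by
    rw [hk]; exact qd.over fun hv => hxv (h2 z hkz hv)
  by_cases hch : G'.IsVertex (c h)
  · -- the flag `h` is contracted by `c`, hence `V_a` is trivalent in `H`
    have hdh := h1 h hch
    have htri : ∃ p q, H.IsTri a p q := by
      rcases qd with ⟨hv, hd⟩ | ⟨p, q, t, hd⟩
      · rcases (hd.vertex_iff _).1 hdh with h3 | h3 | h3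
        · exact absurd h3 hkh
        · exact absurd (fn_inj k hkh (by rw [h3, fn_leg])) (hG.over_ne_leg hst hx)
        · exact h3.elim
      · exact ⟨p, q, t⟩
    obtain ⟨p, q, t⟩ := htri
    have h3 : H.nameOf a (fn k z) = H.nameOf a (fn k h) := by
      rw [← t.fn_nameOf, ← t.fn_nameOf, hzname]
    have h4 : ¬ H.IsVertex (fn k z) := fun hv => hkh <| by
      rw [← nameOf_vertex_iff hst (a := a), h3.symm, nameOf_vertex_iff hst]; exact hv
    exact (hzx h4).congr h3
  · have h3 : c z = c h := ((qc.over hxv).congr hzname).unique (qc.over hch)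
    obtain rfl := hc.inj hxv h3
    exact hzx hkh

/-- The contraction `ft_a k`, with the map of quotients that it comes from. -/
theorem exists_forgetHom (hst : 3 < 2 * g + A.card) (hB : IsErase B A a.1)
    (hG : G.IsForget a G') (hH : H.IsForget a H') (k : G ⟶ H) :
    ∃ k' : G' ⟶ H', IsForgetHom a k k' ∧ ∃ c d, G.QuotData a G' c ∧ H.QuotData a H' d ∧
      ∀ x, fn k' (c x) = d (fn k x) := by
  obtain ⟨c, d, qc, qd, h1, h2⟩ := exists_compatible hst hB hG hH k
  obtain ⟨E, hc⟩ := qc.isQuot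
  obtain ⟨E', hd⟩ := qd.isQuot
  obtain ⟨k', hk⟩ := hc.exists_hom (fun x hx => ((hB x).1 hx).1) hd k h1
  exact ⟨k', qc.isForgetHom hst hB hG qd h1 h2 hk, c, d, qc, qd, hk⟩

namespace IsForgetHom

/-- A flag whose image under `k'` lies over `h'` lies over a preimage of `h'`. -/
theorem exists_over (hst : 3 < 2 * g + A.card) (hB : IsErase B A a.1)
    (hG : G.IsForget a G') (hH : H.IsForget a H') {k : G ⟶ H} {k' : G' ⟶ H'}
    (hk : IsForgetHom a k k') {x : G'.F} {h' : H.F} (hx : H.Over a (fn k' x) h')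
    (hv : ¬ H.IsVertex h') : ∃ h, G.Over a x h ∧ fn k h = h' := by
  obtain ⟨h, rfl⟩ := fn_surj k h'
  have h1 : ¬ G.IsVertex h := fun h => hv (fn_vertex k h)
  have h2 : h ≠ G.leg a := by
    rintro rfl
    exact hH.over_ne_leg hst hx (fn_leg k a)
  obtain ⟨y, hy⟩ := hG.exists_of_flag hst hB h1 h2
  have h3 : fn k' y = fn k' x := (hk y h hy hv).unique hx
  have h4 : ¬ H'.IsVertex (fn k' y) := by
    rw [h3, hH.over_isVertex_iff hst hB hx]; exact hv
  rw [← fn_inj k' h4 h3]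
  exact ⟨h, hy, rfl⟩

theorem unique (hst : 3 < 2 * g + A.card) (hB : IsErase B A a.1)
    (hG : G.IsForget a G') (hH : H.IsForget a H') {k : G ⟶ H} {k₁ k₂ : G' ⟶ H'}
    (h₁ : IsForgetHom a k k₁) (h₂ : IsForgetHom a k k₂) : k₁ = k₂ := by
  refine hom_ext_of_flags fun x hx => ?_
  obtain ⟨h', hh'⟩ := hH.exists_over hst (fn k₁ x)
  have hv : ¬ H.IsVertex h' := by rwa [← hH.over_isVertex_iff hst hB hh']
  obtain ⟨h, hxh, rfl⟩ := h₁.exists_over hst hB hG hH hh' hv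
  exact (h₂ x h hxh hv).unique hh'

theorem id (a : A) (G : GCat U g A) (G' : GCat U g B) : IsForgetHom a (𝟙 G) (𝟙 G') :=
  fun x h hx _ => by rw [fn_id, fn_id]; exact hx

theorem comp {k : G ⟶ H} {k' : G' ⟶ H'} {l : H ⟶ K} {l' : H' ⟶ K'} (hk : IsForgetHom a k k')
    (hl : IsForgetHom a l l') : IsForgetHom a (k ≫ l) (k' ≫ l') := fun x h hx hv => by
  rw [fn_comp] at hv
  rw [fn_comp, fn_comp]
  exact hl _ _ (hk x h hx fun h => hv (fn_vertex l h)) hv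

/-- The description of `ft_a k` in terms of names. -/
theorem name (hst : 3 < 2 * g + A.card) (hB : IsErase B A a.1)
    (hG : G.IsForget a G') (hH : H.IsForget a H') {k : G ⟶ H} {k' : G' ⟶ H'}
    (hk : IsForgetHom a k k') {x : G'.F} {y : G.F} (hxy : x.1 = y.1) :
    (∀ f₂, GCat.IsContractedEnd k a y f₂ → (fn k' x).1 = (fn k f₂).1) ∧
    ((¬ ∃ f₂, GCat.IsContractedEnd k a y f₂) → (fn k' x).1 = (fn k y).1) := by
  obtain ⟨k'', hk'', c, d, qc, qd, hcd⟩ := exists_forgetHom hst hB hG hH k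
  obtain rfl := hk.unique hst hB hG hH hk''
  obtain ⟨E, hc⟩ := qc.isQuot
  have hx := hG.over_of_name hst hxy
  obtain ⟨hya, hyname, hyV⟩ := hG.name_mem hst hxy
  -- the vertex names of `H'` agree with those of `H`, except at a trivalent `V_a`
  have hdv : ∀ v, H.IsVertex v → (v ≠ H.legVertex a ∨ 3 < H.val (H.legVertex a)) →
      (d v).1 = v.1 := by
    intro v hv h
    rcases qd with ⟨_, hd⟩ | ⟨p, q, t, hd⟩
    · exact hd.name_vertex v hv (Or.inr fun _ h => h)
    · exact hd.name_vertex v hv (h.imp_right fun h => absurd h t.val_le)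
  constructor
  · rintro f₂ ⟨f₁, h12, rfl, hf₁⟩
    have hbig : 3 < H.val (H.legVertex a) := by
      rcases H.nameOf_cases hst a with h | ⟨p, q, t⟩
      · exact h
      · exfalso
        have h1 : fn k f₁ = H.legVertex a := by
          rw [← fn_eq_of_vertex k hf₁, h12.isTri.r_f, fn_legVertex]
        have := t.eq_legVertex k h1
        exact h12.isTri.f_not_vertex (this ▸ G.isVertex_legVertex a)
    by_cases hf₂ : H.IsVertex (fn k f₂)
    · have hV₂ : fn k f₂ = H.legVertex a := by
        rw [← fn_eq_of_vertex k hf₂, h12.isTri.r_p, fn_legVertex]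
      have hV₁ : fn k (G.ι f₁) = H.legVertex a := by
        rw [fn_ι, ι_of_isVertex hf₁, ← fn_eq_of_vertex k hf₁, h12.isTri.r_f, fn_legVertex]
      have hxv : ¬ G'.IsVertex x := by
        rw [hG.over_isVertex_iff hst hB hx, isVertex_ι]; exact h12.isTri.f_not_vertex
      obtain ⟨z, rfl, -⟩ := hc.flag x hxv
      have hz : G.nameOf a z = G.ι f₁ := by rw [(qc.over hxv).nameOf_eq hx, hyname]
      have hz' : fn k z = H.legVertex a := by
        rw [h12.isTri.nameOf_two h12.2.2.1] at hz
        split_ifs at hz with h1 h2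
        · rw [h1, hV₂]
        · exact absurd (by rw [← G.ι_ι f₁, ← hz, G.ι_ι]) h12.1
        · rw [hz, hV₁]
      rw [hcd, hz', hV₂]
      exact hdv _ (H.isVertex_legVertex a) (Or.inr hbig)
    · have h1 : G.Over a x f₂ := hx.congr (by
        rw [h12.isTri.nameOf_ι_f hst])
      have := hk x f₂ h1 hf₂
      rwa [Over, nameOf_of_val hbig] at this
  · intro hno
    by_cases hky : H.IsVertex (fn k y)
    · have hkV : fn k y ≠ H.legVertex a ∨ 3 < H.val (H.legVertex a) := by
        rcases H.nameOf_cases hst a with h | ⟨p, q, t⟩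
        · exact Or.inr h
        · refine Or.inl fun h => ?_
          obtain ⟨f, p', t', -, -⟩ := t.lift k
          exact t'.val_le (hyV (t.eq_legVertex k h))
      have hxc : ∃ z, c z = x ∧ fn k z = fn k y := by
        by_cases hyv : G.IsVertex y
        · refine ⟨y, Subtype.ext ?_, rfl⟩
          rw [hxy]
          rcases qc with ⟨_, hc'⟩ | ⟨f, p, t, hc'⟩
          · exact hc'.name_vertex y hyv (Or.inr fun _ h => h)
          · exact hc'.name_vertex y hyv (Or.inl fun h => t.val_le (hyV h))
        · have hxv : ¬ G'.IsVertex x := by rwa [hG.over_isVertex_iff hst hB hx]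
          obtain ⟨z, rfl, -⟩ := hc.flag x hxv
          refine ⟨z, rfl, ?_⟩
          have hz : G.nameOf a z = y := by rw [(qc.over hxv).nameOf_eq hx, hyname]
          rcases G.nameOf_cases hst a with h | ⟨f, p, t⟩
          · rw [nameOf_of_val h] at hz; rw [hz]
          · by_cases hp : G.ι p = p
            · rw [t.nameOf_leg hp] at hz
              split_ifs at hz
              · rw [← hz] at hky
                exact absurd ⟨t.not_vertex, hp⟩ (((fn_contraction k).fiber _ hky).2.1 p (by simp))
              · rw [hz]
            · rw [t.nameOf_two hp] at hz
              split_ifs at hz with h1 h2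
              · exact absurd ⟨p, f, t.twoEdges hp, hz.symm, by
                  rwa [← hz, fn_ι_vertex] at hky⟩ hno
              · exact absurd ⟨f, p, (t.swap hp).twoEdges t.ι_ne, hz.symm, by
                  rwa [← hz, fn_ι_vertex] at hky⟩ hno
              · rw [hz]
      obtain ⟨z, rfl, hz⟩ := hxc
      rw [hcd, hz]
      exact hdv _ hky hkV
    · have := hk x y hx hky
      unfold Over at this
      rw [this]
      rcases H.nameOf_cases hst a with h | ⟨p, q, t⟩
      · rw [nameOf_of_val h]
      · rw [← t.fn_nameOf k, hyname]

end IsForgetHom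

/-! ### The functor `ft_a` -/

variable (hst : 3 < 2 * g + A.card) (hB : IsErase B A a.1)

/-- The graph `ft_a G`. -/
def forget (hst : 3 < 2 * g + A.card) (hB : IsErase B A a.1) (G : GCat U g A) :
    GCat U g B := (exists_isForget hst hB G).choose

theorem isForget_forget (G : GCat U g A) : G.IsForget a (forget hst hB G) :=
  (exists_isForget hst hB G).choose_spec

/-- The contraction `ft_a k`. -/
def forgetMap (k : G ⟶ H) : forget hst hB G ⟶ forget hst hB H :=
  (exists_forgetHom hst hB (isForget_forget hst hB G) (isForget_forget hst hB H) k).choose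

theorem isForgetHom_forgetMap (k : G ⟶ H) : IsForgetHom a k (forgetMap hst hB k) :=
  (exists_forgetHom hst hB (isForget_forget hst hB G) (isForget_forget hst hB H) k).choose_spec.1

theorem forgetMap_eq {k : G ⟶ H} {k' : forget hst hB G ⟶ forget hst hB H}
    (h : IsForgetHom a k k') : forgetMap hst hB k = k' :=
  (isForgetHom_forgetMap hst hB k).unique hst hB (isForget_forget hst hB G)
    (isForget_forget hst hB H) h

/-- The functor `ft_a` between the opposite categories of graphs. -/
def forgetFunctor : (GCat U g A)ᵒᵖ ⥤ (GCat U g B)ᵒᵖ where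
  obj G := op (forget hst hB G.unop)
  map k := (forgetMap hst hB k.unop).op
  map_id _ := congrArg Quiver.Hom.op (forgetMap_eq hst hB (IsForgetHom.id a _ _))
  map_comp k l := congrArg Quiver.Hom.op (forgetMap_eq hst hB
    ((isForgetHom_forgetMap hst hB l.unop).comp (isForgetHom_forgetMap hst hB k.unop)))

theorem isForgetFunctor : IsForgetFunctor a (forgetFunctor (U := U) hst hB) where
  obj _ := isForget_forget hst hB _
  map _ _ k _ _ hxy := (isForgetHom_forgetMap hst hB k).name hst hB (isForget_forget hst hB _)
    (isForget_forget hst hB _) hxy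

end GCat

/-! ### The metric after forgetting a mark -/

namespace GCat

open DGraph

variable {U Λ : Type u} {g : ℕ} {A B : Finset Λ} {G H : GCat U g A} {a : A} {f p : G.F}
  {G' H' : GCat U g B}

/-- The flags over which an edge flag `x` of `ft_a G` lies: either its namesake `y` alone, or both
`y` and the flag `p` at `V_a` to which the far end of `y` is merged. -/
theorem IsForget.over_cases (hst : 3 < 2 * g + A.card) (hB : IsErase B A a.1)
    (hG : G.IsForget a G') {x : G'.F} (hx : G'.ι x ≠ x) {y : G.F} (hxy : x.1 = y.1) :
    ((∀ h, G.Over a x h ↔ h = y) ∧ (G'.r x).1 = (G.r y).1 ∧ (G'.ι x).1 = (G.ι y).1) ∨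
    ∃ f p, G.IsTri a f p ∧ G.ι p ≠ p ∧ y = G.ι f ∧ (∀ h, G.Over a x h ↔ h = y ∨ h = p) ∧
      (G'.r x).1 = (G.r y).1 ∧ (G'.ι x).1 = (G.ι p).1 := by
  have hov : ∀ h, G.Over a x h ↔ G.nameOf a h = y := fun h => by
    unfold Over
    rw [hxy]
    exact ⟨fun h => (Subtype.ext h).symm, fun h => by rw [h]⟩
  obtain ⟨hya, hyname, -⟩ := hG.name_mem hst hxy
  rcases G.nameOf_cases hst a with hv | ⟨f, p, t⟩
  · exact Or.inl ⟨fun h => by rw [hov, nameOf_of_val hv], hG.struct₁ hv x y hxy⟩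
  · by_cases hp : G.ι p = p
    · have hl := t.edgeAndLeg hp
      have hyp : y ≠ p := by
        rintro rfl
        have := hG.over_ι hst hB ((hov y).2 hyname)
        rw [hp] at this
        exact hx (this.unique ((hov y).2 hyname))
      obtain ⟨h1, h2⟩ := hG.struct₃ _ _ hl x y hxy
      rw [if_neg hyp] at h1
      refine Or.inl ⟨fun h => ?_, h1, h2⟩
      rw [hov, t.nameOf_leg hp]
      rw [t.nameOf_leg hp] at hyname
      split_ifs at hyname with h3
      · exact absurd hyname.symm hyp
      · split_ifs with h4
        · exact ⟨fun h => absurd h.symm hyp, fun h => absurd (h ▸ h4) h3⟩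
        · rfl
    · -- both ends of the merged edge are treated alike
      have main : ∀ {f p}, G.IsTri a f p → G.ι p ≠ p → y = G.ι f →
          ((∀ h, G.Over a x h ↔ h = y) ∧ (G'.r x).1 = (G.r y).1 ∧ (G'.ι x).1 = (G.ι y).1) ∨
          ∃ f p, G.IsTri a f p ∧ G.ι p ≠ p ∧ y = G.ι f ∧ (∀ h, G.Over a x h ↔ h = y ∨ h = p) ∧
            (G'.r x).1 = (G.r y).1 ∧ (G'.ι x).1 = (G.ι p).1 := by
        intro f p t hp hyf
        obtain ⟨h1, h2⟩ := hG.struct₂ _ _ (t.twoEdges hp) x y hxy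
        rw [if_pos hyf] at h2
        refine Or.inr ⟨f, p, t, hp, hyf, fun h => ?_, h1, h2⟩
        rw [hov, t.nameOf_two hp, hyf]
        split_ifs with h3 h4
        · exact ⟨fun _ => Or.inr h3, fun _ => rfl⟩
        · refine ⟨fun h5 => absurd ?_ t.ne, ?_⟩
          · rw [← G.ι_ι f, ← h5, G.ι_ι]
          · rintro (h5 | h5)
            · exact absurd (h5.symm.trans h4) t.ι_ne
            · exact absurd h5 h3
        · exact ⟨fun h => Or.inl h, fun h => h.resolve_right h3⟩
      by_cases h1 : y = G.ι f
      · exact main t hp h1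
      by_cases h2 : y = G.ι p
      · exact main (t.swap hp) t.ι_ne h2
      obtain ⟨h3, h4⟩ := hG.struct₂ _ _ (t.twoEdges hp) x y hxy
      rw [if_neg h1, if_neg h2] at h4
      refine Or.inl ⟨fun h => ?_, h3, h4⟩
      rw [hov, t.nameOf_two hp]
      rw [t.nameOf_two hp] at hyname
      split_ifs at hyname with h5 h6
      · exact absurd hyname.symm h1
      · exact absurd hyname.symm h2
      · split_ifs with h7 h8
        · exact ⟨fun h => absurd h.symm h1, fun h => absurd (h ▸ h7) h5⟩
        · exact ⟨fun h => absurd h.symm h2, fun h => absurd (h ▸ h8) h6⟩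
        · rfl

/-- The set of flags over which `x` lies. -/
def overSet (G : GCat U g A) (a : A) {G₁ : GCat U g B} (x : G₁.F) : Finset G.F :=
  Finset.univ.filter fun h => G.Over a x h

theorem mem_overSet {x : G'.F} {h : G.F} : h ∈ G.overSet a x ↔ G.Over a x h := by
  simp [overSet]

theorem IsForget.sum_overSet_ι (hst : 3 < 2 * g + A.card) (hB : IsErase B A a.1)
    (hG : G.IsForget a G') {M : Type*} [AddCommMonoid M] (F : G.F → M)
    (hF : ∀ h, F (G.ι h) = F h) (x : G'.F) :
    ∑ h ∈ G.overSet a (G'.ι x), F h = ∑ h ∈ G.overSet a x, F h := by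
  refine Finset.sum_bij' (fun h _ => G.ι h) (fun h _ => G.ι h) (fun h hh => ?_) (fun h hh => ?_)
    (fun h _ => G.ι_ι h) (fun h _ => G.ι_ι h) fun h _ => (hF h).symm
  · have := hG.over_ι hst hB (mem_overSet.1 hh)
    rw [G'.ι_ι] at this
    exact mem_overSet.2 this
  · exact mem_overSet.2 (hG.over_ι hst hB (mem_overSet.1 hh))

/-- The length of a flag as a linear form. -/
def flagForm (G : GCat U g A) (h : G.F) : (G.Edge → ℤ) →ₗ[ℤ] ℤ where
  toFun δ := G.flagLen δ h
  map_add' δ δ' := by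
    by_cases hh : G.ι h = h
    · rw [flagLen_of_eq _ hh, flagLen_of_eq _ hh, flagLen_of_eq _ hh, add_zero]
    · rw [flagLen_of_ne _ hh, flagLen_of_ne _ hh, flagLen_of_ne _ hh]; rfl
  map_smul' c δ := by
    by_cases hh : G.ι h = h
    · rw [flagLen_of_eq _ hh, flagLen_of_eq _ hh, smul_zero]
    · rw [flagLen_of_ne _ hh, flagLen_of_ne _ hh]; rfl

/-- The linear map `η` on lattices: the length of an edge of `ft_a G` is the sum of the lengths of
the flags below one of its ends. -/
def forgetLen (G : GCat U g A) (a : A) (G' : GCat U g B) : (G.Edge → ℤ) →ₗ[ℤ] (G'.Edge → ℤ) :=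
  LinearMap.pi fun e => ∑ h ∈ G.overSet a (exists_edgeOf e).choose, G.flagForm h

theorem IsForget.forgetLen_edgeOf (hst : 3 < 2 * g + A.card)
    (hB : IsErase B A a.1) (hG : G.IsForget a G') (δ : G.Edge → ℤ) {x : G'.F}
    (hx : G'.ι x ≠ x) :
    G.forgetLen a G' δ (edgeOf x hx) = ∑ h ∈ G.overSet a x, G.flagLen δ h := by
  obtain ⟨hh, he⟩ := (exists_edgeOf (edgeOf x hx)).choose_spec
  simp only [forgetLen, LinearMap.pi_apply, LinearMap.sum_apply]
  show ∑ h ∈ G.overSet a (exists_edgeOf (edgeOf x hx)).choose, G.flagLen δ h = _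
  rcases edgeOf_eq_iff.1 he with h1 | h1
  · rw [← h1]
  · conv_rhs => rw [h1]
    rw [hG.sum_overSet_ι hst hB _ (G.flagLen_ι δ)]

theorem IsForget.flagLen_forgetLen (hst : 3 < 2 * g + A.card)
    (hB : IsErase B A a.1) (hG : G.IsForget a G') (δ : G.Edge → ℤ) {x : G'.F}
    (hx : G'.ι x ≠ x) :
    G'.flagLen (G.forgetLen a G' δ) x = ∑ h ∈ G.overSet a x, G.flagLen δ h := by
  rw [flagLen_of_ne _ hx, hG.forgetLen_edgeOf hst hB δ hx]

theorem IsForget.isForgetMetric (hst : 3 < 2 * g + A.card)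
    (hB : IsErase B A a.1) (hG : G.IsForget a G') (δ : G.Edge → ℤ) :
    IsForgetMetric G G' δ (G.forgetLen a G' δ) := by
  intro x y z hxy hz hx
  rw [hG.flagLen_forgetLen hst hB δ hx]
  rcases hG.over_cases hst hB hx hxy with ⟨h1, -, h3⟩ | ⟨f, p, t, hp, hyf, h1, -, h3⟩
  · rw [if_pos (Subtype.ext (h3.symm.trans hz))]
    have : G.overSet a x = {y} := by ext h; rw [mem_overSet, h1, Finset.mem_singleton]
    rw [this, Finset.sum_singleton]
  · have hzp : z = G.ι p := Subtype.ext (hz.symm.trans h3)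
    have hyp : y ≠ p := by rw [hyf]; exact t.ι_f_ne hst
    rw [if_neg, hzp, G.flagLen_ι]
    · have : G.overSet a x = {y, p} := by ext h; rw [mem_overSet, h1]; simp
      rw [this, Finset.sum_pair hyp]
    · rw [hyf, G.ι_ι, hzp]
      intro h
      exact t.ι_f_ne hst (by rw [h, G.ι_ι])

theorem IsForgetHom.forgetLen_pull (hst : 3 < 2 * g + A.card)
    (hB : IsErase B A a.1) (hG : G.IsForget a G') (hH : H.IsForget a H')
    {k : G ⟶ H} {k' : G' ⟶ H'} (hk : IsForgetHom a k k') (δ : H.Edge → ℤ) :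
    G.forgetLen a G' (pull k δ) = pull k' (H.forgetLen a H' δ) := by
  refine ext_flagLen fun x hx => ?_
  rw [hG.flagLen_forgetLen hst hB _ hx, flagLen_pull]
  simp only [flagLen_pull]
  by_cases hv : H'.IsVertex (fn k' x)
  · rw [flagLen_of_eq _ (ι_of_isVertex hv)]
    refine Finset.sum_eq_zero fun h hh => flagLen_of_eq _ (ι_of_isVertex ?_)
    by_contra hkh
    have := hk x h (mem_overSet.1 hh) hkh
    exact hkh ((hH.over_isVertex_iff hst hB this).1 hv)
  · rw [hH.flagLen_forgetLen hst hB _ fun h => hx ((fn_ι_eq_iff k' hv).2 h)]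
    rw [← Finset.sum_filter_add_sum_filter_not (G.overSet a x) fun h => H.IsVertex (fn k h)]
    rw [Finset.sum_eq_zero, zero_add]
    · refine Finset.sum_bij (fun h _ => fn k h) (fun h hh => ?_) (fun h hh h' hh' he => ?_)
        (fun h' hh' => ?_) fun h _ => rfl
      · obtain ⟨h1, h2⟩ := Finset.mem_filter.1 hh
        exact mem_overSet.2 (hk x h (mem_overSet.1 h1) h2)
      · exact fn_inj k (Finset.mem_filter.1 hh).2 he
      · have h1 := mem_overSet.1 hh'
        have h2 : ¬ H.IsVertex h' := by rwa [← hH.over_isVertex_iff hst hB h1]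
        obtain ⟨h, hxh, rfl⟩ := hk.exists_over hst hB hG hH h1 h2
        exact ⟨h, Finset.mem_filter.2 ⟨mem_overSet.2 hxh, h2⟩, rfl⟩
    · intro h hh
      exact flagLen_of_eq _ (ι_of_isVertex (Finset.mem_filter.1 hh).2)

/-- The real length of the edge through a flag. -/
def flagLenR (G : GCat U g A) (y : ℝ ⊗[ℤ] (G.Edge → ℤ)) (h : G.F) : ℝ :=
  if hh : G.ι h ≠ h then coord (edgeOf h hh) y else 0

theorem coord_edgeOf (G : GCat U g A) (y : ℝ ⊗[ℤ] (G.Edge → ℤ)) {h : G.F} (hh : G.ι h ≠ h) :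
    coord (edgeOf h hh) y = G.flagLenR y h := by
  unfold flagLenR; rw [dif_pos hh]

theorem IsForget.coord_forgetLen (hst : 3 < 2 * g + A.card)
    (hB : IsErase B A a.1) (hG : G.IsForget a G') (y : ℝ ⊗[ℤ] (G.Edge → ℤ))
    {x : G'.F} (hx : G'.ι x ≠ x) :
    coord (edgeOf x hx) (LinearMap.baseChange ℝ (G.forgetLen a G') y) =
      ∑ h ∈ G.overSet a x, G.flagLenR y h := by
  have hadd : ∀ (y z : ℝ ⊗[ℤ] (G.Edge → ℤ)) h,
      G.flagLenR (y + z) h = G.flagLenR y h + G.flagLenR z h := by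
    intro y z h
    unfold flagLenR coord
    split_ifs <;> simp
  induction y using TensorProduct.induction_on with
  | zero =>
    rw [map_zero, coord, map_zero, Finset.sum_eq_zero]
    intro h _
    unfold flagLenR coord
    split_ifs <;> simp
  | tmul c n =>
    rw [LinearMap.baseChange_tmul, coord, evalR_tmul, LinearMap.proj_apply,
      hG.forgetLen_edgeOf hst hB n hx, Int.cast_sum, Finset.sum_mul]
    refine Finset.sum_congr rfl fun h _ => ?_
    unfold flagLenR flagLen coord
    split_ifs with hh
    · rw [evalR_tmul]; rfl
    · simp
  | add y z hy hz =>
    simp only [map_add, coord, hadd, Finset.sum_add_distrib] at hy hz ⊢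
    rw [hy, hz]

theorem flagLenR_nonneg {y : ℝ ⊗[ℤ] (G.Edge → ℤ)} (hy : ∀ e, 0 ≤ coord e y) (h : G.F) :
    0 ≤ G.flagLenR y h := by
  unfold flagLenR
  split_ifs
  · exact hy _
  · exact le_rfl

theorem IsForget.exists_mem_overSet (hst : 3 < 2 * g + A.card) (hG : G.IsForget a G')
    (x : G'.F) : ∃ h, h ∈ G.overSet a x := by
  obtain ⟨h, hh⟩ := hG.exists_over hst x
  exact ⟨h, mem_overSet.2 hh⟩

theorem IsForget.ι_ne_of_over (hst : 3 < 2 * g + A.card)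
    (hB : IsErase B A a.1) (hG : G.IsForget a G') {x : G'.F} (hx : G'.ι x ≠ x)
    {h : G.F} (hh : G.Over a x h) : G.ι h ≠ h := by
  intro he
  have := hG.over_ι hst hB hh
  rw [he] at this
  exact hx (this.unique hh)

/-- If the metric on `ft_a G` vanishes on a cycle, then so does the metric on `G`. -/
theorem IsForget.isForest (hst : 3 < 2 * g + A.card)
    (hB : IsErase B A a.1) (hG : G.IsForget a G') {S : Set G.Edge}
    {S' : Set G'.Edge} (hS : G.IsForest S)
    (h : ∀ x y, FlagIn S' x → G.Over a x y → FlagIn S y) : G'.IsForest S' := by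
  rw [isForest_iff] at hS ⊢
  intro x hxS hreach
  have hx : G'.ι x ≠ x := hxS.choose
  choose s hs using hG.exists_name hst
  -- a path in `ft_a G` gives a path in `G` through the flags below
  have key : ∀ z, FlagIn S' z → G.Reach (fun q => FlagIn S q ∧
      (G.Over a z q ∨ G.Over a (G'.ι z) q)) (s (G'.r z)) (s (G'.r (G'.ι z))) := by
    intro z hz
    have hzne : G'.ι z ≠ z := hz.choose
    have hzne' : G'.ι (G'.ι z) ≠ G'.ι z := ι_ne hzne
    have e : ∀ {w : G'.F} {v : G.F}, w.1 = v.1 → s w = v := fun {w v} h =>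
      Subtype.ext ((hs w).symm.trans h)
    rcases hG.over_cases hst hB hzne (hs z) with ⟨h1, h2, h3⟩ | ⟨f, p, t, hp, hyf, h1, h2, h3⟩
    · have h4 : (G'.r (G'.ι z)).1 = (G.r (G.ι (s z))).1 := by
        rcases hG.over_cases hst hB hzne' h3 with ⟨_, h5, _⟩ | ⟨_, _, _, _, _, _, h5, _⟩ <;>
          exact h5
      rw [e h2, e h4]
      exact FlagReach.step ⟨h z _ hz ((h1 _).2 rfl), Or.inl ((h1 _).2 rfl)⟩
    · have h4 : (G'.r (G'.ι z)).1 = (G.r (G.ι p)).1 := by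
        rcases hG.over_cases hst hB hzne' h3 with ⟨_, h5, _⟩ | ⟨_, _, _, _, _, _, h5, _⟩ <;>
          exact h5
      rw [e h2, e h4]
      have o1 := (h1 (s z)).2 (Or.inl rfl)
      have o2 := (h1 p).2 (Or.inr rfl)
      refine FlagReach.trans (FlagReach.step ⟨h z _ hz o1, Or.inl o1⟩) ?_
      rw [hyf, G.ι_ι, t.r_f, ← t.r_p]
      exact FlagReach.step ⟨h z _ hz o2, Or.inl o2⟩
  have hreach' := hreach.map (r' := G.r) (ι' := G.ι) (R := fun q => FlagIn S q ∧
      ¬ G.Over a x q ∧ ¬ G.Over a (G'.ι x) q) s fun z hz => (key z hz.1).mono fun q hq => by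
    refine ⟨hq.1, fun h1 => ?_, fun h1 => ?_⟩ <;> rcases hq.2 with h2 | h2
    · exact hz.2.1 (h2.unique h1)
    · exact hz.2.2 (by rw [← G'.ι_ι z, h2.unique h1])
    · exact hz.2.2 (h2.unique h1)
    · exact hz.2.1 (by rw [← G'.ι_ι z, h2.unique h1, G'.ι_ι])
  have e : ∀ {w : G'.F} {v : G.F}, w.1 = v.1 → s w = v := fun {w v} h =>
    Subtype.ext ((hs w).symm.trans h)
  have hx' : G'.ι (G'.ι x) ≠ G'.ι x := ι_ne hx
  rcases hG.over_cases hst hB hx (hs x) with ⟨h1, h2, h3⟩ | ⟨f, p, t, hp, hyf, h1, h2, h3⟩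
  · have h4 : (G'.r (G'.ι x)).1 = (G.r (G.ι (s x))).1 := by
      rcases hG.over_cases hst hB hx' h3 with ⟨_, h5, _⟩ | ⟨_, _, _, _, _, _, h5, _⟩ <;>
          exact h5
    have o1 := (h1 (s x)).2 rfl
    rw [e h2, e h4] at hreach'
    refine hS (s x) (h x _ hxS o1) (hreach'.mono fun q hq => ⟨hq.1, ?_, ?_⟩)
    · rintro rfl; exact hq.2.1 o1
    · rintro rfl; exact hq.2.2 (hG.over_ι hst hB o1)
  · have h4 : (G'.r (G'.ι x)).1 = (G.r (G.ι p)).1 := by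
      rcases hG.over_cases hst hB hx' h3 with ⟨_, h5, _⟩ | ⟨_, _, _, _, _, _, h5, _⟩ <;>
          exact h5
    have o1 := (h1 (s x)).2 (Or.inl rfl)
    have o2 := (h1 p).2 (Or.inr rfl)
    rw [e h2, e h4] at hreach'
    refine hS (s x) (h x _ hxS o1) (FlagReach.trans (hreach'.mono fun q hq => ⟨hq.1, ?_, ?_⟩) ?_)
    · rintro rfl; exact hq.2.1 o1
    · rintro rfl; exact hq.2.2 (hG.over_ι hst hB o1)
    · have h5 := FlagReach.step (r := G.r) (ι := G.ι) (Q := fun q => FlagIn S q ∧ q ≠ s x ∧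
        q ≠ G.ι (s x)) (h := G.ι p) ⟨(h x _ hxS o2).ι, ?_, ?_⟩
      · rw [G.ι_ι, t.r_p, ← t.r_f] at h5
        rw [hyf, G.ι_ι]
        rwa [hyf, G.ι_ι] at h5
      · rw [hyf]
        intro he
        exact t.ne (by rw [← G.ι_ι f, ← he, G.ι_ι])
      · rw [hyf, G.ι_ι]
        intro he
        exact t.ι_f_ne hst (by rw [← he, G.ι_ι])

theorem IsForget.forgetLen_mem (hst : 3 < 2 * g + A.card)
    (hB : IsErase B A a.1) (hG : G.IsForget a G') (y : ℝ ⊗[ℤ] (G.Edge → ℤ))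
    (hy : y ∈ Poic.orthantCone G.Edge G.IsForest) :
    LinearMap.baseChange ℝ (G.forgetLen a G') y ∈ Poic.orthantCone G'.Edge G'.IsForest := by
  refine ⟨fun e => ?_, ?_⟩
  · obtain ⟨x, hx, rfl⟩ := exists_edgeOf e
    have := hG.coord_forgetLen hst hB y hx
    rw [coord] at this
    rw [this]
    exact Finset.sum_nonneg fun h _ => flagLenR_nonneg hy.1 h
  · refine hG.isForest hst hB hy.2 fun x z hxS hz => ?_
    obtain ⟨hx, hxS⟩ := hxS
    have hzne := hG.ι_ne_of_over hst hB hx hz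
    refine ⟨hzne, ?_⟩
    have h1 : coord (edgeOf x hx) (LinearMap.baseChange ℝ (G.forgetLen a G') y) = 0 := hxS
    rw [hG.coord_forgetLen hst hB y hx,
      Finset.sum_eq_zero_iff_of_nonneg fun h _ => flagLenR_nonneg hy.1 h] at h1
    have h2 := h1 z (mem_overSet.2 hz)
    rw [← coord_edgeOf _ _ hzne] at h2
    exact h2

theorem IsForget.coord_pos (hst : 3 < 2 * g + A.card)
    (hB : IsErase B A a.1) (hG : G.IsForget a G') {y : ℝ ⊗[ℤ] (G.Edge → ℤ)}
    (hy : ∀ e, 0 < coord e y) (e : G'.Edge) :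
    0 < coord e (LinearMap.baseChange ℝ (G.forgetLen a G') y) := by
  obtain ⟨x, hx, rfl⟩ := exists_edgeOf e
  rw [hG.coord_forgetLen hst hB y hx]
  obtain ⟨h, hh⟩ := hG.exists_mem_overSet hst x
  refine Finset.sum_pos' (fun h _ => flagLenR_nonneg (fun e => (hy e).le) h) ⟨h, hh, ?_⟩
  rw [← coord_edgeOf _ _ (hG.ι_ne_of_over hst hB hx (mem_overSet.1 hh))]
  exact hy _

end GCat

open GCat in
/-- The morphism of poic-spaces `ft_a`. -/
def forgetMor (U : Type u) {Λ : Type u} {g : ℕ} {A B : Finset Λ} {a : A}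
    (hst : 3 < 2 * g + A.card) (hB : IsErase B A a.1) :
    PoicMor (Mtrop U g A) (Mtrop U g B) where
  functor := forgetFunctor hst hB
  η :=
    { app := fun G => ⟨G.unop.forgetLen a (forget hst hB G.unop),
        (isForget_forget hst hB G.unop).forgetLen_mem hst hB⟩
      naturality := fun G H k => Poic.hom_ext (LinearMap.ext fun δ =>
        (isForgetHom_forgetMap hst hB k.unop).forgetLen_pull hst hB (isForget_forget hst hB _)
          (isForget_forget hst hB _) δ) }
  not_in_proper_face := by
    intro G τ hτ hsub
    obtain ⟨y, hy⟩ := exists_coord (I := G.unop.Edge) fun _ => (1 : ℝ)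
    have hpos : ∀ e, 0 < coord e y := fun e => by rw [hy]; exact one_pos
    exact Poic.eq_orthantCone_of_pos_mem DGraph.isForest_empty DGraph.isForest_mono hτ
      (hsub ⟨y, Poic.mem_orthantCone_of_pos DGraph.isForest_empty hpos, rfl⟩)
      ((isForget_forget hst hB G.unop).coord_pos hst hB hpos)

theorem isForgetMor_forgetMor (U : Type u) {Λ : Type u} {g : ℕ} {A B : Finset Λ} {a : A}
    (hst : 3 < 2 * g + A.card) (hB : IsErase B A a.1) :
    IsForgetMor a (forgetMor U hst hB) where
  functor := GCat.isForgetFunctor hst hB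
  metric G δ := (GCat.isForget_forget hst hB G).isForgetMetric hst hB δ

/-! ### Roots after forgetting a mark -/

namespace GCat

open DGraph

variable {U Λ : Type u} {g : ℕ} {A B : Finset Λ} {G : GCat U g A} {a : A} {f p : G.F}
  {G' : GCat U g B}

namespace IsForget

/-- The vertices of `ft_a G` are those of `G`, except for a trivalent `V_a`. -/
theorem exists_vertex_iff (hst : 3 < 2 * g + A.card) (hB : IsErase B A a.1)
    (hG : G.IsForget a G') {v : G.F} (hv : G.IsVertex v) :
    (∃ w : G'.F, w.1 = v.1) ↔ v ≠ G.legVertex a ∨ 3 < G.val (G.legVertex a) := by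
  constructor
  · rintro ⟨w, hw⟩
    by_contra hcon
    push Not at hcon
    exact absurd ((hG.name_mem hst hw).2.2 hcon.1) (not_lt.2 hcon.2)
  · intro h
    rcases G.nameOf_cases hst a with hval | ⟨f, p, t⟩
    · obtain ⟨c, hc⟩ := hG.exists_quot_val hst hB hval
      exact ⟨c v, hc.name_vertex v hv (Or.inr fun _ h => h)⟩
    · obtain ⟨c, hc⟩ := hG.exists_quot_tri hst hB t
      exact ⟨c v, hc.name_vertex v hv (h.imp_right fun h => absurd h t.val_le)⟩

/-- Every flag of `ft_a G` lies over a flag with the same root. -/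
theorem exists_over_root (hst : 3 < 2 * g + A.card) (hG : G.IsForget a G') (x : G'.F) :
    ∃ h, G.Over a x h ∧ (G'.r x).1 = (G.r h).1 := by
  obtain ⟨y, hy⟩ := hG.exists_name hst x
  rcases G.nameOf_cases hst a with hv | ⟨f, p, t⟩
  · exact ⟨y, hG.over_of_name hst hy, (hG.struct₁ hv x y hy).1⟩
  · by_cases hp : G.ι p = p
    · have h1 := (hG.struct₃ _ _ (t.edgeAndLeg hp) x y hy).1
      by_cases hyp : y = p
      · rw [if_pos hyp] at h1
        refine ⟨G.ι f, (hG.over_of_name hst hy).congr ?_, h1⟩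
        rw [hyp, t.nameOf_ι_f hst]
      · rw [if_neg hyp] at h1
        exact ⟨y, hG.over_of_name hst hy, h1⟩
    · exact ⟨y, hG.over_of_name hst hy, (hG.struct₂ _ _ (t.twoEdges hp) x y hy).1⟩

theorem root_of_over (hst : 3 < 2 * g + A.card) (hG : G.IsForget a G') {x w : G'.F} {h : G.F}
    (hx : G.Over a x h) (hw : w.1 = (G.r h).1) : G'.r x = w := by
  refine Subtype.ext ?_
  rw [hw]
  rcases G.nameOf_cases hst a with hv | ⟨f, p, t⟩
  · rw [Over, nameOf_of_val hv] at hx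
    exact (hG.struct₁ hv x h hx).1
  · have hV : G.r h ≠ G.legVertex a := fun hh => t.val_le ((hG.name_mem hst hw).2.2 hh)
    have h1 : h ≠ f := fun hh => hV (by rw [hh, t.r_f])
    have h2 : h ≠ p := fun hh => hV (by rw [hh, t.r_p])
    by_cases hp : G.ι p = p
    · rw [Over, t.nameOf_leg hp] at hx
      have h3 := (hG.struct₃ _ _ (t.edgeAndLeg hp) x _ hx).1
      rw [h3]
      by_cases h4 : h = G.ι f
      · rw [if_pos (Or.inr h4), if_pos rfl, h4]
      · have h5 : (if h = f ∨ h = G.ι f then p else h) = h := if_neg (by tauto)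
        rw [h5, if_neg h2]
    · rw [Over, t.nameOf_two hp, if_neg h2, if_neg h1] at hx
      exact (hG.struct₂ _ _ (t.twoEdges hp) x _ hx).1

/-- A flag of `ft_a G` lies over only one flag whose root is a vertex of `ft_a G`. -/
theorem over_inj (hst : 3 < 2 * g + A.card) (hG : G.IsForget a G') {x w w' : G'.F} {h h' : G.F}
    (hx : G.Over a x h) (hx' : G.Over a x h') (hw : w.1 = (G.r h).1) (hw' : w'.1 = (G.r h').1) :
    h = h' := by
  have hn := hx.nameOf_eq hx'
  rcases G.nameOf_cases hst a with hv | ⟨f, p, t⟩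
  · rwa [nameOf_of_val hv, nameOf_of_val hv] at hn
  · have key : ∀ {w : G'.F} {h : G.F}, w.1 = (G.r h).1 → h ≠ f ∧ h ≠ p := fun {w h} hw => by
      have hV : G.r h ≠ G.legVertex a := fun hh => t.val_le ((hG.name_mem hst hw).2.2 hh)
      exact ⟨fun hh => hV (by rw [hh, t.r_f]), fun hh => hV (by rw [hh, t.r_p])⟩
    obtain ⟨h1, h2⟩ := key hw
    obtain ⟨h3, h4⟩ := key hw'
    by_cases hp : G.ι p = p
    · rw [t.nameOf_leg hp, t.nameOf_leg hp] at hn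
      split_ifs at hn with h5 h6 h6
      · rw [h5.resolve_left h1, h6.resolve_left h3]
      · exact absurd hn.symm h4
      · exact absurd hn h2
      · exact hn
    · rwa [t.nameOf_two hp, t.nameOf_two hp, if_neg h2, if_neg h1, if_neg h4, if_neg h3] at hn

end IsForget

/-! ### Merging of flags -/

/-- The relation that two flags are merged, or both removed, when all marks in `D` are forgotten:
the smallest equivalence relation, compatible with the involution, which relates the legs with
marks in `D` and, if all but two of the flags at a vertex are related to such legs, passes from one
of the two flags to the other. This description does not depend on an order of the marks. -/
inductive Merge (G : GCat U g A) (D : Λ → Prop) : G.F → G.F → Prop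
  | refl {h : G.F} (hh : ¬ G.IsVertex h) : Merge G D h h
  | symm {h h' : G.F} : Merge G D h h' → Merge G D h' h
  | trans {h h' h'' : G.F} : Merge G D h h' → Merge G D h' h'' → Merge G D h h''
  | ι {h h' : G.F} : Merge G D h h' → Merge G D (G.ι h) (G.ι h')
  | dead {b c : A} : D b.1 → D c.1 → Merge G D (G.leg b) (G.leg c)
  | rule {h p : G.F} (d : G.F → A) : ¬ G.IsVertex h → ¬ G.IsVertex p → h ≠ p → G.r h = G.r p →
      (∀ q, ¬ G.IsVertex q → G.r q = G.r h → q ≠ h → q ≠ p → D (d q).1) →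
      (∀ q, ¬ G.IsVertex q → G.r q = G.r h → q ≠ h → q ≠ p → Merge G D q (G.leg (d q))) →
      Merge G D (G.ι h) p

/-- The flags that are removed, with a leg, when the marks in `D` are forgotten. -/
def Dead (G : GCat U g A) (D : Λ → Prop) (h : G.F) : Prop := ∃ b : A, D b.1 ∧ G.Merge D h (G.leg b)

variable {D : Λ → Prop}

theorem Merge.not_isVertex {h h' : G.F} (m : G.Merge D h h') :
    ¬ G.IsVertex h ∧ ¬ G.IsVertex h' := by
  induction m with
  | refl hh => exact ⟨hh, hh⟩
  | symm _ ih => exact ih.symm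
  | trans _ _ ih1 ih2 => exact ⟨ih1.1, ih2.2⟩
  | ι _ ih => exact ⟨fun h => ih.1 (isVertex_ι.1 h), fun h => ih.2 (isVertex_ι.1 h)⟩
  | dead _ _ => exact ⟨G.leg_not_vertex _, G.leg_not_vertex _⟩
  | rule d h1 h2 _ _ _ _ _ => exact ⟨fun h => h1 (isVertex_ι.1 h), h2⟩

theorem Dead.of_merge {h h' : G.F} (m : G.Merge D h h') (hd : G.Dead D h') : G.Dead D h := by
  obtain ⟨b, hb, m'⟩ := hd
  exact ⟨b, hb, m.trans m'⟩

theorem Dead.merge {h h' : G.F} (hd : G.Dead D h) (hd' : G.Dead D h') : G.Merge D h h' := by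
  obtain ⟨b, hb, m⟩ := hd
  obtain ⟨c, hc, m'⟩ := hd'
  exact m.trans ((Merge.dead hb hc).trans m'.symm)

theorem Dead.ι {h : G.F} (hd : G.Dead D h) : G.Dead D (G.ι h) := by
  obtain ⟨b, hb, m⟩ := hd
  refine ⟨b, hb, ?_⟩
  have := m.ι
  rwa [G.ι_leg] at this

theorem dead_leg {b : A} (hb : D b.1) : G.Dead D (G.leg b) :=
  ⟨b, hb, Merge.refl (G.leg_not_vertex b)⟩

/-- At every vertex there is a flag different from two given ones. -/
theorem exists_other (G : GCat U g A) (v : G.F) (hv : G.IsVertex v) (h p : G.F) :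
    ∃ q, ¬ G.IsVertex q ∧ G.r q = v ∧ q ≠ h ∧ q ≠ p := by
  obtain ⟨x, y, z, h1, h2, h3, h4, h5, h6, h7, h8, h9⟩ := G.isStableGraph.stable v hv
  by_cases hx : x ≠ h ∧ x ≠ p
  · exact ⟨x, h4, h7, hx.1, hx.2⟩
  by_cases hy : y ≠ h ∧ y ≠ p
  · exact ⟨y, h5, h8, hy.1, hy.2⟩
  refine ⟨z, h6, h9, ?_, ?_⟩ <;> rintro rfl <;> grind

/-- The rule that defines `Merge`, in terms of flags that are removed. -/
theorem merge_of_dead {h p : G.F} (h1 : ¬ G.IsVertex h) (h2 : ¬ G.IsVertex p) (h3 : h ≠ p)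
    (h4 : G.r h = G.r p)
    (h5 : ∀ q, ¬ G.IsVertex q → G.r q = G.r h → q ≠ h → q ≠ p → G.Dead D q) :
    G.Merge D (G.ι h) p := by
  obtain ⟨q₀, q1, q2, q3, q4⟩ := G.exists_other (G.r h) (isVertex_r h) h p
  obtain ⟨b, -, -⟩ := h5 q₀ q1 q2 q3 q4
  have : ∀ q, ∃ b : A, ¬ G.IsVertex q → G.r q = G.r h → q ≠ h → q ≠ p →
      D b.1 ∧ G.Merge D q (G.leg b) := fun q => by
    by_cases hq : ¬ G.IsVertex q ∧ G.r q = G.r h ∧ q ≠ h ∧ q ≠ p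
    · obtain ⟨b, hb⟩ := h5 q hq.1 hq.2.1 hq.2.2.1 hq.2.2.2
      exact ⟨b, fun _ _ _ _ => hb⟩
    · exact ⟨b, fun h1 h2 h3 h4 => absurd ⟨h1, h2, h3, h4⟩ hq⟩
  choose d hd using this
  exact Merge.rule d h1 h2 h3 h4 (fun q a b c e => (hd q a b c e).1)
    fun q a b c e => (hd q a b c e).2

/-- Without marks to forget, nothing is merged. -/
theorem Merge.eq_of_no_marks (hD : ∀ b : A, ¬ D b.1) {h h' : G.F} (m : G.Merge D h h') :
    h = h' := by
  induction m with
  | refl _ => rfl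
  | symm _ ih => exact ih.symm
  | trans _ _ ih1 ih2 => exact ih1.trans ih2
  | ι _ ih => rw [ih]
  | dead hb _ => exact absurd hb (hD _)
  | @rule h p d _ _ _ _ h5 _ _ =>
    obtain ⟨q₀, q1, q2, q3, q4⟩ := G.exists_other (G.r h) (isVertex_r h) h p
    exact absurd (h5 q₀ q1 q2 q3 q4) (hD _)

namespace IsTri

theorem merge (t : G.IsTri a f p) (ha : D a.1) : G.Merge D (G.ι f) p := by
  refine merge_of_dead t.f_not_vertex t.not_vertex t.ne (by rw [t.r_f, t.r_p]) ?_
  intro q hq hr h1 h2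
  rw [t.r_f, t.iff] at hr
  rcases hr with rfl | h | h | rfl
  · exact dead_leg ha
  · exact absurd h h1
  · exact absurd h h2
  · exact absurd (G.isVertex_legVertex a) hq

theorem merge' (t : G.IsTri a f p) (ha : D a.1) : G.Merge D (G.ι p) f := by
  have := (t.merge ha).ι
  rw [G.ι_ι] at this
  exact this.symm

end IsTri

/-- Flags with the same name are merged. -/
theorem merge_of_nameOf_eq (hst : 3 < 2 * g + A.card) (ha : D a.1) {h h' : G.F}
    (hh : ¬ G.IsVertex h) (hn : G.nameOf a h = G.nameOf a h') : G.Merge D h h' := by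
  have key : ∀ h, ¬ G.IsVertex h → G.Merge D h (G.nameOf a h) := by
    intro h hh
    rcases G.nameOf_cases hst a with hv | ⟨f, p, t⟩
    · rw [nameOf_of_val hv]; exact .refl hh
    · by_cases hp : G.ι p = p
      · rw [t.nameOf_leg hp]
        split_ifs with h1
        · rcases h1 with rfl | rfl
          · have := t.merge' ha
            rw [hp] at this; exact this.symm
          · exact t.merge ha
        · exact .refl hh
      · rw [t.nameOf_two hp]
        split_ifs with h1 h2
        · rw [h1]; exact (t.merge ha).symm
        · rw [h2]; exact (t.merge' ha).symm
        · exact .refl hh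
  have hh' : ¬ G.IsVertex h' := by
    rw [← nameOf_vertex_iff hst (a := a), ← hn, nameOf_vertex_iff hst]; exact hh
  exact (key h hh).trans (hn ▸ (key h' hh').symm)

namespace IsForget

/-- If flags of `ft_a G` are merged, then so are the flags of `G` below. -/
theorem merge_down (hst : 3 < 2 * g + A.card) (hB : IsErase B A a.1)
    (hG : G.IsForget a G') (ha : D a.1) {x x' : G'.F} (m : G'.Merge D x x') :
    ∀ {h h' : G.F}, G.Over a x h → G.Over a x' h' → G.Merge D h h' := by
  have same : ∀ {x : G'.F} {h h' : G.F}, ¬ G'.IsVertex x → G.Over a x h → G.Over a x h' →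
      G.Merge D h h' := fun hx h1 h2 =>
    merge_of_nameOf_eq hst ha (fun hv => hx ((hG.over_isVertex_iff hst hB h1).2 hv))
      (h1.nameOf_eq h2)
  have hA : ∀ b : B, ∃ c : A, c.1 = b.1 := fun b => ⟨⟨b.1, ((hB _).1 b.2).1⟩, rfl⟩
  induction m with
  | refl hx => exact fun h1 h2 => same hx h1 h2
  | symm _ ih => exact fun h1 h2 => (ih h2 h1).symm
  | trans _ _ ih1 ih2 =>
    intro h h' h1 h2
    obtain ⟨k, hk⟩ := hG.exists_over hst _
    exact (ih1 h1 hk).trans (ih2 hk h2)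
  | ι _ ih =>
    intro h h' h1 h2
    have e1 := hG.over_ι hst hB h1
    have e2 := hG.over_ι hst hB h2
    rw [G'.ι_ι] at e1 e2
    have := (ih e1 e2).ι
    rwa [G.ι_ι, G.ι_ι] at this
  | @dead b c hb hc =>
    intro h h' h1 h2
    obtain ⟨b', hb'⟩ := hA b
    obtain ⟨c', hc'⟩ := hA c
    have m1 := same (G'.leg_not_vertex b) h1 (hG.over_leg hst hb'.symm)
    have m2 := same (G'.leg_not_vertex c) h2 (hG.over_leg hst hc'.symm)
    exact m1.trans ((Merge.dead (by rwa [hb']) (by rwa [hc'])).trans m2.symm)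
  | @rule x p' d hx hp hne hr hd _ ih =>
    intro h h' h1 h2
    obtain ⟨h₀, o1, r1⟩ := hG.exists_over_root hst x
    obtain ⟨h₁, o2, r2⟩ := hG.exists_over_root hst p'
    have hx' : ¬ G'.IsVertex (G'.ι x) := fun h => hx (isVertex_ι.1 h)
    have hroot : G.r h₀ = G.r h₁ := Subtype.ext (by rw [← r1, ← r2, hr])
    have hV0 : ¬ G.IsVertex h₀ := by rwa [← hG.over_isVertex_iff hst hB o1]
    have hV1 : ¬ G.IsVertex h₁ := by rwa [← hG.over_isVertex_iff hst hB o2]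
    refine (same hx' h1 (hG.over_ι hst hB o1)).trans (Merge.trans ?_ (same hp o2 h2))
    refine merge_of_dead hV0 hV1 (fun he => hne (o1.unique (he ▸ o2))) hroot ?_
    intro q hq hqr hq0 hq1
    by_cases hqa : q = G.leg a
    · rw [hqa]; exact dead_leg ha
    · obtain ⟨y, hy⟩ := hG.exists_of_flag hst hB hq hqa
      have hw : (G'.r x).1 = (G.r q).1 := by rw [hqr, r1]
      have hyr : G'.r y = G'.r x := hG.root_of_over hst hy hw
      have hyv : ¬ G'.IsVertex y := by rwa [hG.over_isVertex_iff hst hB hy]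
      have hyx : y ≠ x := fun he => hq0 (hG.over_inj hst (he ▸ hy) o1 hw r1)
      have hyp : y ≠ p' := fun he => hq1 (hG.over_inj hst (he ▸ hy) o2 hw r2)
      obtain ⟨c', hc'⟩ := hA (d y)
      have hDc : D c'.1 := by rw [hc']; exact hd y hyv hyr hyx hyp
      exact ⟨c', hDc, ih y hyv hyr hyx hyp hy (hG.over_leg hst hc'.symm)⟩

/-- If flags of `G` are merged, then so are the flags of `ft_a G` above. -/
theorem merge_up (hst : 3 < 2 * g + A.card) (hB : IsErase B A a.1)
    (hG : G.IsForget a G') {h h' : G.F} (m : G.Merge D h h') :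
    ((h = G.leg a ∨ ∃ x : G'.F, G.Over a x h ∧ G'.Dead D x) ∧
      (h' = G.leg a ∨ ∃ x : G'.F, G.Over a x h' ∧ G'.Dead D x)) ∨
    ∃ x x' : G'.F, G.Over a x h ∧ G.Over a x' h' ∧ G'.Merge D x x' := by
  let Z : G.F → Prop := fun h => h = G.leg a ∨ ∃ x : G'.F, G.Over a x h ∧ G'.Dead D x
  let R : G.F → G.F → Prop := fun h h' => (Z h ∧ Z h') ∨
    ∃ x x' : G'.F, G.Over a x h ∧ G.Over a x' h' ∧ G'.Merge D x x'
  have dead_of_over : ∀ {h : G.F} {x : G'.F}, Z h → G.Over a x h → G'.Dead D x := by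
    rintro h x (rfl | ⟨y, hy, hd⟩) hx
    · exact absurd rfl (hG.over_ne_leg hst hx)
    · rwa [hx.unique hy]
  have Z_of_R : ∀ {h h' : G.F}, R h h' → Z h' → Z h := by
    rintro h h' (⟨h1, -⟩ | ⟨x, x', hx, hx', m⟩) hz
    · exact h1
    · exact Or.inr ⟨x, hx, Dead.of_merge m (dead_of_over hz hx')⟩
  have R_symm : ∀ {h h' : G.F}, R h h' → R h' h := by
    rintro h h' (⟨h1, h2⟩ | ⟨x, x', hx, hx', m⟩)
    · exact Or.inl ⟨h2, h1⟩
    · exact Or.inr ⟨x', x, hx', hx, m.symm⟩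
  have Z_ι : ∀ {h : G.F}, Z h → Z (G.ι h) := by
    rintro h (rfl | ⟨y, hy, hd⟩)
    · exact Or.inl (G.ι_leg a)
    · exact Or.inr ⟨_, hG.over_ι hst hB hy, hd.ι⟩
  have Z_leg : ∀ b : A, D b.1 → Z (G.leg b) := by
    intro b hb
    by_cases hba : b = a
    · exact Or.inl (by rw [hba])
    · let b' : B := ⟨b.1, (hB _).2 ⟨b.2, fun h => hba (Subtype.ext h)⟩⟩
      exact Or.inr ⟨G'.leg b', hG.over_leg hst rfl, dead_leg hb⟩
  show R h h'
  induction m with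
  | @refl h hh =>
    by_cases hha : h = G.leg a
    · exact Or.inl ⟨Or.inl hha, Or.inl hha⟩
    · obtain ⟨x, hx⟩ := hG.exists_of_flag hst hB hh hha
      exact Or.inr ⟨x, x, hx, hx, .refl (by rwa [hG.over_isVertex_iff hst hB hx])⟩
  | symm _ ih => exact R_symm ih
  | trans _ _ ih1 ih2 =>
    rcases ih1 with ⟨h1, h2⟩ | ⟨x, x', hx, hx', m⟩
    · exact Or.inl ⟨h1, Z_of_R (R_symm ih2) h2⟩
    · rcases ih2 with ⟨h1, h2⟩ | ⟨y, y', hy, hy', m'⟩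
      · exact Or.inl ⟨Z_of_R (Or.inr ⟨x, x', hx, hx', m⟩) h1, h2⟩
      · obtain rfl := hx'.unique hy
        exact Or.inr ⟨x, y', hx, hy', m.trans m'⟩
  | ι _ ih =>
    rcases ih with ⟨h1, h2⟩ | ⟨x, x', hx, hx', m⟩
    · exact Or.inl ⟨Z_ι h1, Z_ι h2⟩
    · exact Or.inr ⟨_, _, hG.over_ι hst hB hx, hG.over_ι hst hB hx', m.ι⟩
  | dead hb hc => exact Or.inl ⟨Z_leg _ hb, Z_leg _ hc⟩
  | @rule h p d hh hp hne hr hd _ ih =>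
    have hZ : ∀ q, ¬ G.IsVertex q → G.r q = G.r h → q ≠ h → q ≠ p → Z q :=
      fun q q1 q2 q3 q4 => Z_of_R (ih q q1 q2 q3 q4) (Z_leg _ (hd q q1 q2 q3 q4))
    by_cases hV : ∃ w : G'.F, w.1 = (G.r h).1
    · -- the common root is a vertex of `ft_a G`, where the rule can be applied again
      obtain ⟨w, hw⟩ := hV
      have hwv : G'.IsVertex w := (hG.name_isVertex_iff hst hB hw).2 (isVertex_r h)
      have hdead : ∀ y, ¬ G'.IsVertex y → G'.r y = w → ¬ G.Over a y h → ¬ G.Over a y p →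
          G'.Dead D y := by
        intro y hy hyr h1 h2
        obtain ⟨q, hq, hqr⟩ := hG.exists_over_root hst y
        refine dead_of_over (hZ q ?_ ?_ ?_ ?_) hq
        · rwa [← hG.over_isVertex_iff hst hB hq]
        · exact Subtype.ext (by rw [← hqr, hyr, hw])
        · rintro rfl; exact h1 hq
        · rintro rfl; exact h2 hq
      -- if only the marked leg joins a flag `x` over the common root, then all flags there are dead
      have alone : ∀ x, ¬ G'.IsVertex x → G'.r x = w →
          (∀ y, ¬ G'.IsVertex y → G'.r y = w → y ≠ x → G'.Dead D y) → G'.Dead D (G'.ι x) := by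
        intro x hxv hxr h1
        obtain ⟨y, y1, y2, y3, -⟩ := G'.exists_other w hwv x x
        exact Dead.of_merge (merge_of_dead hxv y1 y3.symm (by rw [y2, hxr]) fun q q1 q2 q3 _ =>
          h1 q q1 (by rw [q2, hxr]) q3) (h1 y y1 y2 y3)
      by_cases hha : h = G.leg a
      · have hpa : p ≠ G.leg a := fun he => hne (hha.trans he.symm)
        obtain ⟨x, hx⟩ := hG.exists_of_flag hst hB hp hpa
        have := alone x (by rwa [hG.over_isVertex_iff hst hB hx])
          (hG.root_of_over hst hx (by rw [hw, hr])) fun y y1 y2 y3 =>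
            hdead y y1 y2 (fun h => hG.over_ne_leg hst h hha) fun h => y3 (h.unique hx)
        exact Or.inl ⟨Or.inl (by rw [hha, G.ι_leg]), Or.inr ⟨x, hx, by
          rw [← G'.ι_ι x]; exact this.ι⟩⟩
      · obtain ⟨x, hx⟩ := hG.exists_of_flag hst hB hh hha
        have hxr : G'.r x = w := hG.root_of_over hst hx hw
        have hxv : ¬ G'.IsVertex x := by rwa [hG.over_isVertex_iff hst hB hx]
        by_cases hpa : p = G.leg a
        · exact Or.inl ⟨Or.inr ⟨_, hG.over_ι hst hB hx, alone x hxv hxr fun y y1 y2 y3 =>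
            hdead y y1 y2 (fun h => y3 (h.unique hx)) fun h => hG.over_ne_leg hst h hpa⟩,
            Or.inl hpa⟩
        · obtain ⟨x', hx'⟩ := hG.exists_of_flag hst hB hp hpa
          have hxr' : G'.r x' = w := hG.root_of_over hst hx' (by rw [hw, hr])
          have hxv' : ¬ G'.IsVertex x' := by rwa [hG.over_isVertex_iff hst hB hx']
          have hxx : x ≠ x' := fun he =>
            hne (hG.over_inj hst hx (he ▸ hx') hw (by rw [hw, hr]))
          exact Or.inr ⟨_, x', hG.over_ι hst hB hx, hx', merge_of_dead hxv hxv' hxx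
            (by rw [hxr, hxr']) fun q q1 q2 q3 q4 => hdead q q1 (by rw [q2, hxr])
              (fun h => q3 (h.unique hx)) fun h => q4 (h.unique hx')⟩
    · -- the common root is the trivalent vertex `V_a`
      rw [hG.exists_vertex_iff hst hB (isVertex_r h), not_or, not_not] at hV
      obtain ⟨f, p₀, t⟩ := G.exists_isTri hst a hV.2
      have hV' := (isVertex_legVertex G a)
      have hhr := hV.1
      have hpr := hhr
      rw [hr] at hpr
      have same : ∀ {y z : G.F}, ¬ G.IsVertex y → y ≠ G.leg a → G.nameOf a y = G.nameOf a z →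
          R y z := fun {y z} hy hya hyz => by
        obtain ⟨x, hx⟩ := hG.exists_of_flag hst hB hy hya
        exact Or.inr ⟨x, x, hx, hx.congr hyz, .refl (by rwa [hG.over_isVertex_iff hst hB hx])⟩
      have sf : ∀ {f p : G.F}, G.IsTri a f p → R p (G.ι f) := fun t =>
        same t.not_vertex t.ne_leg (t.nameOf_ι_f hst).symm
      have sp : ∀ {f p : G.F}, G.IsTri a f p → R f (G.ι p) := fun t =>
        same t.f_not_vertex t.f_ne_leg (t.nameOf_ι_p hst).symm
      have hZa : Z (G.leg a) := Or.inl rfl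
      have hZιa : Z (G.ι (G.leg a)) := Or.inl (G.ι_leg a)
      have hf0 : G.r f = G.r h := by rw [hhr, t.r_f]
      have hp0 : G.r p₀ = G.r h := by rw [hhr, t.r_p]
      have := (t.iff h).1 hhr
      have := (t.iff p).1 hpr
      have := hZ p₀ t.not_vertex hp0
      have := hZ f t.f_not_vertex hf0
      have := t.ne
      have := t.ne_leg
      have := t.f_ne_leg
      have := Z_of_R (sp t)
      have := Z_of_R (sf t)
      have := Z_of_R (R_symm (sp t))
      have := Z_of_R (R_symm (sf t))
      have := R_symm (sp t)
      have := R_symm (sf t)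
      have hZR : ∀ {y z}, Z y → Z z → R y z := fun h1 h2 => Or.inl ⟨h1, h2⟩
      change R (G.ι h) p
      clear ih same hd hZ dead_of_over hB hG Z_leg hst
      clear_value R Z
      grind

theorem merge_iff (hst : 3 < 2 * g + A.card) (hB : IsErase B A a.1)
    (hG : G.IsForget a G') (ha : D a.1) {x x' : G'.F} {h h' : G.F} (hx : G.Over a x h)
    (hx' : G.Over a x' h') : G'.Merge D x x' ↔ G.Merge D h h' := by
  refine ⟨fun m => hG.merge_down hst hB ha m hx hx', fun m => ?_⟩
  rcases hG.merge_up hst hB m with ⟨h1, h2⟩ | ⟨y, y', hy, hy', m'⟩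
  · refine Dead.merge ?_ ?_
    · obtain ⟨y, hy, hd⟩ := h1.resolve_left (hG.over_ne_leg hst hx)
      rwa [hx.unique hy]
    · obtain ⟨y, hy, hd⟩ := h2.resolve_left (hG.over_ne_leg hst hx')
      rwa [hx'.unique hy]
  · rwa [hx.unique hy, hx'.unique hy']

theorem dead_iff (hst : 3 < 2 * g + A.card) (hB : IsErase B A a.1)
    (hG : G.IsForget a G') (ha : D a.1) {x : G'.F} {h : G.F} (hx : G.Over a x h) :
    G'.Dead D x ↔ G.Dead D h := by
  constructor
  · rintro ⟨b, hb, m⟩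
    exact ⟨⟨b.1, ((hB _).1 b.2).1⟩, hb, hG.merge_down hst hB ha m hx (hG.over_leg hst rfl)⟩
  · rintro ⟨b, hb, m⟩
    by_cases hba : b = a
    · subst hba
      rcases hG.merge_up hst hB m with ⟨h1, -⟩ | ⟨y, y', -, hy', -⟩
      · obtain ⟨y, hy, hd⟩ := h1.resolve_left (hG.over_ne_leg hst hx)
        rwa [hx.unique hy]
      · exact absurd rfl (hG.over_ne_leg hst hy')
    · let b' : B := ⟨b.1, (hB _).2 ⟨b.2, fun h => hba (Subtype.ext h)⟩⟩
      exact ⟨b', hb, (hG.merge_iff hst hB ha hx (hG.over_leg hst rfl)).2 m⟩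

end IsForget

/-- Three flags at the vertex `v` remain and are not merged with each other: the vertex remains when
the marks in `D` are forgotten. -/
def Survives (G : GCat U g A) (D : Λ → Prop) (v : G.F) : Prop :=
  ∃ h : Fin 3 → G.F, (∀ i, ¬ G.IsVertex (h i) ∧ G.r (h i) = v ∧ ¬ G.Dead D (h i)) ∧
    ∀ i j, G.Merge D (h i) (h j) → i = j

theorem survives_of_no_marks (hD : ∀ b : A, ¬ D b.1) {v : G.F} (hv : G.IsVertex v) :
    G.Survives D v := by
  obtain ⟨x, y, z, h1, h2, h3, h4, h5, h6, h7, h8, h9⟩ := G.isStableGraph.stable v hv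
  have hnd : ∀ h, ¬ G.Dead D h := fun h ⟨b, hb, _⟩ => hD b hb
  refine ⟨![x, y, z], fun i => ?_, fun i j m => ?_⟩
  · fin_cases i
    · exact ⟨h4, h7, hnd _⟩
    · exact ⟨h5, h8, hnd _⟩
    · exact ⟨h6, h9, hnd _⟩
  · have := m.eq_of_no_marks hD
    fin_cases i <;> fin_cases j <;> first | rfl |
      (exfalso; revert this; simp [h1, h2, h3, h1.symm, h2.symm, h3.symm])

theorem IsForget.survives_iff (hst : 3 < 2 * g + A.card) (hB : IsErase B A a.1)
    (hG : G.IsForget a G') (ha : D a.1) {v : G.F} (hv : G.IsVertex v) :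
    G.Survives D v ↔ ∃ w : G'.F, w.1 = v.1 ∧ G'.Survives D w := by
  constructor
  · rintro ⟨h, h1, h2⟩
    have hne : ∀ i, h i ≠ G.leg a := fun i he => (h1 i).2.2 (he ▸ dead_leg ha)
    have hw : ∃ w : G'.F, w.1 = v.1 := by
      rw [hG.exists_vertex_iff hst hB hv]
      by_contra hcon
      rw [not_or, not_not] at hcon
      obtain ⟨f, p, t⟩ := G.exists_isTri hst a hcon.2
      -- only two flags remain at a trivalent `V_a`
      have h3 : ∀ i, h i = f ∨ h i = p := fun i => by
        rcases (t.iff (h i)).1 ((h1 i).2.1.trans hcon.1) with h4 | h4 | h4 | h4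
        · exact absurd h4 (hne i)
        · exact Or.inl h4
        · exact Or.inr h4
        · exact absurd (h4 ▸ G.isVertex_legVertex a) (h1 i).1
      have h4 : ∀ i j, h i = h j → i = j := fun i j he => h2 i j (he ▸ .refl (h1 i).1)
      have e01 := mt (h4 0 1) (by decide)
      have e02 := mt (h4 0 2) (by decide)
      have e12 := mt (h4 1 2) (by decide)
      rcases h3 0 with a0 | a0 <;> rcases h3 1 with a1 | a1 <;> rcases h3 2 with a2 | a2 <;>
        simp_all
    obtain ⟨w, hw⟩ := hw
    choose x hx using fun i => hG.exists_of_flag hst hB (h1 i).1 (hne i)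
    refine ⟨w, hw, x, fun i => ⟨?_, ?_, ?_⟩, fun i j m => ?_⟩
    · rw [hG.over_isVertex_iff hst hB (hx i)]; exact (h1 i).1
    · exact hG.root_of_over hst (hx i) (by rw [hw, (h1 i).2.1])
    · rw [hG.dead_iff hst hB ha (hx i)]; exact (h1 i).2.2
    · exact h2 i j ((hG.merge_iff hst hB ha (hx i) (hx j)).1 m)
  · rintro ⟨w, hw, x, h1, h2⟩
    choose h hx hr using fun i => hG.exists_over_root hst (x i)
    refine ⟨h, fun i => ⟨?_, ?_, ?_⟩, fun i j m => ?_⟩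
    · rw [← hG.over_isVertex_iff hst hB (hx i)]; exact (h1 i).1
    · exact Subtype.ext (by rw [← hr, (h1 i).2.1, hw])
    · rw [← hG.dead_iff hst hB ha (hx i)]; exact (h1 i).2.2
    · exact h2 i j ((hG.merge_iff hst hB ha (hx i) (hx j)).2 m)

end GCat

/-! ### Forgetting two marks -/

namespace GCat

open DGraph

variable {U Λ : Type u} {g : ℕ} {A B C : Finset Λ} {G H : GCat U g A} {a : A}
  {D : Λ → Prop} {X Y X' Y' : GCat U g C}

/-- The relation `O` exhibits the flags of `X` as flags over those of `G`, after forgetting the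
marks in `D`. The properties determine `X` and `O`. -/
structure IsForgetRel (G : GCat U g A) (D : Λ → Prop) (X : GCat U g C) (O : X.F → G.F → Prop) :
    Prop where
  unique : ∀ {x y : X.F} {h : G.F}, O x h → O y h → x = y
  exists_of : ∀ {h : G.F}, ¬ G.IsVertex h → ¬ G.Dead D h → ∃ x, O x h
  not_dead : ∀ {x : X.F} {h : G.F}, O x h → ¬ G.Dead D h
  root_of_over : ∀ {x w : X.F} {h : G.F}, O x h → w.1 = (G.r h).1 → X.r x = w
  over_inj : ∀ {x w w' : X.F} {h h' : G.F}, O x h → O x h' →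
    w.1 = (G.r h).1 → w'.1 = (G.r h').1 → h = h'
  eq_iff : ∀ {x x' : X.F} {h h' : G.F}, O x h → O x' h' → ¬ G.IsVertex h → (x = x' ↔ G.Merge D h h')
  isVertex_iff : ∀ {x : X.F} {h : G.F}, O x h → (X.IsVertex x ↔ G.IsVertex h)
  over_ι : ∀ {x : X.F} {h : G.F}, O x h → O (X.ι x) (G.ι h)
  leg : ∀ c : C, ∃ b : A, b.1 = c.1 ∧ (X.leg c).1 = (G.leg b).1
  exists_name : ∀ x : X.F, ∃ h : G.F, x.1 = h.1
  over_of_name : ∀ {x : X.F} {h : G.F}, x.1 = h.1 → O x h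
  exists_vertex_iff : ∀ {v : G.F}, G.IsVertex v → (G.Survives D v ↔ ∃ w : X.F, w.1 = v.1)
  root_of_name : ∀ {x : X.F} {h : G.F}, X.ι x ≠ x → x.1 = h.1 → (X.r x).1 = (G.r h).1
  exists_over_root : ∀ x : X.F, ∃ h : G.F, O x h ∧ (X.r x).1 = (G.r h).1

namespace IsForgetRel

variable {O : X.F → G.F → Prop} {O' : Y.F → G.F → Prop}

theorem transfer (hO : G.IsForgetRel D X O) (hO' : G.IsForgetRel D Y O') {x : X.F} {y : Y.F}
    {n h : G.F} (hx : O x n) (hy : O' y n) (hn : ¬ G.IsVertex n) (hxh : O x h) : O' y h := by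
  have hm := (hO.eq_iff hx hxh hn).1 rfl
  obtain ⟨y', hy'⟩ := hO'.exists_of hm.not_isVertex.2 (hO.not_dead hxh)
  rwa [(hO'.eq_iff hy hy' hn).2 hm]

/-- A flag has the same name in both descriptions. -/
theorem name_eq (hO : G.IsForgetRel D X O) (hO' : G.IsForgetRel D Y O') {x : X.F} {y : Y.F}
    {n : G.F} (hx : O x n) (hy : O' y n) (hn : ¬ G.IsVertex n) : x.1 = y.1 := by
  have hxv : ¬ X.IsVertex x := by rwa [hO.isVertex_iff hx]
  by_cases hιx : X.ι x = x
  · obtain ⟨c, rfl⟩ := (X.leg_range x).1 ⟨hxv, hιx⟩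
    obtain ⟨b, hb, hc⟩ := hO.leg c
    obtain ⟨b', hb', hc'⟩ := hO'.leg c
    obtain rfl : b = b' := Subtype.ext (hb.trans hb'.symm)
    have h1 := hO.transfer hO' hx hy hn (hO.over_of_name hc)
    rw [hO'.unique h1 (hO'.over_of_name hc'), hc, hc']
  · have hιy : Y.ι y ≠ y := fun h => hιx <| by
      have := (hO'.eq_iff (hO'.over_ι hy) hy fun h => hn (isVertex_ι.1 h)).1 h
      exact (hO.eq_iff (hO.over_ι hx) hx fun h => hn (isVertex_ι.1 h)).2 this
    obtain ⟨m, hm⟩ := hO.exists_name x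
    obtain ⟨m', hm'⟩ := hO'.exists_name y
    have hr := hO.root_of_name hιx hm
    have hr' := hO'.root_of_name hιy hm'
    have h1 := hO.transfer hO' hx hy hn (hO.over_of_name hm)
    obtain ⟨w, hw⟩ := (hO'.exists_vertex_iff (isVertex_r m)).1
      ((hO.exists_vertex_iff (isVertex_r m)).2 ⟨_, hr⟩)
    rw [hm, hm', hO'.over_inj h1 (hO'.over_of_name hm') hw hr']

/-- Every flag has a namesake in the other description, over the same flags. -/
theorem exists_namesake (hO : G.IsForgetRel D X O) (hO' : G.IsForgetRel D Y O') (x : X.F) :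
    ∃ y : Y.F, y.1 = x.1 := by
  obtain ⟨n, hn⟩ := hO.exists_name x
  have hx := hO.over_of_name hn
  by_cases hnv : G.IsVertex n
  · obtain ⟨w, hw⟩ := (hO'.exists_vertex_iff hnv).1 ((hO.exists_vertex_iff hnv).2 ⟨x, hn⟩)
    exact ⟨w, hw.trans hn.symm⟩
  · obtain ⟨y, hy⟩ := hO'.exists_of hnv (hO.not_dead hx)
    exact ⟨y, (hO.name_eq hO' hx hy hnv).symm⟩

theorem over_namesake (hO : G.IsForgetRel D X O) (hO' : G.IsForgetRel D Y O') {x : X.F} {y : Y.F}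
    (hxy : x.1 = y.1) {h : G.F} (hh : ¬ G.IsVertex h) (hx : O x h) : O' y h := by
  obtain ⟨n, hn⟩ := hO.exists_name x
  have hxn := hO.over_of_name hn
  refine hO.transfer hO' hxn (hO'.over_of_name (hxy.symm.trans hn)) ?_ hx
  rwa [← hO.isVertex_iff hxn, hO.isVertex_iff hx]

/-- A graph is determined by the properties listed in `IsForgetRel`. -/
theorem eq (hO : G.IsForgetRel D X O) (hO' : G.IsForgetRel D Y O') : X = Y := by
  have hv : ∀ {x : X.F} {y : Y.F}, x.1 = y.1 → (X.IsVertex x ↔ Y.IsVertex y) := by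
    intro x y hxy
    obtain ⟨n, hn⟩ := hO.exists_name x
    rw [hO.isVertex_iff (hO.over_of_name hn),
      hO'.isVertex_iff (hO'.over_of_name (hxy.symm.trans hn))]
  refine ext_names (fun u => ⟨fun hu => ?_, fun hu => ?_⟩) (fun x y hxy => ?_) (fun x y hxy => ?_)
    fun c => ?_
  · obtain ⟨y, hy⟩ := hO.exists_namesake hO' ⟨u, hu⟩
    rw [← show y.1 = u from hy]; exact y.2
  · obtain ⟨y, hy⟩ := hO'.exists_namesake hO ⟨u, hu⟩
    rw [← show y.1 = u from hy]; exact y.2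
  · by_cases hx : X.IsVertex x
    · rw [hx, (hv hxy).1 hx, hxy]
    · obtain ⟨h, hxh, hr⟩ := hO.exists_over_root x
      have hh : ¬ G.IsVertex h := by rwa [← hO.isVertex_iff hxh]
      have hyh := hO.over_namesake hO' hxy hh hxh
      obtain ⟨w, hw⟩ := (hO'.exists_vertex_iff (isVertex_r h)).1
        ((hO.exists_vertex_iff (isVertex_r h)).2 ⟨_, hr⟩)
      rw [hr, hO'.root_of_over hyh hw, hw]
  · by_cases hx : X.IsVertex x
    · rw [ι_of_isVertex hx, ι_of_isVertex ((hv hxy).1 hx), hxy]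
    · obtain ⟨h, hxh, hr⟩ := hO.exists_over_root x
      have hh : ¬ G.IsVertex h := by rwa [← hO.isVertex_iff hxh]
      have hyh := hO.over_namesake hO' hxy hh hxh
      exact hO.name_eq hO' (hO.over_ι hxh) (hO'.over_ι hyh) fun h => hh (isVertex_ι.1 h)
  · obtain ⟨b, hb, hc⟩ := hO.leg c
    obtain ⟨b', hb', hc'⟩ := hO'.leg c
    obtain rfl : b = b' := Subtype.ext (hb.trans hb'.symm)
    rw [hc, hc']

end IsForgetRel

/-- The flag `x` of `ft_b (ft_a G)` lies over a flag of `ft_a G` that lies over `h`. -/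
def Over₂ (G : GCat U g A) (a : A) (G₁ : GCat U g B) (b : B) {X : GCat U g C}
    (x : X.F) (h : G.F) : Prop :=
  ∃ x₁ : G₁.F, G₁.Over b x x₁ ∧ G.Over a x₁ h

section

variable {G₁ : GCat U g B} {H₁ : GCat U g B} {b : B}

/-- Forgetting two marks, one after the other. -/
theorem isForgetRel_over₂ (hst : 3 < 2 * g + A.card) (hst' : 3 < 2 * g + B.card)
    (hB : IsErase B A a.1) (hC : IsErase C B b.1)
    (ha : D a.1) (hb : D b.1) (hD : ∀ c ∈ C, ¬ D c) (h₁ : G.IsForget a G₁)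
    (h₂ : G₁.IsForget b X) : G.IsForgetRel D X (G.Over₂ a G₁ b) := by
  have hD' : ∀ c : C, ¬ D c.1 := fun c => hD c.1 c.2
  have hnd : ∀ x : X.F, ¬ X.Dead D x := fun x ⟨c, hc, _⟩ => hD' c hc
  refine ⟨?_, ?_, ?_, ?_, ?_, ?_, ?_, ?_, ?_, ?_, ?_, ?_, ?_, ?_⟩
  · rintro x y h ⟨x₁, o1, o2⟩ ⟨y₁, o3, o4⟩
    obtain rfl := o2.unique o4
    exact o1.unique o3
  · intro h hh hdead
    obtain ⟨x₁, o1⟩ := h₁.exists_of_flag hst hB hh fun he => hdead (he ▸ dead_leg ha)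
    have hx₁ : ¬ G₁.IsVertex x₁ := by rwa [h₁.over_isVertex_iff hst hB o1]
    obtain ⟨x, o2⟩ := h₂.exists_of_flag hst' hC hx₁ fun he =>
      hdead ((h₁.dead_iff hst hB ha o1).1 (he ▸ dead_leg hb))
    exact ⟨x, x₁, o2, o1⟩
  · rintro x h ⟨x₁, o1, o2⟩ hd
    rw [← h₁.dead_iff hst hB ha o2, ← h₂.dead_iff hst' hC hb o1] at hd
    exact hnd x hd
  · rintro x w h ⟨x₁, o1, o2⟩ hw
    obtain ⟨w₁, hw₁⟩ := h₂.exists_name hst' w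
    have h1 := h₁.root_of_over hst o2 (hw₁.symm.trans hw)
    exact h₂.root_of_over hst' o1 (by rw [h1, hw₁])
  · rintro x w w' h h' ⟨x₁, o1, o2⟩ ⟨x₁', o1', o2'⟩ hw hw'
    obtain ⟨w₁, hw₁⟩ := h₂.exists_name hst' w
    obtain ⟨w₁', hw₁'⟩ := h₂.exists_name hst' w'
    have h1 := h₁.root_of_over hst o2 (hw₁.symm.trans hw)
    have h1' := h₁.root_of_over hst o2' (hw₁'.symm.trans hw')
    obtain rfl := h₂.over_inj hst' o1 o1' (w := w) (w' := w') (by rw [h1, hw₁]) (by rw [h1', hw₁'])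
    exact h₁.over_inj hst o2 o2' (hw₁.symm.trans hw) (hw₁'.symm.trans hw')
  · rintro x x' h h' ⟨x₁, o1, o2⟩ ⟨x₁', o1', o2'⟩ hh
    have hx : ¬ X.IsVertex x := by
      rwa [h₂.over_isVertex_iff hst' hC o1, h₁.over_isVertex_iff hst hB o2]
    rw [← h₁.merge_iff hst hB ha o2 o2', ← h₂.merge_iff hst' hC hb o1 o1']
    exact ⟨fun h => h ▸ .refl hx, fun m => m.eq_of_no_marks hD'⟩
  · rintro x h ⟨x₁, o1, o2⟩
    rw [h₂.over_isVertex_iff hst' hC o1, h₁.over_isVertex_iff hst hB o2]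
  · rintro x h ⟨x₁, o1, o2⟩
    exact ⟨_, h₂.over_ι hst' hC o1, h₁.over_ι hst hB o2⟩
  · intro c
    let c₁ : B := ⟨c.1, ((hC _).1 c.2).1⟩
    let c₀ : A := ⟨c.1, ((hB _).1 c₁.2).1⟩
    exact ⟨c₀, rfl, by rw [h₂.marking c c₁ rfl, h₁.marking c₁ c₀ rfl]⟩
  · intro x
    obtain ⟨x₁, hx₁⟩ := h₂.exists_name hst' x
    obtain ⟨h, hh⟩ := h₁.exists_name hst x₁
    exact ⟨h, hx₁.trans hh⟩
  · intro x h hx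
    obtain ⟨x₁, hx₁⟩ := h₂.exists_name hst' x
    exact ⟨x₁, h₂.over_of_name hst' hx₁, h₁.over_of_name hst (hx₁.symm.trans hx)⟩
  · intro v hv
    rw [h₁.survives_iff hst hB ha hv]
    constructor
    · rintro ⟨w₁, hw₁, hs⟩
      have hwv : G₁.IsVertex w₁ := (h₁.name_isVertex_iff hst hB hw₁).2 hv
      obtain ⟨w, hw, -⟩ := (h₂.survives_iff hst' hC hb hwv).1 hs
      exact ⟨w, hw.trans hw₁⟩
    · rintro ⟨w, hw⟩
      obtain ⟨w₁, hw₁⟩ := h₂.exists_name hst' w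
      have hw₁v := hw₁.symm.trans hw
      have hwv : G₁.IsVertex w₁ := (h₁.name_isVertex_iff hst hB hw₁v).2 hv
      refine ⟨w₁, hw₁v, (h₂.survives_iff hst' hC hb hwv).2 ⟨w, hw₁, ?_⟩⟩
      exact survives_of_no_marks hD' ((h₂.name_isVertex_iff hst' hC hw₁).2 hwv)
  · intro x h hx hxh
    have r₁ : ∀ {A B : Finset Λ} {a : A} {G : GCat U g A} {X : GCat U g B} {x : X.F} {y : G.F},
        3 < 2 * g + A.card → (IsErase B A a.1) → G.IsForget a X → X.ι x ≠ x →
        x.1 = y.1 → (X.r x).1 = (G.r y).1 := by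
      intro A B a G X x y hst hB h hx hxy
      rcases h.over_cases hst hB hx hxy with ⟨-, h1, -⟩ | ⟨_, _, _, _, _, -, h1, -⟩ <;> exact h1
    obtain ⟨x₁, hx₁⟩ := h₂.exists_name hst' x
    have hι₁ : G₁.ι x₁ ≠ x₁ := h₂.ι_ne_of_over hst' hC hx (h₂.over_of_name hst' hx₁)
    rw [r₁ hst' hC h₂ hx hx₁, r₁ hst hB h₁ hι₁ (hx₁.symm.trans hxh)]
  · intro x
    obtain ⟨x₁, o1, r1⟩ := h₂.exists_over_root hst' x
    obtain ⟨h, o2, r2⟩ := h₁.exists_over_root hst x₁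
    exact ⟨h, ⟨x₁, o1, o2⟩, r1.trans r2⟩

theorem over₂_fn {k : G ⟶ H} {k₁ : G₁ ⟶ H₁} {k₂ : X ⟶ Y} (h₁ : IsForgetHom a k k₁)
    (hst : 3 < 2 * g + A.card) (hB : IsErase B A a.1) (hH : H.IsForget a H₁)
    (h₂ : IsForgetHom b k₁ k₂) {x : X.F} {h : G.F} (hx : G.Over₂ a G₁ b x h)
    (hk : ¬ H.IsVertex (fn k h)) : H.Over₂ a H₁ b (fn k₂ x) (fn k h) := by
  obtain ⟨x₁, o1, o2⟩ := hx
  have o3 := h₁ x₁ h o2 hk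
  exact ⟨_, h₂ x x₁ o1 (by rwa [hH.over_isVertex_iff hst hB o3]), o3⟩

theorem exists_over₂ {k : G ⟶ H} {k₁ : G₁ ⟶ H₁} {k₂ : X ⟶ Y} (hst : 3 < 2 * g + A.card)
    (hst' : 3 < 2 * g + B.card) (hB : IsErase B A a.1)
    (hC : IsErase C B b.1) (hG₁ : G.IsForget a G₁) (hH₁ : H.IsForget a H₁)
    (hX : G₁.IsForget b X) (hY : H₁.IsForget b Y) (h₁ : IsForgetHom a k k₁)
    (h₂ : IsForgetHom b k₁ k₂) {x : X.F} (hx : ¬ Y.IsVertex (fn k₂ x)) :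
    ∃ h, G.Over₂ a G₁ b x h ∧ ¬ H.IsVertex (fn k h) ∧
      H.Over₂ a H₁ b (fn k₂ x) (fn k h) := by
  obtain ⟨y₁, o1⟩ := hY.exists_over hst' (fn k₂ x)
  have hy₁ : ¬ H₁.IsVertex y₁ := by rwa [← hY.over_isVertex_iff hst' hC o1]
  obtain ⟨x₁, o2, rfl⟩ := h₂.exists_over hst' hC hX hY o1 hy₁
  obtain ⟨y, o3⟩ := hH₁.exists_over hst (fn k₁ x₁)
  have hy : ¬ H.IsVertex y := by rwa [← hH₁.over_isVertex_iff hst hB o3]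
  obtain ⟨h, o4, rfl⟩ := h₁.exists_over hst hB hG₁ hH₁ o3 hy
  exact ⟨h, ⟨x₁, o2, o4⟩, hy, ⟨_, o1, o3⟩⟩

/-- After forgetting two marks, the length of an edge is the sum of the lengths of the edges over
which it lies. -/
theorem flagLen_forgetLen₂ (hst : 3 < 2 * g + A.card) (hst' : 3 < 2 * g + B.card)
    (hB : IsErase B A a.1) (hC : IsErase C B b.1)
    (hG₁ : G.IsForget a G₁) (hX : G₁.IsForget b X) (δ : G.Edge → ℤ) {x : X.F} (hx : X.ι x ≠ x) :
    X.flagLen (G₁.forgetLen b X (G.forgetLen a G₁ δ)) x =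
      ∑ h ∈ Finset.univ.filter fun h => G.Over₂ a G₁ b x h, G.flagLen δ h := by
  rw [hX.flagLen_forgetLen hst' hC _ hx]
  have h1 : (Finset.univ.filter fun h => G.Over₂ a G₁ b x h) =
      (G₁.overSet b x).biUnion fun x₁ => G.overSet a x₁ := by
    ext h
    simp only [Finset.mem_filter, Finset.mem_univ, true_and, Finset.mem_biUnion, mem_overSet]
    rfl
  rw [h1, Finset.sum_biUnion]
  · refine Finset.sum_congr rfl fun x₁ hx₁ => ?_
    exact hG₁.flagLen_forgetLen hst hB δ (hX.ι_ne_of_over hst' hC hx (mem_overSet.1 hx₁))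
  · intro x₁ _ y₁ _ hne
    refine Finset.disjoint_left.2 fun h h2 h3 => hne ?_
    exact (mem_overSet.1 h2).unique (mem_overSet.1 h3)

end

end GCat

/-- Morphisms of poic-spaces agree if their functors and their maps of cones agree up to the
equalities of objects. -/
theorem PoicMor.ext_eqToHom {C D : Type v} [Category.{w} C] [Category.{w} D] {X : C ⥤ Poic.{u}}
    {Y : D ⥤ Poic.{u}} {F G : PoicMor X Y} (hobj : ∀ x, F.functor.obj x = G.functor.obj x)
    (hmap : ∀ x y (f : x ⟶ y), F.functor.map f =
      eqToHom (hobj x) ≫ G.functor.map f ≫ eqToHom (hobj y).symm)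
    (hη : ∀ x, F.at' x ≫ Y.map (eqToHom (hobj x)) = G.at' x) : F = G := by
  have hf : F.functor = G.functor := CategoryTheory.Functor.ext hobj hmap
  rcases F with ⟨F, η, hF⟩
  rcases G with ⟨G, η', hG⟩
  obtain rfl : F = G := hf
  obtain rfl : η = η' := by
    ext x
    have := hη x
    simpa [PoicMor.at'] using this
  rfl

open GCat DGraph in
/-- The forgetful morphisms of two marks commute. -/
theorem forgetMor_comm (U : Type u) {Λ : Type u} {g : ℕ} {A B B' C : Finset Λ} {a b : A} {b₁ : B}
    {a₁ : B'} (hb₁ : b₁.1 = b.1) (ha₁ : a₁.1 = a.1) (hst : 3 < 2 * g + A.card)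
    (hst₁ : 3 < 2 * g + B.card) (hst₂ : 3 < 2 * g + B'.card) (hB : IsErase B A a.1)
    (hB' : IsErase B' A b.1) (hC : IsErase C B b₁.1)
    (hC' : IsErase C B' a₁.1) :
    (forgetMor U hst hB).comp (forgetMor U hst₁ hC) =
      (forgetMor U hst hB').comp (forgetMor U hst₂ hC') := by
  let D : Λ → Prop := fun x => x = a.1 ∨ x = b.1
  have hD : ∀ c ∈ C, ¬ D c := by
    rintro c hc (rfl | rfl)
    · exact ((hC' _).1 hc).2 ha₁.symm
    · exact ((hC _).1 hc).2 hb₁.symm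
  have rel₁ : ∀ G : GCat U g A, G.IsForgetRel D (forget hst₁ hC (forget hst hB G)) _ := fun G =>
    isForgetRel_over₂ hst hst₁ hB hC (Or.inl rfl) (Or.inr hb₁) hD (isForget_forget hst hB G)
      (isForget_forget hst₁ hC _)
  have rel₂ : ∀ G : GCat U g A, G.IsForgetRel D (forget hst₂ hC' (forget hst hB' G)) _ := fun G =>
    isForgetRel_over₂ hst hst₂ hB' hC' (Or.inr rfl) (Or.inl ha₁) hD (isForget_forget hst hB' G)
      (isForget_forget hst₂ hC' _)
  have hobj : ∀ G : GCat U g A, forget hst₁ hC (forget hst hB G) =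
      forget hst₂ hC' (forget hst hB' G) := fun G => (rel₁ G).eq (rel₂ G)
  refine PoicMor.ext_eqToHom (fun G => congrArg op (hobj G.unop)) (fun G H k => ?_) fun G => ?_
  · refine Quiver.Hom.unop_inj (hom_ext_of_flags fun x hx => Subtype.ext ?_)
    obtain ⟨h, o1, hk, o2⟩ := exists_over₂ hst hst₁ hB hC (isForget_forget hst hB H.unop)
      (isForget_forget hst hB G.unop) (isForget_forget hst₁ hC _) (isForget_forget hst₁ hC _)
      (isForgetHom_forgetMap hst hB k.unop) (isForgetHom_forgetMap hst₁ hC _) hx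
    have hh : ¬ H.unop.IsVertex h := fun hv => hk (fn_vertex _ hv)
    -- the namesake of `x` in the other graph
    rw [unop_comp, unop_comp, fn_comp, fn_comp]
    refine (fn_eqToHom_unop (congrArg op (hobj G.unop)) _).trans ?_
    set y := fn (eqToHom (congrArg op (hobj H.unop)).symm).unop x with hy
    have hyx : x.1 = y.1 := (fn_eqToHom_unop (congrArg op (hobj H.unop)).symm x).symm
    have o3 := (rel₁ H.unop).over_namesake (rel₂ H.unop) hyx hh o1
    have o4 := over₂_fn (isForgetHom_forgetMap hst hB' k.unop) hst hB'
      (isForget_forget hst hB' G.unop) (isForgetHom_forgetMap hst₂ hC' _) o3 hk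
    exact ((rel₁ G.unop).name_eq (rel₂ G.unop) o2 o4 hk).symm
  · refine Poic.hom_ext (LinearMap.ext fun δ => ext_flagLen fun y hy => ?_)
    set x := fn (eqToHom (congrArg op (hobj G.unop))).unop y with hx
    have hxy : x.1 = y.1 := fn_eqToHom_unop (congrArg op (hobj G.unop)) y
    have hxι : (forget hst₁ hC (forget hst hB G.unop)).ι x ≠ x := by
      intro h
      have e := fn_ι (eqToHom (congrArg op (hobj G.unop))).unop y
      rw [← hx, h] at e
      refine hy (Subtype.ext ?_)
      refine (fn_eqToHom_unop (congrArg op (hobj G.unop)) _).symm.trans ?_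
      exact (congrArg Subtype.val e).trans hxy
    refine (flagLen_pull (eqToHom (congrArg op (hobj G.unop))).unop _ y).trans ?_
    refine (flagLen_forgetLen₂ hst hst₁ hB hC (isForget_forget hst hB G.unop)
      (isForget_forget hst₁ hC _) δ hxι).trans
      (Eq.trans ?_ (flagLen_forgetLen₂ hst hst₂ hB' hC' (isForget_forget hst hB' G.unop)
      (isForget_forget hst₂ hC' _) δ hy).symm)
    refine Finset.sum_congr (Finset.ext fun h => ?_) fun _ _ => rfl
    rw [Finset.mem_filter, Finset.mem_filter]
    refine and_congr_right fun _ => ⟨fun h1 => ?_, fun h1 => ?_⟩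
    · refine (rel₁ G.unop).over_namesake (rel₂ G.unop) hxy ?_ h1
      rw [← (rel₁ G.unop).isVertex_iff h1]
      exact not_isVertex_of_ne hxι
    · refine (rel₂ G.unop).over_namesake (rel₁ G.unop) hxy.symm ?_ h1
      rw [← (rel₂ G.unop).isVertex_iff h1]
      exact not_isVertex_of_ne hy

/-! ### Lifting isomorphisms -/

namespace GCat

open DGraph

variable {U Λ : Type u} {g : ℕ} {A B : Finset Λ} {a : A} {G H : GCat U g A} {G' H' : GCat U g B}

/-- A graph is determined by an isomorphism to it and the names of the images of the flags. -/
theorem eq_of_iso_names {X Y Z : GCat U g A} (i : X ≅ Y) (j : X ≅ Z)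
    (h : ∀ x, (fn i.hom x).1 = (fn j.hom x).1) : Y = Z := by
  have key : ∀ (y : Y.F) (z : Z.F), y.1 = z.1 → ∃ x, y = fn i.hom x ∧ z = fn j.hom x := by
    intro y z hyz
    obtain ⟨x, rfl⟩ := fn_surj i.hom y
    exact ⟨x, rfl, Subtype.ext (hyz.symm.trans (h x))⟩
  refine ext_names (fun u => ⟨fun hu => ?_, fun hu => ?_⟩) ?_ ?_ fun c => ?_
  · obtain ⟨x, hx⟩ := fn_surj i.hom ⟨u, hu⟩
    rw [← show (fn i.hom x).1 = u from congrArg Subtype.val hx, h]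
    exact (fn j.hom x).2
  · obtain ⟨x, hx⟩ := fn_surj j.hom ⟨u, hu⟩
    rw [← show (fn j.hom x).1 = u from congrArg Subtype.val hx, ← h]
    exact (fn i.hom x).2
  · intro y z hyz
    obtain ⟨x, rfl, rfl⟩ := key y z hyz
    rw [← fn_r, ← fn_r, h]
  · intro y z hyz
    obtain ⟨x, rfl, rfl⟩ := key y z hyz
    rw [← fn_ι, ← fn_ι, h]
  · rw [← fn_leg i.hom, ← fn_leg j.hom, h]

/-- On isomorphisms, `ft_a` is the restriction to the remaining flags. -/
theorem IsForgetHom.name_of_iso (hst : 3 < 2 * g + A.card) (hB : IsErase B A a.1)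
    (hG : G.IsForget a G') (hH : H.IsForget a H') {i : G ≅ H} {k' : G' ⟶ H'}
    (hk : IsForgetHom a i.hom k') {x : G'.F} {y : G.F} (hxy : x.1 = y.1) :
    (fn k' x).1 = (fn i.hom y).1 := by
  refine (hk.name hst hB hG hH hxy).2 ?_
  rintro ⟨f₂, f₁, ht, -, hv⟩
  exact not_isVertex_of_ne ht.2.1 ((isVertex_iso i).1 hv)

/-- An isomorphism of graphs is determined by its restriction to the flags that remain after
forgetting a mark. -/
theorem iso_hom_ext_of_names (hst : 3 < 2 * g + A.card) (hG : G.IsForget a G') (i j : G ≅ H)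
    (h : ∀ (x : G'.F) (y : G.F), x.1 = y.1 → fn i.hom y = fn j.hom y) : i = j := by
  have hr : ∀ y, fn i.hom y = fn j.hom y → fn i.hom (G.r y) = fn j.hom (G.r y) := by
    intro y hy; rw [fn_r, fn_r, hy]
  have hι : ∀ y, fn i.hom (G.ι y) = fn j.hom (G.ι y) → fn i.hom y = fn j.hom y := by
    intro y hy
    rw [← G.ι_ι y, fn_ι i.hom, hy, fn_ι j.hom (G.ι y)]
  have hl : ∀ c, fn i.hom (G.leg c) = fn j.hom (G.leg c) := fun c => by rw [fn_leg, fn_leg]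
  refine Iso.ext (hom_ext_fn fun y => ?_)
  rcases G.nameOf_cases hst a with hv | ⟨f, p, t⟩
  · by_cases hy : y = G.leg a
    · rw [hy, hl]
    · exact h ⟨y.1, (hG.flags₁ hv _).2 ⟨y, rfl, hy⟩⟩ y rfl
  · have ht : ∀ {f p}, G.IsTri a f p → G.ι p ≠ p → fn i.hom f = fn j.hom f := fun t hp =>
      hι _ (h ⟨_, (hG.flags₂ _ _ (t.twoEdges hp) _).2 ⟨_, rfl, t.root_ne hst⟩⟩ _ rfl)
    by_cases hp : G.ι p = p
    · have hpij : fn i.hom p = fn j.hom p := by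
        obtain ⟨c, rfl⟩ := (G.leg_range p).1 ⟨t.not_vertex, hp⟩
        exact hl c
      have hf : fn i.hom f = fn j.hom f := by
        have hi := t.descend i.hom (fun h => t.f_not_vertex ((isVertex_iso i).1 h))
          fun h => t.not_vertex ((isVertex_iso i).1 h)
        have hj := t.descend j.hom (fun h => t.f_not_vertex ((isVertex_iso j).1 h))
          fun h => t.not_vertex ((isVertex_iso j).1 h)
        rcases hi.unique hj with h1 | h1
        · exact h1.1.symm
        · exact absurd (h1.1.trans hpij) hj.ne
      by_cases hy : y = G.leg a ∨ y = f ∨ y = G.ι f ∨ y = G.legVertex a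
      · rcases hy with rfl | rfl | rfl | rfl
        · exact hl a
        · exact hf
        · exact hι _ (by rwa [G.ι_ι])
        · exact hr _ (hl a)
      · push Not at hy
        exact h ⟨y.1, (hG.flags₃ p f (t.edgeAndLeg hp) _).2 ⟨y, rfl, hy⟩⟩ y rfl
    · by_cases hy : G.r y = G.legVertex a
      · rcases (t.iff y).1 hy with rfl | rfl | rfl | rfl
        · exact hl a
        · exact ht t hp
        · exact ht (t.swap hp) t.ι_ne
        · exact hr _ (hl a)
      · exact h ⟨y.1, (hG.flags₂ f p (t.twoEdges hp) _).2 ⟨y, rfl, hy⟩⟩ y rfl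

/-- An injection of part of a finite type into a finite set `S` of an infinite type extends to the
whole type, with the other values outside of `S`. -/
theorem exists_embedding_extending {X : Type u} [Finite X] [Infinite U] (S : Finset U)
    (P : X → Prop) (c : ∀ x, P x → U) (hc : ∀ x hx, c x hx ∈ S)
    (hinj : ∀ x hx y hy, c x hx = c y hy → x = y) : ∃ e : X ↪ U, ∀ x hx, e x = c x hx := by
  have : Infinite {u // u ∉ S} := S.finite_toSet.infinite_compl.to_subtype
  obtain ⟨n, ⟨q⟩⟩ := Finite.exists_equiv_fin X
  let f : X ↪ {u // u ∉ S} :=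
    q.toEmbedding.trans (Fin.valEmbedding.trans (Infinite.natEmbedding _))
  refine ⟨⟨fun x => if hx : P x then c x hx else (f x).1, fun x y hxy => ?_⟩, fun x hx =>
    dif_pos hx⟩
  by_cases hx : P x <;> by_cases hy : P y <;> simp only [hx, hy, dif_pos, dif_neg,
    not_false_iff] at hxy
  · exact hinj _ _ _ _ hxy
  · exact absurd (hxy ▸ hc x hx) (f y).2
  · exact absurd (hxy ▸ hc y hy) (f x).2
  · exact f.injective (Subtype.ext hxy)

/-- An isomorphism of `ft_a G` to a graph `Y` lifts to an isomorphism of `G` to a graph whose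
remaining flags are those of `Y`. -/
theorem exists_lift_iso [Infinite U] (hst : 3 < 2 * g + A.card)
    (hB : IsErase B A a.1) (G : GCat U g A) {Y : GCat U g B}
    (i : forget hst hB G ≅ Y) :
    ∃ (H : GCat U g A) (j : G ≅ H), forget hst hB H = Y ∧
      ∀ x, (fn (forgetMap hst hB j.hom) x).1 = (fn i.hom x).1 := by
  let P : G.F → Prop := fun y => ∃ x : (forget hst hB G).F, x.1 = y.1
  obtain ⟨e, he⟩ := exists_embedding_extending Y.F P (fun y hy => (fn i.hom hy.choose).1)
    (fun y hy => (fn i.hom hy.choose).2) (fun y hy z hz h => Subtype.ext (by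
      rw [← hy.choose_spec, ← hz.choose_spec,
        (flagEquiv i).injective (Subtype.ext (h : (flagEquiv i _).1 = _))]))
  have hname : ∀ x, (fn (forgetMap hst hB (isoOfEmb G e).hom) x).1 = (fn i.hom x).1 := by
    intro x
    obtain ⟨y, hy⟩ := (isForget_forget hst hB G).exists_name hst x
    have hP : P y := ⟨x, hy⟩
    rw [(isForgetHom_forgetMap hst hB (isoOfEmb G e).hom).name_of_iso hst hB
      (isForget_forget hst hB G) (isForget_forget hst hB _) hy, fn_isoOfEmb, he y hP,
      show hP.choose = x from Subtype.ext (hP.choose_spec.trans hy.symm)]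
  exact ⟨_, isoOfEmb G e, eq_of_iso_names
    (((forgetFunctor hst hB).mapIso (isoOfEmb G e).op.symm).unop.symm) i hname, hname⟩

/-- The functor `ft_a` is faithful on isomorphisms. -/
theorem forgetMap_iso_injective (hst : 3 < 2 * g + A.card) (hB : IsErase B A a.1)
    {i j : G ≅ H} (h : forgetMap hst hB i.hom = forgetMap hst hB j.hom) : i = j := by
  refine iso_hom_ext_of_names hst (isForget_forget hst hB G) i j fun x y hxy => Subtype.ext ?_
  rw [← (isForgetHom_forgetMap hst hB i.hom).name_of_iso hst hB (isForget_forget hst hB G)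
    (isForget_forget hst hB H) hxy, ← (isForgetHom_forgetMap hst hB j.hom).name_of_iso hst hB
    (isForget_forget hst hB G) (isForget_forget hst hB H) hxy, h]

end GCat

open GCat in
theorem forgetMor_liftsIsos (U : Type u) [Infinite U] {Λ : Type u} {g : ℕ} {A B : Finset Λ} {a : A}
    (hst : 3 < 2 * g + A.card) (hB : IsErase B A a.1) :
    (forgetMor U hst hB).LiftsIsos := by
  intro x y f
  refine ⟨?_, ?_⟩
  · obtain ⟨H, j, hH, hj⟩ := exists_lift_iso hst hB x.unop f.unop.symm
    refine ⟨op H, j.symm.op, congrArg op hH, Quiver.Hom.unop_inj (hom_ext_fn fun w => ?_)⟩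
    obtain ⟨z, rfl⟩ := fn_surj f.unop.symm.hom w
    have h1 : fn f.hom.unop (fn f.unop.symm.hom z) = z := by
      rw [← fn_comp]
      show fn (f.unop.inv ≫ f.unop.hom) z = z
      rw [Iso.inv_hom_id, fn_id]
    refine Eq.trans ?_ h1.symm
    rw [unop_comp, fn_comp]
    have h2 : fn (eqToHom (congrArg op hH : (forgetMor U hst hB).functor.obj (op H) = y)).unop
        (fn f.unop.symm.hom z) = fn (forgetMap hst hB j.hom) z :=
      Subtype.ext ((fn_eqToHom_unop _ _).trans (hj z).symm)
    refine (congrArg (fn (forgetMap hst hB j.inv)) h2).trans ?_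
    have h3 : forgetMap hst hB j.hom ≫ forgetMap hst hB j.inv = 𝟙 _ := by
      have h4 := ((forgetFunctor (U := U) hst hB).map_comp j.inv.op j.hom.op).symm
      have h5 : j.inv.op ≫ j.hom.op = 𝟙 _ := by rw [← op_comp, j.hom_inv_id]; rfl
      rw [h5, CategoryTheory.Functor.map_id] at h4
      exact congrArg Quiver.Hom.unop h4
    exact (fn_comp _ _ _).symm.trans ((congrArg (fun k => fn k z) h3).trans (fn_id _ _))
  · intro x₁ x₂ f₁ f₂ h₁ h₂ e₁ e₂
    have key : (forgetMor U hst hB).functor.map (f₁.symm ≪≫ f₂).hom =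
        eqToHom (h₁.trans h₂.symm) := by
      have e₃ : (forgetMor U hst hB).functor.map f₂.hom =
          (forgetMor U hst hB).functor.map f₁.hom ≫ eqToHom (h₁.trans h₂.symm) := by
        rw [← cancel_mono (eqToHom h₂), e₂, Category.assoc, eqToHom_trans, e₁]
      rw [Iso.trans_hom, Functor.map_comp, e₃, ← Category.assoc, ← Functor.map_comp,
        Iso.symm_hom, Iso.inv_hom_id, CategoryTheory.Functor.map_id, Category.id_comp]
    refine ⟨f₁.symm ≪≫ f₂, by simp, key, fun j hj => ?_⟩
    have h3 : j.unop = (f₁.symm ≪≫ f₂).unop := forgetMap_iso_injective hst hB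
      (congrArg Quiver.Hom.unop (hj.trans key.symm))
    exact congrArg Iso.op h3

/-! ### Properness -/

namespace PoicMor

variable {C D : Type v} [Category.{w} C] [Category.{w} D] {X : C ⥤ Poic.{u}} {Y : D ⥤ Poic.{u}}

/-- A cone that contains the origin satisfies no strict linear inequality. Hence it is polyhedral,
and so is its image. -/
theorem isClosed_image_of_zero_mem {σ ξ : Poic.{u}} (f : σ ⟶ ξ)
    (h : (0 : ℝ ⊗[ℤ] σ.N) ∈ σ.cone) : @IsClosed _ (moduleTopology ℝ _) (Poic.linR f '' σ.cone) := by
  obtain ⟨-, K, O, hσ⟩ := σ.isPoic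
  have hO : O = ∅ := by
    refine Finset.eq_empty_of_forall_notMem fun k hk => ?_
    rw [hσ] at h
    simpa using h.2 k hk
  have h1 : σ.cone = {x | ∀ l ∈ K.image evalR, 0 ≤ l x} := by
    rw [hσ, hO]
    ext x
    simp
  rw [h1]
  exact isClosed_image_polyhedral (Poic.linR f) _

/-- If every cone of the source has the origin as a face, then so has every cone of a subdivision.
Hence these cones are closed, and so are their images. -/
theorem isProper_of_isFace_zero (F : PoicMor X Y) (hX : IsPoicSpace X)
    (h : ∀ x, IsFace (X.obj x).cone {0}) : F.IsProper := by
  intro B _ W S hS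
  refine (S.comp F).isWeaklyProper_of_closed hS.complex.toIsPoicSpace fun t => ?_
  have h0 : (0 : ℝ ⊗[ℤ] (W.obj t).N) ∈ (W.obj t).cone := by
    obtain ⟨s, f, -, hf, -⟩ := hX.face_exists _ _ (h (S.functor.obj t))
    obtain ⟨q, k, i, hi⟩ := hS.lift t s f
    obtain ⟨y, hy⟩ := (W.obj q).isPoic.1
    have h1 : Poic.linR (S.at' t) (Poic.linR (W.map k) y) = 0 := by
      have hn : W.map k ≫ S.at' t = (S.at' q ≫ X.map i.hom) ≫ X.map f := by
        rw [Category.assoc, ← X.map_comp, hi]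
        exact S.η.naturality k
      have h2 : Poic.linR (S.at' t) (Poic.linR (W.map k) y) ∈ ({0} : Set _) := by
        rw [← hf, ← LinearMap.comp_apply, ← Poic.linR_comp, hn, Poic.linR_comp]
        exact ⟨_, Poic.linR_mem _ hy, rfl⟩
      exact h2
    have h2 : Poic.linR (W.map k) y = 0 :=
      Poic.linR_injective (hS.injective t) (h1.trans (map_zero _).symm)
    rw [← h2]
    exact Poic.linR_mem _ hy
  unfold closureIn
  rw [@IsClosed.closure_eq _ (moduleTopology ℝ _) _ (isClosed_image_of_zero_mem _ h0)]
  refine Set.inter_eq_right.2 ?_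
  rintro _ ⟨x, hx, rfl⟩
  exact Poic.linR_mem _ hx

end PoicMor

open GCat DGraph in
/-- In genus zero every set of edges is a forest, so all lengths may vanish. -/
theorem isFace_zero_Mtrop (U : Type u) {Λ : Type u} (A : Finset Λ) (G : (GCat U 0 A)ᵒᵖ) :
    IsFace ((Mtrop U 0 A).obj G).cone {0} := by
  refine (Poic.isFace_orthantCone_iff isForest_empty isForest_mono {0}).2
    ⟨Set.univ, isForest_of_genus_zero _ _, Set.ext fun x => ⟨?_, fun hx => ?_⟩⟩
  · intro hx
    have h0 : ∀ i : G.unop.Edge, coord i x = 0 := fun i => by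
      rw [Set.mem_singleton_iff.1 hx]; exact map_zero _
    exact ⟨⟨fun i => (h0 i).ge, isForest_of_genus_zero _ _⟩, fun i _ => h0 i⟩
  · refine Set.mem_singleton_iff.2 (coord_ext fun i => ?_)
    rw [hx.2 i trivial]; exact (map_zero (coord i)).symm

/-! ### Joining pairs of legs of a tree -/

namespace GCat

open DGraph

variable {U Λ : Type u} {g : ℕ} {A : Finset Λ} {T T' : GCat U 0 (legSet g A)}

theorem legSet_cases (c : legSet g A) : (∃ a : A, c = ⟨Sum.inl a.1, inl_mem_legSet a.2⟩) ∨
    ∃ i, c = ⟨Sum.inr i, inr_mem_legSet i⟩ := by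
  obtain ⟨c | i, hc⟩ := c
  · exact Or.inl ⟨⟨c, Finset.inl_mem_disjSum.1 hc⟩, rfl⟩
  · exact Or.inr ⟨i, rfl⟩

theorem newLeg_injective (T : GCat U 0 (legSet g A)) : Function.Injective T.newLeg := by
  intro i j h
  have := congrArg Subtype.val (T.leg_injective h)
  exact Sum.inr_injective this

theorem oldLeg_injective (T : GCat U 0 (legSet g A)) : Function.Injective T.oldLeg := by
  intro i j h
  have := congrArg Subtype.val (T.leg_injective h)
  exact Subtype.ext (Sum.inl_injective this)

theorem oldLeg_ne_newLeg (T : GCat U 0 (legSet g A)) (a : A) (i : Fin g × Bool) :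
    T.oldLeg a ≠ T.newLeg i := by
  intro h
  have := congrArg Subtype.val (T.leg_injective h)
  cases this

theorem ι_newLeg (T : GCat U 0 (legSet g A)) (i : Fin g × Bool) :
    T.ι (T.newLeg i) = T.newLeg i := T.ι_leg _

theorem newLeg_not_vertex (T : GCat U 0 (legSet g A)) (i : Fin g × Bool) :
    ¬ T.IsVertex (T.newLeg i) := T.leg_not_vertex _

theorem fn_newLeg (f : T ⟶ T') (i : Fin g × Bool) : fn f (T.newLeg i) = T'.newLeg i := fn_leg f _

/-- The flag is one of the legs `1,…,g,1*,…,g*`. -/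
def IsNew (T : GCat U 0 (legSet g A)) (x : T.F) : Prop := ∃ i, x = T.newLeg i

theorem not_isNew {x : T.F} : ¬ T.IsNew x ↔ ∀ i, x ≠ T.newLeg i := by
  simp [IsNew]

theorem IsNew.ι {x : T.F} (h : T.IsNew x) : T.ι x = x := by
  obtain ⟨i, rfl⟩ := h; exact T.ι_newLeg i

theorem IsNew.not_vertex {x : T.F} (h : T.IsNew x) : ¬ T.IsVertex x := by
  obtain ⟨i, rfl⟩ := h; exact T.newLeg_not_vertex i

theorem not_isNew_ι {x : T.F} (h : ¬ T.IsNew x) : ¬ T.IsNew (T.ι x) := fun h' =>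
  h (by have := h'.ι; rw [T.ι_ι] at this; rwa [this])

theorem isNew_fn_iff (f : T ⟶ T') {x : T.F} : T'.IsNew (fn f x) ↔ T.IsNew x := by
  constructor
  · rintro ⟨i, hi⟩
    exact ⟨i, fn_inj f (hi ▸ T'.newLeg_not_vertex i) (hi.trans (fn_newLeg f i).symm)⟩
  · rintro ⟨i, rfl⟩
    exact ⟨i, fn_newLeg f i⟩

/-- The involution that exchanges the `i`-leg and the `i*`-leg for all `i`. -/
def glueι (T : GCat U 0 (legSet g A)) (x : T.F) : T.F :=
  if h : T.IsNew x then T.newLeg (h.choose.1, !h.choose.2) else T.ι x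

theorem glueι_newLeg (T : GCat U 0 (legSet g A)) (i : Fin g) (b : Bool) :
    T.glueι (T.newLeg (i, b)) = T.newLeg (i, !b) := by
  have h : T.IsNew (T.newLeg (i, b)) := ⟨_, rfl⟩
  rw [glueι, dif_pos h, ← T.newLeg_injective h.choose_spec]

theorem glueι_of_not {x : T.F} (h : ¬ T.IsNew x) : T.glueι x = T.ι x := dif_neg h

theorem glueι_ne_of_isNew {x : T.F} (h : T.IsNew x) : T.glueι x ≠ x := by
  obtain ⟨⟨i, b⟩, rfl⟩ := h
  rw [glueι_newLeg]
  intro h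
  have := congrArg Prod.snd (T.newLeg_injective h)
  simp at this

theorem glueι_ne_iff {x : T.F} : T.glueι x ≠ x ↔ T.ι x ≠ x ∨ T.IsNew x := by
  by_cases h : T.IsNew x
  · simp [h, glueι_ne_of_isNew h]
  · simp [h, glueι_of_not h]

/-- Joining `g` pairs of legs of a tree gives a graph of genus `g`, since it adds `g` edges and no
vertices. -/
theorem isStableGraph_glue (T : GCat U 0 (legSet g A)) :
    IsStableGraph g A T.r T.glueι T.oldLeg where
  r_r := T.r_r
  ι_ι x := by
    by_cases h : T.IsNew x
    · obtain ⟨⟨i, b⟩, rfl⟩ := h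
      rw [glueι_newLeg, glueι_newLeg, Bool.not_not]
    · rw [glueι_of_not h, glueι_of_not (not_isNew_ι h), T.ι_ι]
  ι_r x := by
    rw [glueι_of_not fun h => h.not_vertex (isVertex_r x), T.ι_r]
  leg_inj := T.oldLeg_injective
  leg_range x := by
    constructor
    · rintro ⟨hv, hx⟩
      have hn : ¬ T.IsNew x := fun h => glueι_ne_of_isNew h hx
      rw [glueι_of_not hn] at hx
      obtain ⟨c, rfl⟩ := (T.leg_range x).1 ⟨hv, hx⟩
      rcases legSet_cases c with ⟨a, rfl⟩ | ⟨i, rfl⟩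
      · exact ⟨a, rfl⟩
      · exact absurd ⟨i, rfl⟩ hn
    · rintro ⟨a, rfl⟩
      refine ⟨T.leg_not_vertex _, ?_⟩
      rw [glueι_of_not (not_isNew.2 fun i => T.oldLeg_ne_newLeg a i)]
      exact T.ι_leg _
  nonempty := T.isStableGraph.nonempty
  conn v w hv hw := by
    refine (T.conn' hv hw).map id fun h _ => ?_
    by_cases hn : T.IsNew h
    · exact FlagReach.of_eq (by rw [hn.ι])
    · have := FlagReach.step (r := T.r) (ι := T.glueι) (Q := fun _ => True) (h := h) trivial
      rwa [glueι_of_not hn] at this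
  genus := by
    have h1 := T.isStableGraph.genus
    have h2 : Nat.card {h : T.F // T.glueι h ≠ h} = Nat.card {h : T.F // T.ι h ≠ h} + 2 * g := by
      have h3 : Finset.univ.filter (fun h => T.glueι h ≠ h) =
          Finset.univ.filter (fun h => T.ι h ≠ h) ∪ Finset.univ.image T.newLeg := by
        ext x
        simp only [Finset.mem_filter, Finset.mem_univ, true_and, Finset.mem_union,
          Finset.mem_image, glueι_ne_iff, IsNew, eq_comm]
      have h4 : Disjoint (Finset.univ.filter fun h => T.ι h ≠ h)
          (Finset.univ.image T.newLeg) := by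
        rw [Finset.disjoint_left]
        intro x hx hx'
        obtain ⟨i, -, rfl⟩ := Finset.mem_image.1 hx'
        exact (Finset.mem_filter.1 hx).2 (T.ι_newLeg i)
      have h5 := congrArg Finset.card h3
      rw [Finset.card_union_of_disjoint h4,
        Finset.card_image_of_injective _ T.newLeg_injective] at h5
      rw [Nat.card_eq_fintype_card, Nat.card_eq_fintype_card, Fintype.card_subtype,
        Fintype.card_subtype, h5]
      simp [mul_comm]
    omega
  stable := T.isStableGraph.stable

/-- The graph obtained from a tree by joining the `i`-leg and the `i*`-leg to an edge for all `i`.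
It has the same flags. -/
def glue (T : GCat U 0 (legSet g A)) : GCat U g A :=
  ofStable
    { F := T.F
      r := T.r
      ι := T.glueι
      r_r := T.r_r
      ι_ι := T.isStableGraph_glue.ι_ι
      ι_r := T.isStableGraph_glue.ι_r } T.oldLeg T.isStableGraph_glue

theorem fn_glueι (f : T ⟶ T') (x : T.F) : fn f (T.glueι x) = T'.glueι (fn f x) := by
  by_cases h : T.IsNew x
  · obtain ⟨⟨i, b⟩, rfl⟩ := h
    rw [glueι_newLeg, fn_newLeg, fn_newLeg, glueι_newLeg]
  · rw [glueι_of_not h, glueι_of_not ((not_congr (isNew_fn_iff f)).2 h), fn_ι]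

/-- A contraction of trees as a contraction of the graphs with joined legs. -/
def glueMap (f : T ⟶ T') : T.glue ⟶ T'.glue :=
  homMk (G := T.glue) (H := T'.glue) (@fn U _ 0 (legSet g A) T T' f) (fn_r f)
    (fn_glueι f) (fun a => fn_leg f _) (fn_contraction f).flag
    fun v w hv hw hvw => by
      refine (reach_fiber f hv hw hvw).map id fun h hh => ?_
      have hn : ¬ T.IsNew h := fun hn => ((isNew_fn_iff f).2 hn).not_vertex hh
      refine @Eq.subst _ (fun y => FlagReach T.r T.glueι (fun h => T'.IsVertex (fn f h)) (T.r h)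
        (T.r y)) _ _ (glueι_of_not hn) (FlagReach.step hh)

/-- The functor that joins pairs of legs. -/
def glueFunctor (U : Type u) {Λ : Type u} (g : ℕ) (A : Finset Λ) :
    (GCat U 0 (legSet g A))ᵒᵖ ⥤ (GCat U g A)ᵒᵖ where
  obj T := op T.unop.glue
  map f := (glueMap f.unop).op
  map_id _ := rfl
  map_comp _ _ := rfl

/-- The edges of the tree and the new edges are the edges of the graph with joined legs. -/
def glueEdge (T : GCat U 0 (legSet g A)) : T.Edge ⊕ Fin g → T.glue.Edge :=
  Sum.elim (fun e => ⟨e.1, by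
      obtain ⟨h, hh, he⟩ := e.2
      have hn : ¬ T.IsNew h := fun hn => hh hn.ι
      exact ⟨h, by rwa [show T.glue.ι h = T.ι h from glueι_of_not hn], by
        rw [show T.glue.ι h = T.ι h from glueι_of_not hn]; exact he⟩⟩)
    fun i => edgeOf (G := T.glue.toDGraph) (T.newLeg (i, false)) (glueι_ne_of_isNew ⟨_, rfl⟩)

theorem glueEdge_inl {x : T.F} (hx : T.ι x ≠ x) :
    T.glueEdge (Sum.inl (edgeOf x hx)) =
      edgeOf (G := T.glue.toDGraph) x (glueι_ne_iff.2 (Or.inl hx)) := by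
  refine Subtype.ext ?_
  show s(x, T.ι x) = s(x, T.glueι x)
  rw [glueι_of_not fun h => hx h.ι]

theorem glueEdge_inr (T : GCat U 0 (legSet g A)) (i : Fin g) (b : Bool) :
    T.glueEdge (Sum.inr i) =
      edgeOf (G := T.glue.toDGraph) (T.newLeg (i, b)) (glueι_ne_of_isNew ⟨_, rfl⟩) := by
  refine Subtype.ext ?_
  show s(T.newLeg (i, false), T.glueι (T.newLeg (i, false))) = s(_, T.glueι _)
  rw [glueι_newLeg, glueι_newLeg]
  cases b
  · rfl
  · exact Sym2.eq_swap

theorem glueEdge_bijective (T : GCat U 0 (legSet g A)) : Function.Bijective T.glueEdge := by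
  have hne : ∀ (e : T.Edge) i, T.glueEdge (Sum.inl e) ≠ T.glueEdge (Sum.inr i) := by
    intro e i h
    obtain ⟨x, hx, rfl⟩ := exists_edgeOf e
    rw [glueEdge_inl hx, T.glueEdge_inr i false] at h
    rcases edgeOf_eq_iff.1 h with h | h
    · exact hx (by rw [show x = T.newLeg _ from h]; exact T.ι_newLeg _)
    · have h : x = T.glueι (T.newLeg (i, false)) := h
      rw [glueι_newLeg] at h
      exact hx (by rw [h]; exact T.ι_newLeg _)
  constructor
  · rintro (e | i) (e' | i') h
    · exact congrArg Sum.inl (Subtype.ext (show e.1 = e'.1 from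
        congrArg (fun z : T.glue.Edge => z.1) h))
    · exact absurd h (hne e i')
    · exact absurd h.symm (hne e' i)
    · rw [T.glueEdge_inr i false, T.glueEdge_inr i' false] at h
      rcases edgeOf_eq_iff.1 h with h | h
      · exact congrArg Sum.inr (Prod.ext_iff.1 (T.newLeg_injective h)).1
      · have h : T.newLeg _ = T.glueι (T.newLeg (i', false)) := h
        rw [glueι_newLeg] at h
        exact congrArg Sum.inr (Prod.ext_iff.1 (T.newLeg_injective h)).1
  · intro e
    obtain ⟨x, hx, rfl⟩ := exists_edgeOf e
    rcases glueι_ne_iff.1 hx with h | ⟨⟨i, b⟩, rfl⟩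
    · exact ⟨_, glueEdge_inl h⟩
    · exact ⟨_, T.glueEdge_inr i b⟩

/-- The bijection between the edges of the graph with joined legs and the edges of the tree together
with the new edges. -/
def glueEquiv (T : GCat U 0 (legSet g A)) : T.glue.Edge ≃ T.Edge ⊕ Fin g :=
  (Equiv.ofBijective _ T.glueEdge_bijective).symm

theorem glueEquiv_glueEdge (T : GCat U 0 (legSet g A)) (e : T.Edge ⊕ Fin g) :
    T.glueEquiv (T.glueEdge e) = e :=
  (Equiv.ofBijective _ T.glueEdge_bijective).symm_apply_apply e

/-- The identification of `ℤ^E(T) × ℤ^g` with the lattice of the graph with joined legs. -/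
def glueLen (T : GCat U 0 (legSet g A)) : (T.Edge ⊕ Fin g → ℤ) →ₗ[ℤ] (T.glue.Edge → ℤ) :=
  LinearMap.funLeft ℤ ℤ T.glueEquiv

theorem glueLen_bijective (T : GCat U 0 (legSet g A)) : Function.Bijective T.glueLen :=
  ⟨LinearMap.funLeft_injective_of_surjective _ _ _ T.glueEquiv.surjective,
    LinearMap.funLeft_surjective_of_injective _ _ _ T.glueEquiv.injective⟩

theorem flagLen_glueLen_new (T : GCat U 0 (legSet g A)) (δ : T.Edge ⊕ Fin g → ℤ) (i : Fin g)
    (b : Bool) : T.glue.flagLen (T.glueLen δ) (T.newLeg (i, b)) = δ (Sum.inr i) := by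
  rw [flagLen_of_ne (G := T.glue.toDGraph) _ (glueι_ne_of_isNew ⟨_, rfl⟩), ← T.glueEdge_inr i b]
  exact congrArg δ (T.glueEquiv_glueEdge _)

theorem flagLen_glueLen_old (δ : T.Edge ⊕ Fin g → ℤ) {x : T.F} (hx : ¬ T.IsNew x) :
    T.glue.flagLen (T.glueLen δ) x = T.flagLen (δ ∘ Sum.inl) x := by
  by_cases h : T.ι x = x
  · rw [flagLen_of_eq _ h]
    exact flagLen_of_eq (G := T.glue.toDGraph) _ ((glueι_of_not hx).trans h)
  · rw [flagLen_of_ne _ h, flagLen_of_ne (G := T.glue.toDGraph) _ (glueι_ne_iff.2 (Or.inl h)),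
      ← glueEdge_inl h]
    exact congrArg δ (T.glueEquiv_glueEdge _)

theorem glueLen_pullST (f : T ⟶ T') (δ : T'.Edge ⊕ Fin g → ℤ) :
    T.glueLen (pullST f δ) = pull (glueMap f) (T'.glueLen δ) := by
  refine ext_flagLen fun x _ => ?_
  rw [flagLen_pull]
  have hx : fn (glueMap f) x = fn f x := rfl
  rw [hx]
  by_cases h : T.IsNew x
  · obtain ⟨⟨i, b⟩, rfl⟩ := h
    rw [flagLen_glueLen_new, fn_newLeg, flagLen_glueLen_new]
    rfl
  · rw [flagLen_glueLen_old _ h, flagLen_glueLen_old _ ((not_congr (isNew_fn_iff f)).2 h)]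
    exact flagLen_pull f (δ ∘ Sum.inl) x

theorem coord_glueLen (T : GCat U 0 (legSet g A)) (e : T.glue.Edge)
    (x : ℝ ⊗[ℤ] (T.Edge ⊕ Fin g → ℤ)) :
    coord e (LinearMap.baseChange ℝ T.glueLen x) = coord (T.glueEquiv e) x := by
  rw [coord, evalR_baseChange]
  rfl

/-- Edges of the tree form a forest in the graph with joined legs. -/
theorem isForest_glue (T : GCat U 0 (legSet g A)) {S : Set T.glue.Edge}
    (hS : ∀ i, T.glueEdge (Sum.inr i) ∉ S) : T.glue.IsForest S := by
  have hold : ∀ x, FlagIn S x → ¬ T.IsNew x := by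
    rintro _ ⟨hx, hxS⟩ ⟨⟨i, b⟩, rfl⟩
    rw [← T.glueEdge_inr i b] at hxS
    exact hS i hxS
  refine (isForest_iff S).2 fun h hh hr => ?_
  have hι : T.glue.ι h = T.ι h := glueι_of_not (hold h hh)
  obtain ⟨hne, -⟩ := id hh
  rw [hι] at hr hne
  refine not_reach_ends T hne (hr.map id fun x hx => ?_)
  have := FlagReach.step (r := T.r) (ι := T.ι) (Q := fun x => x ≠ h ∧ x ≠ T.ι h) (h := x)
    ⟨hx.2.1, hx.2.2⟩
  rwa [← glueι_of_not (hold x hx.1)] at this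

theorem glueLen_mem (T : GCat U 0 (legSet g A)) (x : ℝ ⊗[ℤ] (T.Edge ⊕ Fin g → ℤ))
    (hx : x ∈ Poic.orthantCone (T.Edge ⊕ Fin g) T.STzero) :
    LinearMap.baseChange ℝ T.glueLen x ∈ Poic.orthantCone T.glue.Edge T.glue.IsForest := by
  refine ⟨fun e => (hx.1 _).trans_eq (T.coord_glueLen e x).symm, T.isForest_glue fun i hi => ?_⟩
  have h1 : coord (T.glueEdge (Sum.inr i)) (LinearMap.baseChange ℝ T.glueLen x) = 0 := hi
  rw [coord_glueLen, glueEquiv_glueEdge] at h1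
  exact hx.2.2 i h1

end GCat

open GCat DGraph in
/-- The morphism `st_{g,A}`. -/
def stMor (U : Type u) {Λ : Type u} (g : ℕ) (A : Finset Λ) :
    PoicMor (STcomplex U g A) (Mtrop U g A) where
  functor := glueFunctor U g A
  η :=
    { app := fun T => ⟨T.unop.glueLen, T.unop.glueLen_mem⟩
      naturality := fun _ _ f => Poic.hom_ext (LinearMap.ext fun δ => glueLen_pullST f.unop δ) }
  not_in_proper_face := by
    intro T τ hτ hsub
    obtain ⟨y, hy⟩ := exists_coord (I := T.unop.Edge ⊕ Fin g) fun _ => (1 : ℝ)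
    have hpos : ∀ e, 0 < coord e y := fun e => by rw [hy]; exact one_pos
    refine Poic.eq_orthantCone_of_pos_mem DGraph.isForest_empty DGraph.isForest_mono hτ
      (hsub ⟨y, Poic.mem_orthantCone_of_pos T.unop.stzero_empty hpos, rfl⟩) fun e => ?_
    exact (hpos _).trans_eq (T.unop.coord_glueLen e y).symm

open GCat in
theorem isSpanningTree_stMor (U : Type u) {Λ : Type u} (g : ℕ) (A : Finset Λ) :
    IsSpanningTree (stMor U g A) where
  flags _ := rfl
  root T x y hxy := by
    obtain rfl : x = y := Subtype.ext hxy
    rfl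
  involution_new T x i b hx := by
    obtain rfl : x = T.newLeg (i, b) := Subtype.ext hx
    exact congrArg Subtype.val (T.glueι_newLeg i b)
  involution_old T x y hxy hy := by
    obtain rfl : x = y := Subtype.ext hxy
    exact congrArg Subtype.val (glueι_of_not (not_isNew.2 hy))
  marking _ _ := rfl
  map T T' f x y hxy := by
    obtain rfl : x = y := Subtype.ext hxy
    rfl
  length_new T δ x i b hx := by
    obtain rfl : x = T.newLeg (i, b) := Subtype.ext hx
    exact T.flagLen_glueLen_new δ i b
  length_old T δ x y hxy hy := by
    obtain rfl : x = y := Subtype.ext hxy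
    exact flagLen_glueLen_old δ (not_isNew.2 hy)

/-! ### Cutting edges, and the fibration of spanning trees -/

namespace GCat

open DGraph

variable {U Λ : Type u} {g : ℕ} {A : Finset Λ} {T T' : GCat U 0 (legSet g A)} {G : GCat U g A}
  {m : Fin g × Bool → G.F}

/-- The flags `m (i, false)` and `m (i, true)` form `g` edges whose complement is connected: it is a
spanning tree. -/
structure IsCut (G : GCat U g A) (m : Fin g × Bool → G.F) : Prop where
  inj : Function.Injective m
  ι : ∀ i b, G.ι (m (i, b)) = m (i, !b)
  conn : ∀ v w, G.IsVertex v → G.IsVertex w → G.Reach (fun h => h ∉ Set.range m) v w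

/-- The involution after cutting the edges `m` in the middle. -/
def cutι (G : GCat U g A) (m : Fin g × Bool → G.F) (x : G.F) : G.F :=
  if x ∈ Set.range m then x else G.ι x

/-- The marking after cutting the edges `m` in the middle. -/
def cutLeg (G : GCat U g A) (m : Fin g × Bool → G.F) : legSet g A → G.F
  | ⟨Sum.inl c, h⟩ => G.leg ⟨c, Finset.inl_mem_disjSum.1 h⟩
  | ⟨Sum.inr i, _⟩ => m i

theorem cutι_of_mem {x : G.F} (h : x ∈ Set.range m) : G.cutι m x = x := if_pos h

theorem cutι_of_not {x : G.F} (h : x ∉ Set.range m) : G.cutι m x = G.ι x := if_neg h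

namespace IsCut

theorem ι_ne (h : G.IsCut m) {x : G.F} (hx : x ∈ Set.range m) : G.ι x ≠ x := by
  obtain ⟨⟨i, b⟩, rfl⟩ := hx
  rw [h.ι]
  intro he
  have := congrArg Prod.snd (h.inj he)
  simp at this

theorem ι_mem (h : G.IsCut m) {x : G.F} : G.ι x ∈ Set.range m ↔ x ∈ Set.range m := by
  have key : ∀ y, y ∈ Set.range m → G.ι y ∈ Set.range m := by
    rintro _ ⟨⟨i, b⟩, rfl⟩
    exact ⟨(i, !b), (h.ι i b).symm⟩
  exact ⟨fun hx => by rw [← G.ι_ι x]; exact key _ hx, key x⟩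

/-- Cutting `g` edges of a graph of genus `g` without disconnecting it leaves a tree. -/
theorem isStableGraph (h : G.IsCut m) :
    IsStableGraph 0 (legSet g A) G.r (G.cutι m) (G.cutLeg m) where
  r_r := G.r_r
  ι_ι x := by
    by_cases hx : x ∈ Set.range m
    · rw [cutι_of_mem hx, cutι_of_mem hx]
    · rw [cutι_of_not hx, cutι_of_not (h.ι_mem.not.2 hx), G.ι_ι]
  ι_r x := by
    rw [cutι_of_not fun hx => h.ι_ne hx (G.ι_r x), G.ι_r]
  leg_inj c d hcd := by
    have hlm : ∀ a i, G.leg a ≠ m i := fun a i he =>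
      h.ι_ne ⟨i, rfl⟩ (by rw [← he]; exact G.ι_leg a)
    rcases c with ⟨c | i, hc⟩ <;> rcases d with ⟨d | j, hd⟩
    · exact Subtype.ext (congrArg Sum.inl (congrArg Subtype.val (G.leg_injective hcd)))
    · exact absurd hcd (hlm _ _)
    · exact absurd hcd.symm (hlm _ _)
    · exact Subtype.ext (congrArg Sum.inr (h.inj hcd))
  leg_range x := by
    constructor
    · rintro ⟨hv, hx⟩
      by_cases hm : x ∈ Set.range m
      · obtain ⟨i, rfl⟩ := hm
        exact ⟨⟨Sum.inr i, inr_mem_legSet i⟩, rfl⟩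
      · rw [cutι_of_not hm] at hx
        obtain ⟨a, rfl⟩ := (G.leg_range x).1 ⟨hv, hx⟩
        exact ⟨⟨Sum.inl a.1, inl_mem_legSet a.2⟩, rfl⟩
    · rintro ⟨c, rfl⟩
      rcases c with ⟨c | i, hc⟩
      · have h1 : G.leg ⟨c, Finset.inl_mem_disjSum.1 hc⟩ ∉ Set.range m := fun h1 =>
          h.ι_ne h1 (G.ι_leg _)
        exact ⟨G.leg_not_vertex _, (cutι_of_not h1).trans (G.ι_leg _)⟩
      · exact ⟨not_isVertex_of_ne (h.ι_ne ⟨i, rfl⟩), cutι_of_mem ⟨i, rfl⟩⟩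
  nonempty := G.isStableGraph.nonempty
  conn v w hv hw := by
    refine (h.conn v w hv hw).map id fun x hx => ?_
    have := FlagReach.step (r := G.r) (ι := G.cutι m) (Q := fun _ => True) (h := x) trivial
    rwa [cutι_of_not hx] at this
  genus := by
    have h1 := G.isStableGraph.genus
    have h2 : Nat.card {x : G.F // G.ι x ≠ x} = Nat.card {x : G.F // G.cutι m x ≠ x} + 2 * g := by
      have h3 : Finset.univ.filter (fun x => G.ι x ≠ x) =
          Finset.univ.filter (fun x => G.cutι m x ≠ x) ∪ Finset.univ.image m := by
        ext x
        simp only [Finset.mem_filter, Finset.mem_univ, true_and, Finset.mem_union,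
          Finset.mem_image]
        by_cases hx : x ∈ Set.range m
        · exact ⟨fun _ => Or.inr hx, fun _ => h.ι_ne hx⟩
        · rw [cutι_of_not hx]
          exact ⟨Or.inl, fun h => h.resolve_right hx⟩
      have h4 : Disjoint (Finset.univ.filter fun x => G.cutι m x ≠ x) (Finset.univ.image m) := by
        rw [Finset.disjoint_left]
        intro x hx hx'
        obtain ⟨i, -, hi⟩ := Finset.mem_image.1 hx'
        exact (Finset.mem_filter.1 hx).2 (cutι_of_mem ⟨i, hi⟩)
      have h5 := congrArg Finset.card h3
      rw [Finset.card_union_of_disjoint h4, Finset.card_image_of_injective _ h.inj] at h5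
      rw [Nat.card_eq_fintype_card, Nat.card_eq_fintype_card, Fintype.card_subtype,
        Fintype.card_subtype, h5]
      simp [mul_comm]
    omega
  stable := G.isStableGraph.stable

end IsCut

/-- The tree obtained by cutting the edges `m` in the middle. It has the same flags. -/
def cut (G : GCat U g A) (m : Fin g × Bool → G.F) (h : G.IsCut m) : GCat U 0 (legSet g A) :=
  ofStable
    { F := G.F
      r := G.r
      ι := G.cutι m
      r_r := G.r_r
      ι_ι := h.isStableGraph.ι_ι
      ι_r := h.isStableGraph.ι_r } (G.cutLeg m) h.isStableGraph

/-- Joining the legs of a cut graph gives back the graph. -/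
def glueCutIso (h : G.IsCut m) : (G.cut m h).glue ≅ G :=
  isoMk (G := (G.cut m h).glue) (Equiv.refl G.F) (fun _ => rfl) (fun x => by
      show (G.cut m h).glueι x = G.ι x
      by_cases hx : (G.cut m h).IsNew x
      · obtain ⟨⟨i, b⟩, rfl⟩ := hx
        rw [glueι_newLeg]
        exact (h.ι i b).symm
      · rw [glueι_of_not hx]
        exact cutι_of_not fun ⟨i, hi⟩ => hx ⟨i, hi.symm⟩) fun _ => rfl

/-- A fixed point free involution of a set of `2 g` flags numbers the edges that they form. -/
theorem exists_numbering {X : Type u} (ι : X → X) (hι : ∀ x, ι (ι x) = x) (N : Finset X)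
    (hN : ∀ x ∈ N, ι x ∈ N ∧ ι x ≠ x) (hcard : N.card = 2 * g) :
    ∃ m : Fin g × Bool → X, Function.Injective m ∧ (∀ i b, ι (m (i, b)) = m (i, !b)) ∧
      Set.range m = N := by
  let E : Finset (Sym2 X) := N.image fun x => s(x, ι x)
  have hE : E.card = g := by
    have h1 : N.card = E.card * 2 := by
      rw [Finset.card_eq_sum_card_fiberwise (t := E) (f := fun x => s(x, ι x))
        (fun x hx => Finset.mem_image_of_mem _ hx)]
      refine Finset.sum_const_nat fun e he => ?_
      obtain ⟨x, hx, rfl⟩ := Finset.mem_image.1 he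
      have : (N.filter fun y => s(y, ι y) = s(x, ι x)) = {x, ι x} := by
        ext y
        simp only [Finset.mem_filter, Finset.mem_insert, Finset.mem_singleton]
        constructor
        · rintro ⟨-, h⟩
          rcases Sym2.eq_iff.1 h with h | h
          · exact Or.inl h.1
          · exact Or.inr h.1
        · rintro (rfl | rfl)
          · exact ⟨hx, rfl⟩
          · exact ⟨(hN x hx).1, by rw [hι]; exact Sym2.eq_swap⟩
      rw [this, Finset.card_pair (hN x hx).2.symm]
    omega
  let q : Fin g ≃ E := (Fintype.equivFinOfCardEq (by simp [hE])).symm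
  have hrep : ∀ i, ∃ x ∈ N, (q i).1 = s(x, ι x) := fun i => by
    obtain ⟨x, hx, h⟩ := Finset.mem_image.1 (q i).2
    exact ⟨x, hx, h.symm⟩
  choose p hpN hp using hrep
  let m : Fin g × Bool → X := fun i => if i.2 then ι (p i.1) else p i.1
  have hm : ∀ i, (q i.1).1 = s(m i, ι (m i)) := by
    rintro ⟨i, b⟩
    cases b
    · exact hp i
    · show _ = s(ι (p i), ι (ι (p i)))
      rw [hι, hp]
      exact Sym2.eq_swap
  have hmN : ∀ i, m i ∈ N := by
    rintro ⟨i, b⟩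
    cases b
    · exact hpN i
    · exact (hN _ (hpN i)).1
  have hmι : ∀ i b, ι (m (i, b)) = m (i, !b) := by
    intro i b
    cases b
    · rfl
    · exact hι _
  refine ⟨m, ?_, hmι, Set.eq_of_subset_of_subset ?_ fun x hx => ?_⟩
  · rintro ⟨i, b⟩ ⟨j, c⟩ hij
    have h1 := hm (i, b)
    rw [hij, ← hm (j, c)] at h1
    obtain rfl : i = j := q.injective (Subtype.ext h1)
    by_contra hne
    obtain rfl : c = !b := by
      cases b <;> cases c <;> simp_all
    rw [← hmι] at hij
    exact (hN _ (hmN (i, b))).2 hij.symm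
  · rintro _ ⟨i, rfl⟩
    exact hmN i
  · let e : E := ⟨s(x, ι x), Finset.mem_image_of_mem _ hx⟩
    have h1 := hm (q.symm e, false)
    rw [Equiv.apply_symm_apply] at h1
    rcases Sym2.eq_iff.1 h1 with h | h
    · exact ⟨_, h.1.symm⟩
    · exact ⟨(q.symm e, true), by
        rw [show true = !false from rfl, ← hmι]; exact h.1.symm⟩

/-- The cut edges are those outside a spanning tree; there are `g` of them by the formula for the
genus. -/
theorem exists_isCut (G : GCat U g A) : ∃ m, G.IsCut m := by
  obtain ⟨K, -, hK, hKv⟩ := exists_spanning_tree (G := G.toDGraph) (K := Finset.univ)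
    (fun x _ => ⟨Finset.mem_univ _, Finset.mem_univ _⟩) G.conn
  have hK' : ∀ x, G.ι x ∈ K → x ∈ K := fun x hx => by
    have := (hK.1 _ hx).2
    rwa [G.ι_ι] at this
  let N : Finset G.F := Finset.univ.filter fun x => G.ι x ≠ x ∧ x ∉ K
  have hN : ∀ x, x ∈ N ↔ G.ι x ≠ x ∧ x ∉ K := fun x => by simp [N]
  have hcard : N.card = 2 * g := by
    have h1 : (K.filter fun x => G.ι x ≠ x) ∪ N = Finset.univ.filter fun x => G.ι x ≠ x := by
      ext x
      simp only [Finset.mem_union, Finset.mem_filter, hN, Finset.mem_univ, true_and]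
      tauto
    have h2 : Disjoint (K.filter fun x => G.ι x ≠ x) N := by
      rw [Finset.disjoint_left]
      exact fun x hx hx' => ((hN x).1 hx').2 (Finset.mem_filter.1 hx).1
    have h3 : G.verts K = Finset.univ.filter fun v => G.IsVertex v := by
      ext v
      simp only [verts, Finset.mem_filter, Finset.mem_univ, true_and]
      exact ⟨fun h => h.2, fun h => ⟨hKv v (Finset.mem_univ v) h, h⟩⟩
    have h4 := G.card_flags
    have h5 := two_mul_card_edges hK.1
    have h6 := hK.2.2.2
    have h7 := congrArg Finset.card h1
    rw [Finset.card_union_of_disjoint h2] at h7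
    rw [← h3] at h4
    unfold genus at h6
    omega
  obtain ⟨m, hm, hmι, hmN⟩ := exists_numbering (g := g) G.ι G.ι_ι N (fun x hx => by
    rw [hN] at hx ⊢
    exact ⟨⟨DGraph.ι_ne hx.1, fun h => hx.2 (hK' x h)⟩, hx.1⟩) hcard
  refine ⟨m, hm, hmι, fun v w hv hw => ?_⟩
  have := reach_of_joined (G := G.toDGraph) (K := K) (Q := fun h => h ∉ Set.range m)
    (fun x hx _ h => ((hN x).1 (by rw [hmN] at h; exact h)).2 hx)
    (hK.2.2.1.2 v (hKv v (Finset.mem_univ v) hv) w (hKv w (Finset.mem_univ w) hw) hv hw)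
  exact this

/-- A contraction to a graph with joined legs is, up to isomorphism, a contraction of trees: the new
edges are not contracted, and may be cut in the source. -/
theorem exists_lift_glueMap (f : G ⟶ T.glue) :
    ∃ (Q : GCat U 0 (legSet g A)) (h : Q ⟶ T) (i : Q.glue ≅ G), i.hom ≫ f = glueMap h := by
  have hpre := fun i => fn_surj f (T.newLeg i)
  choose m hm using hpre
  have hmv : ∀ i, ¬ T.glue.IsVertex (fn f (m i)) := fun i => by
    rw [hm]; exact T.newLeg_not_vertex i
  have hrange : ∀ x, x ∈ Set.range m ↔ T.IsNew (fn (H := T.glue) f x) := by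
    intro x
    constructor
    · rintro ⟨i, rfl⟩; exact ⟨i, hm i⟩
    · rintro ⟨i, hi⟩
      exact ⟨i, fn_inj f (hmv i) ((hm i).trans hi.symm)⟩
  have hcut : G.IsCut m := by
    refine ⟨fun i j hij => T.newLeg_injective ?_, fun i b => ?_, fun v w hv hw => ?_⟩
    · rw [← hm, ← hm, hij]
    · refine (fn_inj f (hmv _) ?_).symm
      rw [hm, fn_ι, hm]
      exact (T.glueι_newLeg i b).symm
    · have h1 : T.glue.Reach (fun x => ¬ T.IsNew x) (fn f v) (fn f w) := by
        refine (T.conn' (fn_vertex f hv) (fn_vertex f hw)).map id fun x _ => ?_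
        by_cases hx : T.IsNew x
        · exact FlagReach.of_eq (by rw [hx.ι])
        · exact @Eq.subst _ (fun y => FlagReach T.r T.glueι (fun x => ¬ T.IsNew x) (T.r x)
            (T.r y)) _ _ (glueι_of_not hx) (FlagReach.step hx)
      refine (lift_reach f hv hw h1).mono fun x hx => ?_
      rw [hrange]
      rcases hx with hx | hx
      · exact fun h => h.not_vertex hx
      · exact hx
  refine ⟨G.cut m hcut, homMk (G := G.cut m hcut) (H := T) (@fn U Λ g A G T.glue f) (fn_r f)
    (fun x => ?_) (fun c => ?_) (fn_contraction f).flag (fun v w hv hw hvw => ?_),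
    glueCutIso hcut, rfl⟩
  · show fn (H := T.glue) f (G.cutι m x) = T.ι (fn (H := T.glue) f x)
    by_cases hx : x ∈ Set.range m
    · rw [cutι_of_mem hx]
      exact ((hrange x).1 hx).ι.symm
    · rw [cutι_of_not hx]
      exact (fn_ι f x).trans (glueι_of_not ((hrange x).not.1 hx))
  · rcases legSet_cases c with ⟨a, rfl⟩ | ⟨i, rfl⟩
    · exact fn_leg f a
    · exact hm i
  · refine (reach_fiber f hv hw hvw).map id fun h hh => ?_
    have hn : h ∉ Set.range m := fun hn => ((hrange h).1 hn).not_vertex hh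
    exact @Eq.subst _ (fun y => FlagReach G.r (G.cutι m) (fun h => T.glue.IsVertex (fn f h))
      (G.r h) (G.r y)) _ _ (cutι_of_not hn) (FlagReach.step hh)

/-- An isomorphism of graphs with joined legs which respects the numbering of the new edges and
their orientations is an isomorphism of trees. -/
theorem exists_iso_of_glue (i : T.glue ≅ T'.glue)
    (hi : ∀ j, fn i.hom (T.newLeg j) = T'.newLeg j) :
    ∃ k : T ≅ T', ∀ x, fn k.hom x = fn (G := T.glue) (H := T'.glue) i.hom x := by
  have hnew : ∀ x : T.F, ¬ T.IsNew x → ¬ T'.IsNew (fn (G := T.glue) (H := T'.glue) i.hom x) := by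
    rintro x hx ⟨j, hj⟩
    exact hx ⟨j, (flagEquiv i).injective (hj.trans (hi j).symm)⟩
  refine ⟨isoMk (@flagEquiv U Λ g A T.glue T'.glue i) (fn_r i.hom) (fun x => ?_) fun c => ?_,
    fun _ => rfl⟩
  · show fn (G := T.glue) (H := T'.glue) i.hom (T.ι x) =
      T'.ι (fn (G := T.glue) (H := T'.glue) i.hom x)
    by_cases hx : T.IsNew x
    · obtain ⟨j, rfl⟩ := hx
      rw [ι_newLeg, hi, ι_newLeg]
    · have h1 := fn_ι i.hom x
      have h2 : T.glue.ι x = T.ι x := glueι_of_not hx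
      have h3 : T'.glue.ι (fn i.hom x) = T'.ι (fn (G := T.glue) (H := T'.glue) i.hom x) :=
        glueι_of_not (hnew x hx)
      rwa [h2, h3] at h1
  · rcases legSet_cases c with ⟨a, rfl⟩ | ⟨j, rfl⟩
    · exact fn_leg i.hom a
    · exact hi j

end GCat

open GCat DGraph in
/-- The map is essentially surjective since every graph has a spanning tree. A contraction to a
graph with joined legs is lifted by cutting the edges over the joined legs. -/
theorem isPoicFibration_stMor (U : Type u) {Λ : Type u} (g : ℕ) (A : Finset Λ) :
    (stMor U g A).IsPoicFibration where
  complex := isPoicComplex_STcomplex U g A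
  space := isPoicSpace_Mtrop U g A
  essSurj := ⟨fun G => by
    obtain ⟨m, hm⟩ := exists_isCut G.unop
    exact ⟨op (G.unop.cut m hm), ⟨(glueCutIso hm).symm.op⟩⟩⟩
  bijective T := T.unop.glueLen_bijective
  interior T := by
    have h1 := Poic.relInt_orthantCone T.unop.stzero_empty stzero_mono
    have h2 := Poic.relInt_orthantCone (I := T.unop.glue.Edge) (P := T.unop.glue.IsForest)
      DGraph.isForest_empty DGraph.isForest_mono
    refine (congrArg _ h1).trans (Eq.trans ?_ h2.symm)
    refine Set.eq_of_subset_of_subset ?_ fun y hy => ?_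
    · rintro _ ⟨x, hx, rfl⟩ e
      exact (hx _).trans_eq (T.unop.coord_glueLen e x).symm
    · obtain ⟨x, hx⟩ := exists_coord fun e => coord (T.unop.glueEdge e) y
      refine ⟨x, fun e => (hx e).symm ▸ hy _, coord_ext fun e => ?_⟩
      refine (T.unop.coord_glueLen e x).trans ((hx _).trans ?_)
      rw [show T.unop.glueEdge (T.unop.glueEquiv e) = e from
        (Equiv.ofBijective _ T.unop.glueEdge_bijective).apply_symm_apply e]
      rfl
  lift T G f := by
    obtain ⟨Q, h, i, hi⟩ := exists_lift_glueMap (T := T.unop) f.unop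
    refine ⟨op Q, h.op, i.symm.op, Quiver.Hom.unop_inj ?_⟩
    exact (Iso.inv_comp_eq i).2 hi.symm
  lift_unique T G f Q₁ Q₂ h₁ h₂ i₁ i₂ e₁ e₂ := by
    let φ : G.unop ≅ Q₁.unop.glue := i₁.unop
    let ψ : G.unop ≅ Q₂.unop.glue := i₂.unop
    have e₁' : φ.hom ≫ glueMap h₁.unop = f.unop := congrArg Quiver.Hom.unop e₁
    have e₂' : ψ.hom ≫ glueMap h₂.unop = f.unop := congrArg Quiver.Hom.unop e₂
    have key : (ψ.symm ≪≫ φ).hom ≫ glueMap h₁.unop = glueMap h₂.unop := by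
      rw [Iso.trans_hom, Iso.symm_hom, Category.assoc, e₁', ← e₂', Iso.inv_hom_id_assoc]
    have hfn : ∀ x, fn h₁.unop (fn (G := Q₂.unop.glue) (H := Q₁.unop.glue) (ψ.symm ≪≫ φ).hom x) =
        fn h₂.unop x := fun x =>
      congrArg (fun k : Q₂.unop.glue ⟶ T.unop.glue => fn k x) key
    obtain ⟨k, hk⟩ := exists_iso_of_glue (ψ.symm ≪≫ φ) fun j => by
      have h3 := hfn (Q₂.unop.newLeg j)
      rw [fn_newLeg] at h3
      exact fn_inj h₁.unop (h3 ▸ T.unop.newLeg_not_vertex j)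
        (h3.trans (fn_newLeg h₁.unop j).symm)
    refine ⟨k.op, Quiver.Hom.unop_inj (hom_ext_fn fun x => ?_),
      Quiver.Hom.unop_inj (hom_ext_fn fun x => ?_)⟩
    · show fn h₁.unop (fn k.hom x) = fn h₂.unop x
      rw [hk]
      exact hfn x
    · show fn k.hom (fn (H := Q₂.unop.glue) ψ.hom x) = fn (H := Q₁.unop.glue) φ.hom x
      refine (hk _).trans ?_
      have : ψ.hom ≫ (ψ.symm ≪≫ φ).hom = φ.hom := by
        rw [Iso.trans_hom, Iso.symm_hom, Iso.hom_inv_id_assoc]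
      exact congrArg (fun k : G.unop ⟶ Q₁.unop.glue => fn k x) this

/-! ### Forgetting a mark of spanning trees -/

namespace GCat

open DGraph

variable {U Λ : Type u} {g : ℕ} {A B : Finset Λ} {a : A} {T H : GCat U 0 (legSet g A)}
  {T' : GCat U 0 (legSet g B)}

/-- The mark `a` as a mark of the trees. -/
def oldMark (a : A) : legSet g A := ⟨Sum.inl a.1, inl_mem_legSet a.2⟩

/-- The flag `f` belongs to an edge at `V_a`, which is trivalent and carries the `i`-leg or the
`i*`-leg. -/
def IsShrunk (T : GCat U 0 (legSet g A)) (a : A) (i : Fin g) (f : T.F) : Prop :=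
  ∃ b, T.IsTri (oldMark a) f (T.newLeg (i, b))

theorem IsShrunk.unique {i : Fin g} {f f' : T.F} (h : T.IsShrunk a i f) (h' : T.IsShrunk a i f') :
    f' = f := by
  obtain ⟨b, t⟩ := h
  obtain ⟨b', t'⟩ := h'
  rcases t.unique t' with h1 | h1
  · exact h1.1
  · exact absurd (by rw [h1.1]; exact T.ι_newLeg _) t'.ι_ne

/-- The non-zero entries of the matrix `M(T,a)` belong to the edges at `V_a` that shrink. -/
theorem forgetMatrix_ne_zero_iff (hst : 3 < 2 * 0 + (legSet g A).card) (i : Fin g) (e : T.Edge) :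
    (T.val (T.r (T.oldLeg a)) = 3 ∧ (∃ b, T.r (T.newLeg (i, b)) = T.r (T.oldLeg a)) ∧
      ∃ h ∈ e.1, T.r h = T.r (T.oldLeg a)) ↔
    ∃ (f : T.F) (hf : T.ι f ≠ f), T.IsShrunk a i f ∧ e = edgeOf f hf := by
  have hV : T.r (T.oldLeg a) = T.legVertex (oldMark a) := rfl
  rw [hV]
  constructor
  · rintro ⟨h3, ⟨b, hb⟩, h, hhe, hh⟩
    obtain ⟨f, p, t⟩ := T.exists_isTri hst (oldMark a) (by rw [h3]; exact lt_irrefl 3)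
    have he : ∃ hne : T.ι h ≠ h, e = edgeOf h hne := by
      obtain ⟨x, hx, rfl⟩ := exists_edgeOf e
      rcases Sym2.mem_iff.1 hhe with rfl | rfl
      · exact ⟨hx, rfl⟩
      · exact ⟨ι_ne hx, (edgeOf_ι hx).symm⟩
    obtain ⟨hne, rfl⟩ := he
    have key : ∀ {f p}, T.IsTri (oldMark a) f p → h = f → T.IsShrunk a i h := by
      rintro f p t rfl
      rcases (t.iff _).1 hb with h1 | h1 | h1 | h1
      · exact absurd h1.symm (T.oldLeg_ne_newLeg a _)
      · exact absurd (by rw [← h1]; exact T.ι_newLeg _) hne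
      · exact ⟨b, h1 ▸ t⟩
      · exact absurd (h1 ▸ T.isVertex_legVertex _) (T.newLeg_not_vertex _)
    refine ⟨h, hne, ?_, rfl⟩
    rcases (t.iff h).1 hh with h1 | h1 | h1 | h1
    · exact absurd (by rw [h1]; exact T.ι_leg _) hne
    · exact key t h1
    · exact key (t.swap (by rwa [h1] at hne)) h1
    · exact absurd (h1 ▸ T.isVertex_legVertex _) (not_isVertex_of_ne hne)
  · rintro ⟨f, hf, ⟨b, t⟩, rfl⟩
    exact ⟨le_antisymm (not_lt.1 t.val_le) (T.stable _ (T.isVertex_legVertex _)), ⟨b, t.r_p⟩, f,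
      Sym2.mem_mk_left _ _, t.r_f⟩

/-- The part `M(T,a)` of the map of lattices. -/
def shrinkLen (T : GCat U 0 (legSet g A)) (a : A) (i : Fin g) (δ : T.Edge → ℤ) : ℤ :=
  ∑ e : T.Edge, forgetMatrix T a i e * δ e

theorem shrinkLen_eq (hst : 3 < 2 * 0 + (legSet g A).card) {i : Fin g} {f : T.F}
    (h : T.IsShrunk a i f) (δ : T.Edge → ℤ) : T.shrinkLen a i δ = T.flagLen δ f := by
  have hf : T.ι f ≠ f := h.choose_spec.ι_ne
  rw [flagLen_of_ne _ hf, shrinkLen, Finset.sum_eq_single (edgeOf f hf)]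
  · rw [forgetMatrix, if_pos ((forgetMatrix_ne_zero_iff hst i _).2 ⟨f, hf, h, rfl⟩), one_mul]
  · intro e _ he
    rw [forgetMatrix, if_neg, zero_mul]
    intro h1
    obtain ⟨f', hf', h2, rfl⟩ := (forgetMatrix_ne_zero_iff hst i _).1 h1
    obtain rfl := h.unique h2
    exact he rfl
  · exact fun h => absurd (Finset.mem_univ _) h

theorem shrinkLen_eq_zero (hst : 3 < 2 * 0 + (legSet g A).card) {i : Fin g}
    (h : ∀ f, ¬ T.IsShrunk a i f) (δ : T.Edge → ℤ) : T.shrinkLen a i δ = 0 := by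
  refine Finset.sum_eq_zero fun e _ => ?_
  rw [forgetMatrix, if_neg, zero_mul]
  intro h1
  obtain ⟨f, -, h2, -⟩ := (forgetMatrix_ne_zero_iff hst i _).1 h1
  exact h f h2

theorem shrinkLen_pull (hst : 3 < 2 * 0 + (legSet g A).card) (k : T ⟶ H) (i : Fin g)
    (δ : H.Edge → ℤ) : T.shrinkLen a i (pull k δ) = H.shrinkLen a i δ := by
  by_cases hH : ∃ f, H.IsShrunk a i f
  · obtain ⟨f, b, t⟩ := hH
    obtain ⟨f₀, p₀, t₀, rfl, hp⟩ := t.lift k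
    obtain rfl : p₀ = T.newLeg (i, b) := fn_inj k (hp ▸ H.newLeg_not_vertex _)
      (hp.trans (fn_newLeg k _).symm)
    rw [shrinkLen_eq hst ⟨b, t₀⟩, shrinkLen_eq hst ⟨b, t⟩, flagLen_pull]
  · push Not at hH
    rw [shrinkLen_eq_zero hst hH]
    by_cases hT : ∃ f, T.IsShrunk a i f
    · obtain ⟨f, b, t⟩ := hT
      rw [shrinkLen_eq hst ⟨b, t⟩, flagLen_pull, flagLen_of_eq]
      refine ι_of_isVertex ?_
      by_contra hv
      refine hH (fn k f) ⟨b, ?_⟩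
      have := t.descend k hv (by rw [fn_newLeg]; exact H.newLeg_not_vertex _)
      rwa [fn_newLeg] at this
    · push Not at hT
      exact shrinkLen_eq_zero hst hT _

/-- The map of lattices with matrix `(η 0; M(T,a) Id)`. -/
def forgetST (T : GCat U 0 (legSet g A)) (a : A) (T' : GCat U 0 (legSet g B)) :
    (T.Edge ⊕ Fin g → ℤ) →ₗ[ℤ] (T'.Edge ⊕ Fin g → ℤ) :=
  LinearMap.pi (Sum.elim
    (fun e => LinearMap.proj e ∘ₗ T.forgetLen (oldMark a) T' ∘ₗ T.projST)
    fun i => LinearMap.proj (Sum.inr i) +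
      ∑ e : T.Edge, forgetMatrix T a i e • LinearMap.proj (Sum.inl e))

theorem forgetST_inr (δ : T.Edge ⊕ Fin g → ℤ) (i : Fin g) :
    T.forgetST a T' δ (Sum.inr i) = δ (Sum.inr i) + T.shrinkLen a i (δ ∘ Sum.inl) := by
  simp [forgetST, shrinkLen]

theorem coord_forgetST_inl (x : ℝ ⊗[ℤ] (T.Edge ⊕ Fin g → ℤ)) (e : T'.Edge) :
    coord (Sum.inl e) (LinearMap.baseChange ℝ (T.forgetST a T') x) =
      coord e (LinearMap.baseChange ℝ (T.forgetLen (oldMark a) T')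
        (LinearMap.baseChange ℝ T.projST x)) := by
  rw [coord, coord, evalR_baseChange, evalR_baseChange, evalR_baseChange]
  rfl

theorem coord_projST (x : ℝ ⊗[ℤ] (T.Edge ⊕ Fin g → ℤ)) (e : T.Edge) :
    coord e (LinearMap.baseChange ℝ T.projST x) = coord (Sum.inl e) x := by
  rw [coord, evalR_baseChange]
  rfl

theorem coord_forgetST_inr (x : ℝ ⊗[ℤ] (T.Edge ⊕ Fin g → ℤ)) (i : Fin g) :
    coord (Sum.inr i) (LinearMap.baseChange ℝ (T.forgetST a T') x) =
      coord (Sum.inr i) x + ∑ e : T.Edge, (forgetMatrix T a i e : ℝ) * coord (Sum.inl e) x := by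
  induction x using TensorProduct.induction_on with
  | zero => simp [coord]
  | tmul c n =>
    simp only [LinearMap.baseChange_tmul, coord, evalR_tmul, LinearMap.proj_apply, forgetST_inr,
      shrinkLen, Function.comp_apply]
    push_cast
    rw [add_mul, Finset.sum_mul]
    simp only [mul_assoc]
  | add y z hy hz =>
    simp only [map_add, coord, mul_add, Finset.sum_add_distrib] at hy hz ⊢
    rw [hy, hz]
    ring

theorem forgetMatrix_nonneg (i : Fin g) (e : T.Edge) : 0 ≤ forgetMatrix T a i e := by
  unfold forgetMatrix
  split_ifs
  · exact zero_le_one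
  · exact le_rfl

theorem mem_STcone {x : ℝ ⊗[ℤ] (T.Edge ⊕ Fin g → ℤ)} :
    x ∈ Poic.orthantCone (T.Edge ⊕ Fin g) T.STzero ↔
      (∀ e, 0 ≤ coord (Sum.inl e) x) ∧ ∀ i, 0 < coord (Sum.inr i) x := by
  constructor
  · rintro ⟨h1, -, h2⟩
    exact ⟨fun e => h1 _, fun i => lt_of_le_of_ne (h1 _) fun h => h2 i h.symm⟩
  · rintro ⟨h1, h2⟩
    refine ⟨?_, isForest_of_genus_zero _ _, fun i hi => (h2 i).ne' hi⟩
    rintro (e | i)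
    · exact h1 e
    · exact (h2 i).le

theorem forgetST_mem (hst : 3 < 2 * 0 + (legSet g A).card)
    (hB : IsErase (legSet g B) (legSet g A) (oldMark a : legSet g A).1)
    (hT : T.IsForget (oldMark a) T') (x : ℝ ⊗[ℤ] (T.Edge ⊕ Fin g → ℤ))
    (hx : x ∈ Poic.orthantCone (T.Edge ⊕ Fin g) T.STzero) :
    LinearMap.baseChange ℝ (T.forgetST a T') x ∈
      Poic.orthantCone (T'.Edge ⊕ Fin g) T'.STzero := by
  refine mem_STcone.2 ⟨fun e => ?_, fun i => ?_⟩
  · rw [coord_forgetST_inl]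
    exact (hT.forgetLen_mem hst hB _ (T.projST_mem x hx)).1 e
  · rw [mem_STcone] at hx
    rw [coord_forgetST_inr]
    exact add_pos_of_pos_of_nonneg (hx.2 i) (Finset.sum_nonneg fun e _ =>
      mul_nonneg (by exact_mod_cast forgetMatrix_nonneg i e) (hx.1 e))

/-- An edge of `ft_a T` lies over some edge of `T`: put its length there. The lengths of the other
edges, in particular of an edge that is removed, are zero. -/
theorem forgetST_surj (hst : 3 < 2 * 0 + (legSet g A).card)
    (hB : IsErase (legSet g B) (legSet g A) (oldMark a : legSet g A).1)
    (hT : T.IsForget (oldMark a) T') (y : ℝ ⊗[ℤ] (T'.Edge ⊕ Fin g → ℤ))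
    (hy : y ∈ Poic.orthantCone (T'.Edge ⊕ Fin g) T'.STzero) :
    ∃ x ∈ Poic.orthantCone (T.Edge ⊕ Fin g) T.STzero,
      LinearMap.baseChange ℝ (T.forgetST a T') x = y := by
  rw [mem_STcone] at hy
  have hs : ∀ e : T'.Edge, ∃ (e₀ : T.Edge) (w : T'.F) (hw : T'.ι w ≠ w) (h : T.F) (hh : T.ι h ≠ h),
      e = edgeOf w hw ∧ T.Over (oldMark a) w h ∧ e₀ = edgeOf h hh := by
    intro e
    obtain ⟨w, hw, rfl⟩ := exists_edgeOf e
    obtain ⟨h, hh⟩ := hT.exists_over hst w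
    exact ⟨_, w, hw, h, hT.ι_ne_of_over hst hB hw hh, rfl, hh, rfl⟩
  choose s hs using hs
  -- a flag of a chosen edge lies over the edge that it was chosen for
  have hsO : ∀ (e : T'.Edge) (h : T.F) (hh : T.ι h ≠ h), edgeOf h hh = s e →
      ∃ (w : T'.F) (hw : T'.ι w ≠ w), e = edgeOf w hw ∧ T.Over (oldMark a) w h := by
    intro e h hh he
    obtain ⟨w, hw, h', hh', h1, h2, h3⟩ := hs e
    rw [h3] at he
    rcases edgeOf_eq_iff.1 he with rfl | rfl
    · exact ⟨w, hw, h1, h2⟩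
    · exact ⟨_, ι_ne hw, by rw [edgeOf_ι]; exact h1, hT.over_ι hst hB h2⟩
  have hinj : Function.Injective s := by
    intro e e' hee
    obtain ⟨w, hw, h, hh, rfl, h2, h3⟩ := hs e
    obtain ⟨w', hw', rfl, h4⟩ := hsO e' h hh (h3.symm.trans hee)
    obtain rfl := h2.unique h4
    rfl
  obtain ⟨x, hx⟩ := exists_coord (I := T.Edge ⊕ Fin g) (Sum.elim
    (Function.extend s (fun e => coord (Sum.inl e) y) 0) fun i => coord (Sum.inr i) y)
  have hxs : ∀ e, coord (Sum.inl (s e)) x = coord (Sum.inl e) y := fun e =>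
    (hx _).trans (hinj.extend_apply (fun e => coord (Sum.inl e) y) (0 : T.Edge → ℝ) e)
  have hx0 : ∀ e, e ∉ Set.range s → coord (Sum.inl e) x = 0 := fun e he =>
    (hx _).trans (Function.extend_apply' (fun e => coord (Sum.inl e) y) (0 : T.Edge → ℝ) e he)
  have hxi : ∀ i, coord (Sum.inr i) x = coord (Sum.inr i) y := fun i => hx _
  refine ⟨x, mem_STcone.2 ⟨fun e => ?_, fun i => ?_⟩, coord_ext ?_⟩
  · by_cases he : e ∈ Set.range s
    · obtain ⟨e', rfl⟩ := he
      rw [hxs]; exact hy.1 e'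
    · rw [hx0 e he]
  · rw [hxi]; exact hy.2 i
  rintro (e | i)
  · rw [coord_forgetST_inl]
    obtain ⟨w, hw, h, hh, rfl, h2, h3⟩ := hs e
    have hflag : ∀ q (hq : T.ι q ≠ q), T.flagLenR (LinearMap.baseChange ℝ T.projST x) q =
        coord (Sum.inl (edgeOf q hq)) x := fun q hq => by rw [← coord_edgeOf _ _ hq, coord_projST]
    rw [hT.coord_forgetLen hst hB _ hw, Finset.sum_eq_single h, hflag h hh, ← h3, hxs]
    · intro q hq hqh
      have hq := mem_overSet.1 hq
      have hqι := hT.ι_ne_of_over hst hB hw hq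
      rw [hflag q hqι]
      refine hx0 _ ?_
      rintro ⟨e', he'⟩
      obtain ⟨w', hw', rfl, h4⟩ := hsO e' q hqι he'.symm
      obtain rfl := h4.unique hq
      rw [h3] at he'
      rcases edgeOf_eq_iff.1 he' with h5 | h5
      · exact hqh h5.symm
      · rw [h5] at h2
        exact hw ((hT.over_ι hst hB hq).unique h2)
    · exact fun h4 => absurd (mem_overSet.2 h2) h4
  · rw [coord_forgetST_inr, hxi, Finset.sum_eq_zero, add_zero]
    intro e _
    by_cases he : e ∈ Set.range s
    · rw [forgetMatrix, if_neg, Int.cast_zero, zero_mul]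
      intro h1
      obtain ⟨f, hf, ⟨b, t⟩, rfl⟩ := (forgetMatrix_ne_zero_iff hst i _).1 h1
      obtain ⟨e', he'⟩ := he
      obtain ⟨w, hw, -, h2⟩ := hsO e' f hf he'.symm
      have h3 : T.nameOf (oldMark a) f = T.nameOf (oldMark a) (T.newLeg (i, b)) := by
        rw [t.nameOf_p, if_pos (T.ι_newLeg _), t.nameOf_leg (T.ι_newLeg _), if_pos (Or.inl rfl)]
      exact hT.ι_ne_of_over hst hB hw (h2.congr h3) (T.ι_newLeg _)
    · rw [hx0 e he, mul_zero]

theorem forgetST_pull (hst : 3 < 2 * 0 + (legSet g A).card)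
    (hB : IsErase (legSet g B) (legSet g A) (oldMark a : legSet g A).1)
    {H' : GCat U 0 (legSet g B)} (hT : T.IsForget (oldMark a) T')
    (hH : H.IsForget (oldMark a) H') {k : T ⟶ H} {k' : T' ⟶ H'}
    (hk : IsForgetHom (oldMark a) k k') (δ : H.Edge ⊕ Fin g → ℤ) :
    T.forgetST a T' (pullST k δ) = pullST k' (H.forgetST a H' δ) := by
  funext e
  rcases e with e | i
  · exact congrFun (hk.forgetLen_pull hst hB hT hH (δ ∘ Sum.inl)) e
  · rw [forgetST_inr]
    show δ (Sum.inr i) + T.shrinkLen a i (pull k (δ ∘ Sum.inl)) = H.forgetST a H' δ (Sum.inr i)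
    rw [forgetST_inr, shrinkLen_pull hst]

end GCat

open GCat in
/-- The morphism `𝔣𝔱_a^c` between complexes of spanning trees. -/
def forgetSTMor (U : Type u) {Λ : Type u} {g : ℕ} {A B : Finset Λ} {a : A}
    (hst : 3 < 2 * 0 + (legSet g A).card)
    (hB : IsErase (legSet g B) (legSet g A) (oldMark a : legSet g A).1) :
    PoicMor (STcomplex U g A) (STcomplex U g B) where
  functor := forgetFunctor hst hB
  η :=
    { app := fun T => ⟨T.unop.forgetST a (forget hst hB T.unop),
        forgetST_mem hst hB (isForget_forget hst hB T.unop)⟩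
      naturality := fun G H k => Poic.hom_ext (LinearMap.ext fun δ =>
        forgetST_pull hst hB (isForget_forget hst hB _) (isForget_forget hst hB _)
          (isForgetHom_forgetMap hst hB k.unop) δ) }
  not_in_proper_face := by
    intro T τ hτ hsub
    obtain ⟨-, f, hf, rfl⟩ := hτ
    refine Set.Subset.antisymm (fun y hy => hy.1) fun y hy => ?_
    obtain ⟨x, hx, rfl⟩ := forgetST_surj hst hB (isForget_forget hst hB T.unop) y hy
    exact hsub ⟨x, hx, rfl⟩

section

open GCat

variable (U : Type u) {Λ : Type u} {g : ℕ} {A B : Finset Λ} {a : A}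
  (hst : 3 < 2 * 0 + (legSet g A).card)
  (hB : IsErase (legSet g B) (legSet g A) (oldMark a : legSet g A).1)

theorem isForgetST_forgetSTMor : IsForgetST a (forgetSTMor U hst hB) where
  functor := isForgetFunctor hst hB
  metric T δ := (isForget_forget hst hB T).isForgetMetric hst hB (δ ∘ Sum.inl)
  extra _ δ i := forgetST_inr δ i

theorem isWeaklyProper_forgetSTMor : (forgetSTMor U hst hB).IsWeaklyProper := by
  refine PoicMor.isWeaklyProper_of_closed _ (isPoicSpace_STcomplex U g A) fun T => ?_
  have h1 : Poic.linR ((forgetSTMor U hst hB).at' T) '' ((STcomplex U g A).obj T).cone =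
      ((STcomplex U g B).obj ((forgetSTMor U hst hB).functor.obj T)).cone := by
    refine Set.eq_of_subset_of_subset ?_ fun y hy => ?_
    · rintro _ ⟨x, hx, rfl⟩
      exact Poic.linR_mem _ hx
    · obtain ⟨x, hx, rfl⟩ := forgetST_surj hst hB (isForget_forget hst hB T.unop) y hy
      exact ⟨x, hx, rfl⟩
  rw [h1]
  exact Set.inter_eq_left.2 (@subset_closure _ (moduleTopology ℝ _) _)

end

/-! ### Forgetting a mark commutes with joining legs -/

namespace GCat

open DGraph

variable {U Λ : Type u} {g : ℕ} {A B : Finset Λ} {a : A} {T H : GCat U 0 (legSet g A)}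
  {T' H' : GCat U 0 (legSet g B)} {G' K' : GCat U g B} {f p : T.F}

theorem IsTri.not_isNew (t : T.IsTri (oldMark a) f p) : ¬ T.IsNew f := fun h => t.ι_ne h.ι

theorem IsTri.glue (t : T.IsTri (oldMark a) f p) : IsTri (G := T.glue) a f p where
  ι_ne := glueι_ne_iff.2 (Or.inl t.ι_ne)
  ne := t.ne
  ne_leg := t.ne_leg
  not_vertex := t.not_vertex
  iff := t.iff

/-- The name of a flag with respect to the graph with joined legs, as a flag of the tree. -/
def glueName (T : GCat U 0 (legSet g A)) (a : A) (h : T.F) : T.F := nameOf (G := T.glue) a h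

theorem IsTri.nameOf_glue_two (t : T.IsTri (oldMark a) f p) (hp : T.glueι p ≠ p) (h : T.F) :
    T.glueName a h = if h = p then T.ι f else if h = f then T.glueι p else h := by
  have h0 := t.glue.nameOf_two hp h
  by_cases h1 : h = p
  · exact (h0.trans (if_pos h1)).trans ((glueι_of_not t.not_isNew).trans (if_pos h1).symm)
  by_cases h2 : h = f
  · exact (h0.trans ((if_neg h1).trans (if_pos h2))).trans
      ((if_neg h1).trans (if_pos h2)).symm
  · exact (h0.trans ((if_neg h1).trans (if_neg h2))).trans
      ((if_neg h1).trans (if_neg h2)).symm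

theorem IsTri.nameOf_glue_leg (t : T.IsTri (oldMark a) f p) (hp : T.glueι p = p) (h : T.F) :
    T.glueName a h = if h = f ∨ h = T.ι f then p else h := by
  have h0 := t.glue.nameOf_leg hp h
  rw [show T.glue.ι f = T.ι f from glueι_of_not t.not_isNew] at h0
  by_cases h1 : h = f ∨ h = T.ι f
  · exact (h0.trans (if_pos h1)).trans (if_pos h1).symm
  · exact (h0.trans (if_neg h1)).trans (if_neg h1).symm

/-- The names of flags are not changed by joining legs, except for a leg which is moved. -/
theorem nameOf_glue (hst : 3 < 2 * 0 + (legSet g A).card) {h : T.F}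
    (hn : ¬ T.IsNew (T.nameOf (oldMark a) h)) :
    T.glueName a h = T.nameOf (oldMark a) h := by
  rcases T.nameOf_cases hst (oldMark a) with hv | ⟨f, p, t⟩
  · rw [nameOf_of_val hv]
    exact nameOf_of_val (G := T.glue) hv h
  by_cases hp : T.ι p = p
  · rw [t.nameOf_leg hp] at hn ⊢
    by_cases hpn : T.IsNew p
    · rw [t.nameOf_glue_two (glueι_ne_of_isNew hpn)]
      have h1 : ¬ (h = f ∨ h = T.ι f) := fun h1 => hn (by rw [if_pos h1]; exact hpn)
      rw [if_neg h1] at hn ⊢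
      rw [if_neg fun h2 => hn (by rw [h2]; exact hpn), if_neg fun h2 => h1 (Or.inl h2)]
    · rw [t.nameOf_glue_leg ((glueι_of_not hpn).trans hp)]
  · rw [t.nameOf_two hp, t.nameOf_glue_two (glueι_ne_iff.2 (Or.inl hp)),
      glueι_of_not fun h => hp h.ι]

/-- Only a flag of the contracted edge lies below a new leg other than itself. -/
theorem IsTri.nameOf_of_isNew (t : T.IsTri (oldMark a) f p) {h : T.F}
    (hn : T.IsNew (T.nameOf (oldMark a) h)) :
    T.nameOf (oldMark a) h = h ∨ ((h = f ∨ h = T.ι f) ∧ T.IsNew p) := by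
  by_cases hp : T.ι p = p
  · rw [t.nameOf_leg hp] at hn ⊢
    split_ifs at hn ⊢ with h1
    · exact Or.inr ⟨h1, hn⟩
    · exact Or.inl rfl
  · rw [t.nameOf_two hp] at hn ⊢
    split_ifs at hn ⊢ with h1 h2
    · exact absurd hn (not_isNew_ι t.not_isNew)
    · exact absurd hn (not_isNew_ι fun h => hp h.ι)
    · exact Or.inl rfl

theorem isNew_nameOf_glue (hst : 3 < 2 * 0 + (legSet g A).card) {h : T.F}
    (hn : T.IsNew (T.nameOf (oldMark a) h)) :
    T.IsNew (T.nameOf (oldMark a) (T.glueName a h)) := by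
  rcases T.nameOf_cases hst (oldMark a) with hv | ⟨f, p, t⟩
  · rw [show T.glueName a h = h from nameOf_of_val (G := T.glue) hv h]
    exact hn
  have hleg : ∀ q, T.IsNew q → T.IsNew (T.nameOf (oldMark a) q) := by
    rintro _ ⟨i, rfl⟩
    exact ⟨i, T.nameOf_leg hst _⟩
  by_cases hpn : T.IsNew p
  · -- the new leg `p` is the name of both ends of the edge at `V_a`
    have hfar : T.IsNew (T.nameOf (oldMark a) (T.ι f)) := by
      rw [t.nameOf_leg hpn.ι, if_pos (Or.inr rfl)]; exact hpn
    rw [t.nameOf_glue_two (glueι_ne_of_isNew hpn)]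
    split_ifs
    · exact hfar
    · obtain ⟨⟨i, b⟩, rfl⟩ := hpn
      exact hleg _ ⟨_, T.glueι_newLeg i b⟩
    · exact hn
  · have h1 := (t.nameOf_of_isNew hn).resolve_right fun h => hpn h.2
    rw [h1] at hn
    have : T.glueName a h = h := by
      refine t.glue.nameOf_of_ne (h := h) ?_ ?_ ?_
      · rintro rfl; exact t.not_isNew hn
      · rintro rfl
        rw [show T.glue.ι f = T.ι f from glueι_of_not t.not_isNew] at hn
        exact not_isNew_ι t.not_isNew hn
      · rintro rfl; exact hpn hn
    rw [this]; exact hleg _ hn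

/-- The graphs `ft_a T` and `ft_a` of the graph with joined legs are quotients by the same edge. -/
theorem exists_glue_quot (hst : 3 < 2 * g + A.card) (hB : IsErase B A a.1)
    (hst₀ : 3 < 2 * 0 + (legSet g A).card)
    (hB₀ : IsErase (legSet g B) (legSet g A) (oldMark a : legSet g A).1)
    (hT : T.IsForget (oldMark a) T') (hG : T.glue.IsForget a G') :
    ∃ (E : T.F → Prop) (c : T.F → T'.F) (d : T.F → G'.F), T.IsQuot (oldMark a) T' E c ∧
      IsQuot (G := T.glue) a G' E d ∧
      ∀ z, ¬ T'.IsVertex (c z) → T.IsNew (T.nameOf (oldMark a) z) →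
        T.nameOf (oldMark a) z = z := by
  rcases T.nameOf_cases hst₀ (oldMark a) with hv | ⟨f, p, t⟩
  · obtain ⟨c, hc⟩ := hT.exists_quot_val hst₀ hB₀ hv
    obtain ⟨d, hd⟩ := hG.exists_quot_val hst hB hv
    exact ⟨_, c, d, hc, hd, fun z _ _ => nameOf_of_val hv z⟩
  · obtain ⟨c, hc⟩ := hT.exists_quot_tri hst₀ hB₀ t
    obtain ⟨d, hd⟩ := hG.exists_quot_tri hst hB t.glue
    have hf : T.glue.ι f = T.ι f := glueι_of_not t.not_isNew
    rw [hf] at hd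
    refine ⟨_, c, d, hc, hd, fun z hz hn => (t.nameOf_of_isNew hn).resolve_right fun h => hz ?_⟩
    exact (hc.vertex_iff z).2 (Or.inr (Or.inr h.1))

/-- The isomorphism between the graph obtained from `ft_a T` by joining legs and `ft_a` of the graph
obtained from `T`. It preserves names, except that a new leg that is moved along an edge gets the
name of the far end of this edge. -/
theorem exists_iso_glue_forget (hst : 3 < 2 * g + A.card)
    (hB : IsErase B A a.1) (hst₀ : 3 < 2 * 0 + (legSet g A).card)
    (hB₀ : IsErase (legSet g B) (legSet g A) (oldMark a : legSet g A).1)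
    (hT : T.IsForget (oldMark a) T') (hG : T.glue.IsForget a G') :
    ∃ i : T'.glue ≅ G', ∀ (x : T'.F) (y : T.F), ¬ T'.IsVertex x → x.1 = y.1 →
      Over (G := T.glue) a (fn (G := T'.glue) i.hom x) y := by
  obtain ⟨E, c, d, hc, hd, hname⟩ := exists_glue_quot hst hB hst₀ hB₀ hT hG
  have hv : ∀ z, T'.IsVertex (c z) ↔ G'.IsVertex (d z) := fun z =>
    (hc.vertex_iff z).trans (hd.vertex_iff z).symm
  have hleg : ∀ i, c (T.newLeg i) = T'.newLeg i := fun i => hc.map_leg _ _ rfl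
  have hι : ∀ z, c (T.glueι z) = T'.glueι (c z) := by
    intro z
    by_cases hz : T.IsNew z
    · obtain ⟨⟨i, b⟩, rfl⟩ := hz
      rw [glueι_newLeg, hleg, hleg, glueι_newLeg]
    · rw [glueι_of_not hz, hc.map_ι, glueι_of_not]
      rintro ⟨i, hi⟩
      rw [← hleg] at hi
      exact hz ⟨i, hc.inj (by rw [hi, hleg]; exact T'.newLeg_not_vertex i) hi⟩
  have hcd : ∀ x y, c x = c y ↔ d x = d y := by
    intro x y
    constructor
    · refine hc.factors d (fun z hz => (hd.map_r z).trans ((hv z).1 hz)) fun z hz => ?_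
      by_cases hn : T.IsNew z
      · rw [hn.ι]
      · rw [← glueι_of_not hn]
        exact (hd.map_ι z).trans (ι_of_isVertex ((hv z).1 hz))
    · refine hd.factors c (fun z hz => (hc.map_r z).trans ((hv z).2 hz)) fun z hz => ?_
      refine (hι z).trans ?_
      have hz' := (hv z).2 hz
      rw [glueι_of_not fun h => h.not_vertex hz', ι_of_isVertex hz']
  choose s hs using hc.surjective
  have hds : ∀ z, d (s (c z)) = d z := fun z => (hcd _ _).1 (hs _)
  have hbij : Function.Bijective fun x => d (s x) := by
    refine ⟨fun x y hxy => ?_, fun y => ?_⟩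
    · have := (hcd _ _).2 hxy
      rwa [hs, hs] at this
    · obtain ⟨z, rfl⟩ := hd.surjective y
      exact ⟨c z, hds z⟩
  refine ⟨isoMk (G := T'.glue) (Equiv.ofBijective (fun x => d (s x)) hbij) (fun x => ?_)
    (fun x => ?_) (fun b => ?_), fun x y hx hxy => ?_⟩
  · obtain ⟨z, rfl⟩ := hc.surjective x
    show d (s (T'.r (c z))) = G'.r (d (s (c z)))
    rw [← hc.map_r, hds, hds]
    exact hd.map_r z
  · obtain ⟨z, rfl⟩ := hc.surjective x
    show d (s (T'.glueι (c z))) = G'.ι (d (s (c z)))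
    rw [← hι, hds, hds]
    exact hd.map_ι z
  · show d (s (T'.oldLeg b)) = G'.leg b
    have hbA : b.1 ∈ A := ((hB _).1 b.2).1
    rw [← show c (T.oldLeg ⟨b.1, hbA⟩) = T'.oldLeg b from hc.map_leg _ _ rfl, hds]
    exact hd.map_leg b ⟨b.1, hbA⟩ rfl
  · obtain ⟨z, rfl⟩ := hc.surjective x
    have h1 : (d z).1 = (T.glueName a z).1 := hd.name z fun h => hx ((hv z).2 h)
    have h2 : T.nameOf (oldMark a) z = y := Subtype.ext ((hc.name z hx).symm.trans hxy)
    show (d (s (c z))).1 = (T.glueName a y).1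
    rw [hds, h1]
    by_cases hn : T.IsNew y
    · rw [← h2, hname z hx (h2 ▸ hn)]
    · rw [nameOf_glue hst₀ (h2 ▸ hn), h2, nameOf_glue hst₀] <;>
      rw [(hT.name_mem hst₀ hxy).2.1]
      exact hn

theorem IsForget.isNew_iff (hT : T.IsForget (oldMark a) T') {x : T'.F} {y : T.F} (hxy : x.1 = y.1) :
    T'.IsNew x ↔ T.IsNew y := by
  constructor
  · rintro ⟨i, rfl⟩
    exact ⟨i, Subtype.ext (hxy.symm.trans (hT.marking _ ⟨Sum.inr i, inr_mem_legSet i⟩ rfl))⟩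
  · rintro ⟨i, rfl⟩
    exact ⟨i, Subtype.ext (hxy.trans (hT.marking _ ⟨Sum.inr i, inr_mem_legSet i⟩ rfl).symm)⟩

/-- The flags over which a flag of `ft_a T` other than a new leg lies are not changed by joining
legs. -/
theorem IsForget.over_glue_iff (hst₀ : 3 < 2 * 0 + (legSet g A).card)
    (hT : T.IsForget (oldMark a) T') {x : T'.F} {y : T.F} (hxy : x.1 = y.1) (hy : ¬ T.IsNew y)
    {w : G'.F} (hw : Over (G := T.glue) a w y) (h : T.F) :
    Over (G := T.glue) a w h ↔ T.Over (oldMark a) x h := by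
  have hyn := (hT.name_mem hst₀ hxy).2.1
  have hyg : T.glueName a y = y := (nameOf_glue hst₀ (by rwa [hyn])).trans hyn
  have h1 : Over (G := T.glue) a w h ↔ T.glueName a h = y := by
    have hw' : w.1 = (T.glueName a y).1 := hw
    rw [hyg] at hw'
    exact ⟨fun h => Subtype.ext (h.symm.trans hw'),
      fun h => hw'.trans (congrArg Subtype.val h.symm)⟩
  have h2 : T.Over (oldMark a) x h ↔ T.nameOf (oldMark a) h = y := by
    unfold Over
    rw [hxy]
    exact ⟨fun h => (Subtype.ext h).symm, fun h => congrArg Subtype.val h.symm⟩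
  rw [h1, h2]
  by_cases hn : T.IsNew (T.nameOf (oldMark a) h)
  · refine ⟨fun h3 => ?_, fun h3 => absurd (h3 ▸ hn) hy⟩
    have := isNew_nameOf_glue hst₀ hn
    rw [h3, hyn] at this
    exact absurd this hy
  · exact iff_of_eq (congrArg (· = y) (nameOf_glue hst₀ hn))

/-- The isomorphism of `exists_iso_glue_forget` is natural in the tree. -/
theorem iso_glue_forget_naturality (hst₀ : 3 < 2 * 0 + (legSet g A).card)
    (hB₀ : IsErase (legSet g B) (legSet g A) (oldMark a : legSet g A).1)
    (hT : T.IsForget (oldMark a) T') (hH : H.IsForget (oldMark a) H')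
    {k : T ⟶ H} {k' : T' ⟶ H'} (hk : IsForgetHom (oldMark a) k k')
    {l : G' ⟶ K'} (hl : IsForgetHom (G := T.glue) (H := H.glue) a (glueMap k) l)
    {i : T'.glue ≅ G'} (hi : ∀ (x : T'.F) (y : T.F), ¬ T'.IsVertex x → x.1 = y.1 →
      Over (G := T.glue) a (fn (G := T'.glue) i.hom x) y)
    {j : H'.glue ≅ K'} (hj : ∀ (x : H'.F) (y : H.F), ¬ H'.IsVertex x → x.1 = y.1 →
      Over (G := H.glue) a (fn (G := H'.glue) j.hom x) y) :
    glueMap k' ≫ j.hom = i.hom ≫ l := by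
  refine hom_ext_of_flags fun x hx => ?_
  rw [fn_comp] at hx
  rw [fn_comp, fn_comp]
  have hx' : ¬ H'.IsVertex (fn k' x) := fun h => hx (fn_vertex (G := H'.glue) j.hom h)
  have hxT : ¬ T'.IsVertex x := fun h => hx' (fn_vertex k' h)
  obtain ⟨y', hy'⟩ := hH.exists_name hst₀ (fn k' x)
  obtain ⟨y, hy⟩ := hT.exists_name hst₀ x
  have hy'v : ¬ H.IsVertex y' := fun h => hx' ((hH.name_isVertex_iff hst₀ hB₀ hy').2 h)
  -- a flag over which both `x` and its image lie
  obtain ⟨h, hh, rfl⟩ : ∃ h, Over (G := T.glue) a (fn (G := T'.glue) i.hom x) h ∧ fn k h = y' := by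
    by_cases hn : T'.IsNew x
    · obtain ⟨q, rfl⟩ := hn
      refine ⟨T.newLeg q, hi _ _ hxT (hT.marking _ ⟨Sum.inr q, inr_mem_legSet q⟩ rfl), ?_⟩
      refine Subtype.ext ?_
      rw [fn_newLeg, ← hy', fn_newLeg]
      exact (hH.marking _ ⟨Sum.inr q, inr_mem_legSet q⟩ rfl).symm
    · obtain ⟨h, hh, hkh⟩ := hk.exists_over hst₀ hB₀ hT hH (hH.over_of_name hst₀ hy') hy'v
      exact ⟨h, (hT.over_glue_iff hst₀ hy (fun h => hn ((hT.isNew_iff hy).2 h))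
        (hi x y hxT hy) h).2 hh, hkh⟩
  exact (hl _ h hh hy'v).unique (hj _ _ hx' hy')

/-- The isomorphism is compatible with the maps of lattices: if the edge through a flag `f` at
`V_a` and the `i`-leg at `V_a` are merged, its length is the sum of the lengths of `f` and of the
new edge, which is the coordinate given by the matrix `M(T,a)`. -/
theorem flagLen_glueLen_forgetST (hst : 3 < 2 * g + A.card)
    (hB : IsErase B A a.1) (hst₀ : 3 < 2 * 0 + (legSet g A).card)
    (hB₀ : IsErase (legSet g B) (legSet g A) (oldMark a : legSet g A).1)
    (hT : T.IsForget (oldMark a) T') (hG : T.glue.IsForget a G')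
    {i : T'.glue ≅ G'} (hi : ∀ (x : T'.F) (y : T.F), ¬ T'.IsVertex x → x.1 = y.1 →
      Over (G := T.glue) a (fn (G := T'.glue) i.hom x) y)
    (δ : T.Edge ⊕ Fin g → ℤ) {x : T'.F} (hx : T'.glueι x ≠ x) :
    T'.glue.flagLen (T'.glueLen (T.forgetST a T' δ)) x =
      ∑ h ∈ overSet T.glue a (fn (G := T'.glue) i.hom x), T.glue.flagLen (T.glueLen δ) h := by
  by_cases hn : T'.IsNew x
  · obtain ⟨⟨q, b⟩, rfl⟩ := hn
    have hover : ∀ b, Over (G := T.glue) a (fn (G := T'.glue) i.hom (T'.newLeg (q, b)))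
        (T.newLeg (q, b)) := fun b => hi _ _ (T'.newLeg_not_vertex _)
      (hT.marking _ ⟨Sum.inr (q, b), inr_mem_legSet _⟩ rfl)
    have hmem : ∀ (b : Bool) (h : T.F), h ∈ overSet T.glue a
        (fn (G := T'.glue) i.hom (T'.newLeg (q, b))) ↔
          T.glueName a h = T.glueName a (T.newLeg (q, b)) := fun b h =>
      mem_overSet.trans ⟨fun h' => h'.nameOf_eq (hover b), fun h' => (hover b).congr h'.symm⟩
    rw [flagLen_glueLen_new, forgetST_inr]
    by_cases hs : ∃ f, T.IsShrunk a q f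
    · obtain ⟨f, b', t⟩ := hs
      rw [shrinkLen_eq hst₀ ⟨b', t⟩]
      -- both ends of the merged edge give the same sum
      have hb : ∑ h ∈ overSet T.glue a (fn (G := T'.glue) i.hom (T'.newLeg (q, b))),
          T.glue.flagLen (T.glueLen δ) h =
          ∑ h ∈ overSet T.glue a (fn (G := T'.glue) i.hom (T'.newLeg (q, b'))),
            T.glue.flagLen (T.glueLen δ) h := by
        by_cases hbb : b = b'
        · rw [hbb]
        · have h1 : b = !b' := by cases b <;> cases b' <;> simp_all
          have h2 := hG.sum_overSet_ι hst hB _ (flagLen_ι (G := T.glue.toDGraph) (T.glueLen δ))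
            (fn (G := T'.glue) i.hom (T'.newLeg (q, b')))
          rw [h1, ← T'.glueι_newLeg q b']
          exact (congrArg (fun w => ∑ h ∈ overSet T.glue a w, T.glue.flagLen (T.glueLen δ) h)
            (fn_ι (G := T'.glue) i.hom (T'.newLeg (q, b')))).trans h2
      rw [hb]
      have hp : T.glueι (T.newLeg (q, b')) ≠ T.newLeg (q, b') := glueι_ne_of_isNew ⟨_, rfl⟩
      have h1 : overSet T.glue a (fn (G := T'.glue) i.hom (T'.newLeg (q, b'))) =
          ({T.newLeg (q, b'), T.ι f} : Finset T.F) := by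
        refine Finset.ext fun (h : T.F) => (hmem b' h).trans (Iff.trans ?_
          (Finset.mem_insert.trans (or_congr Iff.rfl Finset.mem_singleton)).symm)
        rw [t.nameOf_glue_two hp, t.nameOf_glue_two hp, if_pos rfl]
        split_ifs with h2 h3
        · exact ⟨fun _ => Or.inl h2, fun _ => rfl⟩
        · refine ⟨fun h4 => absurd ?_ (not_isNew_ι t.not_isNew), fun h4 => ?_⟩
          · rw [← h4, glueι_newLeg]; exact ⟨_, rfl⟩
          · rw [h3] at h4
            exact (h4.elim t.ne fun h5 => t.ι_ne h5.symm).elim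
        · exact ⟨Or.inr, fun h4 => h4.resolve_left h2⟩
      rw [h1]
      refine (Finset.sum_pair (M := ℤ) (a := T.newLeg (q, b')) (b := T.ι f) ?_).trans ?_ |>.symm
      · exact (t.ι_f_ne hst₀).symm
      · rw [flagLen_glueLen_new, flagLen_glueLen_old δ (not_isNew_ι t.not_isNew), flagLen_ι]
    · push Not at hs
      rw [shrinkLen_eq_zero hst₀ hs, add_zero]
      have h1 : overSet T.glue a (fn (G := T'.glue) i.hom (T'.newLeg (q, b))) =
          ({T.newLeg (q, b)} : Finset T.F) := by
        refine Finset.ext fun (h : T.F) => (hmem b h).trans (Iff.trans ?_ Finset.mem_singleton.symm)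
        rcases T.nameOf_cases hst₀ (oldMark a) with hv | ⟨f, p, t⟩
        · rw [show T.glueName a h = h from nameOf_of_val (G := T.glue) hv h]
          exact iff_of_eq (congrArg (h = ·) (nameOf_of_val (G := T.glue) hv (T.newLeg (q, b))))
        have hp : ∀ b, T.newLeg (q, b) ≠ p := fun b h => hs f ⟨b, h ▸ t⟩
        have hf : T.newLeg (q, b) ≠ f := fun h => t.not_isNew ⟨_, h.symm⟩
        have hf' : T.newLeg (q, b) ≠ T.ι f := fun h => not_isNew_ι t.not_isNew ⟨_, h.symm⟩
        by_cases hpι : T.glueι p = p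
        · rw [t.nameOf_glue_leg hpι, t.nameOf_glue_leg hpι, if_neg (not_or.2 ⟨hf, hf'⟩)]
          split_ifs with h2
          · refine ⟨fun h3 => absurd h3.symm (hp b), ?_⟩
            rintro rfl
            exact absurd h2 (not_or.2 ⟨hf, hf'⟩)
          · rfl
        · have hpι' : T.newLeg (q, b) ≠ T.glueι p := by
            intro h
            have h2 := congrArg T.glueι h
            rw [glueι_newLeg, T.isStableGraph_glue.ι_ι] at h2
            exact hp _ h2
          rw [t.nameOf_glue_two hpι, t.nameOf_glue_two hpι, if_neg (hp b), if_neg hf]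
          split_ifs with h2 h3
          · exact ⟨fun h3 => absurd h3.symm hf', fun h3 => absurd (h3.symm.trans h2) (hp b)⟩
          · exact ⟨fun h4 => absurd h4.symm hpι', fun h4 => absurd (h4.symm.trans h3) hf⟩
          · rfl
      rw [h1]
      exact ((Finset.sum_singleton _ _).trans (T.flagLen_glueLen_new δ q b)).symm
  · have hx' : T'.ι x ≠ x := by rwa [glueι_of_not hn] at hx
    obtain ⟨y, hy⟩ := hT.exists_name hst₀ x
    have hyn : ¬ T.IsNew y := fun h => hn ((hT.isNew_iff hy).2 h)
    rw [flagLen_glueLen_old _ hn]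
    refine (hT.flagLen_forgetLen hst₀ hB₀ (δ ∘ Sum.inl) hx').trans ?_
    refine Finset.sum_congr (M := ℤ) ?_ fun h hh => (flagLen_glueLen_old δ fun hn' =>
      hT.ι_ne_of_over hst₀ hB₀ hx' (mem_overSet.1 ?_) hn'.ι).symm
    · ext h
      exact mem_overSet.trans ((hT.over_glue_iff hst₀ hy hyn
        (hi x y (not_isVertex_of_ne hx') hy) h).symm.trans mem_overSet.symm)
    · exact mem_overSet.2 ((hT.over_glue_iff hst₀ hy hyn
        (hi x y (not_isVertex_of_ne hx') hy) h).1 (mem_overSet.1 hh))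

end GCat

open GCat in
theorem isCommSquare_forget (U : Type u) {Λ : Type u} {g : ℕ} {A B : Finset Λ} {a : A}
    (hst : 3 < 2 * g + A.card) (hB : IsErase B A a.1)
    (hst₀ : 3 < 2 * 0 + (legSet g A).card)
    (hB₀ : IsErase (legSet g B) (legSet g A) (oldMark a : legSet g A).1) :
    IsCommSquare (stMor U g A) (stMor U g B) (forgetSTMor U hst₀ hB₀) (forgetMor U hst hB) := by
  have hT := fun T : GCat U 0 (legSet g A) => isForget_forget hst₀ hB₀ T
  have hG := fun T : GCat U 0 (legSet g A) => isForget_forget hst hB T.glue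
  choose i hi using fun T => exists_iso_glue_forget hst hB hst₀ hB₀ (hT T) (hG T)
  refine ⟨NatIso.ofComponents (fun T => (i T.unop).symm.op) fun {S T} f => ?_, fun T => ?_⟩
  · have h := iso_glue_forget_naturality hst₀ hB₀ (hT _) (hT _)
      (isForgetHom_forgetMap hst₀ hB₀ f.unop) (isForgetHom_forgetMap hst hB (glueMap f.unop))
      (hi _) (hi _)
    refine Quiver.Hom.unop_inj ?_
    show (i T.unop).inv ≫ glueMap (forgetMap hst₀ hB₀ f.unop) =
      forgetMap hst hB (glueMap f.unop) ≫ (i S.unop).inv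
    rw [Iso.inv_comp_eq, ← Category.assoc, Iso.eq_comp_inv]
    exact h
  · refine Poic.hom_ext (LinearMap.ext fun δ => DGraph.ext_flagLen
      (G := (GCat.forget hst hB T.unop.glue).toDGraph) fun x hx => ?_)
    show DGraph.flagLen _ (pull (i T.unop).inv ((forget hst₀ hB₀ T.unop).glueLen
      (T.unop.forgetST a (forget hst₀ hB₀ T.unop) δ))) x = DGraph.flagLen _
        (T.unop.glue.forgetLen a (forget hst hB T.unop.glue) (T.unop.glueLen δ)) x
    obtain ⟨w, rfl⟩ := fn_surj (i T.unop).hom x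
    rw [flagLen_pull, (hG _).flagLen_forgetLen hst hB _ hx, ← fn_comp, Iso.hom_inv_id, fn_id]
    refine flagLen_glueLen_forgetST hst hB hst₀ hB₀ (hT _) (hG _) (hi _) δ fun hw => hx ?_
    rw [← fn_ι]
    exact congrArg _ hw

/-! ### Forgetting a mark and distances -/

namespace GCat

open DGraph

variable {U Λ : Type u} {A B : Finset Λ} {a : A} {T : GCat U 0 A} {T' : GCat U 0 B} {f p : T.F}

/-- The split of an edge of `ft_a T` is the restriction of the split of an edge over which it
lies. -/
theorem IsQuot.split_eq {E : T.F → Prop} {c : T.F → T'.F} (hBA : B ⊆ A)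
    (hc : T.IsQuot a T' E c) {h : T.F} (hh : T'.ι (c h) ≠ c h) :
    T'.split (c h) = T.split h ∩ B := by
  ext b
  by_cases hb : b ∈ B
  · rw [Finset.mem_inter, and_iff_left hb, T'.mem_split _ ⟨b, hb⟩, T.mem_split _ ⟨b, hBA hb⟩,
      ← hc.map_leg ⟨b, hb⟩ ⟨b, hBA hb⟩ rfl, ← hc.map_r,
      side_map hc.map_r hc.map_ι hc.inj hh (isVertex_r _)]
  · exact ⟨fun h => absurd (split_subset _ _ h) hb, fun h => absurd (Finset.mem_inter.1 h).2 hb⟩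

/-- A flag of an edge is kept by some quotient map, unless it belongs to the edge at a trivalent
`V_a` with two legs. -/
theorem IsForget.exists_quot_eq (hst : 3 < 2 * 0 + A.card)
    (hB : IsErase B A a.1) (hT : T.IsForget a T') {x : T'.F} {h : T.F}
    (hx : T.Over a x h) (hv : ¬ T.IsVertex h) :
    (∃ (E : T.F → Prop) (c : T.F → T'.F), T.IsQuot a T' E c ∧ c h = x) ∨
      ∃ f p, T.IsTri a f p ∧ T.ι p = p ∧ (h = f ∨ h = T.ι f) := by
  have hha := hT.over_ne_leg hst hx
  have key : ∀ {E : T.F → Prop} {c : T.F → T'.F}, T.IsQuot a T' E c → ¬ E h →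
      ∃ (E : T.F → Prop) (c : T.F → T'.F), T.IsQuot a T' E c ∧ c h = x := fun {E c} hc hE => by
    refine ⟨E, c, hc, Over.unique (h := h) (hc.name h fun hch => ?_) hx⟩
    rcases (hc.vertex_iff h).1 hch with h1 | h1 | h1 <;> contradiction
  rcases T.nameOf_cases hst a with hval | ⟨f, p, t⟩
  · obtain ⟨c, hc⟩ := hT.exists_quot_val hst hB hval
    exact Or.inl (key hc fun h => h)
  by_cases hf : h = f ∨ h = T.ι f
  · by_cases hp : T.ι p = p
    · exact Or.inr ⟨f, p, t, hp, hf⟩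
    · obtain ⟨c, hc⟩ := hT.exists_quot_tri hst hB (t.swap hp)
      refine Or.inl (key hc ?_)
      have h1 := t.ι_f_ne hst
      rcases hf with rfl | rfl <;> rintro (h2 | h2)
      · exact t.ne h2
      · exact h1 (by rw [h2, T.ι_ι])
      · exact h1 h2
      · exact t.ne (by rw [← T.ι_ι f, h2, T.ι_ι])
  · obtain ⟨c, hc⟩ := hT.exists_quot_tri hst hB t
    exact Or.inl (key hc hf)

/-- If `V_a` is trivalent with an edge and the `b`-leg, then the edge separates the marks `a`, `b`
from the others. -/
theorem IsTri.card_split_inter_le_one (t : T.IsTri a f p) (hp : T.ι p = p)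
    (hB : IsErase B A a.1) : (T.split (T.ι f) ∩ B).card ≤ 1 := by
  have hside : ∀ v, T.Side (T.ι f) v → v = T.legVertex a := by
    intro v hv
    unfold Side at hv
    rw [T.ι_ι, t.r_f] at hv
    have hstep : ∀ y, y ≠ T.ι f ∧ y ≠ f → T.r y = T.legVertex a → T.r (T.ι y) = T.legVertex a := by
      intro y hy h1
      rcases (t.iff y).1 h1 with h2 | h2 | h2 | h2
      · rw [h2, T.ι_leg]; rfl
      · exact absurd h2 hy.2
      · rw [h2, hp]; exact t.r_p
      · rw [h2, ι_of_isVertex (T.isVertex_legVertex a)]; exact T.isVertex_legVertex a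
    refine (FlagReach.induct (c := fun w => w = T.legVertex a) (fun y hy =>
      ⟨hstep y hy, fun h1 => ?_⟩) hv).1 rfl
    have := hstep (T.ι y) ⟨fun h => hy.2 ?_, fun h => hy.1 ?_⟩ h1
    · rwa [T.ι_ι] at this
    · rw [← T.ι_ι y, h, T.ι_ι]
    · rw [← T.ι_ι y, h]
  refine Finset.card_le_one.2 fun b hb b' hb' => ?_
  have key : ∀ b, b ∈ T.split (T.ι f) ∩ B → ∃ hb : b ∈ A, T.leg ⟨b, hb⟩ = p := by
    intro b hb
    obtain ⟨h1, h2⟩ := Finset.mem_inter.1 hb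
    have h3 := (hB b).1 h2
    refine ⟨h3.1, ?_⟩
    rcases (t.iff _).1 (hside _ ((T.mem_split _ ⟨b, h3.1⟩).1 h1)) with h4 | h4 | h4 | h4
    · exact absurd (congrArg Subtype.val (T.leg_injective h4)) h3.2
    · exact absurd (by rw [← h4, T.ι_leg]) t.ι_ne
    · exact h4
    · exact absurd (h4 ▸ T.isVertex_legVertex a) (T.leg_not_vertex _)
  obtain ⟨h1, h2⟩ := key b hb
  obtain ⟨h3, h4⟩ := key b' hb'
  exact congrArg Subtype.val (T.leg_injective (h2.trans h4.symm))

/-- An edge over which a leg of `ft_a T` lies does not contribute to the distances. -/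
theorem IsForget.mk_splitVector_eq_zero (hst : 3 < 2 * 0 + A.card)
    (hB : IsErase B A a.1) (hT : T.IsForget a T') {x : T'.F} {h : T.F}
    (hx : T.Over a x h) (hxι : T'.ι x = x) (hh : T.ι h ≠ h) :
    QSpace.mk (splitVector B (T.split h ∩ B)) = 0 := by
  have hv := not_isVertex_of_ne hh
  rcases hT.exists_quot_eq hst hB hx hv with ⟨E, c, hc, rfl⟩ | ⟨f, p, t, hp, hf⟩
  · refine absurd ((hc.inj ?_ ?_).symm) hh
    · rwa [hT.over_isVertex_iff hst hB hx]
    · rw [hc.map_ι, hxι]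
  · have h0 := mk_splitVector_of_card_le_one (A := B) (t.card_split_inter_le_one hp hB)
    rcases hf with rfl | rfl
    · rw [T.split_ι hh] at h0
      rw [← h0, ← splitVector_sdiff]
      refine congrArg _ (splitVector_congr fun i hi => ?_)
      simp [hi, ((hB i).1 hi).1]
    · exact h0

/-- Forgetting a mark is compatible with the distance maps. -/
theorem forgetDist_distLin (hst : 3 < 2 * 0 + A.card) (hB : IsErase B A a.1)
    (hT : T.IsForget a T') (hBA : B ⊆ A) (δ : T.Edge → ℤ) :
    forgetDist hBA (T.distLin δ) = T'.distLin (T.forgetLen a T' δ) := by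
  have htwo : ∀ u v : QSpace B, 2 • u = 2 • v → u = v := fun u v h => by
    rw [← Nat.cast_smul_eq_nsmul ℝ, ← Nat.cast_smul_eq_nsmul ℝ] at h
    exact smul_right_injective (QSpace B) (by norm_num : ((2 : ℕ) : ℝ) ≠ 0) h
  refine Subtype.ext (htwo _ _ ?_)
  show 2 • restrictQ hBA (T.distLin δ) = 2 • (T'.distLin (T.forgetLen a T' δ) : QSpace B)
  rw [← map_nsmul, two_smul_distLin, two_smul_distLin, map_sum]
  set F : T.F → QSpace B := fun h =>
    T.flagLen δ h • QSpace.mk (splitVector B (T.split h ∩ B)) with hF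
  have hF0 : ∀ h, T.ι h = h → F h = 0 := fun h hh => by
    rw [hF]; dsimp only; rw [flagLen_of_eq δ hh, zero_smul]
  have h1 : ∀ h, restrictQ hBA (T.flagLen δ h • QSpace.mk (splitVector A (T.split h))) = F h :=
    fun h => by rw [map_zsmul, restrictQ_mk_splitVector]
  have h2 : ∀ x, T'.flagLen (T.forgetLen a T' δ) x • QSpace.mk (splitVector B (T'.split x)) =
      ∑ h ∈ T.overSet a x, F h := by
    intro x
    by_cases hx : T'.ι x = x
    · rw [flagLen_of_eq _ hx, zero_smul]
      refine (Finset.sum_eq_zero fun h hh => ?_).symm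
      by_cases hhι : T.ι h = h
      · exact hF0 h hhι
      · rw [hF]; dsimp only
        rw [hT.mk_splitVector_eq_zero hst hB (mem_overSet.1 hh) hx hhι, smul_zero]
    · rw [hT.flagLen_forgetLen hst hB δ hx, Finset.sum_smul]
      refine Finset.sum_congr rfl fun h hh => ?_
      have hxh := mem_overSet.1 hh
      have hhι := hT.ι_ne_of_over hst hB hx hxh
      rcases hT.exists_quot_eq hst hB hxh (not_isVertex_of_ne hhι) with
        ⟨E, c, hc, rfl⟩ | ⟨f, p, t, hp, hf⟩
      · rw [hc.split_eq hBA hx]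
      · have h3 : T.nameOf a h = T.nameOf a p := by
          rw [t.nameOf_leg hp, t.nameOf_leg hp, if_pos hf]
          split_ifs <;> rfl
        exact absurd hp (hT.ι_ne_of_over hst hB hx (hxh.congr h3))
  rw [Finset.sum_congr rfl fun h _ => h1 h, Finset.sum_congr rfl fun x _ => h2 x]
  simp only [overSet, Finset.sum_filter]
  rw [Finset.sum_comm]
  refine Finset.sum_congr rfl fun h _ => ?_
  by_cases hx : ∃ x : T'.F, T.Over a x h
  · obtain ⟨x, hx⟩ := hx
    rw [Finset.sum_eq_single x (fun y _ hy => if_neg fun h3 => hy (h3.unique hx))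
      fun h3 => absurd (Finset.mem_univ _) h3, if_pos hx]
  · push Not at hx
    rw [Finset.sum_eq_zero fun x _ => if_neg (hx x)]
    refine hF0 h ?_
    by_contra hh
    obtain ⟨x, hx'⟩ := hT.exists_of_flag hst hB (not_isVertex_of_ne hh)
      fun h3 => hh (by rw [h3, T.ι_leg])
    exact hx x hx'

end GCat

section

open GCat

variable (U : Type u) {Λ : Type u}

theorem isLinearMor_forgetMor {A B : Finset Λ} {a : A} (hst : 3 < 2 * 0 + A.card)
    (hB : IsErase B A a.1) (hBA : B ⊆ A) :
    IsLinearMor (distMor U A) (distMor U B) (forgetMor U hst hB) (forgetDist hBA) :=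
  fun T δ => forgetDist_distLin hst hB (isForget_forget hst hB T.unop) hBA δ

theorem isLinearMor_forgetSTMor {g : ℕ} {A B : Finset Λ} {a : A}
    (hst : 3 < 2 * 0 + (legSet g A).card)
    (hB : IsErase (legSet g B) (legSet g A) (oldMark a : legSet g A).1)
    (hBA : legSet g B ⊆ legSet g A) :
    IsLinearMor ((STproj U g A).comp (distMor U (legSet g A)))
      ((STproj U g B).comp (distMor U (legSet g B))) (forgetSTMor U hst hB) (forgetDist hBA) :=
  fun T δ => forgetDist_distLin hst hB (isForget_forget hst hB T.unop) hBA (δ ∘ Sum.inl)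

end

end

theorem mainTheorem7 {U Λ : Type u} [Infinite U] (g : ℕ) (A : Finset Λ) (a : Λ) (ha : a ∈ A)
    (hst : 3 < 2 * g + A.card) :
    IsPoicSpace (Mtrop U g A) ∧ IsPoicSpace (Mtrop U g (A.erase a)) ∧
    ∃ ft : PoicMor (Mtrop U g A) (Mtrop U g (A.erase a)),
      IsForgetMor ⟨a, ha⟩ ft ∧
      -- forgetful morphisms for distinct marks commute
      (∀ (b : Λ) (hb : b ∈ A) (hba : b ≠ a), 4 < 2 * g + A.card →
        ∃ (ftb : PoicMor (Mtrop U g A) (Mtrop U g (A.erase b)))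
          (ftb' : PoicMor (Mtrop U g (A.erase a)) (Mtrop U g ((A.erase a).erase b)))
          (fta' : PoicMor (Mtrop U g (A.erase b)) (Mtrop U g ((A.erase a).erase b))),
          IsForgetMor ⟨b, hb⟩ ftb ∧
          IsForgetMor ⟨b, Finset.mem_erase_of_ne_of_mem hba hb⟩ ftb' ∧
          IsForgetMor ⟨a, Finset.mem_erase_of_ne_of_mem hba.symm ha⟩ fta' ∧
          ft.comp ftb' = ftb.comp fta') ∧
      -- genus zero
      (g = 0 → IsPoicComplex (Mtrop U g A) ∧ IsPoicComplex (Mtrop U g (A.erase a)) ∧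
        ft.IsProper) ∧
      -- lifting of isomorphisms
      ft.LiftsIsos ∧
      -- distance maps and the morphism of spanning tree fibrations
      ∃ (dist : PoicMor (Mtrop U 0 (legSet g A)) (wholeComplex.{u, u} (Ndist (legSet g A))))
        (dist' : PoicMor (Mtrop U 0 (legSet g (A.erase a)))
          (wholeComplex.{u, u} (Ndist (legSet g (A.erase a)))))
        (ft₀ : PoicMor (Mtrop U 0 (legSet g A)) (Mtrop U 0 (legSet g (A.erase a))))
        (p : Ndist (legSet g A) →ₗ[ℤ] Ndist (legSet g (A.erase a)))
        (st : PoicMor (STcomplex U g A) (Mtrop U g A))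
        (st' : PoicMor (STcomplex U g (A.erase a)) (Mtrop U g (A.erase a)))
        (ftc : PoicMor (STcomplex U g A) (STcomplex U g (A.erase a))),
        IsPoicComplex (Mtrop U 0 (legSet g A)) ∧
        IsPoicComplex (Mtrop U 0 (legSet g (A.erase a))) ∧
        IsDist dist ∧ IsDist dist' ∧
        IsForgetMor ⟨Sum.inl a, inl_mem_legSet ha⟩ ft₀ ∧
        IsForgetDist (legSet_mono (Finset.erase_subset a A)) p ∧
        IsLinearMor dist dist' ft₀ p ∧
        IsSpanningTree st ∧ IsSpanningTree st' ∧ IsForgetST ⟨a, ha⟩ ftc ∧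
        IsWeaklyProperFibrationMor st ((STproj U g A).comp dist) st'
          ((STproj U g (A.erase a)).comp dist') ftc ft p := by
  have hB : ∀ {s : Finset Λ} {c : Λ}, ∀ x, x ∈ s.erase c ↔ x ∈ s ∧ x ≠ c := fun {s c} x =>
    Finset.mem_erase.trans and_comm
  have hcard : (legSet g A).card = A.card + 2 * g := by
    rw [legSet, Finset.card_disjSum]
    simp [mul_comm]
  have hst₀ : 3 < 2 * 0 + (legSet g A).card := by omega
  have hB₀ : ∀ x, x ∈ legSet g (A.erase a) ↔
      x ∈ legSet g A ∧ x ≠ (GCat.oldMark ⟨a, ha⟩ : legSet g A).1 := by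
    rintro (x | i)
    · refine Finset.inl_mem_disjSum.trans ((hB x).trans (and_congr Finset.inl_mem_disjSum.symm ?_))
      exact not_congr Sum.inl_injective.eq_iff.symm
    · exact ⟨fun _ => ⟨inr_mem_legSet i, Sum.inr_ne_inl⟩, fun _ => inr_mem_legSet i⟩
  refine ⟨isPoicSpace_Mtrop U g A, isPoicSpace_Mtrop U g _,
    forgetMor U (a := ⟨a, ha⟩) hst hB, isForgetMor_forgetMor U hst hB, ?_, ?_,
    forgetMor_liftsIsos U hst hB, distMor U _, distMor U _, forgetMor U hst₀ hB₀,
    forgetDist (legSet_mono (Finset.erase_subset a A)), stMor U g A, stMor U g _,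
    forgetSTMor U hst₀ hB₀, isPoicComplex_Mtrop_zero U _, isPoicComplex_Mtrop_zero U _,
    isDist_distMor U _, isDist_distMor U _, isForgetMor_forgetMor U hst₀ hB₀,
    isForgetDist_forgetDist _, isLinearMor_forgetMor U hst₀ hB₀ _, isSpanningTree_stMor U g A,
    isSpanningTree_stMor U g _, isForgetST_forgetSTMor U hst₀ hB₀, ?_⟩
  · intro b hb hba h4
    have hst₁ : 3 < 2 * g + (A.erase a).card := by
      rw [Finset.card_erase_of_mem ha]; omega
    have hst₂ : 3 < 2 * g + (A.erase b).card := by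
      rw [Finset.card_erase_of_mem hb]; omega
    have hC : ∀ x, x ∈ (A.erase a).erase b ↔ x ∈ A.erase b ∧ x ≠ a := fun x => by
      rw [Finset.erase_right_comm]; exact hB x
    exact ⟨forgetMor U (a := ⟨b, hb⟩) hst hB,
      forgetMor U (a := ⟨b, Finset.mem_erase_of_ne_of_mem hba hb⟩) hst₁ hB,
      forgetMor U (a := ⟨a, Finset.mem_erase_of_ne_of_mem hba.symm ha⟩) hst₂ hC,
      isForgetMor_forgetMor U hst hB, isForgetMor_forgetMor U hst₁ hB,
      isForgetMor_forgetMor U hst₂ hC, forgetMor_comm U (B := A.erase a)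
        (B' := A.erase b) (a := ⟨a, ha⟩) (b := ⟨b, hb⟩) (a₁ := ⟨a, _⟩) (b₁ := ⟨b, _⟩) rfl rfl
        hst hst₁ hst₂ hB hB hB hC⟩
  · rintro rfl
    exact ⟨isPoicComplex_Mtrop_zero U A, isPoicComplex_Mtrop_zero U _,
      PoicMor.isProper_of_isFace_zero _ (isPoicSpace_Mtrop U 0 A) (isFace_zero_Mtrop U A)⟩
  · exact
      { fibration_source := isPoicFibration_stMor U g A
        fibration_target := isPoicFibration_stMor U g _
        square := isCommSquare_forget U hst hB hst₀ hB₀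
        linear := isLinearMor_forgetSTMor U hst₀ hB₀ _
        weaklyProper := isWeaklyProper_forgetSTMor U hst₀ hB₀
        lifts := forgetMor_liftsIsos U hst hB }
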